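/- Let $G$ be a complex semisimple simply connected linear algebraic group with Lie algebra $\mathfrak g$, let $\nu\in\mathfrak g$ be a principal nilpotent element (its orbit is dense in the cone of nilpotent elements), and let $\{h,e,f\}$ be a standard $\mathfrak{sl}_2$-triple in $\mathfrak g$ with $e=\nu$. Let $\mathfrak g_i$ be the $i$-eigenspace of $\operatorname{ad} h$ and $\mathfrak g_{\ge k}=\bigoplus_{i\ge k}\mathfrak g_i$; put $\mathfrak t=\mathfrak g_0$, $\mathfrak u=\mathfrak g_{>0}$, $\mathfrak b=\mathfrak t+\mathfrak u$, and let $T,U,B\subset G$ be the connected subgroups with these Lie algebras. Let $\mathcal P$ be the character group of $T$, let $\mathcal Q$ be the root lattice, let $\alpha_1,\dots,\alpha_r$ be the simple roots of the positive system given by $\mathfrak u$, and let $\sigma^\vee\subset\mathcal P\otimes\mathbb R$ be the cone that they generate. Let $\mathcal V$ be the affine $T$-toric variety with coordinate ring $\mathbb C[\sigma^\vee\cap\mathcal P]$. Write $\nu=\sum_i E_{\alpha_i}$ with root vectors $E_{\alpha_i}\in\mathfrak g_{\alpha_i}$ and let $\rho:\mathcal V\to\mathfrak g_2=\mathfrak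 u/\mathfrak g_{\ge4}$ be the map $v\mapsto\sum_i e^{\alpha_i}(v)E_{\alpha_i}$. Let $\tilde{\mathfrak u}=\mathcal V\times_{\mathfrak g_2}\mathfrak u$, on which $B=TU$ acts ($U$ acts trivially on $\mathcal V$), and let $\widetilde{\mathcal M}=G\times^B\tilde{\mathfrak u}$, the quotient of $G\times\tilde{\mathfrak u}$ by the action $b\cdot(g,w)=(gb^{-1},bw)$ of $B$. There is an integer $d\ge1$ with $\mathcal P\subset\mathcal Q_d:=\frac1d\mathcal Q$. For every such $d$ let $T_d$ be the torus with character group $\mathcal Q_d$, let $Z_d$ be the kernel of the map $T_d\to T$ that corresponds to the inclusion $\mathcal P\subset\mathcal Q_d$, and let $\mathcal V_d$ be the affine variety with coordinate ring $\mathbb C[\sigma^\vee\cap\mathcal Q_d]$. Then: 1. $T_d\cong(\mathbb C^\times)^r$, the map $T_d\to T$ is a surjective homomorphism of algebraic groups, and $Z_d$ is finite. The variety $\mathcal V_d$ is a toric variety for $T_d$ (it contains $T_d$ as a dense open subset, and the action of $T_d$ on itself extends), and $\mathcal V_d\cong\mathbb C^r$. The natural map $\mathcal V_d\to\mathcal V$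 induces an isomorphism $\mathcal V_d/Z_d\cong\mathcal V$. Hence $\mathcal V$ is an orbifold, i.e. locally the quotient of a smooth variety by a finite group. 2. There is a covering of $\widetilde{\mathcal M}$ by open subvarieties $W_i$ of the form $W_i\cong\widetilde W_i/Z_d$, where $\widetilde W_i$ is a smooth variety with an action of $Z_d$. Hence $\widetilde{\mathcal M}$ is an orbifold. -/

import Mathlib

open Filter Topology TensorProduct

noncomputable section

namespace Orbifold

/-! ### Complex varieties as spaces with functions

A classical complex variety is a topological space together with a sheaf of `ℂ`-valued functions
(its regular functions).  The sheaf is recorded by saying which functions are regular near a given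
point; a function is regular on an open set when it is regular near each of its points. -/

/-- A topological space with a sheaf of `ℂ`-algebras of `ℂ`-valued functions, such that a regular
function that does not vanish at a point is invertible near that point.  `RegAt x f` says that the
function `f` is regular in a neighbourhood of `x`; it depends only on the germ of `f` at `x`. -/
structure FunctionSpace where
  /-- the points -/
  carrier : Type
  /-- the (Zariski) topology -/
  top : TopologicalSpace carrier
  /-- `f` is regular in a neighbourhood of `x` -/
  RegAt : carrier → (carrier → ℂ) → Prop
  const : ∀ x c, RegAt x (fun _ => c)
  add : ∀ x f g, RegAt x f → RegAt x g → RegAt x (f + g)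
  mul : ∀ x f g, RegAt x f → RegAt x g → RegAt x (f * g)
  inv : ∀ x f, RegAt x f → f x ≠ 0 → RegAt x f⁻¹
  ne_zero : ∀ x f, RegAt x f → f x ≠ 0 → ∀ᶠ y in 𝓝 x, f y ≠ 0
  congr : ∀ x f g, RegAt x f → (∀ᶠ y in 𝓝 x, f y = g y) → RegAt x g
  eventually : ∀ x f, RegAt x f → ∀ᶠ y in 𝓝 x, RegAt y f

attribute [instance] FunctionSpace.top

namespace FunctionSpace

/-- The Zariski topology defined by an algebra of functions: the sets `{f ≠ 0}` are a basis. -/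
abbrev zariski {X : Type} (A : Subalgebra ℂ (X → ℂ)) : TopologicalSpace X :=
  TopologicalSpace.generateFrom {s | ∃ f ∈ A, s = {x | f x ≠ 0}}

theorem zariski_eventually {X : Type} (A : Subalgebra ℂ (X → ℂ)) {x : X} {f : X → ℂ}
    (hf : f ∈ A) (hx : f x ≠ 0) : ∀ᶠ y in @nhds X (zariski A) x, f y ≠ 0 :=
  @IsOpen.mem_nhds X (zariski A) x {y | f y ≠ 0}
    (TopologicalSpace.isOpen_generateFrom_of_mem ⟨f, hf, rfl⟩) hx

/-- The space with functions defined by an algebra `A` of functions on a set `X`: the topology is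
the Zariski topology of `A`, and the regular functions are locally fractions `p / q`
with `p, q ∈ A`. -/
def ofAlgebra (X : Type) (A : Subalgebra ℂ (X → ℂ)) : FunctionSpace where
  carrier := X
  top := zariski A
  RegAt x f := ∃ p ∈ A, ∃ q ∈ A, q x ≠ 0 ∧
    ∀ᶠ y in @nhds X (zariski A) x, f y * q y = p y
  const x c := ⟨algebraMap ℂ (X → ℂ) c, A.algebraMap_mem c, 1, A.one_mem, by simp,
    Eventually.of_forall fun y => by simp⟩
  add := by
    rintro x f g ⟨p, hp, q, hq, hqx, h⟩ ⟨p', hp', q', hq', hqx', h'⟩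
    refine ⟨p * q' + p' * q, A.add_mem (A.mul_mem hp hq') (A.mul_mem hp' hq), q * q',
      A.mul_mem hq hq', mul_ne_zero hqx hqx', ?_⟩
    filter_upwards [h, h'] with y h1 h2
    simp only [Pi.add_apply, Pi.mul_apply, ← h1, ← h2]
    ring
  mul := by
    rintro x f g ⟨p, hp, q, hq, hqx, h⟩ ⟨p', hp', q', hq', hqx', h'⟩
    refine ⟨p * p', A.mul_mem hp hp', q * q', A.mul_mem hq hq', mul_ne_zero hqx hqx', ?_⟩
    filter_upwards [h, h'] with y h1 h2
    simp only [Pi.mul_apply, ← h1, ← h2]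
    ring
  inv := by
    rintro x f ⟨p, hp, q, hq, hqx, h⟩ hx
    have hpx : p x ≠ 0 := by
      rw [← @Eventually.self_of_nhds X (zariski A) _ _ h]; exact mul_ne_zero hx hqx
    refine ⟨q, hq, p, hp, hpx, ?_⟩
    filter_upwards [h, zariski_eventually A hp hpx] with y h1 h2
    have hy : f y ≠ 0 := by
      intro h0; rw [h0, zero_mul] at h1; exact h2 h1.symm
    rw [← h1, Pi.inv_apply, inv_mul_cancel_left₀ hy]
  ne_zero := by
    rintro x f ⟨p, hp, q, hq, hqx, h⟩ hx
    have hpx : p x ≠ 0 := by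
      rw [← @Eventually.self_of_nhds X (zariski A) _ _ h]; exact mul_ne_zero hx hqx
    filter_upwards [h, zariski_eventually A hp hpx] with y h1 h2 h0
    rw [h0, zero_mul] at h1; exact h2 h1.symm
  congr := by
    rintro x f g ⟨p, hp, q, hq, hqx, h⟩ hfg
    refine ⟨p, hp, q, hq, hqx, ?_⟩
    filter_upwards [h, hfg] with y h1 h2
    rw [← h2, h1]
  eventually := by
    rintro x f ⟨p, hp, q, hq, hqx, h⟩
    filter_upwards [@Eventually.eventually_nhds X (zariski A) _ _ h,
      zariski_eventually A hq hqx] with y h1 h2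
    exact ⟨p, hp, q, hq, h2, h1⟩

/-- The induced structure on a subset `s` (used for open subsets): a function is regular near `x`
when it is near `x` the restriction of a function that is regular near `x`. -/
def restrict (X : FunctionSpace) (s : Set X.carrier) : FunctionSpace where
  carrier := s
  top := instTopologicalSpaceSubtype
  RegAt x f := ∃ F, X.RegAt x.1 F ∧ ∀ᶠ y in 𝓝 x, f y = F y.1
  const x c := ⟨fun _ => c, X.const _ _, Eventually.of_forall fun _ => rfl⟩
  add := by
    rintro x f g ⟨F, hF, h⟩ ⟨F', hF', h'⟩
    refine ⟨F + F', X.add _ _ _ hF hF', ?_⟩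
    filter_upwards [h, h'] with y h1 h2
    simp [h1, h2]
  mul := by
    rintro x f g ⟨F, hF, h⟩ ⟨F', hF', h'⟩
    refine ⟨F * F', X.mul _ _ _ hF hF', ?_⟩
    filter_upwards [h, h'] with y h1 h2
    simp [h1, h2]
  inv := by
    rintro x f ⟨F, hF, h⟩ hx
    refine ⟨F⁻¹, X.inv _ _ hF (by rwa [← h.self_of_nhds]), ?_⟩
    filter_upwards [h] with y h1
    simp [h1]
  ne_zero := by
    rintro x f ⟨F, hF, h⟩ hx
    have h2 := X.ne_zero _ _ hF (by rwa [← h.self_of_nhds])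
    filter_upwards [h, continuous_subtype_val.continuousAt.eventually h2] with y h1 h3
    rwa [h1]
  congr := by
    rintro x f g ⟨F, hF, h⟩ hfg
    refine ⟨F, hF, ?_⟩
    filter_upwards [h, hfg] with y h1 h2
    rw [← h2, h1]
  eventually := by
    rintro x f ⟨F, hF, h⟩
    filter_upwards [h.eventually_nhds,
      continuous_subtype_val.continuousAt.eventually (X.eventually _ _ hF)] with y h1 h2
    exact ⟨F, h2, h1⟩

/-- The quotient of `X` by (the equivalence relation generated by) a relation `r`: the quotient
topology, and a function is regular on an open set when its pullback to the inverse image of that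
open set in `X` is regular. -/
def quot (X : FunctionSpace) (r : X.carrier → X.carrier → Prop) : FunctionSpace where
  carrier := Quot r
  top := instTopologicalSpaceQuot
  RegAt q f := ∀ᶠ q' in 𝓝 q, ∀ x, Quot.mk r x = q' → X.RegAt x (f ∘ Quot.mk r)
  const q c := Eventually.of_forall fun _ x _ => X.const x c
  add := by
    intro q f g hf hg
    filter_upwards [hf, hg] with q' h1 h2 x hx
    exact X.add _ _ _ (h1 x hx) (h2 x hx)
  mul := by
    intro q f g hf hg
    filter_upwards [hf, hg] with q' h1 h2 x hx
    exact X.mul _ _ _ (h1 x hx) (h2 x hx)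
  inv := by
    intro q f hf hq
    obtain ⟨U, hU, hUo, hqU⟩ := eventually_nhds_iff.1 hf
    have ho : IsOpen {q' | q' ∈ U ∧ f q' ≠ 0} := by
      rw [← isQuotientMap_quot_mk.isOpen_preimage, isOpen_iff_mem_nhds]
      rintro x ⟨hx, hfx⟩
      filter_upwards [X.ne_zero x _ (hU _ hx x rfl) hfx,
        (hUo.preimage continuous_quot_mk).mem_nhds hx] with y h1 h2
      exact ⟨h2, h1⟩
    filter_upwards [ho.mem_nhds ⟨hqU, hq⟩] with q' hq' x hx
    subst hx
    exact X.inv _ _ (hU _ hq'.1 x rfl) hq'.2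
  ne_zero := by
    intro q f hf hq
    obtain ⟨U, hU, hUo, hqU⟩ := eventually_nhds_iff.1 hf
    have ho : IsOpen {q' | q' ∈ U ∧ f q' ≠ 0} := by
      rw [← isQuotientMap_quot_mk.isOpen_preimage, isOpen_iff_mem_nhds]
      rintro x ⟨hx, hfx⟩
      filter_upwards [X.ne_zero x _ (hU _ hx x rfl) hfx,
        (hUo.preimage continuous_quot_mk).mem_nhds hx] with y h1 h2
      exact ⟨h2, h1⟩
    filter_upwards [ho.mem_nhds ⟨hqU, hq⟩] with q' hq'
    exact hq'.2
  congr := by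
    intro q f g hf hfg
    filter_upwards [hf, hfg.eventually_nhds] with q' h1 h2 x hx
    subst hx
    exact X.congr _ _ _ (h1 x rfl) (continuous_quot_mk.continuousAt.eventually h2)
  eventually := fun _ _ hf => hf.eventually_nhds

/-- Morphisms: continuous maps that pull back regular functions to regular functions. -/
def IsMorphism (X Y : FunctionSpace) (φ : X.carrier → Y.carrier) : Prop :=
  Continuous φ ∧ ∀ x f, Y.RegAt (φ x) f → X.RegAt x (f ∘ φ)

/-- A bijection that is a morphism in both directions. -/
def IsIso (X Y : FunctionSpace) (e : X.carrier ≃ Y.carrier) : Prop :=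
  X.IsMorphism Y e ∧ Y.IsMorphism X e.symm

/-- `X ≅ Y`. -/
def Isomorphic (X Y : FunctionSpace) : Prop := ∃ e, X.IsIso Y e

/-- A morphism that is an isomorphism onto an open subspace. -/
def IsOpenImmersion (X Y : FunctionSpace) (φ : X.carrier → Y.carrier) : Prop :=
  IsOpen (Set.range φ) ∧
    ∃ e, X.IsIso (Y.restrict (Set.range φ)) e ∧ ∀ x, (e x).1 = φ x

/-- The affine variety with coordinate ring `R` (modulo nilpotents): its points are the algebra
homomorphisms `R → ℂ`, i.e. the maximal ideals of `R` when `R` is finitely generated. -/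
def specm (R : Type) [CommRing R] [Algebra ℂ R] : FunctionSpace :=
  ofAlgebra (R →ₐ[ℂ] ℂ)
    (AlgHom.range (AlgHom.pi (fun x : R →ₐ[ℂ] ℂ => x)))

/-- A complex variety (not necessarily irreducible): quasi-compact, locally affine of finite type,
and separated, i.e. two morphisms from an affine variety agree on a closed set. -/
structure IsVariety (X : FunctionSpace) : Prop where
  compact : CompactSpace X.carrier
  affine : ∀ x : X.carrier, ∃ U : Set X.carrier, IsOpen U ∧ x ∈ U ∧
    ∃ (R : Type) (_ : CommRing R) (_ : Algebra ℂ R),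
      Algebra.FiniteType ℂ R ∧ (X.restrict U).Isomorphic (specm R)
  separated : ∀ (R : Type) [CommRing R] [Algebra ℂ R] [Algebra.FiniteType ℂ R]
    (a b : (specm R).carrier → X.carrier),
      (specm R).IsMorphism X a → (specm R).IsMorphism X b → IsClosed {z | a z = b z}

/-- A smooth variety: every point has an affine open neighbourhood whose coordinate ring is a
smooth `ℂ`-algebra. -/
structure IsSmoothVariety (X : FunctionSpace) : Prop extends IsVariety X where
  smooth : ∀ x : X.carrier, ∃ U : Set X.carrier, IsOpen U ∧ x ∈ U ∧
    ∃ (R : Type) (_ : CommRing R) (_ : Algebra ℂ R),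
      Algebra.Smooth ℂ R ∧ (X.restrict U).Isomorphic (specm R)

/-- The quotient `X / Γ` by a group action. -/
def orbitSpace (X : FunctionSpace) (Γ : Type) [Group Γ] [MulAction Γ X.carrier] : FunctionSpace :=
  X.quot (fun x y => ∃ γ : Γ, γ • x = y)

/-- `X ≅ W / Γ` for a smooth variety `W` with an action of the group `Γ` by automorphisms of
the variety `W`. -/
def IsSmoothQuotient (X : FunctionSpace) (Γ : Type) [Group Γ] : Prop :=
  ∃ (W : FunctionSpace) (_ : MulAction Γ W.carrier), W.IsSmoothVariety ∧
    (∀ γ : Γ, W.IsMorphism W (fun w => γ • w)) ∧ X.Isomorphic (W.orbitSpace Γ)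

/-- `X` is an orbifold: locally the quotient of a smooth variety by a finite group. -/
def IsOrbifold (X : FunctionSpace) : Prop :=
  ∀ x : X.carrier, ∃ U : Set X.carrier, IsOpen U ∧ x ∈ U ∧
    ∃ (Γ : Type) (_ : Group Γ), Finite Γ ∧ (X.restrict U).IsSmoothQuotient Γ

/-- The functions on `X × Y` generated by functions on `X` and functions on `Y`. -/
def prodAlgebra {X Y : Type} (A : Subalgebra ℂ (X → ℂ)) (C : Subalgebra ℂ (Y → ℂ)) :
    Subalgebra ℂ (X × Y → ℂ) :=
  Algebra.adjoin ℂ ({F | ∃ f ∈ A, F = f ∘ Prod.fst} ∪ {F | ∃ g ∈ C, F = g ∘ Prod.snd})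

/-- The restrictions to a subset of an algebra of functions. -/
def restrictAlgebra {X : Type} (A : Subalgebra ℂ (X → ℂ)) (s : Set X) : Subalgebra ℂ (s → ℂ) :=
  Algebra.adjoin ℂ {F | ∃ f ∈ A, F = fun x => f x.1}

/-- The polynomial functions on a complex vector space. -/
def polyAlgebra (E : Type) [AddCommGroup E] [Module ℂ E] : Subalgebra ℂ (E → ℂ) :=
  Algebra.adjoin ℂ {F | ∃ l : Module.Dual ℂ E, F = fun x => l x}

/-- The affine space `ℂ ^ r`. -/
def affineSpace (r : ℕ) : FunctionSpace := ofAlgebra (Fin r → ℂ) (polyAlgebra (Fin r → ℂ))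

/-- The torus `(ℂ ^ ×) ^ r`. -/
def standardTorus (r : ℕ) : FunctionSpace :=
  ofAlgebra (Fin r → ℂˣ) (Algebra.adjoin ℂ
    ({F | ∃ i : Fin r, F = fun s => (s i : ℂ)} ∪ {F | ∃ i : Fin r, F = fun s => (((s i)⁻¹ : ℂˣ) : ℂ)}))

end FunctionSpace

open FunctionSpace

/-! ### Linear algebraic groups and their Lie algebras -/

section Groups

variable {n : ℕ}

attribute [local instance 100] LieRing.ofAssociativeRing

/-- The value of a polynomial in the matrix entries at a matrix. -/
def evalMat (M : Matrix (Fin n) (Fin n) ℂ) : MvPolynomial (Fin n × Fin n) ℂ →+* ℂ :=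
  MvPolynomial.eval fun ij => M ij.1 ij.2

/-- `G` is a linear algebraic group: a subgroup of `GL_n(ℂ)` defined by polynomial equations. -/
def IsLinearAlgebraic (G : Subgroup (GL (Fin n) ℂ)) : Prop :=
  ∃ I : Set (MvPolynomial (Fin n × Fin n) ℂ),
    ∀ g : GL (Fin n) ℂ, g ∈ G ↔ ∀ p ∈ I, evalMat (g : Matrix (Fin n) (Fin n) ℂ) p = 0

/-- The polynomials in the matrix entries that vanish on `G`. -/
def vanishing (G : Subgroup (GL (Fin n) ℂ)) : Set (MvPolynomial (Fin n × Fin n) ℂ) :=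
  {p | ∀ g ∈ G, evalMat (g : Matrix (Fin n) (Fin n) ℂ) p = 0}

/-- The derivative of `p` at the identity matrix in the direction `M`. -/
def derivAtOne (M : Matrix (Fin n) (Fin n) ℂ) (p : MvPolynomial (Fin n × Fin n) ℂ) : ℂ :=
  ∑ ij, M ij.1 ij.2 * evalMat 1 (MvPolynomial.pderiv ij p)

/-- The left invariant vector field on matrices with value `M` at the identity. -/
def leftField (M : Matrix (Fin n) (Fin n) ℂ) :
    Derivation ℂ (MvPolynomial (Fin n × Fin n) ℂ) (MvPolynomial (Fin n × Fin n) ℂ) :=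
  MvPolynomial.mkDerivation ℂ fun ij =>
    ∑ k, MvPolynomial.X (ij.1, k) * MvPolynomial.C (M k ij.2)

/-- Left translation of polynomials by a matrix. -/
def leftTranslate (g : Matrix (Fin n) (Fin n) ℂ) :
    MvPolynomial (Fin n × Fin n) ℂ →ₐ[ℂ] MvPolynomial (Fin n × Fin n) ℂ :=
  MvPolynomial.aeval fun ij => ∑ k, MvPolynomial.C (g ij.1 k) * MvPolynomial.X (k, ij.2)

theorem evalMat_X (M : Matrix (Fin n) (Fin n) ℂ) (i j : Fin n) :
    evalMat M (MvPolynomial.X (i, j)) = M i j := by simp [evalMat]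

theorem evalMat_C (M : Matrix (Fin n) (Fin n) ℂ) (a : ℂ) :
    evalMat M (MvPolynomial.C a) = a := by simp [evalMat]

theorem leftField_X (M : Matrix (Fin n) (Fin n) ℂ) (i j : Fin n) :
    leftField M (MvPolynomial.X (i, j)) =
      ∑ k, MvPolynomial.X (i, k) * MvPolynomial.C (M k j) := by
  simp [leftField, MvPolynomial.mkDerivation_X]

theorem leftField_C (M : Matrix (Fin n) (Fin n) ℂ) (a : ℂ) :
    leftField M (MvPolynomial.C a) = 0 := MvPolynomial.derivation_C _ _

theorem leftTranslate_X (g : Matrix (Fin n) (Fin n) ℂ) (i j : Fin n) :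
    leftTranslate g (MvPolynomial.X (i, j)) =
      ∑ k, MvPolynomial.C (g i k) * MvPolynomial.X (k, j) := by
  simp [leftTranslate]

theorem leftTranslate_C (g : Matrix (Fin n) (Fin n) ℂ) (a : ℂ) :
    leftTranslate g (MvPolynomial.C a) = MvPolynomial.C a := by
  simp [leftTranslate]

theorem evalMat_one_leftField (M : Matrix (Fin n) (Fin n) ℂ)
    (p : MvPolynomial (Fin n × Fin n) ℂ) : evalMat 1 (leftField M p) = derivAtOne M p := by
  unfold derivAtOne
  induction p using MvPolynomial.induction_on with
  | C a => simp
  | add p q hp hq => simp only [map_add, hp, hq, mul_add, Finset.sum_add_distrib]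
  | mul_X p ij hp =>
    obtain ⟨i, j⟩ := ij
    simp only [Derivation.leibniz, smul_eq_mul, map_add, map_mul, hp, mul_add,
      Finset.sum_add_distrib, Finset.mul_sum, leftField_X, map_sum, evalMat_X, evalMat_C]
    congr 1
    · rw [Finset.sum_eq_single (i, j), Finset.sum_eq_single i]
      · rw [MvPolynomial.pderiv_X_self]
        simp [mul_comm]
      · intro k _ hk
        simp [hk.symm]
      · simp
      · intro kl _ hkl
        rw [MvPolynomial.pderiv_X_of_ne hkl.symm]
        simp
      · simp
    · exact Finset.sum_congr rfl fun kl _ => by ring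

theorem evalMat_leftTranslate (g M : Matrix (Fin n) (Fin n) ℂ)
    (p : MvPolynomial (Fin n × Fin n) ℂ) :
    evalMat M (leftTranslate g p) = evalMat (g * M) p := by
  induction p using MvPolynomial.induction_on with
  | C a => simp only [leftTranslate_C, evalMat_C]
  | add p q hp hq => simp only [map_add, hp, hq]
  | mul_X p ij hp =>
    obtain ⟨i, j⟩ := ij
    simp only [map_mul, hp, leftTranslate_X, map_sum, evalMat_X, evalMat_C, Matrix.mul_apply]

theorem leftField_leftTranslate (M g : Matrix (Fin n) (Fin n) ℂ)
    (p : MvPolynomial (Fin n × Fin n) ℂ) :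
    leftField M (leftTranslate g p) = leftTranslate g (leftField M p) := by
  induction p using MvPolynomial.induction_on with
  | C a => simp only [leftTranslate_C, leftField_C, map_zero]
  | add p q hp hq => simp only [map_add, hp, hq]
  | mul_X p ij hp =>
    obtain ⟨i, j⟩ := ij
    simp only [map_mul, Derivation.leibniz, smul_eq_mul, map_add, hp]
    congr 2
    simp only [leftTranslate_X, leftField_X, map_sum, Derivation.leibniz, leftField_C,
      leftTranslate_C, smul_eq_mul, map_mul, mul_zero, add_zero, Finset.mul_sum, Finset.sum_mul]
    rw [Finset.sum_comm]
    exact Finset.sum_congr rfl fun k _ => Finset.sum_congr rfl fun l _ => by ring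

theorem leftField_leftField_X (M N : Matrix (Fin n) (Fin n) ℂ) (i j : Fin n) :
    leftField M (leftField N (MvPolynomial.X (i, j))) =
      ∑ k, MvPolynomial.X (i, k) * MvPolynomial.C ((M * N) k j) := by
  rw [leftField_X, map_sum]
  have : ∀ k, leftField M (MvPolynomial.X (i, k) * MvPolynomial.C (N k j)) =
      ∑ l, MvPolynomial.X (i, l) * (MvPolynomial.C (M l k) * MvPolynomial.C (N k j)) := by
    intro k
    rw [Derivation.leibniz, leftField_C, smul_zero, zero_add, leftField_X, smul_eq_mul, Finset.mul_sum]
    exact Finset.sum_congr rfl fun l _ => by ring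
  simp only [this]
  rw [Finset.sum_comm]
  refine Finset.sum_congr rfl fun l _ => ?_
  rw [Matrix.mul_apply, map_sum, Finset.mul_sum]
  exact Finset.sum_congr rfl fun k _ => by rw [map_mul]

theorem leftField_bracket (M N : Matrix (Fin n) (Fin n) ℂ) :
    ⁅leftField M, leftField N⁆ = leftField ⁅M, N⁆ := by
  refine MvPolynomial.derivation_ext fun ij => ?_
  obtain ⟨i, j⟩ := ij
  rw [Derivation.commutator_apply, leftField_leftField_X, leftField_leftField_X, leftField_X,
    ← Finset.sum_sub_distrib]
  refine Finset.sum_congr rfl fun k _ => ?_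
  rw [Ring.lie_def, Matrix.sub_apply, map_sub, mul_sub]

theorem leftField_mem_vanishing (G : Subgroup (GL (Fin n) ℂ)) {M : Matrix (Fin n) (Fin n) ℂ}
    (hM : ∀ p ∈ vanishing G, derivAtOne M p = 0) {p : MvPolynomial (Fin n × Fin n) ℂ}
    (hp : p ∈ vanishing G) : leftField M p ∈ vanishing G := by
  intro g hg
  have h1 : leftTranslate (g : Matrix (Fin n) (Fin n) ℂ) p ∈ vanishing G := by
    intro k hk
    rw [evalMat_leftTranslate]
    exact hp (g * k) (G.mul_mem hg hk)
  have h2 := hM _ h1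
  rwa [← evalMat_one_leftField, leftField_leftTranslate, evalMat_leftTranslate, mul_one] at h2

/-- The Lie algebra of `G`: the tangent space at the identity, with the commutator bracket. -/
def lieAlg (G : Subgroup (GL (Fin n) ℂ)) : LieSubalgebra ℂ (Matrix (Fin n) (Fin n) ℂ) where
  carrier := {M | ∀ p ∈ vanishing G, derivAtOne M p = 0}
  zero_mem' := fun p _ => by simp [derivAtOne]
  add_mem' := fun {M N} hM hN p hp => by
    have h1 := hM p hp
    have h2 := hN p hp
    unfold derivAtOne at *
    simp only [Matrix.add_apply, add_mul, Finset.sum_add_distrib, h1, h2, add_zero]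
  smul_mem' := fun c {M} hM p hp => by
    have h1 := hM p hp
    unfold derivAtOne at *
    simp only [Matrix.smul_apply, smul_eq_mul, mul_assoc, ← Finset.mul_sum, h1, mul_zero]
  lie_mem' := fun {M N} hM hN p hp => by
    rw [← evalMat_one_leftField, ← leftField_bracket, Derivation.commutator_apply, map_sub,
      evalMat_one_leftField, evalMat_one_leftField, hM _ (leftField_mem_vanishing G hN hp),
      hN _ (leftField_mem_vanishing G hM hp), sub_zero]

/-- The underlying matrix of an element of `G`. -/
abbrev mat {G : Subgroup (GL (Fin n) ℂ)} (g : G) : Matrix (Fin n) (Fin n) ℂ :=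
  ((g : GL (Fin n) ℂ) : Matrix (Fin n) (Fin n) ℂ)

/-- `x' = Ad(g) x`. -/
def IsAd {G : Subgroup (GL (Fin n) ℂ)} (g : G) (x x' : lieAlg G) : Prop :=
  (x' : Matrix (Fin n) (Fin n) ℂ) = mat g * x * mat g⁻¹

/-- The nilpotent element `ν` is principal: its orbit is dense in the cone of nilpotent elements
of the Lie algebra (an orbit is always open in its closure). -/
def IsPrincipal (G : Subgroup (GL (Fin n) ℂ)) (ν : lieAlg G) : Prop :=
  IsNilpotent (ν : Matrix (Fin n) (Fin n) ℂ) ∧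
    ∀ p : MvPolynomial (Fin n × Fin n) ℂ,
      (∀ (g : G) (x : lieAlg G), IsAd g ν x → evalMat (x : Matrix (Fin n) (Fin n) ℂ) p = 0) →
      ∀ x : lieAlg G, IsNilpotent (x : Matrix (Fin n) (Fin n) ℂ) →
        evalMat (x : Matrix (Fin n) (Fin n) ℂ) p = 0

/-- The connected subgroup of `G` that corresponds to a Lie subalgebra: it is generated by the
exponentials of the elements of that subalgebra. -/
def connectedSubgroup (G : Subgroup (GL (Fin n) ℂ)) (𝔥 : Submodule ℂ (lieAlg G)) : Subgroup G :=
  Subgroup.closure {g | ∃ x ∈ 𝔥, mat g = NormedSpace.exp (x : Matrix (Fin n) (Fin n) ℂ)}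

/-- The regular functions on a set of invertible matrices: polynomials in the matrix entries
and the inverse of the determinant. -/
def matAlgebra {X : Type} (ι : X → GL (Fin n) ℂ) : Subalgebra ℂ (X → ℂ) :=
  Algebra.adjoin ℂ
    ({F | ∃ i j, F = fun x => (ι x : Matrix (Fin n) (Fin n) ℂ) i j} ∪
      {F | F = fun x => (Matrix.det (ι x : Matrix (Fin n) (Fin n) ℂ))⁻¹})

/-! ### The torus, the Borel subgroup and the cone

In the following `h` and `ν` are the neutral and the nilpositive element of an
`sl₂`-triple in the Lie algebra of `G`, with `ν` principal nilpotent. -/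

variable (G : Subgroup (GL (Fin n) ℂ)) (h ν : lieAlg G)

/-- `𝔤_k`, the eigenspace of `ad h` with eigenvalue `k`. -/
def gr (k : ℤ) : Submodule ℂ (lieAlg G) :=
  Module.End.eigenspace (LieAlgebra.ad ℂ (lieAlg G) h : Module.End ℂ (lieAlg G)) (k : ℂ)

/-- `𝔤_{≥ k}`, the sum of the `𝔤_i` with `i ≥ k`. -/
def grGE (k : ℤ) : Submodule ℂ (lieAlg G) := ⨆ i : {i : ℤ // k ≤ i}, gr G h i

/-- `𝔲 = 𝔤_{> 0}`. -/
def nilradical : Submodule ℂ (lieAlg G) := grGE G h 1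

/-- The torus `T` with Lie algebra `𝔱 = 𝔤_0`. -/
def torusT : Subgroup G := connectedSubgroup G (gr G h 0)

/-- The group `U` with Lie algebra `𝔲`. -/
def groupU : Subgroup G := connectedSubgroup G (nilradical G h)

/-- The Borel subgroup `B` with Lie algebra `𝔟 = 𝔱 + 𝔲`. -/
def borel : Subgroup G := connectedSubgroup G (gr G h 0 ⊔ nilradical G h)

/-- The regular functions on `T`. -/
def torusAlgebra : Subalgebra ℂ (torusT G h → ℂ) :=
  matAlgebra fun t => ((t : G) : GL (Fin n) ℂ)

/-- The algebraic characters of `T`: homomorphisms of algebraic groups `T → ℂ^×`. -/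
def characters : Subgroup (torusT G h →* ℂˣ) where
  carrier := {χ | (fun t => (χ t : ℂ)) ∈ torusAlgebra G h ∧
    (fun t => (((χ t)⁻¹ : ℂˣ) : ℂ)) ∈ torusAlgebra G h}
  one_mem' := by
    constructor
    · convert (torusAlgebra G h).one_mem using 1
      ext t
      simp
    · convert (torusAlgebra G h).one_mem using 1
      ext t
      simp
  mul_mem' := fun {a b} ha hb => by
    constructor
    · convert (torusAlgebra G h).mul_mem ha.1 hb.1 using 1
      ext t
      simp
    · convert (torusAlgebra G h).mul_mem ha.2 hb.2 using 1
      ext t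
      simp [mul_comm]
  inv_mem' := fun {a} ha => ⟨by simpa using ha.2, by simpa using ha.1⟩

/-- The character group of `T`, written additively. -/
abbrev CharLattice : Type := Additive (characters G h)

variable {G h} in
/-- The value `e^χ(t)`. -/
def charEval (χ : CharLattice G h) (t : torusT G h) : ℂˣ := (Additive.toMul χ).1 t

/-- The real vector space spanned by the characters. -/
abbrev RealSpan : Type := ℝ ⊗[ℤ] CharLattice G h

/-- The embedding of the character group of `T` in its real span. -/
def toReal : CharLattice G h →+ RealSpan G h :=
  (TensorProduct.mk ℤ ℝ (CharLattice G h) 1).toAddMonoidHom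

/-- `x ∈ 𝔤` is a vector of weight `χ` for the adjoint action of `T`. -/
def IsWeightVector (χ : CharLattice G h) (x : lieAlg G) : Prop :=
  ∀ (t : torusT G h), IsAd (t : G) x ((charEval χ t : ℂ) • x)

/-- The roots `Φ`: the nonzero weights of `T` on `𝔤`. -/
def roots : Set (CharLattice G h) := {α | α ≠ 0 ∧ ∃ x, x ≠ 0 ∧ IsWeightVector G h α x}

/-- The positive roots `Φ⁺`: the weights of `T` on `𝔲`. -/
def posRoots : Set (CharLattice G h) :=
  {α | ∃ x ∈ nilradical G h, x ≠ 0 ∧ IsWeightVector G h α x}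

/-- The simple roots: the positive roots that are not the sum of two positive roots. -/
def simpleRoots : Set (CharLattice G h) :=
  {α | α ∈ posRoots G h ∧ ∀ β ∈ posRoots G h, ∀ γ ∈ posRoots G h, α ≠ β + γ}

/-- The cone `σ^∨` generated by the simple roots. -/
def dualCone : PointedCone ℝ (RealSpan G h) :=
  PointedCone.hull ℝ (toReal G h '' simpleRoots G h)

/-- The lattice `P`, the character group of `T`, in its real span. -/
def latticeP : AddSubgroup (RealSpan G h) := (toReal G h).range

/-- The root lattice `Q`, in the real span of `P`. -/
def latticeQ : AddSubgroup (RealSpan G h) := AddSubgroup.closure (toReal G h '' roots G h)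

/-- The lattice `Q_d = (1/d) Q` (for `d > 0`). -/
def latticeQd (d : ℕ) : AddSubgroup (RealSpan G h) :=
  (latticeQ G h).comap (nsmulAddMonoidHom d)

/-! ### Toric varieties -/

section Toric

variable {G h} (L : AddSubgroup (RealSpan G h))

/-- The semigroup `σ^∨ ∩ L`. -/
def coneSemigroup : AddSubmonoid (RealSpan G h) :=
  (dualCone G h).toAddSubmonoid ⊓ L.toAddSubmonoid

/-- The torus with character group `L`. -/
abbrev TorusOf : Type := Multiplicative L →* ℂˣ

/-- The torus with character group `L` as a variety: its ring of functions is spanned by the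
functions `e^μ`, `μ ∈ L`. -/
def torusOf : FunctionSpace :=
  ofAlgebra (TorusOf L)
    (Algebra.adjoin ℂ {F | ∃ μ : L, F = fun s => (s (Multiplicative.ofAdd μ) : ℂ)})

/-- The points of the affine toric variety with coordinate ring `ℂ[σ^∨ ∩ L]`: semigroup
homomorphisms `σ^∨ ∩ L → ℂ`, i.e. algebra homomorphisms `ℂ[σ^∨ ∩ L] → ℂ`. -/
abbrev ToricPoint : Type := Multiplicative (coneSemigroup L) →* ℂ

/-- The coordinate ring `ℂ[σ^∨ ∩ L]`, spanned by the functions `e^μ : v ↦ v(μ)`, `μ ∈ σ^∨ ∩ L`. -/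
def toricAlgebra : Subalgebra ℂ (ToricPoint L → ℂ) :=
  Algebra.adjoin ℂ {F | ∃ μ : coneSemigroup L, F = fun v => v (Multiplicative.ofAdd μ)}

/-- The affine toric variety with coordinate ring `ℂ[σ^∨ ∩ L]`. -/
def toric : FunctionSpace := ofAlgebra (ToricPoint L) (toricAlgebra L)

/-- The value `v(μ)` of `e^μ` at the point `v` of the toric variety, for `μ ∈ σ^∨ ∩ L`. -/
def toricEval {L : AddSubgroup (RealSpan G h)} (v : ToricPoint L) (μ : RealSpan G h)
    (hμ : μ ∈ coneSemigroup L) : ℂ := v (Multiplicative.ofAdd ⟨μ, hμ⟩)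

/-- The inclusion of `σ^∨ ∩ L` in `L`. -/
def coneInclusion : Multiplicative (coneSemigroup L) →* Multiplicative L :=
  AddMonoidHom.toMultiplicative
    (AddSubmonoid.inclusion (S := coneSemigroup L) (T := L.toAddSubmonoid) inf_le_right)

/-- The embedding of the torus in the toric variety, which restricts `s : L → ℂ^×` to
`σ^∨ ∩ L`. -/
def torusToToric : TorusOf L →* ToricPoint L where
  toFun s := (Units.coeHom ℂ).comp (s.comp (coneInclusion L))
  map_one' := by ext; rfl
  map_mul' := fun s s' => by ext; rfl

/-- The action of the torus on the toric variety: `(s • v)(μ) = e^μ(s) v(μ)`. -/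
instance toricAction : MulAction (TorusOf L) (toric L).carrier :=
  MulAction.compHom (ToricPoint L) (torusToToric L)

theorem toricEval_smul (s : TorusOf L) (v : (toric L).carrier) (μ : RealSpan G h)
    (hμ : μ ∈ coneSemigroup L) :
    toricEval (L := L) (s • v) μ hμ =
      (s (Multiplicative.ofAdd ⟨μ, hμ.2⟩) : ℂ) * toricEval (L := L) v μ hμ := rfl

end Toric

/-- The toric variety `𝒱` for the torus `T`, with coordinate ring `ℂ[σ^∨ ∩ P]`. -/
abbrev toricV : FunctionSpace := toric (latticeP G h)

/-- `Z_d`: the kernel of the map from the torus `T_d` with character group `Q_d` to `T` (which has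
character group `P`), i.e. the elements at which the characters in `P` take the value `1`. -/
def groupZd (d : ℕ) : Subgroup (TorusOf (latticeQd G h d)) where
  carrier := {z | ∀ μ : latticeQd G h d, μ.1 ∈ latticeP G h → z (Multiplicative.ofAdd μ) = 1}
  one_mem' := fun _ _ => rfl
  mul_mem' := fun {a b} ha hb μ hμ => by simp [ha μ hμ, hb μ hμ]
  inv_mem' := fun {a} ha μ hμ => by simp [ha μ hμ]

/-! ### The variety `𝔲̃` and the mixed space `G ×^B 𝔲̃` -/

theorem simpleRoot_mem (α : simpleRoots G h) :
    toReal G h α.1 ∈ coneSemigroup (latticeP G h) :=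
  ⟨Submodule.subset_span ⟨α.1, α.2, rfl⟩, ⟨α.1, rfl⟩⟩

/-- The graph of the map `ρ : 𝒱 → 𝒱_ad = 𝔤_2` given on coordinate rings by `E_α^* ↦ e^α`. Here
`ν` is the sum over the simple roots `α` of root vectors `E_α` (which are determined by `ν`), so
that `ρ(v)` is the sum of the `v(α) E_α`. -/
def IsRho (v : ToricPoint (latticeP G h)) (y : lieAlg G) : Prop :=
  ∃ E : simpleRoots G h → lieAlg G, (∀ α, IsWeightVector G h α.1 (E α)) ∧ ν = ∑ᶠ α, E α ∧
    y = ∑ᶠ α, toricEval v (toReal G h α.1) (simpleRoot_mem G h α) • E α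

/-- The fibre product `𝔲̃` of `𝒱` and `𝔲` over `𝒱_ad = 𝔤_2 = 𝔲 / 𝔤_{≥ 4}`. -/
def uTilde : Set (ToricPoint (latticeP G h) × lieAlg G) :=
  {w | w.2 ∈ nilradical G h ∧ ∃ y, IsRho G h ν w.1 y ∧ w.2 - y ∈ grGE G h 4}

/-- The regular functions on `𝔲̃`. -/
def uTildeAlgebra : Subalgebra ℂ (uTilde G h ν → ℂ) :=
  restrictAlgebra (prodAlgebra (toricAlgebra (latticeP G h)) (polyAlgebra (lieAlg G)))
    (uTilde G h ν)

/-- `w' = b • w` for the action of `b ∈ B` on `𝔲̃`: on the component in `𝒱` the group `B = T U`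
acts through the action of `T` with `U` acting trivially, and on the component in `𝔲` it acts by
the adjoint action. -/
def IsBorelTranslate (b : G) (w w' : uTilde G h ν) : Prop :=
  (∃ t : torusT G h, ∃ u ∈ groupU G h, b = (t : G) * u ∧
    ∀ (χ : CharLattice G h) (hχ : toReal G h χ ∈ coneSemigroup (latticeP G h)),
      toricEval w'.1.1 (toReal G h χ) hχ =
        charEval χ t * toricEval w.1.1 (toReal G h χ) hχ) ∧
  IsAd b w.1.2 w'.1.2

/-- The mixed space `ℳ̃ = G ×^B 𝔲̃`: the quotient of `G × 𝔲̃` by the action of `B` given by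
`b • (g, w) = (g b⁻¹, b • w)`. -/
def mixedSpace : FunctionSpace :=
  (ofAlgebra (G × uTilde G h ν)
    (prodAlgebra (matAlgebra fun g : G => (g : GL (Fin n) ℂ)) (uTildeAlgebra G h ν))).quot
  fun p q => ∃ b ∈ borel G h, q.1 = p.1 * b⁻¹ ∧ IsBorelTranslate G h ν b p.2 q.2

end Groups

end Orbifold

end

open Orbifold FunctionSpace

noncomputable section

namespace Orbifold

namespace FunctionSpace

/-! ### Morphisms -/

/-! Structure of `𝔤`. The rank of `ad x` is lower semicontinuous and the orbit of `ν` is dense among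
the nilpotents, so the centralizer of `ν` is no larger than that of the nilpotent element obtained
by adding simple root vectors for some Cartan subalgebra; its dimension is at most the rank of `𝔤`
(`IsPrincipal.finrank_ker_ad_le_rank`). By `sl₂`-theory that dimension equals `dim 𝔤_0 + dim 𝔤_{-1}`
(`IsSl2.finrank_ker_e`). Hence `𝔤_0` is a Cartan subalgebra, `𝔤_{±1} = 0`, and the simple roots are
the weights of `ad h`-degree `2`; they form a basis of the dual of `𝔱`. Characters take integral
values on coroots, so by Cramer's rule the root lattice has finite index in `P`
(`PrincipalTriple.exists_nsmul_mem_closure`).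

Part 1. In the basis `α / d` the lattice `Q_d` is `ℤ ^ r` and `σ^∨ ∩ Q_d` is `ℕ ^ r`, so `T_d` is a
torus and `𝒱_d` is affine space. The group `Z_d` is the annihilator of `P` in `T_d`. Summing a
monomial `e^μ` over `Z_d` gives a multiple of `e^μ` if `μ ∈ P` and zero otherwise, by orthogonality
of characters (`hasReynolds_annihilator`). Thus the invariants of `ℂ[σ^∨ ∩ Q_d]` are `ℂ[σ^∨ ∩ P]`,
and the quotient of an affine variety by a finite group is the variety of its invariants
(`exists_isIso_orbitSpace`).

Part 2. The group `U` acts trivially on `𝔤_2 = 𝔲 / 𝔤_{≥ 4}`, and subtracting `ρ(v)` identifies `𝔲̃`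
with `𝒱 × 𝔤_{≥ 4}`. Over a translate `g₀ U⁻ T U` of the big cell every `B`-orbit has exactly one
representative with group component in `g₀ U⁻`. Since `exp` identifies `𝔲⁻` with `U⁻`, this part of
`ℳ̃` is `𝒱 × E` with the vector space `E = 𝔲⁻ × 𝔤_{≥ 4}` (`PrincipalTriple.chart_isomorphic`), that
is `(𝒱_d × E) / Z_d`, and `𝒱_d × E` is an affine space.

The remaining point is that the big cell is Zariski open and its factors are regular
(`PrincipalTriple.isOpen_bigCell`). The lower unipotent factor is a rational expression in the
matrix entries (`lowerPart_mul`). The big cell contains curves in every direction of `𝔤` at the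
identity, so by Krull's intersection theorem a regular function vanishing on it vanishes near the
identity (`exists_localizer`). The equations satisfied by the factors then extend to a
neighbourhood, and translation finishes the argument. -/

theorem isMorphism_id (X : FunctionSpace) : X.IsMorphism X id := ⟨continuous_id, fun _ _ h => h⟩

theorem IsMorphism.comp {X Y Z : FunctionSpace} {ψ : Y.carrier → Z.carrier}
    {φ : X.carrier → Y.carrier} (hψ : Y.IsMorphism Z ψ) (hφ : X.IsMorphism Y φ) :
    X.IsMorphism Z (ψ ∘ φ) :=
  ⟨hψ.1.comp hφ.1, fun x f hf => hφ.2 x _ (hψ.2 (φ x) f hf)⟩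

theorem IsIso.symm {X Y : FunctionSpace} {e : X.carrier ≃ Y.carrier} (h : X.IsIso Y e) :
    Y.IsIso X e.symm := ⟨h.2, h.1⟩

theorem IsIso.trans {X Y Z : FunctionSpace} {e : X.carrier ≃ Y.carrier} {e' : Y.carrier ≃ Z.carrier}
    (h : X.IsIso Y e) (h' : Y.IsIso Z e') : X.IsIso Z (e.trans e') :=
  ⟨h'.1.comp h.1, h.2.comp h'.2⟩

theorem Isomorphic.trans {X Y Z : FunctionSpace} :
    X.Isomorphic Y → Y.Isomorphic Z → X.Isomorphic Z :=
  fun ⟨e, h⟩ ⟨e', h'⟩ => ⟨e.trans e', h.trans h'⟩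

theorem isMorphism_subtypeVal (X : FunctionSpace) (s : Set X.carrier) :
    (X.restrict s).IsMorphism X Subtype.val :=
  ⟨continuous_subtype_val, fun _ f hf => ⟨f, hf, Eventually.of_forall fun _ => rfl⟩⟩

theorem IsMorphism.codRestrict {X Y : FunctionSpace} {φ : X.carrier → Y.carrier}
    (hφ : X.IsMorphism Y φ) {s : Set Y.carrier} (hs : ∀ x, φ x ∈ s) :
    X.IsMorphism (Y.restrict s) (fun x => ⟨φ x, hs x⟩) := by
  have hc : Continuous (fun x => (⟨φ x, hs x⟩ : s)) := hφ.1.subtype_mk hs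
  refine ⟨hc, ?_⟩
  rintro x f ⟨F, hF, h⟩
  refine X.congr _ _ _ (hφ.2 x F hF) ?_
  filter_upwards [hc.continuousAt.eventually h] with y hy
  exact hy.symm

theorem restrict_univ_isomorphic (X : FunctionSpace) : (X.restrict Set.univ).Isomorphic X :=
  ⟨Equiv.Set.univ _, X.isMorphism_subtypeVal _,
    X.isMorphism_id.codRestrict (s := Set.univ) fun _ => Set.mem_univ _⟩

theorem isMorphism_quotMk (X : FunctionSpace) (r : X.carrier → X.carrier → Prop) :
    X.IsMorphism (X.quot r) (Quot.mk r) :=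
  ⟨continuous_quot_mk, fun x _ hf => hf.self_of_nhds x rfl⟩

theorem IsMorphism.quotLift {X Y : FunctionSpace} {r : X.carrier → X.carrier → Prop}
    {φ : X.carrier → Y.carrier} (hφ : X.IsMorphism Y φ) (hr : ∀ x y, r x y → φ x = φ y) :
    (X.quot r).IsMorphism Y (Quot.lift φ hr) := by
  have hc : Continuous (Quot.lift φ hr) := continuous_quot_lift hr hφ.1
  refine ⟨hc, fun q f hf => ?_⟩
  filter_upwards [hc.continuousAt.eventually (Y.eventually _ _ hf)] with q' h x hx
  subst hx
  exact hφ.2 x f h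

/-- A quotient is described near a point by a saturated open set with an invariant morphism that has
a section. -/
theorem quot_restrict_isomorphic {X Y : FunctionSpace} {r : X.carrier → X.carrier → Prop}
    {s : Set X.carrier} (hs : IsOpen s) (hr : ∀ x y, r x y → (x ∈ s ↔ y ∈ s))
    {p : s → Y.carrier} (hp : (X.restrict s).IsMorphism Y p)
    (hpr : ∀ x y : s, r x.1 y.1 → p x = p y)
    {σ : Y.carrier → X.carrier} (hσ : Y.IsMorphism X σ) (hσs : ∀ y, σ y ∈ s)
    (hpσ : ∀ y, p ⟨σ y, hσs y⟩ = y) (hσp : ∀ x : s, Relation.EqvGen r x.1 (σ (p x))) :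
    IsOpen (X := (X.quot r).carrier) (Quot.mk r '' s) ∧
      ((X.quot r).restrict (Quot.mk r '' s)).Isomorphic Y := by
  have hr' : ∀ x y, Relation.EqvGen r x y → (x ∈ s ↔ y ∈ s) := fun x y h => by
    induction h with
    | rel x y h => exact hr x y h
    | refl => rfl
    | symm _ _ _ h => exact h.symm
    | trans _ _ _ _ _ h1 h2 => exact h1.trans h2
  have hpr' : ∀ x y, Relation.EqvGen r x y → ∀ (hx : x ∈ s) (hy : y ∈ s), p ⟨x, hx⟩ = p ⟨y, hy⟩ :=
    fun x y h => by
    induction h with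
    | rel x y h => exact fun hx hy => hpr ⟨x, hx⟩ ⟨y, hy⟩ h
    | refl => exact fun _ _ => rfl
    | symm _ _ _ h => exact fun hx hy => (h hy hx).symm
    | trans x y z h1 _ h3 h4 =>
      exact fun hx hz => (h3 hx ((hr' _ _ h1).1 hx)).trans (h4 _ hz)
  have hpre : ∀ x, Quot.mk r x ∈ Quot.mk r '' s ↔ x ∈ s := by
    intro x
    constructor
    · rintro ⟨y, hy, hyx⟩
      exact (hr' _ _ (Quot.eqvGen_exact hyx)).1 hy
    · exact fun hx => ⟨x, hx, rfl⟩
  -- Because `p` is constant on the classes inside the saturated set `s`, the preimage under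
  -- `Quot.mk` is `p ⁻¹' V` itself, which is open in the open set `s`.
  have hopen : ∀ V : Set Y.carrier, IsOpen V →
      IsOpen {q : Quot r | ∃ x : s, Quot.mk r x.1 = q ∧ p x ∈ V} := by
    intro V hV
    have h1 : IsOpen (X := X.carrier) (Subtype.val '' (p ⁻¹' V)) :=
      hs.isOpenEmbedding_subtypeVal.isOpenMap _ (hV.preimage hp.1)
    rw [← isQuotientMap_quot_mk.isOpen_preimage]
    convert h1 using 1
    ext x
    constructor
    · rintro ⟨y, hy, hyV⟩
      have hx : x ∈ s := (hr' _ _ (Quot.eqvGen_exact hy)).1 y.2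
      refine ⟨⟨x, hx⟩, ?_, rfl⟩
      rwa [Set.mem_preimage, ← hpr' _ _ (Quot.eqvGen_exact hy) y.2 hx]
    · rintro ⟨y, hy, rfl⟩
      exact ⟨y, rfl, hy⟩
  let W : Set (Quot r) := Quot.mk r '' s
  have hW : IsOpen W := by
    convert hopen Set.univ isOpen_univ using 1
    ext q
    constructor
    · rintro ⟨x, hx, rfl⟩
      exact ⟨⟨x, hx⟩, rfl, trivial⟩
    · rintro ⟨x, rfl, -⟩
      exact ⟨x, x.2, rfl⟩
  refine ⟨hW, ?_⟩
  -- The section supplies the inverse chart; surjectivity holds because each point of `s` is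
  -- equivalent to a value of the section.
  let τ : Y.carrier → W := fun y => ⟨Quot.mk r (σ y), σ y, hσs y, rfl⟩
  have hτp : ∀ x : s, (τ (p x)).1 = Quot.mk r x.1 := fun x => (Quot.eqvGen_sound (hσp x)).symm
  have hτ : Function.Bijective τ := by
    constructor
    · intro y y' h
      have h1 := hpr' _ _ (Quot.eqvGen_exact (congrArg Subtype.val h)) (hσs y) (hσs y')
      rwa [hpσ, hpσ] at h1
    · rintro ⟨_, x, hx, rfl⟩
      exact ⟨p ⟨x, hx⟩, Subtype.ext (hτp ⟨x, hx⟩)⟩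
  let e := Equiv.ofBijective τ hτ
  have he : ∀ (x : s) (hx : Quot.mk r x.1 ∈ W), e.symm ⟨Quot.mk r x.1, hx⟩ = p x := by
    intro x hx
    rw [Equiv.symm_apply_eq]
    exact Subtype.ext (hτp x).symm
  have hmorτ : Y.IsMorphism ((X.quot r).restrict W) e :=
    IsMorphism.codRestrict (Y := X.quot r) ((X.isMorphism_quotMk r).comp hσ) _
  have hcont : Continuous e.symm := by
    refine continuous_def.2 fun V hV => ?_
    refine ⟨_, hopen V hV, ?_⟩
    ext ⟨_, x, hx, rfl⟩
    constructor
    · rintro ⟨y, hy, hyV⟩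
      have h1 : (⟨Quot.mk r x, x, hx, rfl⟩ : W) = ⟨Quot.mk r y.1, y.1, y.2, rfl⟩ :=
        Subtype.ext hy.symm
      have h2 := he y ⟨y.1, y.2, rfl⟩
      rw [← h1] at h2
      change e.symm _ ∈ V
      rw [h2]
      exact hyV
    · intro h
      have h2 := he ⟨x, hx⟩ ⟨x, hx, rfl⟩
      exact ⟨⟨x, hx⟩, rfl, h2 ▸ h⟩
  refine ⟨e.symm, ⟨hcont, ?_⟩, hmorτ⟩
  intro (w : W) f hf
  classical
  -- Regularity on a subspace asks for a function on the whole quotient. Extension by zero is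
  -- harmless: `W` is open and only germs at its points are tested.
  let F : Quot r → ℂ := fun q => if hq : q ∈ W then f (e.symm ⟨q, hq⟩) else 0
  have hF : ∀ q : W, f (e.symm q) = F q := fun q => by simp only [F, dif_pos q.2]
  have hFe : ∀ x : s, F (Quot.mk r x.1) = f (p x) := by
    intro x
    have : Quot.mk r x.1 ∈ W := ⟨x, x.2, rfl⟩
    simp only [F, dif_pos this, he]
  refine ⟨F, ?_, Eventually.of_forall hF⟩
  have h1 := hcont.continuousAt.eventually (Y.eventually _ _ hf)
  have h2 : ∀ᶠ q in 𝓝 w.1, ∃ hq : q ∈ W, Y.RegAt (e.symm ⟨q, hq⟩) f := by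
    have h3 := hW.isOpenEmbedding_subtypeVal.map_nhds_eq w
    rw [← h3, eventually_map]
    exact h1.mono fun q hq => ⟨q.2, hq⟩
  change ∀ᶠ q' in 𝓝 w.1, ∀ x, Quot.mk r x = q' → X.RegAt x (F ∘ Quot.mk r)
  filter_upwards [h2] with q' hq' x hx
  subst hx
  obtain ⟨hq, hreg⟩ := hq'
  have hxs : x ∈ s := (hpre x).1 hq
  rw [he ⟨x, hxs⟩ hq] at hreg
  obtain ⟨F', hF', h5⟩ := hp.2 ⟨x, hxs⟩ f hreg
  refine X.congr _ _ _ hF' ?_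
  have h6 := hs.isOpenEmbedding_subtypeVal.map_nhds_eq (⟨x, hxs⟩ : s)
  rw [← h6, eventually_map]
  refine h5.mono fun y hy => ?_
  rw [← hy]
  exact (hFe y).symm

/-! ### Spaces defined by an algebra of functions -/

section OfAlgebra

variable {X Y : Type} {A : Subalgebra ℂ (X → ℂ)} {C : Subalgebra ℂ (Y → ℂ)}

theorem isTopologicalBasis_zariski (A : Subalgebra ℂ (X → ℂ)) :
    @TopologicalSpace.IsTopologicalBasis X (zariski A) {s | ∃ f ∈ A, s = {x | f x ≠ 0}} :=
  @TopologicalSpace.IsTopologicalBasis.mk X (zariski A) _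
    (by
      rintro _ ⟨f, hf, rfl⟩ _ ⟨g, hg, rfl⟩ x ⟨hx1, hx2⟩
      refine ⟨_, ⟨f * g, A.mul_mem hf hg, rfl⟩, mul_ne_zero hx1 hx2, fun y hy => ?_⟩
      exact ⟨left_ne_zero_of_mul hy, right_ne_zero_of_mul hy⟩)
    (Set.eq_univ_of_forall fun x => ⟨_, ⟨1, A.one_mem, rfl⟩, one_ne_zero⟩) rfl

theorem exists_basic_of_isOpen {U : Set X} (hU : IsOpen[zariski A] U) {x : X} (hx : x ∈ U) :
    ∃ b ∈ A, b x ≠ 0 ∧ ∀ y, b y ≠ 0 → y ∈ U := by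
  obtain ⟨_, ⟨b, hb, rfl⟩, hxb, hbU⟩ :=
    @TopologicalSpace.IsTopologicalBasis.exists_subset_of_mem_open X (zariski A) _
      (isTopologicalBasis_zariski A) x U hx hU
  exact ⟨b, hb, hxb, hbU⟩

theorem exists_basic_of_eventually {P : X → Prop} {x : X} (h : ∀ᶠ y in @nhds X (zariski A) x, P y) :
    ∃ b ∈ A, b x ≠ 0 ∧ ∀ y, b y ≠ 0 → P y := by
  obtain ⟨U, hUP, hU, hxU⟩ := @eventually_nhds_iff X (zariski A) x P |>.1 h
  obtain ⟨b, hb, hxb, hbU⟩ := exists_basic_of_isOpen hU hxU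
  exact ⟨b, hb, hxb, fun y hy => hUP y (hbU y hy)⟩

theorem isOpen_ne_zero {f : X → ℂ} (hf : f ∈ A) : IsOpen[zariski A] {x | f x ≠ 0} :=
  TopologicalSpace.isOpen_generateFrom_of_mem ⟨f, hf, rfl⟩

theorem regAt_of_mem {f : X → ℂ} (hf : f ∈ A) (x : X) : (ofAlgebra X A).RegAt x f :=
  ⟨f, hf, 1, A.one_mem, one_ne_zero, Eventually.of_forall fun _ => mul_one _⟩

/-- A function `f` is regular at `x` when `f q = p` with `p, q ∈ A` and `q x ≠ 0`. -/
theorem regAt_iff {f : X → ℂ} {x : X} : (ofAlgebra X A).RegAt x f ↔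
    ∃ p ∈ A, ∃ q ∈ A, q x ≠ 0 ∧ f * q = p := by
  constructor
  · rintro ⟨p, hp, q, hq, hqx, h⟩
    -- Multiplying numerator and denominator by a function that vanishes wherever the fraction might
    -- fail to represent `f` makes the local identity global.
    obtain ⟨b, hb, hbx, h⟩ := exists_basic_of_eventually h
    refine ⟨p * b, A.mul_mem hp hb, q * b, A.mul_mem hq hb, mul_ne_zero hqx hbx, ?_⟩
    ext y
    by_cases hy : b y = 0
    · simp [hy]
    · simp only [Pi.mul_apply]
      rw [← h y hy, mul_assoc]
  · rintro ⟨p, hp, q, hq, hqx, h⟩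
    exact ⟨p, hp, q, hq, hqx, Eventually.of_forall fun y => congrFun h y⟩

/-- The basic open sets are non-vanishing loci and the regular functions are fractions of elements
of `A`, so continuity and pull-back need only be tested on `A`; `isMorphism_adjoin` reduces this
further to generators. -/
theorem isMorphism_ofAlgebra {Z : FunctionSpace} {φ : Z.carrier → X}
    (H : ∀ f ∈ A, ∀ z, Z.RegAt z (f ∘ φ)) : Z.IsMorphism (ofAlgebra X A) φ := by
  have hc : @Continuous _ X _ (zariski A) φ := by
    refine continuous_generateFrom_iff.2 ?_
    rintro _ ⟨f, hf, rfl⟩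
    rw [isOpen_iff_mem_nhds]
    exact fun z hz => Z.ne_zero z _ (H f hf z) hz
  refine ⟨hc, ?_⟩
  intro z f hf
  obtain ⟨p, hp, q, hq, hqx, h⟩ := regAt_iff.1 hf
  have h1 := Z.mul z _ _ (H p hp z) (Z.inv z _ (H q hq z) hqx)
  refine Z.congr z _ _ h1 ?_
  filter_upwards [Z.ne_zero z _ (H q hq z) hqx] with y hy
  have h2 : f (φ y) * q (φ y) = p (φ y) := congrFun h (φ y)
  change p (φ y) * (q (φ y))⁻¹ = f (φ y)
  rw [← h2]
  exact mul_inv_cancel_right₀ (G₀ := ℂ) hy _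

theorem isMorphism_adjoin {Z : FunctionSpace} {φ : Z.carrier → X} {s : Set (X → ℂ)}
    (H : ∀ f ∈ s, ∀ z, Z.RegAt z (f ∘ φ)) : Z.IsMorphism (ofAlgebra X (Algebra.adjoin ℂ s)) φ := by
  refine isMorphism_ofAlgebra fun f hf z => ?_
  induction hf using Algebra.adjoin_induction with
  | mem f hf => exact H f hf z
  | algebraMap c => exact Z.const z c
  | add f g _ _ hf hg => exact Z.add z _ _ hf hg
  | mul f g _ _ hf hg => exact Z.mul z _ _ hf hg

theorem isMorphism_of_comp_mem {φ : X → Y} (H : ∀ f ∈ C, f ∘ φ ∈ A) :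
    (ofAlgebra X A).IsMorphism (ofAlgebra Y C) φ :=
  isMorphism_ofAlgebra fun f hf z => regAt_of_mem (H f hf) z

theorem comp_mem_of_adjoin {s : Set (Y → ℂ)} {φ : X → Y} (H : ∀ f ∈ s, f ∘ φ ∈ A) {f : Y → ℂ}
    (hf : f ∈ Algebra.adjoin ℂ s) : f ∘ φ ∈ A := by
  induction hf using Algebra.adjoin_induction with
  | mem f hf => exact H f hf
  | algebraMap c => exact A.algebraMap_mem c
  | add f g _ _ hf hg => exact A.add_mem hf hg
  | mul f g _ _ hf hg => exact A.mul_mem hf hg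

theorem isIso_of_comp_mem {e : X ≃ Y} (H : ∀ f ∈ C, f ∘ e ∈ A) (H' : ∀ f ∈ A, f ∘ e.symm ∈ C) :
    (ofAlgebra X A).IsIso (ofAlgebra Y C) e :=
  ⟨isMorphism_of_comp_mem H, isMorphism_of_comp_mem H'⟩

end OfAlgebra

/-! ### Quotients by finite groups -/

section FiniteGroup

variable {X Y : Type} {A : Subalgebra ℂ (X → ℂ)} {C : Subalgebra ℂ (Y → ℂ)}
  {Γ : Type} [Group Γ] [Finite Γ] [MulAction Γ X]

/-- An element of a stable ideal can be replaced by an invariant element of the ideal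
(a coefficient of the product of the `T + γ b`). -/
theorem exists_invariant (hA : ∀ γ : Γ, ∀ f ∈ A, (fun x => f (γ • x)) ∈ A) {I : Set (X → ℂ)}
    (hI0 : 0 ∈ I) (hIadd : ∀ f ∈ I, ∀ g ∈ I, f + g ∈ I) (hImul : ∀ f ∈ I, ∀ g ∈ A, g * f ∈ I)
    (hIΓ : ∀ γ : Γ, ∀ f ∈ I, (fun x => f (γ • x)) ∈ I)
    {b : X → ℂ} (hb : b ∈ I) (hbA : b ∈ A) {x : X} (hx : b x ≠ 0) :
    ∃ b' ∈ I, b' ∈ A ∧ b' x ≠ 0 ∧ ∀ (γ : Γ) y, b' (γ • y) = b' y := by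
  classical
  have : Fintype Γ := Fintype.ofFinite Γ
  -- Translation by the group only permutes the factors, so all coefficients of `P` are invariant
  -- functions.
  let P : X → Polynomial ℂ := fun y => ∏ γ : Γ, (Polynomial.X + Polynomial.C (b (γ • y)))
  have hP : ∀ (γ : Γ) y, P (γ • y) = P y := by
    intro γ y
    simp only [P, smul_smul]
    exact Fintype.prod_equiv (Equiv.mulRight γ) _ _ fun _ => rfl
  -- These are elementary symmetric functions of positive degree in the translates of `b`, so each
  -- term has a factor in the stable ideal. The leading coefficient `1` has to be excluded.
  have hcoeff : ∀ (k : ℕ), k < Fintype.card Γ →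
      (fun y => (P y).coeff k) ∈ I ∧ (fun y => (P y).coeff k) ∈ A := by
    intro k hk
    have h1 : (fun y => (P y).coeff k) =
        ∑ t ∈ Finset.powersetCard (Fintype.card Γ - k) (Finset.univ : Finset Γ),
          ∏ γ ∈ t, (fun y => b (γ • y)) := by
      ext y
      simp only [P]
      rw [Finset.prod_X_add_C_coeff _ _ (by rw [Finset.card_univ]; exact hk.le)]
      simp
    rw [h1]
    constructor
    · refine Finset.sum_induction _ (· ∈ I) (fun a c ha hc => hIadd a ha c hc) hI0 fun t ht => ?_
      have hcard : t.card ≠ 0 := by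
        rw [(Finset.mem_powersetCard.1 ht).2]; omega
      obtain ⟨γ, hγ⟩ := Finset.card_ne_zero.1 hcard
      rw [← Finset.prod_erase_mul _ _ hγ]
      exact hImul _ (hIΓ γ b hb) _ (prod_mem fun γ _ => hA γ b hbA)
    · exact sum_mem fun t _ => prod_mem fun γ _ => hA γ b hbA
  -- If all lower coefficients vanished at `x`, then `P x` would be a power of the variable; but `-b
  -- x` is a root, from the factor of the identity.
  have hne : ∃ k < Fintype.card Γ, (P x).coeff k ≠ 0 := by
    by_contra! H
    have h1 : P x = Polynomial.X ^ Fintype.card Γ := by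
      have hmonic : (P x).Monic := Polynomial.monic_prod_of_monic _ _ fun γ _ => Polynomial.monic_X_add_C _
      have hdeg : (P x).natDegree = Fintype.card Γ := by
        simp only [P]
        rw [Polynomial.natDegree_prod_of_monic _ _ fun γ _ => Polynomial.monic_X_add_C _]
        simp
      ext k
      rw [Polynomial.coeff_X_pow]
      rcases lt_trichotomy k (Fintype.card Γ) with hk | hk | hk
      · rw [H k hk, if_neg hk.ne]
      · rw [hk, if_pos rfl, ← hdeg]; exact hmonic
      · rw [if_neg hk.ne', Polynomial.coeff_eq_zero_of_natDegree_lt (by omega)]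
    have h2 : (P x).eval (-b x) = 0 := by
      simp only [P, Polynomial.eval_prod, Polynomial.eval_add, Polynomial.eval_X, Polynomial.eval_C]
      exact Finset.prod_eq_zero (Finset.mem_univ (1 : Γ)) (by rw [one_smul, neg_add_cancel])
    rw [h1, Polynomial.eval_pow, Polynomial.eval_X] at h2
    exact hx (neg_eq_zero.1 (eq_zero_of_pow_eq_zero h2))
  obtain ⟨k, hk, hne⟩ := hne
  exact ⟨_, (hcoeff k hk).1, (hcoeff k hk).2, hne, fun γ y => by rw [hP]⟩

/-- The fibres of a map whose functions are the invariant functions are the orbits. -/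
theorem exists_smul_eq (hsep : ∀ x y, (∀ f ∈ A, f x = f y) → x = y)
    (hA : ∀ γ : Γ, ∀ f ∈ A, (fun x => f (γ • x)) ∈ A) {x x' : X}
    (H : ∀ f ∈ A, (∀ (γ : Γ) y, f (γ • y) = f y) → f x = f x') : ∃ γ : Γ, γ • x = x' := by
  have : Fintype Γ := Fintype.ofFinite Γ
  -- If `x'` lies off the orbit of `x`, there is a function in `A` that vanishes at `x'` and is `1`
  -- on the whole orbit of `x`. Its norm, the product of its translates, is invariant and separates
  -- the two points.
  by_contra! hne
  have h1 : ∀ γ : Γ, ∃ g ∈ A, g x' = 1 ∧ g (γ • x) = 0 := by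
    intro γ
    have : ∃ f ∈ A, f (γ • x) ≠ f x' := by
      by_contra! h
      exact hne γ (hsep _ _ h)
    obtain ⟨f, hf, hfx⟩ := this
    refine ⟨(f x' - f (γ • x))⁻¹ • (f - algebraMap ℂ _ (f (γ • x))),
      A.smul_mem (A.sub_mem hf (A.algebraMap_mem _)) _, ?_, ?_⟩
    · simp [inv_mul_cancel₀ (sub_ne_zero.2 (Ne.symm hfx))]
    · simp
  choose g hg hg1 hg0 using h1
  let b : X → ℂ := 1 - ∏ γ, g γ
  have hb : b ∈ A := A.sub_mem A.one_mem (prod_mem fun γ _ => hg γ)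
  have hbx' : b x' = 0 := by simp [b, hg1]
  have hbx : ∀ γ : Γ, b (γ • x) = 1 := by
    intro γ
    simp only [b, Pi.sub_apply, Pi.one_apply, Finset.prod_apply]
    rw [Finset.prod_eq_zero (Finset.mem_univ γ) (hg0 γ), sub_zero]
  let N : X → ℂ := ∏ γ : Γ, fun y => b (γ • y)
  have hN := H N (prod_mem fun γ _ => hA γ b hb) fun γ y => by
    simp only [N, Finset.prod_apply, smul_smul]
    exact Fintype.prod_equiv (Equiv.mulRight γ) _ _ fun _ => rfl
  simp only [N, Finset.prod_apply, hbx, Finset.prod_const_one] at hN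
  rw [Finset.prod_eq_zero (Finset.mem_univ (1 : Γ)) (by rw [one_smul, hbx'])] at hN
  exact one_ne_zero hN

omit [Finite Γ] in
theorem isMorphism_smul (hA : ∀ γ : Γ, ∀ f ∈ A, (fun x => f (γ • x)) ∈ A) (γ : Γ) :
    (ofAlgebra X A).IsMorphism (ofAlgebra X A) (fun x : X => γ • x) :=
  isMorphism_of_comp_mem (hA γ)

/-- The quotient by a finite group is described by the invariant functions. -/
theorem exists_isIso_orbitSpace (hsep : ∀ x y, (∀ f ∈ A, f x = f y) → x = y)
    (hA : ∀ γ : Γ, ∀ f ∈ A, (fun x => f (γ • x)) ∈ A) {π : X → Y} (hπ : Function.Surjective π)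
    (hπΓ : ∀ (γ : Γ) x, π (γ • x) = π x) (hC : ∀ c ∈ C, c ∘ π ∈ A)
    (hinv : ∀ f ∈ A, (∀ (γ : Γ) x, f (γ • x) = f x) → ∃ c ∈ C, f = c ∘ π) :
    ∃ e : Quot (fun x y : X => ∃ γ : Γ, γ • x = y) ≃ Y,
      ((ofAlgebra X A).quot (fun x y : X => ∃ γ : Γ, γ • x = y)).IsIso (ofAlgebra Y C) e ∧
      ∀ x, e (Quot.mk _ x) = π x := by
  let r : X → X → Prop := fun x y => ∃ γ : Γ, γ • x = y
  have hr : ∀ x y, r x y → π x = π y := by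
    rintro x _ ⟨γ, rfl⟩
    exact (hπΓ γ x).symm
  have hr' : ∀ x y, π x = π y → r x y := by
    intro x y hxy
    refine exists_smul_eq hsep hA fun f hf hfi => ?_
    obtain ⟨c, -, rfl⟩ := hinv f hf hfi
    exact congrArg c hxy
  let e : Quot r ≃ Y := Equiv.ofBijective (Quot.lift π hr) ⟨by
      rintro ⟨x⟩ ⟨y⟩ hxy
      exact Quot.sound (hr' x y hxy), fun y => by
      obtain ⟨x, rfl⟩ := hπ y
      exact ⟨Quot.mk r x, rfl⟩⟩
  have he : ∀ x, e (Quot.mk r x) = π x := fun _ => rfl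
  have he' : ∀ x, e.symm (π x) = Quot.mk r x := fun x => by rw [Equiv.symm_apply_eq, he]
  have hmor : ((ofAlgebra X A).quot r).IsMorphism (ofAlgebra Y C) e :=
    (isMorphism_of_comp_mem hC).quotLift hr
  refine ⟨e, ⟨hmor, ?_, ?_⟩, he⟩
  · refine continuous_def.2 fun (U : Set (Quot r)) hU => ?_
    refine @isOpen_iff_mem_nhds _ (ofAlgebra Y C).top _ |>.2 fun y hy => ?_
    obtain ⟨x, rfl⟩ := hπ y
    have hU' : IsOpen[zariski A] (Quot.mk r ⁻¹' U) :=
      @IsOpen.preimage _ _ (zariski A) _ _ ((ofAlgebra X A).isMorphism_quotMk r).1 _ hU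
    have hxU : x ∈ Quot.mk r ⁻¹' U := by
      rw [Set.mem_preimage, ← he']; exact hy
    obtain ⟨b, hb, hbx, hbU⟩ := exists_basic_of_isOpen hU' hxU
    have hsat : ∀ (γ : Γ) y, γ • y ∈ Quot.mk r ⁻¹' U → y ∈ Quot.mk r ⁻¹' U := by
      intro γ y hy
      have : Quot.mk r y = Quot.mk r (γ • y) := Quot.sound ⟨γ, rfl⟩
      rw [Set.mem_preimage, this]; exact hy
    -- The functions supported in a saturated open set form a stable ideal, so a basic neighbourhood
    -- inside it can be cut out by an invariant function, which is the pull-back of a function in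
    -- `C`.
    obtain ⟨b', hb'I, hb'A, hb'x, hb'inv⟩ := exists_invariant hA
      (I := {f | ∀ y, f y ≠ 0 → y ∈ Quot.mk r ⁻¹' U}) (fun y hy => absurd rfl hy)
      (fun f hf g hg y hy => by
        by_cases h0 : f y = 0
        · exact hg y fun h1 => hy (by rw [Pi.add_apply, h0, h1, add_zero])
        · exact hf y h0)
      (fun f hf g _ y hy => hf y (right_ne_zero_of_mul hy))
      (fun γ f hf y hy => hsat γ y (hf _ hy)) hbU hb hbx
    obtain ⟨c, hc, rfl⟩ := hinv b' hb'A hb'inv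
    refine Filter.mem_of_superset (zariski_eventually C hc hb'x) fun y hy => ?_
    obtain ⟨x', rfl⟩ := hπ y
    have := hb'I x' hy
    rw [Set.mem_preimage, ← he'] at this
    exact this
  · intro y (f : Quot r → ℂ) hf
    obtain ⟨x, rfl⟩ := hπ y
    have hreg : (ofAlgebra X A).RegAt x (f ∘ Quot.mk r) :=
      ((ofAlgebra X A).isMorphism_quotMk r).2 x f
        ((congrArg (fun q : Quot r => ((ofAlgebra X A).quot r).RegAt q f) (he' x)).mp hf)
    set F : X → ℂ := f ∘ Quot.mk r with hF
    have hFinv : ∀ (γ : Γ) y, F (γ • y) = F y := fun γ y =>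
      congrArg f (Quot.sound ⟨γ, rfl⟩ : Quot.mk r y = Quot.mk r (γ • y)).symm
    obtain ⟨p, hp, q, hq, hqx, hpq⟩ := regAt_iff.1 hreg
    -- The denominators of the invariant function `F` form a stable ideal. With an invariant
    -- denominator the numerator is invariant as well, and both descend to `Y`.
    obtain ⟨b', hb'I, hb'A, hb'x, hb'inv⟩ := exists_invariant hA (I := {b | F * b ∈ A})
      (by simp only [Set.mem_ofPred_eq, mul_zero]; exact A.zero_mem)
      (fun b hb c hc => by simp only [Set.mem_ofPred_eq, mul_add]; exact A.add_mem hb hc)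
      (fun b hb c hc => by simp only [Set.mem_ofPred_eq, mul_left_comm]; exact A.mul_mem hc hb)
      (fun γ b hb => by
        have h1 := hA γ _ hb
        simp only [Pi.mul_apply, hFinv] at h1
        exact h1) (b := q) (show F * q ∈ A from (show F * q = p from hpq) ▸ hp) hq hqx
    obtain ⟨c, hc, rfl⟩ := hinv b' hb'A hb'inv
    obtain ⟨c', hc', hcc⟩ := hinv _ hb'I fun γ y => by
      simp only [Pi.mul_apply, hFinv, hb'inv γ y]
    refine regAt_iff.2 ⟨c', hc', c, hc, hb'x, ?_⟩
    ext y
    obtain ⟨x', rfl⟩ := hπ y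
    have := congrFun hcc x'
    rw [← show F x' * c (π x') = c' (π x') from this]
    exact congrArg (fun q : Quot r => f q * c (π x')) (he' x')

end FiniteGroup

/-! ### Affine varieties -/

section Affine

variable {X : Type} (A : Subalgebra ℂ (X → ℂ))

/-- The algebra `A` is the coordinate ring of an affine variety with set of points `X`. -/
structure IsAffineModel : Prop where
  finiteType : Algebra.FiniteType ℂ A
  separates : ∀ x y, (∀ f ∈ A, f x = f y) → x = y
  exists_eval : ∀ φ : A →ₐ[ℂ] ℂ, ∃ x, ∀ f : A, φ f = f.1 x

variable {A}

theorem IsAffineModel.isomorphic (h : IsAffineModel A) : (ofAlgebra X A).Isomorphic (specm A) := by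
  let ev : X → (A →ₐ[ℂ] ℂ) := fun x => (Pi.evalAlgHom ℂ (fun _ : X => ℂ) x).comp A.val
  have hev : ∀ x (f : A), ev x f = f.1 x := fun _ _ => rfl
  let e : X ≃ (A →ₐ[ℂ] ℂ) := Equiv.ofBijective ev ⟨fun x y hxy => h.separates x y fun f hf =>
    DFunLike.congr_fun hxy (⟨f, hf⟩ : A), fun φ => by
      obtain ⟨x, hx⟩ := h.exists_eval φ
      exact ⟨x, AlgHom.ext fun f => (hx f).symm⟩⟩
  refine ⟨e, isIso_of_comp_mem ?_ ?_⟩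
  · rintro _ ⟨f, rfl⟩
    exact f.2
  · intro f hf
    refine ⟨⟨f, hf⟩, ?_⟩
    ext φ
    obtain ⟨x, rfl⟩ := e.surjective φ
    change f x = f (e.symm (e x))
    rw [Equiv.symm_apply_apply]

theorem isAffineModel_specm (R : Type) [CommRing R] [Algebra ℂ R] [Algebra.FiniteType ℂ R] :
    IsAffineModel (AlgHom.range (AlgHom.pi (fun x : R →ₐ[ℂ] ℂ => x))) where
  finiteType := Algebra.FiniteType.of_surjective _ (AlgHom.rangeRestrict_surjective _)
  separates x y H := AlgHom.ext fun r => H _ ⟨r, rfl⟩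
  exists_eval φ := ⟨φ.comp (AlgHom.pi (fun x : R →ₐ[ℂ] ℂ => x)).rangeRestrict, by
    rintro ⟨_, r, rfl⟩; rfl⟩

/-- Sending a point to the prime of functions vanishing there induces the Zariski topology from the
prime spectrum of a Noetherian ring, and subspaces of Noetherian spaces are Noetherian. This
provides quasi-compactness. -/
theorem noetherianSpace_zariski (hA : Algebra.FiniteType ℂ A) :
    @TopologicalSpace.NoetherianSpace X (zariski A) := by
  let := zariski A
  have : IsNoetherianRing A := Algebra.FiniteType.isNoetherianRing ℂ A
  let ι : X → PrimeSpectrum A := fun x =>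
    ⟨RingHom.ker ((Pi.evalRingHom (fun _ : X => ℂ) x).comp A.val.toRingHom), RingHom.ker_isPrime _⟩
  have hι : Topology.IsInducing ι := by
    refine ⟨?_⟩
    rw [(PrimeSpectrum.isTopologicalBasis_basic_opens (R := A)).eq_generateFrom, induced_generateFrom_eq]
    change TopologicalSpace.generateFrom _ = TopologicalSpace.generateFrom _
    congr 1
    ext s
    constructor
    · rintro ⟨f, hf, rfl⟩
      refine ⟨_, ⟨⟨f, hf⟩, rfl⟩, ?_⟩
      ext x
      rfl
    · rintro ⟨_, ⟨f, rfl⟩, rfl⟩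
      exact ⟨f.1, f.2, rfl⟩
  exact hι.noetherianSpace

/-- Separation: the equality locus is the intersection over `f ∈ A` of the zero loci of the regular
functions `f ∘ a - f ∘ b`. -/
theorem isClosed_eqOn_of_isMorphism (hsep : ∀ x y, (∀ f ∈ A, f x = f y) → x = y) {Z : FunctionSpace}
    {a b : Z.carrier → X} (ha : Z.IsMorphism (ofAlgebra X A) a)
    (hb : Z.IsMorphism (ofAlgebra X A) b) : IsClosed {z | a z = b z} := by
  have : {z | a z = b z} = ⋂ f : A, {z | f.1 (a z) = f.1 (b z)} := by
    ext z
    simp only [Set.mem_iInter]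
    exact ⟨fun h f => congrArg f.1 h, fun h => hsep _ _ fun f hf => h ⟨f, hf⟩⟩
  rw [this]
  refine isClosed_iInter fun f => ?_
  rw [← isOpen_compl_iff, isOpen_iff_mem_nhds]
  intro z hz
  have h1 := ha.2 z f.1 (regAt_of_mem f.2 _)
  have h2 := hb.2 z f.1 (regAt_of_mem f.2 _)
  have h3 := Z.add z _ _ h1 (Z.mul z _ _ (Z.const z (-1)) h2)
  refine Filter.mem_of_superset (Z.ne_zero z _ h3 ?_) fun y hy hy' => hy ?_
  · intro h0
    refine hz ?_
    have h4 : f.1 (a z) + -1 * f.1 (b z) = 0 := h0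
    change f.1 (a z) = f.1 (b z)
    linear_combination h4
  · have h4 : f.1 (a y) = f.1 (b y) := hy'
    change f.1 (a y) + -1 * f.1 (b y) = 0
    linear_combination h4

theorem isVariety_of_isomorphic_specm {X : FunctionSpace} {R : Type} [CommRing R] [Algebra ℂ R]
    (hR : Algebra.FiniteType ℂ R) (h : X.Isomorphic (specm R)) : X.IsVariety where
  compact := by
    obtain ⟨e, he⟩ := h
    have h1 := @TopologicalSpace.NoetherianSpace.compactSpace _ (specm R).top
      (noetherianSpace_zariski (isAffineModel_specm R).finiteType)
    let E : X.carrier ≃ₜ (specm R).carrier := ⟨e, he.1.1, he.2.1⟩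
    exact E.symm.compactSpace
  affine := fun _ => ⟨Set.univ, isOpen_univ, trivial, R, _, _, hR,
    X.restrict_univ_isomorphic.trans h⟩
  separated := by
    intro R' _ _ _ a b ha hb
    obtain ⟨e, he⟩ := h
    have h1 := isClosed_eqOn_of_isMorphism (isAffineModel_specm R).separates (he.1.comp ha) (he.1.comp hb)
    convert h1 using 1
    ext z
    exact e.injective.eq_iff.symm

theorem isSmoothVariety_of_isomorphic_specm {X : FunctionSpace} {R : Type} [CommRing R] [Algebra ℂ R]
    (hR : Algebra.Smooth ℂ R) (h : X.Isomorphic (specm R)) : X.IsSmoothVariety where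
  toIsVariety := isVariety_of_isomorphic_specm inferInstance h
  smooth := fun _ => ⟨Set.univ, isOpen_univ, trivial, R, _, _, hR,
    X.restrict_univ_isomorphic.trans h⟩

theorem IsAffineModel.isVariety {X : FunctionSpace} {Y : Type} {C : Subalgebra ℂ (Y → ℂ)}
    (hC : IsAffineModel C) (h : X.Isomorphic (ofAlgebra Y C)) : X.IsVariety :=
  isVariety_of_isomorphic_specm hC.finiteType (h.trans hC.isomorphic)

end Affine

/-! ### Affine space -/

section PolyAlgebra

theorem comp_mem_polyAlgebra {E F : Type} [AddCommGroup E] [Module ℂ E] [AddCommGroup F] [Module ℂ F]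
    (φ : E →ₗ[ℂ] F) {f : F → ℂ} (hf : f ∈ polyAlgebra F) : f ∘ φ ∈ polyAlgebra E := by
  refine comp_mem_of_adjoin ?_ hf
  rintro _ ⟨l, rfl⟩
  exact Algebra.subset_adjoin ⟨l ∘ₗ φ, rfl⟩

theorem dual_mem_polyAlgebra {E : Type} [AddCommGroup E] [Module ℂ E] (l : Module.Dual ℂ E) :
    (fun x => l x) ∈ polyAlgebra E := Algebra.subset_adjoin ⟨l, rfl⟩

/-- The polynomial functions on a finite-dimensional space, in coordinates. -/
theorem polyAlgebra_eq_adjoin {E ι : Type} [AddCommGroup E] [Module ℂ E] [Finite ι]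
    (b : Module.Basis ι ℂ E) : polyAlgebra E = Algebra.adjoin ℂ {F | ∃ i, F = fun x => b.repr x i} := by
  have : Fintype ι := Fintype.ofFinite ι
  unfold polyAlgebra
  refine le_antisymm (Algebra.adjoin_le ?_) (Algebra.adjoin_mono ?_)
  · rintro _ ⟨l, rfl⟩
    have : (fun x => l x) = ∑ i, l (b i) • fun x => b.repr x i := by
      ext x
      conv_lhs => rw [← b.sum_repr x, map_sum]
      rw [Finset.sum_apply]
      refine Finset.sum_congr rfl fun i _ => ?_
      rw [map_smul, smul_eq_mul, mul_comm]; rfl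
    rw [this]
    exact sum_mem fun i _ => (Algebra.adjoin ℂ {F : E → ℂ | ∃ i, F = fun x => b.repr x i}).smul_mem
      (Algebra.subset_adjoin ⟨i, rfl⟩) _
  · rintro _ ⟨i, rfl⟩
    exact ⟨b.coord i, rfl⟩

theorem isAffineModel_polyAlgebra (E : Type) [AddCommGroup E] [Module ℂ E] [FiniteDimensional ℂ E] :
    IsAffineModel (polyAlgebra E) where
  finiteType := by
    rw [polyAlgebra_eq_adjoin (Module.finBasis ℂ E), ← Subalgebra.fg_iff_finiteType]
    refine Subalgebra.fg_def.2 ⟨_, ?_, rfl⟩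
    convert Set.finite_range (fun i => fun x => (Module.finBasis ℂ E).repr x i) using 1
    ext F
    exact ⟨fun ⟨i, hi⟩ => ⟨i, hi.symm⟩, fun ⟨i, hi⟩ => ⟨i, hi.symm⟩⟩
  separates x y H := (Module.finBasis ℂ E).ext_elem fun i =>
    H _ (dual_mem_polyAlgebra ((Module.finBasis ℂ E).coord i))
  exists_eval φ := by
    -- On linear forms `φ` is an element of the double dual, hence evaluation at a vector; the
    -- linear forms generate the algebra.
    let ψ : Module.Dual ℂ (Module.Dual ℂ E) :=
      { toFun := fun l => φ ⟨_, dual_mem_polyAlgebra l⟩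
        map_add' := fun l l' => by rw [← map_add]; rfl
        map_smul' := fun c l => by rw [RingHom.id_apply, ← map_smul]; rfl }
    obtain ⟨x, hx⟩ := (Module.evalEquiv ℂ E).surjective ψ
    refine ⟨x, ?_⟩
    rintro ⟨f, hf⟩
    induction hf using Algebra.adjoin_induction with
    | mem f hf =>
      obtain ⟨l, rfl⟩ := hf
      exact (LinearMap.congr_fun hx l).symm
    | algebraMap c => exact φ.commutes c
    | add f g hf hg h1 h2 =>
      exact (map_add φ ⟨f, hf⟩ ⟨g, hg⟩).trans (congrArg₂ (· + ·) h1 h2)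
    | mul f g hf hg h1 h2 =>
      exact (map_mul φ ⟨f, hf⟩ ⟨g, hg⟩).trans (congrArg₂ (· * ·) h1 h2)

/-- A polynomial as a function. -/
def evalAlgHom (ι : Type) : MvPolynomial ι ℂ →ₐ[ℂ] (ι → ℂ) → ℂ :=
  MvPolynomial.aeval fun i x => x i

theorem evalAlgHom_apply {ι : Type} (p : MvPolynomial ι ℂ) (x : ι → ℂ) :
    evalAlgHom ι p x = MvPolynomial.eval x p := by
  have : (Pi.evalAlgHom ℂ (fun _ : ι → ℂ => ℂ) x).comp (evalAlgHom ι) = MvPolynomial.aeval x := by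
    ext i
    simp [evalAlgHom]
  exact (DFunLike.congr_fun this p).trans (by rw [MvPolynomial.aeval_eq_eval])

theorem polyAlgebra_eq_range (ι : Type) [Finite ι] : polyAlgebra (ι → ℂ) = (evalAlgHom ι).range := by
  rw [polyAlgebra_eq_adjoin (Pi.basisFun ℂ ι), evalAlgHom, MvPolynomial.aeval_range]
  congr 1
  ext F
  exact ⟨fun ⟨i, hi⟩ => ⟨i, hi.symm⟩, fun ⟨i, hi⟩ => ⟨i, hi.symm⟩⟩

/-- A polynomial over an infinite field is determined by its values, so the coordinate ring is a
polynomial ring, which is a smooth algebra. -/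
theorem isSmoothVariety_polyAlgebra {X : FunctionSpace} {ι : Type} [Finite ι]
    (h : X.Isomorphic (ofAlgebra (ι → ℂ) (polyAlgebra (ι → ℂ)))) : X.IsSmoothVariety := by
  have hinj : Function.Injective (evalAlgHom ι) := fun p q hpq => MvPolynomial.funext fun x => by
    rw [← evalAlgHom_apply, ← evalAlgHom_apply, hpq]
  let e : MvPolynomial ι ℂ ≃ₐ[ℂ] polyAlgebra (ι → ℂ) :=
    (AlgEquiv.ofInjective _ hinj).trans (Subalgebra.equivOfEq _ _ (polyAlgebra_eq_range ι).symm)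
  have hS : Algebra.Smooth ℂ (MvPolynomial ι ℂ) :=
    ⟨inferInstance, inferInstance⟩
  have hS' : Algebra.Smooth ℂ (polyAlgebra (ι → ℂ)) := Algebra.Smooth.of_equiv e
  exact isSmoothVariety_of_isomorphic_specm hS' (h.trans (isAffineModel_polyAlgebra _).isomorphic)

end PolyAlgebra

/-! ### Products -/

section Prod

variable {X Y : Type} {A : Subalgebra ℂ (X → ℂ)} {C : Subalgebra ℂ (Y → ℂ)}

theorem fst_mem_prodAlgebra {f : X → ℂ} (hf : f ∈ A) : f ∘ Prod.fst ∈ prodAlgebra A C :=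
  Algebra.subset_adjoin (Or.inl ⟨f, hf, rfl⟩)

theorem snd_mem_prodAlgebra {g : Y → ℂ} (hg : g ∈ C) : g ∘ Prod.snd ∈ prodAlgebra A C :=
  Algebra.subset_adjoin (Or.inr ⟨g, hg, rfl⟩)

theorem prodAlgebra_le {B : Subalgebra ℂ (X × Y → ℂ)} (h1 : ∀ f ∈ A, f ∘ Prod.fst ∈ B)
    (h2 : ∀ g ∈ C, g ∘ Prod.snd ∈ B) : prodAlgebra A C ≤ B := by
  refine Algebra.adjoin_le ?_
  rintro _ (⟨f, hf, rfl⟩ | ⟨g, hg, rfl⟩)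
  exacts [h1 f hf, h2 g hg]

theorem prod_comp_mem {Z : Type} {B : Subalgebra ℂ (Z → ℂ)} {φ : Z → X × Y}
    (h1 : ∀ f ∈ A, (fun z => f (φ z).1) ∈ B) (h2 : ∀ g ∈ C, (fun z => g (φ z).2) ∈ B)
    {f : X × Y → ℂ} (hf : f ∈ prodAlgebra A C) : f ∘ φ ∈ B := by
  refine comp_mem_of_adjoin ?_ hf
  rintro _ (⟨f, hf, rfl⟩ | ⟨g, hg, rfl⟩)
  exacts [h1 f hf, h2 g hg]

theorem isMorphism_prod {Z : FunctionSpace} {φ : Z.carrier → X × Y}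
    (h1 : Z.IsMorphism (ofAlgebra X A) fun z => (φ z).1)
    (h2 : Z.IsMorphism (ofAlgebra Y C) fun z => (φ z).2) :
    Z.IsMorphism (ofAlgebra (X × Y) (prodAlgebra A C)) φ := by
  refine isMorphism_adjoin ?_
  rintro _ (⟨f, hf, rfl⟩ | ⟨g, hg, rfl⟩) z
  · exact h1.2 z f (regAt_of_mem hf _)
  · exact h2.2 z g (regAt_of_mem hg _)

/-- Pulling back functions to a product. -/
def compAlgHom {Z : Type} (φ : Z → X) (B : Subalgebra ℂ (Z → ℂ)) (h : ∀ f ∈ A, f ∘ φ ∈ B) : A →ₐ[ℂ] B where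
  toFun f := ⟨f.1 ∘ φ, h f.1 f.2⟩
  map_one' := rfl
  map_mul' _ _ := rfl
  map_zero' := rfl
  map_add' _ _ := rfl
  commutes' _ := rfl

theorem IsAffineModel.prod (hA : IsAffineModel A) (hC : IsAffineModel C) :
    IsAffineModel (prodAlgebra A C) where
  finiteType := by
    let φ : A →ₐ[ℂ] prodAlgebra A C := compAlgHom Prod.fst _ fun f hf => fst_mem_prodAlgebra hf
    let ψ : C →ₐ[ℂ] prodAlgebra A C := compAlgHom Prod.snd _ fun f hf => snd_mem_prodAlgebra hf
    have hA' := hA.finiteType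
    have hC' := hC.finiteType
    have : Algebra.FiniteType ℂ (A ⊗[ℂ] C) := .trans hA' inferInstance
    refine Algebra.FiniteType.of_surjective (Algebra.TensorProduct.productMap φ ψ) ?_
    rintro ⟨f, hf⟩
    have key : prodAlgebra A C ≤ ((prodAlgebra A C).val.comp (Algebra.TensorProduct.productMap φ ψ)).range := by
      refine prodAlgebra_le (fun f hf => ⟨⟨f, hf⟩ ⊗ₜ 1, ?_⟩) fun g hg => ⟨1 ⊗ₜ ⟨g, hg⟩, ?_⟩
      · change (Algebra.TensorProduct.productMap φ ψ _).1 = _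
        rw [Algebra.TensorProduct.productMap_apply_tmul, map_one, mul_one]; rfl
      · change (Algebra.TensorProduct.productMap φ ψ _).1 = _
        rw [Algebra.TensorProduct.productMap_apply_tmul, map_one, one_mul]; rfl
    obtain ⟨t, ht⟩ := key hf
    exact ⟨t, Subtype.ext ht⟩
  separates := by
    rintro ⟨x, y⟩ ⟨x', y'⟩ H
    have h1 := hA.separates x x' fun f hf => H _ (fst_mem_prodAlgebra hf)
    have h2 := hC.separates y y' fun f hf => H _ (snd_mem_prodAlgebra hf)
    rw [h1, h2]
  exists_eval φ := by
    obtain ⟨x, hx⟩ := hA.exists_eval (φ.comp (compAlgHom Prod.fst _ fun f hf => fst_mem_prodAlgebra hf))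
    obtain ⟨y, hy⟩ := hC.exists_eval (φ.comp (compAlgHom Prod.snd _ fun f hf => snd_mem_prodAlgebra hf))
    refine ⟨(x, y), ?_⟩
    rintro ⟨f, hf⟩
    induction hf using Algebra.adjoin_induction with
    | mem f hf =>
      rcases hf with ⟨f, hf, rfl⟩ | ⟨g, hg, rfl⟩
      · exact hx ⟨f, hf⟩
      · exact hy ⟨g, hg⟩
    | algebraMap c => exact φ.commutes c
    | add f g hf hg h1 h2 =>
      exact (map_add φ ⟨f, hf⟩ ⟨g, hg⟩).trans (congrArg₂ (· + ·) h1 h2)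
    | mul f g hf hg h1 h2 =>
      exact (map_mul φ ⟨f, hf⟩ ⟨g, hg⟩).trans (congrArg₂ (· * ·) h1 h2)

theorem prodAlgebra_polyAlgebra (E F : Type) [AddCommGroup E] [Module ℂ E] [AddCommGroup F]
    [Module ℂ F] : prodAlgebra (polyAlgebra E) (polyAlgebra F) = polyAlgebra (E × F) := by
  refine le_antisymm (prodAlgebra_le (fun f hf => comp_mem_polyAlgebra (LinearMap.fst ℂ E F) hf)
    fun f hf => comp_mem_polyAlgebra (LinearMap.snd ℂ E F) hf) (Algebra.adjoin_le ?_)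
  rintro _ ⟨l, rfl⟩
  have : (fun x => l x) = (fun x => l (LinearMap.inl ℂ E F x)) ∘ Prod.fst +
      (fun x => l (LinearMap.inr ℂ E F x)) ∘ Prod.snd := by
    ext x
    simp [← map_add]
  rw [this]
  exact add_mem (fst_mem_prodAlgebra (dual_mem_polyAlgebra (l ∘ₗ LinearMap.inl ℂ E F)))
    (snd_mem_prodAlgebra (dual_mem_polyAlgebra (l ∘ₗ LinearMap.inr ℂ E F)))

end Prod

end FunctionSpace

/-! ### Points of ideals, averaging over finite groups, and quotients of products -/

namespace FunctionSpace

theorem IsAffineModel.of_equiv {X Y : Type} {A : Subalgebra ℂ (X → ℂ)} {C : Subalgebra ℂ (Y → ℂ)}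
    (hC : IsAffineModel C) (e : X ≃ Y) (H : ∀ f ∈ C, f ∘ e ∈ A) (H' : ∀ f ∈ A, f ∘ e.symm ∈ C) :
    IsAffineModel A where
  finiteType := by
    have := hC.finiteType
    refine Algebra.FiniteType.of_surjective (compAlgHom e A H) ?_
    rintro ⟨f, hf⟩
    refine ⟨⟨f ∘ e.symm, H' f hf⟩, Subtype.ext ?_⟩
    ext x
    exact congrArg f (e.symm_apply_apply x)
  separates x y h := e.injective (hC.separates _ _ fun f hf => h _ (H f hf))
  exists_eval φ := by
    obtain ⟨y, hy⟩ := hC.exists_eval (φ.comp (compAlgHom e A H))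
    refine ⟨e.symm y, ?_⟩
    rintro ⟨f, hf⟩
    have h1 := hy ⟨f ∘ e.symm, H' f hf⟩
    have h2 : compAlgHom e A H ⟨f ∘ e.symm, H' f hf⟩ = ⟨f, hf⟩ := by
      refine Subtype.ext ?_
      ext x
      exact congrArg f (e.symm_apply_apply x)
    rw [AlgHom.comp_apply, h2] at h1
    exact h1

/-- An ideal of the coordinate ring that does not contain `1` has a zero. -/
theorem IsAffineModel.exists_zero {X : Type} {A : Subalgebra ℂ (X → ℂ)} (hA : IsAffineModel A)
    {I : Ideal A} (hI : I ≠ ⊤) : ∃ x, ∀ f ∈ I, f.1 x = 0 := by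
  obtain ⟨M, hM, hIM⟩ := Ideal.exists_le_maximal I hI
  have := hA.finiteType
  let := Ideal.Quotient.field M
  -- Zariski's lemma: the residue field is finite over `ℂ`, hence equal to `ℂ`, so reduction modulo
  -- `M` is evaluation at a point.
  have h1 : Module.Finite ℂ (A ⧸ M) := finite_of_finite_type_of_isJacobsonRing ℂ (A ⧸ M)
  have h1' : Algebra.IsIntegral ℂ (A ⧸ M) := Algebra.IsIntegral.of_finite ℂ (A ⧸ M)
  have h2 : Function.Bijective (algebraMap ℂ (A ⧸ M)) :=
    IsAlgClosed.algebraMap_bijective_of_isIntegral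
  let ψ : (A ⧸ M) →ₐ[ℂ] ℂ := (AlgEquiv.ofBijective (Algebra.ofId ℂ (A ⧸ M)) h2).symm.toAlgHom
  obtain ⟨x, hx⟩ := hA.exists_eval (ψ.comp (Ideal.Quotient.mkₐ ℂ M))
  refine ⟨x, fun f hf => ?_⟩
  have h3 : Ideal.Quotient.mkₐ ℂ M f = 0 := Ideal.Quotient.eq_zero_iff_mem.2 (hIM hf)
  rw [← hx, AlgHom.comp_apply, h3, map_zero]

/-- Products `f(x) g(y)` are closed under multiplication, so the algebra consists of their sums.
This lets additive properties, such as those of orbit sums, be checked on pure products. -/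
theorem prodAlgebra_induction {X Y : Type} {A : Subalgebra ℂ (X → ℂ)} {C : Subalgebra ℂ (Y → ℂ)}
    {P : (X × Y → ℂ) → Prop} (hadd : ∀ f g, P f → P g → P (f + g)) (h0 : P 0)
    (hmul : ∀ f ∈ A, ∀ g ∈ C, P fun z => f z.1 * g z.2) {F : X × Y → ℂ}
    (hF : F ∈ prodAlgebra A C) : P F := by
  let S : Set (X × Y → ℂ) := {F | ∃ f ∈ A, ∃ g ∈ C, F = fun z => f z.1 * g z.2}
  have hS : ∀ a ∈ AddSubmonoid.closure S, ∀ b ∈ AddSubmonoid.closure S,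
      a * b ∈ AddSubmonoid.closure S := by
    intro a ha b hb
    induction ha using AddSubmonoid.closure_induction with
    | mem a ha =>
      induction hb using AddSubmonoid.closure_induction with
      | mem b hb =>
        obtain ⟨f, hf, g, hg, rfl⟩ := ha
        obtain ⟨f', hf', g', hg', rfl⟩ := hb
        refine AddSubmonoid.subset_closure ⟨f * f', A.mul_mem hf hf', g * g', C.mul_mem hg hg', ?_⟩
        ext z
        simp only [Pi.mul_apply]
        ring
      | zero => rw [mul_zero]; exact zero_mem _
      | add x y _ _ hx hy => rw [mul_add]; exact add_mem hx hy
    | zero => rw [zero_mul]; exact zero_mem _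
    | add x y _ _ hx hy => rw [add_mul]; exact add_mem hx hy
  have hle : ∀ F ∈ prodAlgebra A C, F ∈ AddSubmonoid.closure S := by
    intro F hF
    induction hF using Algebra.adjoin_induction with
    | mem F hF =>
      rcases hF with ⟨f, hf, rfl⟩ | ⟨g, hg, rfl⟩
      · exact AddSubmonoid.subset_closure ⟨f, hf, 1, C.one_mem, by ext; simp⟩
      · exact AddSubmonoid.subset_closure ⟨1, A.one_mem, g, hg, by ext; simp⟩
    | algebraMap c =>
      exact AddSubmonoid.subset_closure ⟨algebraMap ℂ _ c, A.algebraMap_mem c, 1, C.one_mem, by ext; simp⟩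
    | add f g _ _ hf hg => exact add_mem hf hg
    | mul f g _ _ hf hg => exact hS f hf g hg
  have hF' := hle F hF
  clear hF
  induction hF' using AddSubmonoid.closure_induction with
  | mem F hF => obtain ⟨f, hf, g, hg, rfl⟩ := hF; exact hmul f hf g hg
  | zero => exact h0
  | add f g _ _ hf hg => exact hadd f g hf hg

section Reynolds

variable {X Y : Type} {A : Subalgebra ℂ (X → ℂ)} {C : Subalgebra ℂ (Y → ℂ)}
  {Γ : Type} [Group Γ] [Fintype Γ] [MulAction Γ X] {π : X → Y}

/-- The sums over orbits of functions in `A` are the pull-backs of functions in `C`. -/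
def HasReynolds (A : Subalgebra ℂ (X → ℂ)) (C : Subalgebra ℂ (Y → ℂ)) (Γ : Type) [Group Γ]
    [Fintype Γ] [MulAction Γ X] (π : X → Y) : Prop :=
  ∀ f ∈ A, ∃ c ∈ C, (fun x => ∑ γ : Γ, f (γ • x)) = c ∘ π

theorem HasReynolds.exists_eq_comp (hR : HasReynolds A C Γ π) {f : X → ℂ} (hf : f ∈ A)
    (hinv : ∀ (γ : Γ) x, f (γ • x) = f x) : ∃ c ∈ C, f = c ∘ π := by
  obtain ⟨c, hc, h⟩ := hR f hf
  refine ⟨(Fintype.card Γ : ℂ)⁻¹ • c, C.smul_mem hc _, ?_⟩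
  ext x
  have h1 := congrFun h x
  simp only [hinv, Finset.sum_const, Finset.card_univ, nsmul_eq_mul] at h1
  rw [Function.comp_apply, Pi.smul_apply, smul_eq_mul, show c (π x) = _ from h1.symm,
    inv_mul_cancel_left₀ (Nat.cast_ne_zero.2 Fintype.card_ne_zero)]

/-- If `y` had no preimage, the pull-backs of the functions vanishing at `y` would generate the unit
ideal of `A`, by the Nullstellensatz. Summing over the group sends this ideal to pull-backs of
functions vanishing at `y`, while it sends `1` to the order of the group; injectivity of pull-back
gives a contradiction. -/
theorem HasReynolds.surjective (hR : HasReynolds A C Γ π) (hA : IsAffineModel A)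
    (hsep : ∀ x y, (∀ f ∈ C, f x = f y) → x = y) (hC : ∀ c ∈ C, c ∘ π ∈ A)
    (hπ : ∀ (γ : Γ) x, π (γ • x) = π x)
    (hinj : ∀ c ∈ C, c ∘ π = 0 → c = 0) : Function.Surjective π := by
  intro y
  let I : Ideal A := Ideal.span {a | ∃ c ∈ C, c y = 0 ∧ a.1 = c ∘ π}
  have key : ∀ a ∈ I, ∀ b : A, ∃ c ∈ C, c y = 0 ∧ (fun x => ∑ γ : Γ, (b * a).1 (γ • x)) = c ∘ π := by
    intro a ha
    refine Submodule.span_induction (p := fun a _ => ∀ b : A, ∃ c ∈ C, c y = 0 ∧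
      (fun x => ∑ γ : Γ, (b * a).1 (γ • x)) = c ∘ π) ?_ ?_ ?_ ?_ ha
    · rintro a ⟨c, hc, hcy, hac⟩ b
      obtain ⟨c', hc', h'⟩ := hR b.1 b.2
      refine ⟨c' * c, C.mul_mem hc' hc, by rw [Pi.mul_apply, hcy, mul_zero], ?_⟩
      ext x
      have h1 := congrFun h' x
      simp only [Function.comp_apply, Pi.mul_apply] at h1 ⊢
      rw [← h1, Finset.sum_mul]
      refine Finset.sum_congr rfl fun γ _ => ?_
      have h2 := congrFun hac (γ • x)
      rw [Function.comp_apply, hπ] at h2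
      rw [← h2]; rfl
    · intro b
      exact ⟨0, C.zero_mem, rfl, by ext x; simp⟩
    · intro a a' _ _ h1 h2 b
      obtain ⟨c, hc, hcy, h1⟩ := h1 b
      obtain ⟨c', hc', hcy', h2⟩ := h2 b
      refine ⟨c + c', C.add_mem hc hc', by rw [Pi.add_apply, hcy, hcy', add_zero], ?_⟩
      ext x
      have h1 := congrFun h1 x
      have h2 := congrFun h2 x
      simp only [Function.comp_apply, Pi.add_apply] at h1 h2 ⊢
      rw [← h1, ← h2, ← Finset.sum_add_distrib]
      refine Finset.sum_congr rfl fun γ _ => ?_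
      rw [mul_add]; rfl
    · intro a' a _ h b
      rw [smul_eq_mul, ← mul_assoc]
      exact h (b * a')
  have hI : I ≠ ⊤ := by
    intro htop
    obtain ⟨c, hc, hcy, h⟩ := key 1 (htop ▸ Submodule.mem_top) 1
    have h1 : (c - algebraMap ℂ (Y → ℂ) (Fintype.card Γ)) = 0 := by
      refine hinj _ (C.sub_mem hc (C.algebraMap_mem _)) ?_
      ext x
      have h2 := congrFun h x
      simp only [Subalgebra.coe_one, Pi.one_apply, Finset.sum_const, Finset.card_univ,
        nsmul_eq_mul, mul_one, Function.comp_apply] at h2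
      simp [← h2]
    have h2 := congrFun h1 y
    simp [hcy] at h2
  obtain ⟨x, hx⟩ := hA.exists_zero hI
  refine ⟨x, hsep _ _ fun f hf => ?_⟩
  have h1 : f - algebraMap ℂ (Y → ℂ) (f y) ∈ C := C.sub_mem hf (C.algebraMap_mem _)
  have h2 := hx ⟨_, hC _ h1⟩ (Ideal.subset_span ⟨_, h1, by simp, rfl⟩)
  have h3 : f (π x) - f y = 0 := h2
  exact sub_eq_zero.1 h3

/-- The action on the first factor of a product. -/
abbrev fstAction (Γ X E : Type) [Group Γ] [MulAction Γ X] : MulAction Γ (X × E) where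
  smul γ z := (γ • z.1, z.2)
  one_smul z := by
    change ((1 : Γ) • z.1, z.2) = z
    rw [one_smul]
  mul_smul γ γ' z := by
    change ((γ * γ') • z.1, z.2) = (γ • γ' • z.1, z.2)
    rw [mul_smul]

/-- The group moves only the first factor, so for a product `f(x) g(y)` the sum is formed in the
first factor alone; every function is a sum of such products. -/
theorem HasReynolds.prod (hR : HasReynolds A C Γ π) {E : Type} (B : Subalgebra ℂ (E → ℂ)) :
    let := fstAction Γ X E
    HasReynolds (prodAlgebra A B) (prodAlgebra C B) Γ (Prod.map π id) := by
  intro _ F hF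
  refine prodAlgebra_induction (P := fun F => ∃ c ∈ prodAlgebra C B,
    (fun z : X × E => ∑ γ : Γ, F (γ • z.1, z.2)) = c ∘ Prod.map π id) ?_ ?_ ?_ hF
  · rintro f g ⟨c, hc, h1⟩ ⟨c', hc', h2⟩
    refine ⟨c + c', add_mem hc hc', ?_⟩
    ext z
    have h1 := congrFun h1 z
    have h2 := congrFun h2 z
    simp only [Function.comp_apply, Pi.add_apply] at h1 h2 ⊢
    rw [← h1, ← h2, ← Finset.sum_add_distrib]
  · exact ⟨0, zero_mem _, by ext; simp⟩
  · intro f hf g hg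
    obtain ⟨c, hc, h⟩ := hR f hf
    refine ⟨c ∘ Prod.fst * g ∘ Prod.snd, mul_mem (fst_mem_prodAlgebra hc) (snd_mem_prodAlgebra hg), ?_⟩
    ext z
    have h1 := congrFun h z.1
    simp only [Function.comp_apply] at h1
    change ∑ γ : Γ, f (γ • z.1) * g z.2 = c (π z.1) * g z.2
    rw [← Finset.sum_mul, h1]

end Reynolds

/-- If `X / Γ ≅ Y` for affine varieties, described by invariant functions, then
`(X × E) / Γ ≅ Y × E`. -/
theorem isSmoothQuotient_prod {X Y : Type} {A : Subalgebra ℂ (X → ℂ)} {C : Subalgebra ℂ (Y → ℂ)}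
    {Γ : Type} [Group Γ] [Fintype Γ] [MulAction Γ X] {π : X → Y}
    (hR : HasReynolds A C Γ π) (hA : IsAffineModel A)
    (hΓ : ∀ γ : Γ, ∀ f ∈ A, (fun x => f (γ • x)) ∈ A)
    (hC : ∀ c ∈ C, c ∘ π ∈ A) (hπΓ : ∀ (γ : Γ) x, π (γ • x) = π x) (hπ : Function.Surjective π)
    {ι : Type} [Finite ι] (e : X ≃ (ι → ℂ)) (he : (ofAlgebra X A).IsIso (ofAlgebra (ι → ℂ) (polyAlgebra _)) e)
    {E : Type} [AddCommGroup E] [Module ℂ E] [FiniteDimensional ℂ E] {Z : FunctionSpace}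
    (hZ : Z.Isomorphic (ofAlgebra (Y × E) (prodAlgebra C (polyAlgebra E)))) :
    Z.IsSmoothQuotient Γ := by
  let act := fstAction Γ X E
  have hE := isAffineModel_polyAlgebra E
  have hAE := hA.prod hE
  have hΓ' : ∀ γ : Γ, ∀ F ∈ prodAlgebra A (polyAlgebra E), (fun z => F (γ • z)) ∈ prodAlgebra A (polyAlgebra E) :=
    fun γ F hF => prod_comp_mem (φ := fun z : X × E => γ • z)
      (fun f hf => fst_mem_prodAlgebra (hΓ γ f hf)) (fun g hg => snd_mem_prodAlgebra hg) hF
  obtain ⟨q, hq, -⟩ := exists_isIso_orbitSpace (Γ := Γ) (π := Prod.map π id)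
    (C := prodAlgebra C (polyAlgebra E)) hAE.separates hΓ' (hπ.prodMap Function.surjective_id)
    (fun γ z => Prod.ext (hπΓ γ z.1) rfl)
    (fun c hc => prod_comp_mem (φ := Prod.map π id) (fun f hf => fst_mem_prodAlgebra (hC f hf))
      (fun g hg => snd_mem_prodAlgebra hg) hc)
    (fun f hf hinv => (hR.prod (polyAlgebra E)).exists_eq_comp hf hinv)
  refine ⟨ofAlgebra (X × E) (prodAlgebra A (polyAlgebra E)), act, ?_, isMorphism_smul hΓ',
    hZ.trans ⟨q.symm, hq.symm⟩⟩
  let b := Module.finBasis ℂ E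
  let L : ((ι → ℂ) × E) ≃ₗ[ℂ] (ι ⊕ Fin (Module.finrank ℂ E) → ℂ) :=
    ((LinearEquiv.refl ℂ (ι → ℂ)).prodCongr b.equivFun).trans
      (LinearEquiv.sumArrowLequivProdArrow ι (Fin (Module.finrank ℂ E)) ℂ ℂ).symm
  have h1 : (ofAlgebra (X × E) (prodAlgebra A (polyAlgebra E))).IsIso
      (ofAlgebra ((ι → ℂ) × E) (prodAlgebra (polyAlgebra _) (polyAlgebra E))) (e.prodCongr (Equiv.refl E)) := by
    constructor
    · exact isMorphism_prod (φ := e.prodCongr (Equiv.refl E)) (he.1.comp (isMorphism_of_comp_mem fun f hf => fst_mem_prodAlgebra hf))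
        (isMorphism_of_comp_mem fun f hf => snd_mem_prodAlgebra hf)
    · exact isMorphism_prod (φ := (e.prodCongr (Equiv.refl E)).symm) (he.2.comp (isMorphism_of_comp_mem fun f hf => fst_mem_prodAlgebra hf))
        (isMorphism_of_comp_mem fun f hf => snd_mem_prodAlgebra hf)
  rw [prodAlgebra_polyAlgebra] at h1
  have h2 : (ofAlgebra ((ι → ℂ) × E) (polyAlgebra _)).IsIso
      (ofAlgebra (ι ⊕ Fin (Module.finrank ℂ E) → ℂ) (polyAlgebra _)) L.toEquiv :=
    isIso_of_comp_mem (fun f hf => comp_mem_polyAlgebra L.toLinearMap hf)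
      fun f hf => comp_mem_polyAlgebra L.symm.toLinearMap hf
  exact isSmoothVariety_polyAlgebra ⟨_, h1.trans h2⟩

end FunctionSpace

section Monoids

variable {M N ι : Type} [CommMonoid M] [CommGroup N] [Fintype ι] [DecidableEq ι]

/-! ### The affine variety of homomorphisms `M → ℂ` -/

variable (M) in
/-- The algebra of functions on the set of homomorphisms `M → ℂ` generated by the elements of `M`. -/
def homAlgebra : Subalgebra ℂ ((M →* ℂ) → ℂ) := Algebra.adjoin ℂ {F | ∃ μ : M, F = fun v => v μ}

theorem eval_mem_homAlgebra (μ : M) : (fun v : M →* ℂ => v μ) ∈ homAlgebra M :=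
  Algebra.subset_adjoin ⟨μ, rfl⟩

/-- A product of evaluations is an evaluation, so the functions are linear combinations of
monomials. Averaging and linear independence are studied on monomials. -/
theorem homAlgebra_le_span {f : (M →* ℂ) → ℂ} (hf : f ∈ homAlgebra M) :
    f ∈ Submodule.span ℂ (Set.range fun (μ : M) (v : M →* ℂ) => v μ) := by
  set W := Submodule.span ℂ (Set.range fun (μ : M) (v : M →* ℂ) => v μ) with hW
  induction hf using Algebra.adjoin_induction with
  | mem f hf => obtain ⟨μ, rfl⟩ := hf; exact Submodule.subset_span ⟨μ, rfl⟩
  | algebraMap c =>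
    rw [Algebra.algebraMap_eq_smul_one]
    exact W.smul_mem _ (Submodule.subset_span ⟨1, funext fun v => map_one v⟩)
  | add f g _ _ hf hg => exact W.add_mem hf hg
  | mul f g _ _ hf hg =>
    have : f * g ∈ W * W := Submodule.mul_mem_mul hf hg
    rw [hW, Submodule.span_mul_span] at this
    refine Submodule.span_mono ?_ this
    rintro _ ⟨_, ⟨μ, rfl⟩, _, ⟨μ', rfl⟩, rfl⟩
    exact ⟨μ * μ', funext fun v => map_mul v _ _⟩

theorem homAlgebra_separates (v w : M →* ℂ) (H : ∀ f ∈ homAlgebra M, f v = f w) : v = w :=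
  MonoidHom.ext fun μ => H _ (eval_mem_homAlgebra μ)

theorem homAlgebra_exists_eval (φ : homAlgebra M →ₐ[ℂ] ℂ) :
    ∃ v, ∀ f : homAlgebra M, φ f = f.1 v := by
  let v : M →* ℂ :=
    { toFun := fun μ => φ ⟨_, eval_mem_homAlgebra μ⟩
      map_one' := by
        rw [← map_one φ]
        exact congrArg φ (Subtype.ext (funext fun v => map_one v))
      map_mul' := fun μ μ' => by
        rw [← map_mul]
        exact congrArg φ (Subtype.ext (funext fun v => map_mul v _ _)) }
  refine ⟨v, ?_⟩
  rintro ⟨f, hf⟩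
  induction hf using Algebra.adjoin_induction with
  | mem f hf => obtain ⟨μ, rfl⟩ := hf; rfl
  | algebraMap c => exact φ.commutes c
  | add f g hf hg h1 h2 => exact (map_add φ ⟨f, hf⟩ ⟨g, hg⟩).trans (congrArg₂ (· + ·) h1 h2)
  | mul f g hf hg h1 h2 => exact (map_mul φ ⟨f, hf⟩ ⟨g, hg⟩).trans (congrArg₂ (· * ·) h1 h2)

theorem isAffineModel_homAlgebra {s : Finset M} (hs : Submonoid.closure (s : Set M) = ⊤) :
    IsAffineModel (homAlgebra M) where
  finiteType := by
    rw [← Subalgebra.fg_iff_finiteType]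
    refine Subalgebra.fg_def.2 ⟨(fun (μ : M) (v : M →* ℂ) => v μ) '' s, s.finite_toSet.image _, ?_⟩
    refine le_antisymm (Algebra.adjoin_mono ?_) (Algebra.adjoin_le ?_)
    · rintro _ ⟨μ, -, rfl⟩
      exact ⟨μ, rfl⟩
    · rintro _ ⟨μ, rfl⟩
      have hμ : μ ∈ Submonoid.closure (s : Set M) := hs ▸ Submonoid.mem_top μ
      induction hμ using Submonoid.closure_induction with
      | mem μ hμ => exact Algebra.subset_adjoin ⟨μ, hμ, rfl⟩
      | one => exact (funext fun v => map_one v : (fun v : M →* ℂ => v 1) = 1) ▸ Subalgebra.one_mem _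
      | mul μ μ' _ _ h1 h2 =>
        exact (funext fun v => map_mul v _ _ : (fun v : M →* ℂ => v (μ * μ')) =
          (fun v => v μ) * fun v => v μ') ▸ Subalgebra.mul_mem _ h1 h2
  separates := homAlgebra_separates
  exists_eval := homAlgebra_exists_eval

variable (M ι) in
/-- Coordinates on a free commutative monoid. -/
structure MonoidCoords where
  expo : M → ι → ℕ
  expo_one : expo 1 = 0
  expo_mul : ∀ μ μ', expo (μ * μ') = expo μ + expo μ'
  expo_injective : Function.Injective expo
  omega : ι → M
  expo_omega : ∀ α, expo (omega α) = Pi.single α 1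

variable (N ι) in
/-- Coordinates on a free commutative group. -/
structure GroupCoords where
  expo : N → ι → ℤ
  expo_mul : ∀ μ μ', expo (μ * μ') = expo μ + expo μ'
  expo_injective : Function.Injective expo
  omega : ι → N
  expo_omega : ∀ α, expo (omega α) = Pi.single α 1

namespace MonoidCoords

variable (c : MonoidCoords M ι)

/-- The coordinates as a homomorphism. -/
def hom : M →* Multiplicative (ι → ℕ) where
  toFun μ := Multiplicative.ofAdd (c.expo μ)
  map_one' := c.expo_one
  map_mul' := c.expo_mul

theorem eq_prod (μ : M) : μ = ∏ α, c.omega α ^ c.expo μ α := by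
  refine c.expo_injective ?_
  have h1 : c.hom (∏ α, c.omega α ^ c.expo μ α) = ∏ α, c.hom (c.omega α) ^ c.expo μ α := by
    rw [map_prod]
    exact Finset.prod_congr rfl fun α _ => map_pow _ _ _
  have h2 : c.expo (∏ α, c.omega α ^ c.expo μ α) = ∑ α, c.expo μ α • c.expo (c.omega α) := h1
  rw [h2]
  ext β
  simp [c.expo_omega, Finset.sum_apply, Pi.single_apply]

theorem apply_eq_prod {K : Type} [CommMonoid K] (v : M →* K) (μ : M) :
    v μ = ∏ α, v (c.omega α) ^ c.expo μ α := by
  conv_lhs => rw [c.eq_prod μ]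
  rw [map_prod]
  exact Finset.prod_congr rfl fun α _ => map_pow _ _ _

/-- Homomorphisms from a free commutative monoid are given by their values on the generators. -/
def equiv : (M →* ℂ) ≃ (ι → ℂ) where
  toFun v α := v (c.omega α)
  invFun x :=
    { toFun := fun μ => ∏ α, x α ^ c.expo μ α
      map_one' := by simp [c.expo_one]
      map_mul' := fun μ μ' => by
        rw [← Finset.prod_mul_distrib]
        exact Finset.prod_congr rfl fun α _ => by rw [c.expo_mul, Pi.add_apply, pow_add] }
  left_inv v := MonoidHom.ext fun μ => (c.apply_eq_prod v μ).symm
  right_inv x := by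
    ext α
    change ∏ β, x β ^ c.expo (c.omega α) β = x α
    rw [Finset.prod_eq_single α]
    · simp [c.expo_omega]
    · intro β _ hβ
      simp [c.expo_omega, hβ]
    · simp

theorem comp_equiv_mem {F : (ι → ℂ) → ℂ} (hF : F ∈ polyAlgebra (ι → ℂ)) :
    F ∘ c.equiv ∈ homAlgebra M := by
  rw [polyAlgebra_eq_adjoin (Pi.basisFun ℂ _)] at hF
  refine comp_mem_of_adjoin ?_ hF
  rintro _ ⟨α, rfl⟩
  exact eval_mem_homAlgebra (c.omega α)

theorem comp_equiv_symm_mem {F : (M →* ℂ) → ℂ} (hF : F ∈ homAlgebra M) :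
    F ∘ c.equiv.symm ∈ polyAlgebra (ι → ℂ) := by
  refine comp_mem_of_adjoin ?_ hF
  rintro _ ⟨μ, rfl⟩
  have : (fun v : M →* ℂ => v μ) ∘ c.equiv.symm = ∏ α, (fun x => x α) ^ c.expo μ α := by
    ext x
    simp only [Finset.prod_apply, Pi.pow_apply]
    rfl
  rw [this]
  exact prod_mem fun α _ => pow_mem (show (fun x : ι → ℂ => x α) ∈ polyAlgebra (ι → ℂ) from
    dual_mem_polyAlgebra (LinearMap.proj α : (ι → ℂ) →ₗ[ℂ] ℂ)) _

theorem isIso_equiv : (ofAlgebra (M →* ℂ) (homAlgebra M)).IsIso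
    (ofAlgebra (ι → ℂ) (polyAlgebra _)) c.equiv :=
  isIso_of_comp_mem (fun _ hF => c.comp_equiv_mem hF) fun _ hF => c.comp_equiv_symm_mem hF

include c in
theorem isAffineModel : IsAffineModel (homAlgebra M) :=
  (isAffineModel_polyAlgebra _).of_equiv c.equiv (fun _ hF => c.comp_equiv_mem hF)
    fun _ hF => c.comp_equiv_symm_mem hF

include c in
theorem isomorphic_affineSpace {r : ℕ} (ε : Fin r ≃ ι) :
    (ofAlgebra (M →* ℂ) (homAlgebra M)).Isomorphic (affineSpace r) := by
  let E := LinearEquiv.funCongrLeft ℂ ℂ ε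
  have h1 : (ofAlgebra (ι → ℂ) (polyAlgebra _)).IsIso (affineSpace r) E.toEquiv :=
    isIso_of_comp_mem (fun _ hF => comp_mem_polyAlgebra E.toLinearMap hF)
      fun _ hF => comp_mem_polyAlgebra E.symm.toLinearMap hF
  exact ⟨_, c.isIso_equiv.trans h1⟩

end MonoidCoords

/-! ### Tori -/

variable (N) in
/-- The algebra of functions on the torus with character group `N`. -/
def unitsAlgebra : Subalgebra ℂ ((N →* ℂˣ) → ℂ) :=
  Algebra.adjoin ℂ {F | ∃ μ : N, F = fun s => (s μ : ℂ)}

theorem eval_mem_unitsAlgebra (μ : N) : (fun s : N →* ℂˣ => (s μ : ℂ)) ∈ unitsAlgebra N :=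
  Algebra.subset_adjoin ⟨μ, rfl⟩

namespace GroupCoords

variable (c : GroupCoords N ι)

/-- The coordinates as a homomorphism. -/
def hom : N →* Multiplicative (ι → ℤ) := MonoidHom.mk' (fun μ => Multiplicative.ofAdd (c.expo μ)) c.expo_mul

omit [Fintype ι] in
theorem expo_one : c.expo 1 = 0 := map_one c.hom

theorem expo_prod (m : ι → ℤ) : c.expo (∏ α, c.omega α ^ m α) = m := by
  have h1 : c.hom (∏ α, c.omega α ^ m α) = ∏ α, c.hom (c.omega α) ^ m α := by
    rw [map_prod]
    exact Finset.prod_congr rfl fun α _ => map_zpow _ _ _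
  have h2 : c.expo (∏ α, c.omega α ^ m α) = ∑ α, m α • c.expo (c.omega α) := h1
  rw [h2]
  ext β
  simp [c.expo_omega, Finset.sum_apply, Pi.single_apply]

theorem eq_prod (μ : N) : μ = ∏ α, c.omega α ^ c.expo μ α :=
  c.expo_injective (c.expo_prod _).symm

theorem apply_eq_prod {K : Type} [CommGroup K] (s : N →* K) (μ : N) :
    s μ = ∏ α, s (c.omega α) ^ c.expo μ α := by
  conv_lhs => rw [c.eq_prod μ]
  rw [map_prod]
  exact Finset.prod_congr rfl fun α _ => map_zpow _ _ _

/-- Homomorphisms from a free commutative group are given by their values on the generators. -/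
def equiv : (ι → ℂˣ) ≃* (N →* ℂˣ) where
  toFun x := MonoidHom.mk' (fun μ => ∏ α, x α ^ c.expo μ α) fun μ μ' => by
    rw [← Finset.prod_mul_distrib]
    exact Finset.prod_congr rfl fun α _ => by rw [c.expo_mul, Pi.add_apply, zpow_add]
  invFun s α := s (c.omega α)
  left_inv x := by
    ext α : 1
    change ∏ β, x β ^ c.expo (c.omega α) β = x α
    rw [Finset.prod_eq_single α]
    · simp [c.expo_omega]
    · intro β _ hβ
      simp [c.expo_omega, hβ]
    · simp
  right_inv s := MonoidHom.ext fun μ => (c.apply_eq_prod s μ).symm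
  map_mul' x x' := MonoidHom.ext fun μ => by
    change ∏ α, (x α * x' α) ^ _ = (∏ α, x α ^ _) * ∏ α, x' α ^ _
    rw [← Finset.prod_mul_distrib]
    exact Finset.prod_congr rfl fun α _ => by rw [mul_zpow]

theorem equiv_apply (x : ι → ℂˣ) (μ : N) : c.equiv x μ = ∏ α, x α ^ c.expo μ α := rfl

/-- Homomorphisms with prescribed values on the generators. -/
theorem equiv_apply_omega (x : ι → ℂˣ) (α : ι) : c.equiv x (c.omega α) = x α :=
  congrFun (c.equiv.left_inv x) α

theorem apply_eq_exp (s : N →* ℂˣ) (x : ι → ℂ) (hx : ∀ α, (s (c.omega α) : ℂ) = Complex.exp (x α))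
    (μ : N) : (s μ : ℂ) = Complex.exp (∑ α, (c.expo μ α : ℂ) * x α) := by
  rw [c.apply_eq_prod s, Units.coe_prod, Complex.exp_sum]
  refine Finset.prod_congr rfl fun α _ => ?_
  rw [Units.val_zpow_eq_zpow_val, hx, Complex.exp_int_mul]

include c in
theorem exists_isIso_standardTorus {r : ℕ} (ε : Fin r ≃ ι) : ∃ e : (Fin r → ℂˣ) ≃* (N →* ℂˣ),
    (standardTorus r).IsIso (ofAlgebra (N →* ℂˣ) (unitsAlgebra N)) e.toEquiv := by
  let e0 : (Fin r → ℂˣ) ≃* (ι → ℂˣ) :=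
    { toFun := fun x α => x (ε.symm α)
      invFun := fun x i => x (ε i)
      left_inv := fun x => by ext; simp
      right_inv := fun x => by ext; simp
      map_mul' := fun _ _ => rfl }
  let e : (Fin r → ℂˣ) ≃* (N →* ℂˣ) := e0.trans c.equiv
  have he : ∀ x μ, e x μ = ∏ i, x i ^ c.expo μ (ε i) := by
    intro x μ
    change ∏ α, x (ε.symm α) ^ c.expo μ α = _
    rw [← ε.prod_comp]
    exact Finset.prod_congr rfl fun i _ => by rw [Equiv.symm_apply_apply]
  let A : Subalgebra ℂ ((Fin r → ℂˣ) → ℂ) := Algebra.adjoin ℂ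
    ({F | ∃ i : Fin r, F = fun s => (s i : ℂ)} ∪ {F | ∃ i : Fin r, F = fun s => (((s i)⁻¹ : ℂˣ) : ℂ)})
  have hA : ∀ i, (fun s : Fin r → ℂˣ => (s i : ℂ)) ∈ A := fun i => Algebra.subset_adjoin (Or.inl ⟨i, rfl⟩)
  have hA' : ∀ i, (fun s : Fin r → ℂˣ => (((s i)⁻¹ : ℂˣ) : ℂ)) ∈ A :=
    fun i => Algebra.subset_adjoin (Or.inr ⟨i, rfl⟩)
  refine ⟨e, isIso_of_comp_mem (fun F hF => comp_mem_of_adjoin ?_ hF) fun F hF => comp_mem_of_adjoin ?_ hF⟩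
  · rintro _ ⟨μ, rfl⟩
    have h1 : (fun s : N →* ℂˣ => (s μ : ℂ)) ∘ e.toEquiv =
        ∏ i, fun x => ((x i ^ c.expo μ (ε i) : ℂˣ) : ℂ) := by
      ext x
      simp only [Finset.prod_apply]
      rw [← Units.coe_prod, ← he]
      rfl
    rw [h1]
    refine Subalgebra.prod_mem A fun i _ => ?_
    rcases Int.le_total 0 (c.expo μ (ε i)) with h2 | h2
    · obtain ⟨k, hk⟩ := Int.eq_ofNat_of_zero_le h2
      have : (fun x : Fin r → ℂˣ => ((x i ^ c.expo μ (ε i) : ℂˣ) : ℂ)) = (fun x => (x i : ℂ)) ^ k := by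
        ext x
        rw [hk]; simp
      rw [this]
      exact Subalgebra.pow_mem A (hA i) _
    · obtain ⟨k, hk⟩ := Int.eq_ofNat_of_zero_le (neg_nonneg.2 h2)
      have : (fun x : Fin r → ℂˣ => ((x i ^ c.expo μ (ε i) : ℂˣ) : ℂ)) =
          (fun x => (((x i)⁻¹ : ℂˣ) : ℂ)) ^ k := by
        ext x
        rw [show c.expo μ (ε i) = -(k : ℤ) by omega]; simp
      rw [this]
      exact Subalgebra.pow_mem A (hA' i) _
  · rintro _ (⟨i, rfl⟩ | ⟨i, rfl⟩)
    · exact Algebra.subset_adjoin ⟨c.omega (ε i), rfl⟩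
    · refine Algebra.subset_adjoin ⟨(c.omega (ε i))⁻¹, ?_⟩
      ext s
      rw [map_inv]; rfl

end GroupCoords

/-! ### The embedding of the torus -/

section Embedding

variable (i : M →* N)

omit [Fintype ι] in
/-- Coordinates on the submonoid of the elements with non-negative coordinates. -/
def GroupCoords.cone (c : GroupCoords N ι) (hinj : Function.Injective i)
    (hnonneg : ∀ μ α, 0 ≤ c.expo (i μ) α) (hω : ∀ α, ∃ μ, i μ = c.omega α) : MonoidCoords M ι where
  expo μ α := (c.expo (i μ) α).toNat
  expo_one := by
    ext α
    have h1 : c.expo (i 1) = 0 := by rw [map_one, c.expo_one]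
    rw [h1]; rfl
  expo_mul μ μ' := by
    ext α
    rw [map_mul, c.expo_mul]
    exact Int.toNat_add (hnonneg μ α) (hnonneg μ' α)
  expo_injective μ μ' H := by
    refine hinj (c.expo_injective ?_)
    ext α
    rw [← Int.toNat_of_nonneg (hnonneg μ α), ← Int.toNat_of_nonneg (hnonneg μ' α)]
    exact congrArg Nat.cast (congrFun H α)
  omega α := (hω α).choose
  expo_omega α := by
    ext β
    rw [(hω α).choose_spec, c.expo_omega]
    by_cases hβ : β = α
    · subst hβ; simp
    · simp [hβ]

/-- The restriction of homomorphisms `N → ℂ^×` to `M`. -/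
def torusTo : (N →* ℂˣ) →* (M →* ℂ) where
  toFun s := (Units.coeHom ℂ).comp (s.comp i)
  map_one' := by ext; rfl
  map_mul' := fun s s' => by ext; rfl

variable {i} (c : MonoidCoords M ι) (c' : GroupCoords N ι)
  (hi : ∀ μ α, c'.expo (i μ) α = c.expo μ α)

include c c' hi

omit [Fintype ι] in
theorem map_omega (α : ι) : i (c.omega α) = c'.omega α :=
  c'.expo_injective (by
    ext β
    rw [hi, c.expo_omega, c'.expo_omega]
    by_cases hβ : β = α
    · subst hβ; simp
    · simp [hβ])

theorem torusTo_injective : Function.Injective (torusTo i) := by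
  intro s s' H
  refine MonoidHom.ext fun μ => ?_
  rw [c'.apply_eq_prod s, c'.apply_eq_prod s']
  refine Finset.prod_congr rfl fun α _ => ?_
  congr 1
  rw [← map_omega c c' hi]
  exact Units.ext (DFunLike.congr_fun H (c.omega α))

theorem mem_range_torusTo {v : M →* ℂ} : v ∈ Set.range (torusTo i) ↔ ∏ α, v (c.omega α) ≠ 0 := by
  constructor
  · rintro ⟨s, rfl⟩
    exact Finset.prod_ne_zero_iff.2 fun α _ => Units.ne_zero _
  · intro hv
    rw [Finset.prod_ne_zero_iff] at hv
    refine ⟨c'.equiv fun α => Units.mk0 _ (hv α (Finset.mem_univ α)), ?_⟩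
    refine MonoidHom.ext fun μ => ?_
    rw [c.apply_eq_prod v μ, c.apply_eq_prod (torusTo i _) μ]
    refine Finset.prod_congr rfl fun α _ => ?_
    congr 1
    change ((c'.equiv _ (i (c.omega α)) : ℂˣ) : ℂ) = _
    rw [map_omega c c' hi, c'.equiv_apply_omega, Units.val_mk0]

theorem isOpenImmersion_torusTo : (ofAlgebra (N →* ℂˣ) (unitsAlgebra N)).IsOpenImmersion
    (ofAlgebra (M →* ℂ) (homAlgebra M)) (torusTo i) := by
  have hopen : IsOpen[zariski (homAlgebra M)] (Set.range (torusTo i)) := by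
    have h1 := isOpen_ne_zero (A := homAlgebra M)
      (prod_mem fun α (_ : α ∈ Finset.univ) => eval_mem_homAlgebra (c.omega α))
    convert h1 using 1
    ext v
    rw [mem_range_torusTo c c' hi]
    simp only [Finset.prod_apply]
    rfl
  refine ⟨hopen, Equiv.ofInjective _ (torusTo_injective c c' hi), ⟨?_, ?_⟩, fun _ => rfl⟩
  · refine IsMorphism.codRestrict (Y := ofAlgebra (M →* ℂ) (homAlgebra M)) (s := Set.range (torusTo i))
      (φ := torusTo i) (isMorphism_of_comp_mem fun f hf => comp_mem_of_adjoin ?_ hf) fun s => ⟨s, rfl⟩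
    rintro _ ⟨μ, rfl⟩
    exact eval_mem_unitsAlgebra (i μ)
  · refine isMorphism_adjoin ?_
    rintro _ ⟨μ, rfl⟩ z
    -- The positive and negative parts of the exponent write a character as `e^p / e^q` with both
    -- exponents in the semigroup; `e^q` is invertible on the torus.
    obtain ⟨p, hp⟩ : ∃ p : M, c'.expo (i p) = fun α => max (c'.expo μ α) 0 := by
      refine ⟨∏ α, c.omega α ^ (c'.expo μ α).toNat, ?_⟩
      have : i (∏ α, c.omega α ^ (c'.expo μ α).toNat) = ∏ α, c'.omega α ^ (max (c'.expo μ α) 0) := by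
        rw [map_prod]
        refine Finset.prod_congr rfl fun α _ => ?_
        rw [map_pow, map_omega c c' hi, ← zpow_natCast, Int.toNat_eq_max]
      rw [this, c'.expo_prod]
    obtain ⟨q, hq⟩ : ∃ q : M, c'.expo (i q) = fun α => max (-c'.expo μ α) 0 := by
      refine ⟨∏ α, c.omega α ^ (-c'.expo μ α).toNat, ?_⟩
      have : i (∏ α, c.omega α ^ (-c'.expo μ α).toNat) = ∏ α, c'.omega α ^ (max (-c'.expo μ α) 0) := by
        rw [map_prod]
        refine Finset.prod_congr rfl fun α _ => ?_
        rw [map_pow, map_omega c c' hi, ← zpow_natCast, Int.toNat_eq_max]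
      rw [this, c'.expo_prod]
    have hμ : μ * i q = i p := by
      refine c'.expo_injective ?_
      rw [c'.expo_mul, hp, hq]
      ext α
      simp only [Pi.add_apply]
      omega
    obtain ⟨_, (s : N →* ℂˣ), rfl⟩ := z
    have hqs : (torusTo i s) q ≠ 0 := Units.ne_zero _
    refine ⟨(fun v : M →* ℂ => v p) * (fun v : M →* ℂ => v q)⁻¹,
      (ofAlgebra (M →* ℂ) (homAlgebra M)).mul _ _ _ (regAt_of_mem (eval_mem_homAlgebra p) _)
        ((ofAlgebra (M →* ℂ) (homAlgebra M)).inv _ _ (regAt_of_mem (eval_mem_homAlgebra q) _) hqs),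
      Eventually.of_forall ?_⟩
    rintro ⟨_, (s' : N →* ℂˣ), rfl⟩
    have h1 : (Equiv.ofInjective _ (torusTo_injective c c' hi)).symm ⟨torusTo i s', s', rfl⟩ = s' := by
      exact (Equiv.symm_apply_eq _).2 rfl
    change (((Equiv.ofInjective _ (torusTo_injective c c' hi)).symm ⟨torusTo i s', s', rfl⟩) μ : ℂ) = (s' (i p) : ℂ) * (s' (i q) : ℂ)⁻¹
    rw [h1, ← hμ, map_mul, Units.val_mul, mul_inv_cancel_right₀ (Units.ne_zero _)]

/-- In coordinates a basic open set is the locus where a nonzero polynomial does not vanish.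
Multiplied by all coordinate functions it is still nonzero, so it is nonzero at some point with all
coordinates nonzero. -/
theorem dense_range_torusTo :
    Dense (X := (ofAlgebra (M →* ℂ) (homAlgebra M)).carrier) (Set.range (torusTo i)) := by
  rw [dense_iff_inter_open]
  rintro U hU ⟨(x : M →* ℂ), hx⟩
  obtain ⟨(b : (M →* ℂ) → ℂ), hb, hbx, hbU⟩ := exists_basic_of_isOpen hU hx
  have h1 := c.comp_equiv_symm_mem hb
  rw [polyAlgebra_eq_range] at h1
  obtain ⟨p, hp⟩ := h1
  have hp' : ∀ y, MvPolynomial.eval y p = b (c.equiv.symm y) := fun y => by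
    rw [← evalAlgHom_apply]; exact congrFun hp y
  have hp0 : p ≠ 0 := by
    rintro rfl
    have := hp' (c.equiv x)
    rw [Equiv.symm_apply_apply, map_zero] at this
    exact hbx this.symm
  have hne : p * ∏ α, MvPolynomial.X α ≠ 0 :=
    mul_ne_zero hp0 (Finset.prod_ne_zero_iff.2 fun α _ => MvPolynomial.X_ne_zero α)
  have : ∃ y, MvPolynomial.eval y (p * ∏ α, MvPolynomial.X α) ≠ 0 := by
    by_contra! H
    exact hne (MvPolynomial.funext fun y => by rw [H, map_zero])
  obtain ⟨y, hy⟩ := this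
  rw [map_mul, map_prod] at hy
  refine ⟨c.equiv.symm y, hbU _ ?_, (mem_range_torusTo c c' hi).2 ?_⟩
  · rw [← hp']; exact left_ne_zero_of_mul hy
  · have h2 := right_ne_zero_of_mul hy
    convert h2 using 2 with α
    rw [MvPolynomial.eval_X]
    exact congrFun (c.equiv.apply_symm_apply y) α

end Embedding

/-! ### The quotient by the finite group -/

section Quotient

variable {M' : Type} [CommMonoid M'] (i : M →* N) (P : Subgroup N) (j : M' →* M)

/-- The homomorphisms that are trivial on a subgroup. -/
def annihilator : Subgroup (N →* ℂˣ) where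
  carrier := {z | ∀ μ ∈ P, z μ = 1}
  one_mem' := fun _ _ => rfl
  mul_mem' := fun {a b} ha hb μ hμ => by rw [MonoidHom.mul_apply, ha μ hμ, hb μ hμ, one_mul]
  inv_mem' := fun {a} ha μ hμ => by rw [MonoidHom.inv_apply, ha μ hμ, inv_one]

/-- The action of the torus by multiplication. -/
abbrev torusAction : MulAction (N →* ℂˣ) (M →* ℂ) := MulAction.compHom (M →* ℂ) (torusTo i)

/-- The action of the finite group on the toric variety. -/
abbrev annihilatorAction : MulAction (annihilator P) (M →* ℂ) :=
  have := torusAction i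
  inferInstance

variable {P} (c : MonoidCoords M ι) (c' : GroupCoords N ι)
  (hi : ∀ μ α, c'.expo (i μ) α = c.expo μ α) {d : ℕ} (hd : 0 < d) (hP : ∀ μ : N, μ ^ d ∈ P)

include c' hd hP

/-- As all `d`-th powers lie in `P`, every class has a representative with exponents between `0` and
`d - 1`. -/
theorem finite_quotient : Finite (N ⧸ P) := by
  have : NeZero d := ⟨hd.ne'⟩
  refine Finite.of_surjective (fun m : ι → Fin d => (QuotientGroup.mk (∏ α, c'.omega α ^ ((m α : ℕ) : ℤ)) : N ⧸ P)) ?_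
  intro q
  obtain ⟨μ, rfl⟩ := QuotientGroup.mk_surjective q
  refine ⟨fun α => ⟨(c'.expo μ α % d).toNat, ?_⟩, ?_⟩
  · have h1 := Int.emod_lt_of_pos (c'.expo μ α) (Int.natCast_pos.2 hd)
    have h2 := Int.emod_nonneg (c'.expo μ α) (Int.natCast_ne_zero.2 hd.ne')
    omega
  · rw [QuotientGroup.eq]
    have : (∏ α, c'.omega α ^ (((c'.expo μ α % d).toNat : ℕ) : ℤ))⁻¹ * μ =
        (∏ α, c'.omega α ^ (c'.expo μ α / d)) ^ d := by
      rw [inv_mul_eq_iff_eq_mul]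
      conv_lhs => rw [c'.eq_prod μ]
      rw [← Finset.prod_pow, ← Finset.prod_mul_distrib]
      refine Finset.prod_congr rfl fun α _ => ?_
      rw [← zpow_natCast, ← zpow_mul, ← zpow_add]
      congr 1
      have h2 := Int.emod_nonneg (c'.expo μ α) (Int.natCast_ne_zero.2 hd.ne')
      rw [Int.toNat_of_nonneg h2, mul_comm (c'.expo μ α / d), Int.emod_add_mul_ediv]
    rw [this]
    exact hP _

/-- The characters of the finite abelian group `N ⧸ P` separate its elements, since `ℂ` has enough
roots of unity. -/
theorem exists_annihilator_ne_one {μ : N} (hμ : μ ∉ P) : ∃ z ∈ annihilator P, z μ ≠ 1 := by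
  have := finite_quotient c' hd hP
  have h1 : (QuotientGroup.mk μ : N ⧸ P) ≠ 1 := by rwa [ne_eq, QuotientGroup.eq_one_iff]
  obtain ⟨φ, hφ⟩ := CommGroup.exists_apply_ne_one_of_hasEnoughRootsOfUnity (N ⧸ P) ℂ h1
  refine ⟨φ.comp (QuotientGroup.mk' P), fun ν hν => ?_, hφ⟩
  rw [MonoidHom.comp_apply, QuotientGroup.mk'_apply, (QuotientGroup.eq_one_iff ν).2 hν, map_one]

/-- An element of the annihilator is determined by its values on the generators, and these are
`d`-th roots of unity. -/
theorem finite_annihilator : Finite (annihilator P) := by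
  have : NeZero d := ⟨hd.ne'⟩
  refine Finite.of_injective (fun (z : annihilator P) (α : ι) =>
    (⟨z.1 (c'.omega α), by
      rw [mem_rootsOfUnity, ← map_pow]
      exact z.2 _ (hP _)⟩ : rootsOfUnity d ℂ)) ?_
  intro z z' H
  refine Subtype.ext (MonoidHom.ext fun μ => ?_)
  rw [c'.apply_eq_prod z.1, c'.apply_eq_prod z'.1]
  refine Finset.prod_congr rfl fun α _ => ?_
  congr 1
  exact congrArg Subtype.val (congrFun H α)

/-- Orthogonality: translating the sum by an element with value different from `1` at `μ` multiplies
it by that value. -/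
theorem sum_annihilator_eq_zero [Fintype (annihilator P)] {μ : N} (hμ : μ ∉ P) :
    ∑ z : annihilator P, (z.1 μ : ℂ) = 0 := by
  obtain ⟨z0, hz0, hne⟩ := exists_annihilator_ne_one c' hd hP hμ
  have h1 : ∑ z : annihilator P, (z.1 μ : ℂ) = (z0 μ : ℂ) * ∑ z : annihilator P, (z.1 μ : ℂ) := by
    rw [Finset.mul_sum]
    refine Fintype.sum_equiv (Equiv.mulLeft (⟨z0, hz0⟩ : annihilator P)⁻¹) _ _ fun z => ?_
    change _ = (z0 μ : ℂ) * (((z0 μ)⁻¹ * z.1 μ : ℂˣ) : ℂ)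
    rw [← Units.val_mul, mul_inv_cancel_left]
  have h2 : ((z0 μ : ℂ) - 1) * ∑ z : annihilator P, (z.1 μ : ℂ) = 0 := by
    rw [sub_mul, one_mul, ← h1, sub_self]
  refine (mul_eq_zero.1 h2).resolve_left fun h3 => hne (Units.ext ?_)
  rw [Units.val_one]
  exact sub_eq_zero.1 h3

variable {j} (hj : ∀ μ, i μ ∈ P ↔ μ ∈ Set.range j) (hjinj : Function.Injective j)

include hj

/-- The group scales a monomial by its value at the exponent. The orbit sum is therefore a multiple
of the monomial when the exponent comes from `P`, and zero otherwise; this is why the invariants are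
spanned by the monomials of `M'`. -/
theorem hasReynolds_annihilator [Fintype (annihilator P)] :
    @HasReynolds _ _ (homAlgebra M) (homAlgebra M') (annihilator P) _ _ (annihilatorAction i P)
      (fun v => v.comp j) := by
  let := annihilatorAction i P
  have hsmul : ∀ (z : annihilator P) (v : M →* ℂ) μ, (z • v) μ = (z.1 (i μ) : ℂ) * v μ := fun _ _ _ => rfl
  intro f hf
  refine Submodule.span_induction (p := fun f _ => ∃ c ∈ homAlgebra M',
    (fun v => ∑ z : annihilator P, f (z • v)) = c ∘ fun v => v.comp j) ?_ ?_ ?_ ?_ (homAlgebra_le_span hf)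
  · rintro _ ⟨μ, rfl⟩
    by_cases hμ : i μ ∈ P
    · obtain ⟨μ', rfl⟩ := (hj μ).1 hμ
      refine ⟨(Fintype.card (annihilator P) : ℂ) • fun v => v μ',
        Subalgebra.smul_mem _ (eval_mem_homAlgebra μ') _, ?_⟩
      ext v
      simp only [hsmul]
      rw [Finset.sum_congr rfl fun z _ => by rw [z.2 _ hμ, Units.val_one, one_mul]]
      simp
    · refine ⟨0, zero_mem _, ?_⟩
      ext v
      simp only [hsmul]
      rw [← Finset.sum_mul, sum_annihilator_eq_zero c' hd hP hμ, zero_mul]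
      rfl
  · exact ⟨0, zero_mem _, by ext; simp⟩
  · rintro f g _ _ ⟨c1, hc1, h1⟩ ⟨c2, hc2, h2⟩
    refine ⟨c1 + c2, add_mem hc1 hc2, ?_⟩
    ext v
    have h1 := congrFun h1 v
    have h2 := congrFun h2 v
    simp only [Function.comp_apply, Pi.add_apply] at h1 h2 ⊢
    rw [Finset.sum_add_distrib, h1, h2]
  · rintro a f _ ⟨c1, hc1, h1⟩
    refine ⟨a • c1, Subalgebra.smul_mem _ hc1 a, ?_⟩
    ext v
    have h1 := congrFun h1 v
    simp only [Function.comp_apply, Pi.smul_apply, smul_eq_mul] at h1 ⊢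
    rw [← Finset.mul_sum, h1]

omit [Fintype ι] [DecidableEq ι] c' hd hP hj in
theorem comp_annihilator_smul_mem (γ : annihilator P) {f : (M →* ℂ) → ℂ} (hf : f ∈ homAlgebra M) :
    let := annihilatorAction i P
    (fun v : M →* ℂ => f (γ • v)) ∈ homAlgebra M := by
  intro _
  refine comp_mem_of_adjoin (φ := fun v : M →* ℂ => γ • v) ?_ hf
  rintro _ ⟨μ, rfl⟩
  exact Subalgebra.smul_mem _ (eval_mem_homAlgebra μ) (γ.1 (i μ) : ℂ)

omit [Fintype ι] [DecidableEq ι] c' hd hP in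
theorem comp_annihilator_smul (γ : annihilator P) (v : M →* ℂ) :
    let := annihilatorAction i P
    (γ • v).comp j = v.comp j := by
  intro _
  ext μ
  change (γ.1 (i (j μ)) : ℂ) * v (j μ) = v (j μ)
  rw [γ.2 _ ((hj _).2 ⟨μ, rfl⟩), Units.val_one, one_mul]

omit c' hd hP hj [CommGroup N] [Fintype ι] [DecidableEq ι] in
theorem comp_hom_mem_homAlgebra {f : (M' →* ℂ) → ℂ} (hf : f ∈ homAlgebra M') :
    f ∘ (fun v : M →* ℂ => v.comp j) ∈ homAlgebra M := by
  refine comp_mem_of_adjoin ?_ hf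
  rintro _ ⟨μ, rfl⟩
  exact eval_mem_homAlgebra (j μ)

-- The test homomorphism sends one generator to `2` and the others to `1`; since `2` has infinite
-- order in `ℂ^×`, it detects the corresponding exponent.
omit hd hP hj in
theorem GroupCoords.eq_of_forall_apply_eq {μ μ' : N} (H : ∀ s : N →* ℂˣ, s μ = s μ') : μ = μ' := by
  refine c'.expo_injective ?_
  ext α
  have h1 := H (c'.equiv (Pi.mulSingle α (Units.mk0 2 two_ne_zero)))
  have h2 : ∀ ν, c'.equiv (Pi.mulSingle α (Units.mk0 (2 : ℂ) two_ne_zero)) ν =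
      Units.mk0 (2 : ℂ) two_ne_zero ^ c'.expo ν α := by
    intro ν
    rw [c'.equiv_apply, Finset.prod_eq_single α]
    · rw [Pi.mulSingle_eq_same]
    · intro β _ hβ
      rw [Pi.mulSingle_eq_of_ne hβ, one_zpow]
    · simp
  rw [h2, h2] at h1
  have h3 := congrArg (fun u : ℂˣ => ‖(u : ℂ)‖) h1
  simp only [Units.val_zpow_eq_zpow_val, Units.val_mk0, norm_zpow, Complex.norm_ofNat] at h3
  exact zpow_right_injective₀ (by norm_num) (by norm_num) h3

-- On the dense torus distinct exponents give distinct characters, and these are linearly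
-- independent by Dedekind; so a combination of monomials that pulls back to zero has zero
-- coefficients.
include hjinj c hi in
omit hd hP hj in
theorem eq_zero_of_comp_eq_zero {f : (M' →* ℂ) → ℂ} (hf : f ∈ homAlgebra M')
    (hf0 : f ∘ (fun v : M →* ℂ => v.comp j) = 0) : f = 0 := by
  obtain ⟨a, rfl⟩ := (Finsupp.mem_span_range_iff_exists_finsupp).1 (homAlgebra_le_span hf)
  let χ : M' → ((N →* ℂˣ) →* ℂ) := fun μ =>
    { toFun := fun s => (s (i (j μ)) : ℂ)
      map_one' := rfl
      map_mul' := fun _ _ => Units.val_mul _ _ }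
  have hii : Function.Injective i := fun μ μ' H => c.expo_injective (by
    ext α
    have := congrArg (fun ν => c'.expo ν α) H
    simp only [hi] at this
    exact_mod_cast this)
  have hχ : Function.Injective χ := by
    intro μ μ' H
    refine hjinj (hii (c'.eq_of_forall_apply_eq fun s => Units.ext ?_))
    exact DFunLike.congr_fun H s
  have hli := (linearIndependent_monoidHom (N →* ℂˣ) ℂ).comp χ hχ
  rw [linearIndependent_iff] at hli
  have : a = 0 := by
    refine hli a ?_
    ext s
    have h1 := congrFun hf0 (torusTo i s)
    simp only [Finsupp.sum, Function.comp_apply, Finset.sum_apply, Pi.smul_apply, smul_eq_mul,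
      Pi.zero_apply] at h1
    rw [Finsupp.linearCombination_apply, Finsupp.sum, Finset.sum_apply]
    exact h1
  rw [this]
  exact Finsupp.sum_zero_index

include hjinj c hi in
theorem comp_hom_surjective : Function.Surjective (fun v : M →* ℂ => v.comp j) := by
  have := finite_annihilator c' hd hP
  have := Fintype.ofFinite (annihilator P)
  let := annihilatorAction i P
  exact (hasReynolds_annihilator (i := i) c' hd hP hj).surjective c.isAffineModel homAlgebra_separates
    (fun f hf => comp_hom_mem_homAlgebra hf) (fun γ v => comp_annihilator_smul i hj γ v)
    fun f hf hf0 => eq_zero_of_comp_eq_zero i c c' hi hjinj hf hf0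

-- A form of Gordan's lemma. The elements whose exponents are all at most `d` generate: any larger
-- exponent can be reduced by `d`, because the `d`-th power of a generator lies in the submonoid.
include hjinj c in
omit c' in
theorem isAffineModel_homAlgebra_of_hom : IsAffineModel (homAlgebra M') := by
  have hfin : {a : M' | ∀ α, c.expo (j a) α ≤ d}.Finite := by
    refine Set.Finite.of_finite_image (f := fun a => c.expo (j a)) ?_ ((c.expo_injective.comp hjinj).injOn)
    refine (Set.finite_Iic (fun _ : ι => d)).subset ?_
    rintro _ ⟨a, ha, rfl⟩
    exact ha
  refine isAffineModel_homAlgebra (s := hfin.toFinset) ?_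
  rw [eq_top_iff]
  rintro a -
  induction hk : ∑ α, c.expo (j a) α using Nat.strong_induction_on generalizing a with
  | _ k ih =>
    by_cases ha : ∀ α, c.expo (j a) α ≤ d
    · exact Submonoid.subset_closure (by simpa using ha)
    push Not at ha
    obtain ⟨α, hα⟩ := ha
    have hpow : ∀ μ : M, ∀ k : ℕ, c.expo (μ ^ k) = k • c.expo μ := fun μ k => map_pow c.hom μ k
    obtain ⟨b, hb⟩ : ∃ b, j b = c.omega α ^ d := (hj _).1 (by rw [map_pow]; exact hP _)
    obtain ⟨ν, hν⟩ : ∃ ν : M, j a = ν * c.omega α ^ d := by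
      refine ⟨∏ β, c.omega β ^ (c.expo (j a) β - if β = α then d else 0), c.expo_injective ?_⟩
      have h1 : c.omega α ^ d = ∏ β, c.omega β ^ (if β = α then d else 0) := by
        rw [Finset.prod_eq_single α]
        · simp
        · intro β _ hβ; simp [hβ]
        · simp
      rw [h1, ← Finset.prod_mul_distrib]
      conv_lhs => rw [c.eq_prod (j a)]
      congr 1
      refine Finset.prod_congr rfl fun β _ => ?_
      rw [← pow_add]
      congr 1
      by_cases hβ : β = α
      · subst hβ; simp; omega
      · simp [hβ]
    -- The remaining factor stays in the submonoid: its exponents are non-negative and it is a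
    -- quotient of two elements of the subgroup `P`.
    obtain ⟨a', rfl⟩ : ν ∈ Set.range j := (hj _).1 (by
      have h1 : i (j a) = i ν * i (c.omega α) ^ d := by rw [hν, map_mul, map_pow]
      rw [eq_mul_inv_of_mul_eq h1.symm]
      exact P.mul_mem ((hj _).2 ⟨a, rfl⟩) (P.inv_mem (hP _)))
    have hab : a = a' * b := hjinj (by rw [hν, map_mul, hb])
    rw [hab]
    have hea : c.expo (j a) = c.expo (j a') + d • Pi.single α 1 := by
      rw [hν, c.expo_mul, hpow, c.expo_omega]
    refine Submonoid.mul_mem _ (ih _ ?_ rfl) (Submonoid.subset_closure ?_)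
    · rw [← hk, hea]
      simp only [Pi.add_apply, Finset.sum_add_distrib]
      have : ∑ β, (d • Pi.single α 1 : ι → ℕ) β = d := by simp [Pi.single_apply]
      omega
    · rw [Set.Finite.coe_toFinset]
      intro β
      rw [hb, hpow, c.expo_omega]
      by_cases hβ : β = α
      · subst hβ; simp
      · simp [hβ]

include hjinj c hi in
/-- The quotient of the affine variety of homomorphisms `M → ℂ` by the annihilator of a subgroup
of finite index is the variety of homomorphisms on the corresponding submonoid. -/
theorem exists_isIso_quotient_annihilator :
    letI : MulAction (N →* ℂˣ) (ofAlgebra (M →* ℂ) (homAlgebra M)).carrier := torusAction i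
    ∃ e, ((ofAlgebra (M →* ℂ) (homAlgebra M)).orbitSpace (annihilator P)).IsIso
        (ofAlgebra (M' →* ℂ) (homAlgebra M')) e ∧ ∀ (v : M →* ℂ) (μ : M'),
        (show M' →* ℂ from e (Quot.mk _ v)) μ = v (j μ) := by
  let := annihilatorAction i P
  have := finite_annihilator c' hd hP
  have := Fintype.ofFinite (annihilator P)
  suffices H : ∃ e : Quot (fun v w : M →* ℂ => ∃ γ : annihilator P, γ • v = w) ≃ (M' →* ℂ),
      ((ofAlgebra (M →* ℂ) (homAlgebra M)).quot (fun v w : M →* ℂ => ∃ γ : annihilator P, γ • v = w)).IsIso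
        (ofAlgebra (M' →* ℂ) (homAlgebra M')) e ∧ ∀ v, e (Quot.mk _ v) = v.comp j by
    obtain ⟨e, he, hev⟩ := H
    exact ⟨e, he, fun v μ => DFunLike.congr_fun (hev v) μ⟩
  exact exists_isIso_orbitSpace homAlgebra_separates (fun γ f hf => comp_annihilator_smul_mem i γ hf)
    (comp_hom_surjective i c c' hi hd hP hj hjinj) (fun γ v => comp_annihilator_smul i hj γ v)
    (fun f hf => comp_hom_mem_homAlgebra hf)
    fun f hf hinv => (hasReynolds_annihilator (i := i) c' hd hP hj).exists_eq_comp hf hinv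

include hjinj c hi in
theorem isSmoothQuotient_annihilator {E : Type} [AddCommGroup E] [Module ℂ E] [FiniteDimensional ℂ E]
    {Z : FunctionSpace}
    (hZ : Z.Isomorphic (ofAlgebra ((M' →* ℂ) × E) (prodAlgebra (homAlgebra M') (polyAlgebra E)))) :
    Z.IsSmoothQuotient (annihilator P) := by
  have := finite_annihilator c' hd hP
  have := Fintype.ofFinite (annihilator P)
  let := annihilatorAction i P
  exact isSmoothQuotient_prod (hasReynolds_annihilator (i := i) c' hd hP hj) c.isAffineModel
    (fun γ f hf => comp_annihilator_smul_mem i γ hf) (fun f hf => comp_hom_mem_homAlgebra hf)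
    (fun γ v => comp_annihilator_smul i hj γ v) (comp_hom_surjective i c c' hi hd hP hj hjinj)
    c.equiv c.isIso_equiv hZ

end Quotient

end Monoids

/-! ### Finite-dimensional representations of `sl₂` -/

section SlTwo

/-- The relations `[h, e] = 2e`, `[h, f] = -2f`, `[e, f] = h` in an associative algebra. -/
structure IsSl2 {A : Type*} [Ring A] [Algebra ℂ A] (h e f : A) : Prop where
  h_e : h * e = e * h + (2 : ℂ) • e
  h_f : h * f = f * h - (2 : ℂ) • f
  e_f : e * f = f * e + h

namespace IsSl2

variable {A : Type*} [Ring A] [Algebra ℂ A] {e h f : A}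

theorem symm (t : IsSl2 h e f) : IsSl2 (-h) f e where
  h_e := by rw [neg_mul, t.h_f, mul_neg]; abel
  h_f := by rw [neg_mul, t.h_e, mul_neg]; abel
  e_f := by rw [t.e_f]; abel

theorem e_mul_f_pow_succ (t : IsSl2 h e f) (k : ℕ) :
    e * f ^ (k + 1) = f ^ (k + 1) * e + ((k : ℂ) + 1) • (f ^ k * (h - (k : ℂ) • 1)) := by
  induction k with
  | zero => simp [t.e_f]
  | succ k ih =>
    have h1 : e * f ^ (k + 1 + 1) = (f ^ (k + 1) * e + ((k : ℂ) + 1) • (f ^ k * (h - (k : ℂ) • 1))) * f := by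
      rw [← ih]; noncomm_ring
    rw [h1]
    have h2 : f ^ k * (f * (e * f)) = f ^ k * f * (f * e + h) := by rw [← t.e_f]; noncomm_ring
    have h3 : f ^ k * (h * f) = f ^ k * (f * h - (2 : ℂ) • f) := by rw [← t.h_f]
    simp only [pow_succ, mul_add, add_mul, mul_sub, sub_mul, smul_mul_assoc, mul_smul_comm, smul_sub,
      mul_one, mul_assoc, h2, h3, Nat.cast_add, Nat.cast_one]
    module

theorem h_mul_e_pow (t : IsSl2 h e f) (k : ℕ) :
    h * e ^ k = e ^ k * h + (2 * k : ℂ) • e ^ k := by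
  induction k with
  | zero => simp
  | succ k ih =>
    have : h * e ^ (k + 1) = (h * e ^ k) * e := by noncomm_ring
    rw [this, ih, add_mul, mul_assoc, t.h_e]
    simp only [pow_succ, mul_add, mul_smul_comm, smul_mul_assoc, mul_assoc]
    push_cast
    module

theorem h_mul_f_pow (t : IsSl2 h e f) (k : ℕ) :
    h * f ^ k = f ^ k * h - (2 * k : ℂ) • f ^ k := by
  have := t.symm.h_mul_e_pow k
  rw [neg_mul, neg_eq_iff_eq_neg] at this
  rw [this]; simp only [mul_neg]; abel

-- Up to a left multiple of `e`, the element `f ^ k * e ^ k` is a polynomial in `h`. When `e ^ k =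
-- 0` this writes the polynomial as `e * Y` with `Y` of degree `-2`, which produces preimages under
-- `e` that respect the eigenvalues of `h`.
open Polynomial in
theorem exists_prod_eq (t : IsSl2 h e f) (k : ℕ) :
    ∃ Y : A, h * Y = Y * h - (2 : ℂ) • Y ∧ ∃ c : ℂ, c ≠ 0 ∧
      f ^ k * e ^ k = e * Y + c • aeval h (∏ i ∈ Finset.range k, (X + C (i : ℂ))) := by
  induction k with
  | zero => exact ⟨0, by simp, 1, by simp⟩
  | succ k ih =>
    obtain ⟨Y, hY, c, hc, hk⟩ := ih
    refine ⟨f ^ (k + 1) * e ^ k - ((k : ℂ) + 1) • (Y * (h + (k : ℂ) • 1)), ?_, -((k + 1) * c), ?_, ?_⟩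
    · have h1 : h * (f ^ (k + 1) * e ^ k) =
          f ^ (k + 1) * e ^ k * h - (2 : ℂ) • (f ^ (k + 1) * e ^ k) := by
        rw [← mul_assoc, t.h_mul_f_pow, sub_mul, mul_assoc, t.h_mul_e_pow]
        simp only [mul_add, mul_smul_comm, smul_mul_assoc, mul_assoc]
        push_cast
        module
      rw [mul_sub, h1, mul_smul_comm, ← mul_assoc, hY]
      simp only [mul_add, add_mul, sub_mul, smul_mul_assoc, mul_smul_comm, mul_one,
        smul_sub, smul_add]
      module
    · exact neg_ne_zero.2 (mul_ne_zero (by exact_mod_cast k.succ_ne_zero) hc)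
    · have h1 : f ^ (k + 1) * e ^ (k + 1) = (f ^ (k + 1) * e) * e ^ k := by
        rw [pow_succ' e]; noncomm_ring
      have h2 : f ^ (k + 1) * e = e * f ^ (k + 1) - ((k : ℂ) + 1) • (f ^ k * (h - (k : ℂ) • 1)) := by
        rw [t.e_mul_f_pow_succ]; abel
      have h3 : f ^ k * (h - (k : ℂ) • 1) * e ^ k = f ^ k * e ^ k * (h + (k : ℂ) • 1) := by
        rw [mul_assoc, sub_mul, t.h_mul_e_pow, smul_mul_assoc, one_mul, mul_assoc, mul_add,
          mul_smul_comm, mul_one]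
        congr 1; module
      rw [h1, h2, sub_mul, smul_mul_assoc, h3, hk, Finset.prod_range_succ, map_mul]
      have h4 : aeval h (X + C (k : ℂ)) = h + (k : ℂ) • (1 : A) := by
        simp [Algebra.smul_def]
      rw [h4]
      simp only [mul_add, add_mul, mul_sub, smul_mul_assoc, mul_smul_comm, mul_one, smul_add,
        mul_assoc]
      module

end IsSl2

section Representation

variable {V : Type*} [AddCommGroup V] [Module ℂ V] {h e f : Module.End ℂ V}

open Polynomial

theorem IsSl2.e_apply_h_sub (t : IsSl2 h e f) (l : ℂ) (v : V) :
    e ((h - l • 1) v) = (h - (l + 2) • 1) (e v) := by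
  have := LinearMap.congr_fun t.h_e v
  simp only [Module.End.mul_apply, LinearMap.add_apply, LinearMap.smul_apply] at this
  simp only [LinearMap.sub_apply, LinearMap.smul_apply, Module.End.one_apply, map_sub, map_smul, this]
  module

/-- Moving one `e` past the powers of `f` leaves a factor in `h`, since `e` kills `v`; the resulting
vector is again killed by `e`, so the computation repeats. For nilpotent `f` it yields a polynomial
with simple roots that annihilates `ker e`. -/
theorem IsSl2.e_pow_f_pow_apply (t : IsSl2 h e f) (k : ℕ) (v : V) (hv : e v = 0) :
    (e ^ k) ((f ^ k) v) = (k.factorial : ℂ) • aeval h (∏ i ∈ Finset.range k, (X - C (i : ℂ))) v := by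
  induction k generalizing v with
  | zero => simp
  | succ k ih =>
    have h1 := LinearMap.congr_fun (t.e_mul_f_pow_succ k) v
    simp only [Module.End.mul_apply, LinearMap.add_apply, hv, map_zero, zero_add,
      LinearMap.smul_apply] at h1
    have h2 : e ((h - (k : ℂ) • 1) v) = 0 := by
      rw [t.e_apply_h_sub, hv, map_zero]
    rw [pow_succ e, Module.End.mul_apply, h1, map_smul, ih _ h2, Finset.prod_range_succ, map_mul,
      Module.End.mul_apply, smul_smul, Nat.factorial_succ]
    have h4 : aeval h (X - C (k : ℂ)) = h - (k : ℂ) • 1 := by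
      simp [Algebra.smul_def]
    rw [h4]
    push_cast
    rfl

variable [FiniteDimensional ℂ V]

/-- The powers of `e` that do not vanish are eigenvectors of the commutator with `h` for the
distinct eigenvalues `2 * k`, and there are only finitely many eigenvalues. -/
theorem IsSl2.isNilpotent (t : IsSl2 h e f) : IsNilpotent e := by
  by_contra hn
  have hne : ∀ k : ℕ, e ^ k ≠ 0 := fun k hk => hn ⟨k, hk⟩
  let L : Module.End ℂ (Module.End ℂ V) := LinearMap.mulLeft ℂ h - LinearMap.mulRight ℂ h
  have hL : ∀ k : ℕ, L.HasEigenvalue (2 * k : ℂ) := fun k => by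
    refine Module.End.hasEigenvalue_of_hasEigenvector (x := e ^ k) ⟨?_, hne k⟩
    rw [Module.End.mem_eigenspace_iff]
    simp [L, t.h_mul_e_pow]
  have hfin := Module.End.finite_hasEigenvalue L
  refine Set.infinite_of_injective_forall_mem (f := fun k : ℕ => (2 * k : ℂ)) ?_ hL hfin
  intro a b hab
  simpa using hab

theorem IsSl2.exists_ker_e (t : IsSl2 h e f) : ∃ N : ℕ, ∀ v, e v = 0 →
    aeval h (∏ i ∈ Finset.range N, (X - C (i : ℂ))) v = 0 := by
  obtain ⟨N, hN⟩ := t.symm.isNilpotent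
  refine ⟨N, fun v hv => ?_⟩
  have := t.e_pow_f_pow_apply N v hv
  rw [hN, LinearMap.zero_apply, map_zero] at this
  exact (smul_eq_zero.1 this.symm).resolve_left (by exact_mod_cast N.factorial_ne_zero)

theorem IsSl2.exists_prod_eq_e_mul (t : IsSl2 h e f) : ∃ N : ℕ, ∃ Y : Module.End ℂ V,
    h * Y = Y * h - (2 : ℂ) • Y ∧ aeval h (∏ i ∈ Finset.range N, (X + C (i : ℂ))) = e * Y := by
  obtain ⟨N, hN⟩ := t.isNilpotent
  obtain ⟨Y, hY, c, hc, h1⟩ := t.exists_prod_eq N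
  refine ⟨N, -c⁻¹ • Y, ?_, ?_⟩
  · rw [mul_smul_comm, hY, smul_mul_assoc]; module
  · rw [hN, mul_zero] at h1
    rw [mul_smul_comm, eq_neg_of_add_eq_zero_left h1.symm, smul_neg, neg_smul, neg_neg, smul_smul,
      inv_mul_cancel₀ hc, one_smul]

omit [FiniteDimensional ℂ V] in
theorem aeval_apply_of_apply_eq_smul {l : ℂ} {v : V} (hv : h v = l • v) (p : ℂ[X]) :
    aeval h p v = p.eval l • v :=
  Module.End.aeval_apply_of_mem_apply_eq_smul hv

theorem IsSl2.exists_nat_of_e_apply_eq_zero (t : IsSl2 h e f) {l : ℂ} {v : V} (hv : h v = l • v)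
    (he : e v = 0) (h0 : v ≠ 0) : ∃ k : ℕ, l = k := by
  obtain ⟨N, hN⟩ := t.exists_ker_e
  have h1 := hN v he
  rw [aeval_apply_of_apply_eq_smul hv, smul_eq_zero] at h1
  have h2 := h1.resolve_right h0
  rw [eval_prod, Finset.prod_eq_zero_iff] at h2
  obtain ⟨i, _, hi⟩ := h2
  exact ⟨i, by simpa [sub_eq_zero] using hi⟩

/-- On `ker e` the operator `h` satisfies a polynomial with simple roots, so a generalized
eigenvector there is an eigenvector. -/
theorem IsSl2.apply_eq_smul_of_e_apply_eq_zero (t : IsSl2 h e f) {l : ℂ} {v : V} {m : ℕ}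
    (hv : ((h - l • 1) ^ m) v = 0) (he : e v = 0) : h v = l • v := by
  obtain ⟨N, hN⟩ := t.exists_ker_e
  set s := (Finset.range N).filter (fun i : ℕ => (i : ℂ) ≠ l)
  set R : ℂ[X] := ∏ i ∈ s, (X - C (i : ℂ))
  have hdvd : (∏ i ∈ Finset.range N, (X - C (i : ℂ))) ∣ R * (X - C l) := by
    rw [← Finset.prod_filter_mul_prod_filter_not (Finset.range N) (fun i : ℕ => (i : ℂ) ≠ l)]
    refine mul_dvd_mul_left _ ?_
    by_cases hl : ∃ i ∈ Finset.range N, (i : ℂ) = l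
    · obtain ⟨i, hi, rfl⟩ := hl
      have : (Finset.range N).filter (fun j : ℕ => ¬ (j : ℂ) ≠ (i : ℂ)) = {i} := by
        ext j
        simp only [Finset.mem_filter, not_not, Nat.cast_inj, Finset.mem_singleton]
        exact ⟨fun h => h.2, fun h => ⟨h ▸ hi, h⟩⟩
      rw [this]; simp
    · have : (Finset.range N).filter (fun j : ℕ => ¬ (j : ℂ) ≠ l) = ∅ := by
        ext j; simp only [Finset.mem_filter, not_not, Finset.notMem_empty, iff_false]
        exact fun hj => hl ⟨j, hj.1, hj.2⟩
      rw [this]; simp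
  have h1 : aeval h (R * (X - C l)) v = 0 := by
    obtain ⟨q, hq⟩ := hdvd
    rw [hq, mul_comm, map_mul, Module.End.mul_apply, hN v he, map_zero]
  -- `R` collects the roots other than `l`, so it is prime to every power of the factor of `l`; a
  -- Bézout combination removes all but one such factor.
  have hcop : IsCoprime R ((X - C l) ^ m) := by
    refine IsCoprime.pow_right (IsCoprime.prod_left fun i hi => ?_)
    exact isCoprime_X_sub_C_of_isUnit_sub
      (sub_ne_zero.2 (Finset.mem_filter.1 hi).2).isUnit
  have hX : aeval h (X - C l) = h - l • 1 := by simp [Algebra.smul_def]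
  obtain ⟨a, b, hab⟩ := hcop
  have h2 : aeval h (X - C l) v = 0 := by
    have : (X - C l) = a * (R * (X - C l)) + b * (X - C l) * (X - C l) ^ m := by
      linear_combination (- (X - C l)) * hab
    rw [this, map_add, LinearMap.add_apply, map_mul, Module.End.mul_apply, h1, map_zero, zero_add,
      map_mul _ (b * _), Module.End.mul_apply, map_pow, hX, hv, map_zero]
  rw [hX] at h2
  simpa [sub_eq_zero] using h2

/-- On an eigenvector of eigenvalue `l + 2` the identity `∏ (h + i) = e * Y` is multiplication by
the scalar `∏ (l + 2 + i)`, nonzero by hypothesis. -/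
theorem IsSl2.exists_e_apply_eq (t : IsSl2 h e f) {l : ℂ} (hl : ∀ k : ℕ, l + 2 ≠ -k) {x : V}
    (hx : h x = (l + 2) • x) : ∃ y, h y = l • y ∧ e y = x := by
  obtain ⟨N, Y, hY, hN⟩ := t.exists_prod_eq_e_mul
  set c : ℂ := (∏ i ∈ Finset.range N, (X + C (i : ℂ))).eval (l + 2) with hc
  have hc0 : c ≠ 0 := by
    rw [hc, eval_prod, Finset.prod_ne_zero_iff]
    intro i _ h0
    simp at h0
    exact hl i (eq_neg_of_add_eq_zero_left h0)
  refine ⟨c⁻¹ • Y x, ?_, ?_⟩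
  · have := LinearMap.congr_fun hY x
    simp only [Module.End.mul_apply, LinearMap.sub_apply, LinearMap.smul_apply, hx, map_smul] at this
    rw [map_smul, this]
    module
  · rw [map_smul, ← Module.End.mul_apply, ← hN, aeval_apply_of_apply_eq_smul hx, smul_smul, ← hc,
      inv_mul_cancel₀ hc0, one_smul]

/-- The neutral element is semisimple. Otherwise applying `e` to a generalized eigenvector that is
not an eigenvector would give another one with eigenvalue larger by `2`, indefinitely, against the
nilpotency of `e`. -/
theorem IsSl2.apply_eq_smul (t : IsSl2 h e f) {l : ℂ} {v : V} {m : ℕ}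
    (hv : ((h - l • 1) ^ m) v = 0) : h v = l • v := by
  -- If `e` kills `(h - l) v`, a nonzero such vector has natural weight `k`. Then `e v` is an
  -- eigenvector of weight `k + 2` and lifts to an eigenvector `y` of weight `k`; the difference `v
  -- - y` lies in `ker e`, where `h` is already known to be semisimple.
  have key : ∀ (l : ℂ) (v : V), ((h - l • 1) ^ m) v = 0 → e ((h - l • 1) v) = 0 →
      (h - l • 1) v = 0 := by
    intro l v hv he
    by_contra h0
    have hm : ((h - l • 1) ^ m) ((h - l • 1) v) = 0 := by
      rw [← Module.End.mul_apply, ← pow_succ, pow_succ', Module.End.mul_apply, hv, map_zero]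
    have h1 := t.apply_eq_smul_of_e_apply_eq_zero hm he
    obtain ⟨k, rfl⟩ := t.exists_nat_of_e_apply_eq_zero h1 he h0
    have hx : h (e v) = ((k : ℂ) + 2) • e v := by
      rw [t.e_apply_h_sub] at he
      simpa [sub_eq_zero] using he
    obtain ⟨y, hy, hey⟩ := t.exists_e_apply_eq (l := k) (fun j hj => by
      have : ((k + 2 + j : ℕ) : ℂ) = 0 := by push_cast; rw [hj]; ring
      norm_cast at this; omega) hx
    have hs : ∀ j : ℕ, ((h - (k : ℂ) • 1) ^ (j + 1)) y = 0 := fun j => by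
      rw [pow_succ, Module.End.mul_apply]; simp [hy]
    have h3 := t.apply_eq_smul_of_e_apply_eq_zero (l := k) (v := v - y) (m := m + 1) (by
      rw [map_sub, hs, pow_succ', Module.End.mul_apply, hv, map_zero, sub_zero])
      (by rw [map_sub, hey, sub_self])
    apply h0
    rw [map_sub, hy, smul_sub, sub_left_inj] at h3
    simp [h3]
  by_contra hne
  have h0 : (h - l • 1) v ≠ 0 := by simpa [sub_eq_zero] using hne
  have hk : ∀ k : ℕ, ((h - (l + 2 * k) • 1) ^ m) ((e ^ k) v) = 0 ∧
      (h - (l + 2 * k) • 1) ((e ^ k) v) ≠ 0 := by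
    intro k
    induction k with
    | zero => simpa using ⟨hv, hne ∘ fun h => by simpa [sub_eq_zero] using h⟩
    | succ k ih =>
      have hl : l + 2 * ((k + 1 : ℕ) : ℂ) = l + 2 * k + 2 := by push_cast; ring
      rw [hl, pow_succ' e, Module.End.mul_apply]
      refine ⟨?_, ?_⟩
      · have : ∀ (j : ℕ) (w : V), e (((h - (l + 2 * k) • 1) ^ j) w) =
            ((h - (l + 2 * k + 2) • 1) ^ j) (e w) := by
          intro j
          induction j with
          | zero => simp
          | succ j ihj =>
            intro w
            rw [pow_succ, Module.End.mul_apply, ihj, t.e_apply_h_sub, pow_succ, Module.End.mul_apply]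
        rw [← this, ih.1, map_zero]
      · rw [← t.e_apply_h_sub]
        exact fun h0 => ih.2 (key _ _ ih.1 h0)
  obtain ⟨N, hN⟩ := t.isNilpotent
  apply (hk N).2
  rw [hN]; simp

/-- The last nonzero vector `e ^ k v` is a highest weight vector, so `l + 2 k` is a natural number.
-/
theorem IsSl2.exists_int_of_apply_eq_smul (t : IsSl2 h e f) {l : ℂ} {v : V} (hv : h v = l • v)
    (h0 : v ≠ 0) : ∃ k : ℤ, l = k := by
  obtain ⟨N, hN⟩ := t.isNilpotent
  have hex : ∃ k : ℕ, (e ^ k) v = 0 := ⟨N, by rw [hN]; rfl⟩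
  classical
  obtain ⟨k, hk1, hk2⟩ : ∃ k : ℕ, (e ^ k) v ≠ 0 ∧ (e ^ (k + 1)) v = 0 := by
    refine ⟨Nat.find hex - 1, Nat.find_min hex ?_, ?_⟩
    · have : Nat.find hex ≠ 0 := fun h => h0 (by simpa [h] using Nat.find_spec hex)
      omega
    · have : Nat.find hex ≠ 0 := fun h => h0 (by simpa [h] using Nat.find_spec hex)
      rw [Nat.sub_add_cancel (by omega)]; exact Nat.find_spec hex
  have h1 : h ((e ^ k) v) = (l + 2 * k) • (e ^ k) v := by
    have := LinearMap.congr_fun (t.h_mul_e_pow k) v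
    simp only [Module.End.mul_apply, LinearMap.add_apply, LinearMap.smul_apply, hv, map_smul] at this
    rw [this]; module
  obtain ⟨j, hj⟩ := t.exists_nat_of_e_apply_eq_zero h1
    (by rw [← Module.End.mul_apply, ← pow_succ']; exact hk2) hk1
  exact ⟨j - 2 * k, by push_cast; linear_combination hj⟩

theorem IsSl2.iSup_eigenspace (t : IsSl2 h e f) : ⨆ k : ℤ, h.eigenspace (k : ℂ) = ⊤ := by
  rw [eq_top_iff, ← Module.End.iSup_maxGenEigenspace_eq_top h]
  refine iSup_le fun l v hv => ?_
  rw [Module.End.mem_maxGenEigenspace] at hv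
  obtain ⟨m, hm⟩ := hv
  have h1 := t.apply_eq_smul hm
  by_cases h0 : v = 0
  · rw [h0]; exact zero_mem _
  obtain ⟨k, rfl⟩ := t.exists_int_of_apply_eq_smul h1 h0
  exact Submodule.mem_iSup_of_mem k (Module.End.mem_eigenspace_iff.2 h1)

omit [FiniteDimensional ℂ V] in
theorem IsSl2.e_apply_mem (t : IsSl2 h e f) {l : ℂ} {v : V} (hv : v ∈ h.eigenspace l) :
    e v ∈ h.eigenspace (l + 2) := by
  rw [Module.End.mem_eigenspace_iff] at hv ⊢
  have := t.e_apply_h_sub l v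
  rw [LinearMap.sub_apply, LinearMap.smul_apply, Module.End.one_apply, hv, sub_self, map_zero] at this
  simpa [sub_eq_zero] using this.symm

theorem IsSl2.ker_e_le (t : IsSl2 h e f) :
    LinearMap.ker e ≤ ⨆ (k : ℤ) (_ : 0 ≤ k), h.eigenspace (k : ℂ) := by
  have hst : ∀ x ∈ LinearMap.ker e, h x ∈ LinearMap.ker e := fun x hx => by
    rw [LinearMap.mem_ker] at hx ⊢
    have := t.e_apply_h_sub 0 x
    simpa [hx] using this
  have htop : ⨆ l : ℂ, h.genEigenspace l 1 = ⊤ := by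
    rw [eq_top_iff, ← t.iSup_eigenspace]
    exact iSup_le fun k => le_iSup (fun l : ℂ => h.genEigenspace l 1) (k : ℂ)
  have h1 := Submodule.inf_iSup_genEigenspace hst 1
  rw [htop, inf_top_eq] at h1
  rw [h1]
  refine iSup_le fun l v hv => ?_
  by_cases h0 : v = 0
  · rw [h0]; exact zero_mem _
  have hl := Module.End.mem_eigenspace_iff.1 hv.2
  obtain ⟨k, rfl⟩ := t.exists_nat_of_e_apply_eq_zero hl hv.1 h0
  exact Submodule.mem_iSup_of_mem (k : ℤ) (Submodule.mem_iSup_of_mem (Int.natCast_nonneg k)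
    (by simpa using hv.2))

/-- The operator `e` maps the sum `A` of the eigenspaces of eigenvalue at least `-1` onto the sum
`B` of those of eigenvalue at least `1`, and its kernel lies in `A`. The dimensions of `A` and `B`
differ by those of the eigenspaces for `0` and `-1`. -/
theorem IsSl2.finrank_ker_e (t : IsSl2 h e f) :
    Module.finrank ℂ (LinearMap.ker e) =
      Module.finrank ℂ (h.eigenspace 0) + Module.finrank ℂ (h.eigenspace (-1)) := by
  set D : ℤ → Submodule ℂ V := fun k => h.eigenspace (k : ℂ) with hD
  have hind : iSupIndep D := h.eigenspaces_iSupIndep.comp Int.cast_injective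
  set B := ⨆ (k : ℤ) (_ : k ∈ Set.Ici (1 : ℤ)), D k with hB
  set A := B ⊔ (D 0 ⊔ D (-1)) with hA
  have hle : ∀ k : ℤ, -1 ≤ k → D k ≤ A := fun k hk => by
    rcases eq_or_lt_of_le hk with rfl | hk
    · exact le_sup_right.trans' le_sup_right
    rcases eq_or_lt_of_le (show 0 ≤ k by omega) with rfl | hk
    · exact le_sup_right.trans' le_sup_left
    · exact le_sup_left.trans' (le_iSup₂_of_le k hk le_rfl)
  have hmem : ∀ k : ℤ, ∀ v ∈ D k, e v ∈ D (k + 2) := fun k v hv => by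
    have := t.e_apply_mem hv
    simpa [hD] using this
  have hmap : A.map e = B := by
    apply le_antisymm
    · have h2 : ∀ k : ℤ, -1 ≤ k → (D k).map e ≤ B := fun k hk => by
        rintro _ ⟨v, hv, rfl⟩
        exact Submodule.mem_iSup_of_mem (k + 2) (Submodule.mem_iSup_of_mem
          (show (1 : ℤ) ≤ k + 2 by omega) (hmem k v hv))
      rw [hA, Submodule.map_sup, Submodule.map_sup, hB]
      simp only [Submodule.map_iSup]
      exact sup_le (iSup₂_le fun k hk => h2 k (by have : (1 : ℤ) ≤ k := hk; omega))
        (sup_le (h2 _ (by omega)) (h2 _ (by omega)))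
    · refine iSup₂_le fun k hk x hx => ?_
      have hk : (1 : ℤ) ≤ k := hk
      obtain ⟨y, hy, rfl⟩ := t.exists_e_apply_eq (l := (k : ℂ) - 2) (x := x) (fun j hj => by
        have : k = -(j : ℤ) := by
          have : (k : ℂ) = ((-(j : ℤ) : ℤ) : ℂ) := by push_cast; linear_combination hj
          exact_mod_cast this
        omega) (by simpa [hD] using hx)
      refine ⟨y, hle (k - 2) (by omega) ?_, rfl⟩
      simp only [hD, Module.End.mem_eigenspace_iff]
      push_cast
      exact hy
  have hker : LinearMap.ker e ≤ A := t.ker_e_le.trans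
    (iSup₂_le fun k hk => hle k (by omega))
  have hd2 : Disjoint (D 0) (D (-1)) := hind.pairwiseDisjoint (by decide)
  have hd1 : Disjoint B (D 0 ⊔ D (-1)) := by
    have := hind.disjoint_biSup_biSup (s := Set.Ici 1) (t := {0, -1}) (by
      rw [Set.disjoint_left]; rintro k (hk : 1 ≤ k) (rfl | rfl) <;> omega)
    rwa [iSup_pair] at this
  have f1 := Submodule.finrank_sup_add_finrank_inf_eq (D 0) (D (-1))
  have f2 := Submodule.finrank_sup_add_finrank_inf_eq B (D 0 ⊔ D (-1))
  rw [disjoint_iff.1 hd2, finrank_bot] at f1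
  rw [disjoint_iff.1 hd1, finrank_bot] at f2
  have f3 := LinearMap.finrank_range_add_finrank_ker (e.domRestrict A)
  have f4 : LinearMap.range (e.domRestrict A) = B := by
    rw [← hmap]; exact LinearMap.range_domRestrict A e
  have f5 : Module.finrank ℂ (LinearMap.ker (e.domRestrict A)) =
      Module.finrank ℂ (LinearMap.ker e) := by
    rw [LinearMap.ker_domRestrict]
    exact (Submodule.comapSubtypeEquivOfLe hker).finrank_eq
  rw [f4, f5] at f3
  have e0 : D 0 = h.eigenspace 0 := by simp [hD]
  have e1 : D (-1) = h.eigenspace (-1) := by simp [hD]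
  rw [← e0, ← e1]
  change Module.finrank ℂ A + 0 = _ at f2
  omega

end Representation

end SlTwo

/-! ### Tangent vectors, the adjoint action and exponentials in a linear algebraic group -/

section MatrixGroups

attribute [local instance 100] LieRing.ofAssociativeRing

variable {n : ℕ}

local notation "Mat" => Matrix (Fin n) (Fin n) ℂ

theorem hasDerivAt_evalMat {γ : ℂ → Mat} {γ' : Mat} {t₀ : ℂ}
    (hγ : ∀ i j, HasDerivAt (fun t => γ t i j) (γ' i j) t₀)
    (p : MvPolynomial (Fin n × Fin n) ℂ) :
    HasDerivAt (fun t => evalMat (γ t) p)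
      (∑ ij, γ' ij.1 ij.2 * evalMat (γ t₀) (MvPolynomial.pderiv ij p)) t₀ := by
  induction p using MvPolynomial.induction_on with
  | C a => simpa [evalMat] using hasDerivAt_const t₀ a
  | add p q hp hq =>
    simp only [map_add, mul_add, Finset.sum_add_distrib]
    exact hp.add hq
  | mul_X p ij hp =>
    obtain ⟨i, j⟩ := ij
    simp only [map_mul, evalMat_X]
    refine (hp.mul (hγ i j)).congr_deriv ?_
    simp only [Derivation.leibniz, smul_eq_mul, map_add, map_mul, mul_add, Finset.sum_add_distrib,
      evalMat_X]
    rw [add_comm, Finset.sum_mul]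
    congr 1
    · rw [Finset.sum_eq_single (i, j)]
      · rw [MvPolynomial.pderiv_X_self]; simp [mul_comm]
      · intro kl _ hkl
        rw [MvPolynomial.pderiv_X_of_ne hkl.symm]; simp
      · simp
    · exact Finset.sum_congr rfl fun kl _ => by ring

theorem hasDerivAt_evalMat_one {γ : ℂ → Mat} {γ' : Mat} {t₀ : ℂ} (h1 : γ t₀ = 1)
    (hγ : ∀ i j, HasDerivAt (fun t => γ t i j) (γ' i j) t₀)
    (p : MvPolynomial (Fin n × Fin n) ℂ) :
    HasDerivAt (fun t => evalMat (γ t) p) (derivAtOne γ' p) t₀ := by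
  simpa only [h1, derivAtOne] using hasDerivAt_evalMat hγ p

/-- The composition of a polynomial function on matrices with a linear map. -/
def compLinear (φ : Mat →ₗ[ℂ] Mat) :
    MvPolynomial (Fin n × Fin n) ℂ →ₐ[ℂ] MvPolynomial (Fin n × Fin n) ℂ :=
  MvPolynomial.aeval fun ij => ∑ kl : Fin n × Fin n,
    MvPolynomial.C (φ (Matrix.single kl.1 kl.2 1) ij.1 ij.2) * MvPolynomial.X kl

theorem evalMat_compLinear (φ : Mat →ₗ[ℂ] Mat) (M : Mat) (p : MvPolynomial (Fin n × Fin n) ℂ) :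
    evalMat M (compLinear φ p) = evalMat (φ M) p := by
  induction p using MvPolynomial.induction_on with
  | C a => simp [compLinear, evalMat]
  | add p q hp hq => simp only [map_add, hp, hq]
  | mul_X p ij hp =>
    simp only [map_mul, hp]
    congr 1
    obtain ⟨i, j⟩ := ij
    rw [evalMat_X]
    simp only [compLinear, MvPolynomial.aeval_X, map_sum, map_mul, evalMat_C]
    conv_rhs => rw [Matrix.matrix_eq_sum_single M]
    rw [Fintype.sum_prod_type]
    simp only [map_sum, evalMat_X]
    rw [Matrix.sum_apply]
    refine Finset.sum_congr rfl fun k _ => ?_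
    rw [Matrix.sum_apply]
    refine Finset.sum_congr rfl fun l _ => ?_
    have : Matrix.single k l (M k l) = M k l • Matrix.single k l (1 : ℂ) := by
      rw [Matrix.smul_single, smul_eq_mul, mul_one]
    rw [this, map_smul, Matrix.smul_apply, smul_eq_mul, mul_comm]

theorem hasDerivAt_one_add_smul (M : Mat) (i j : Fin n) :
    HasDerivAt (fun t : ℂ => (1 + t • M) i j) (M i j) 0 := by
  simp only [Matrix.add_apply, Matrix.smul_apply, smul_eq_mul]
  simpa using ((hasDerivAt_id (0 : ℂ)).mul_const (M i j)).const_add ((1 : Mat) i j)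

theorem derivAtOne_compLinear (φ : Mat →ₗ[ℂ] Mat) (h1 : φ 1 = 1) (M : Mat)
    (p : MvPolynomial (Fin n × Fin n) ℂ) :
    derivAtOne M (compLinear φ p) = derivAtOne (φ M) p := by
  have a := hasDerivAt_evalMat_one (γ := fun t => 1 + t • M) (by simp)
    (hasDerivAt_one_add_smul M) (compLinear φ p)
  have b := hasDerivAt_evalMat_one (γ := fun t => 1 + t • φ M) (by simp)
    (hasDerivAt_one_add_smul (φ M)) p
  simp only [evalMat_compLinear, map_add, map_smul, h1] at a
  exact a.unique b

variable {G : Subgroup (GL (Fin n) ℂ)}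

theorem mat_mul (a b : G) : mat (a * b) = mat a * mat b := rfl

theorem mat_mul_mat_inv (a : G) : mat a * mat a⁻¹ = 1 := by rw [← mat_mul, mul_inv_cancel]; rfl

theorem mat_inv_mul_mat (a : G) : mat a⁻¹ * mat a = 1 := by rw [← mat_mul, inv_mul_cancel]; rfl

theorem mat_injective : Function.Injective (mat : G → Mat) := fun _ _ h =>
  Subtype.ext (Units.ext h)

/-- Conjugation by an element of `G`. -/
def conjLinear (g : G) : Mat →ₗ[ℂ] Mat :=
  (LinearMap.mulLeft ℂ (mat g)).comp (LinearMap.mulRight ℂ (mat g⁻¹))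

theorem conjLinear_apply (g : G) (M : Mat) : conjLinear g M = mat g * M * mat g⁻¹ := by
  simp [conjLinear, mul_assoc]

/-- Conjugation is linear in the matrix, preserves `G` and fixes the identity, so it preserves the
tangent space there. -/
theorem conj_mem_lieAlg (g : G) {M : Mat} (hM : M ∈ lieAlg G) :
    mat g * M * mat g⁻¹ ∈ lieAlg G := by
  intro p hp
  rw [← conjLinear_apply, ← derivAtOne_compLinear _ (by rw [conjLinear_apply, mul_one, mat_mul_mat_inv])]
  refine hM _ fun k hk => ?_
  rw [evalMat_compLinear, conjLinear_apply]
  have h1 := hp _ (G.mul_mem (G.mul_mem g.2 hk) (g⁻¹).2)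
  rwa [Units.val_mul, Units.val_mul] at h1

/-- The adjoint action. -/
def adG (g : G) : lieAlg G →ₗ[ℂ] lieAlg G where
  toFun x := ⟨mat g * x * mat g⁻¹, conj_mem_lieAlg g x.2⟩
  map_add' x y := Subtype.ext (by simp [mul_add, add_mul])
  map_smul' c x := Subtype.ext (by simp)

theorem coe_adG (g : G) (x : lieAlg G) : (adG g x : Mat) = mat g * x * mat g⁻¹ := rfl

theorem isAd_iff {g : G} {x x' : lieAlg G} : IsAd g x x' ↔ x' = adG g x :=
  ⟨fun h => Subtype.ext h, fun h => congrArg Subtype.val h⟩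

theorem adG_mul (a b : G) (x : lieAlg G) : adG (a * b) x = adG a (adG b x) :=
  Subtype.ext (by simp only [coe_adG, mat_mul, mul_inv_rev, mul_assoc])

theorem adG_one (x : lieAlg G) : adG (1 : G) x = x :=
  Subtype.ext (by simp [coe_adG, mat])

theorem coe_lie (x y : lieAlg G) : ((⁅x, y⁆ : lieAlg G) : Mat) = x * y - y * x := by
  rw [LieSubalgebra.coe_bracket, Ring.lie_def]

theorem adG_lie (g : G) (x y : lieAlg G) : adG g ⁅x, y⁆ = ⁅adG g x, adG g y⁆ := by
  refine Subtype.ext ?_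
  have h1 := mat_inv_mul_mat g
  simp only [coe_adG, coe_lie, mul_sub, sub_mul]
  congr 1
  · calc mat g * ((x : Mat) * y) * mat g⁻¹ = mat g * x * 1 * y * mat g⁻¹ := by noncomm_ring
      _ = _ := by rw [← h1]; noncomm_ring
  · calc mat g * ((y : Mat) * x) * mat g⁻¹ = mat g * y * 1 * x * mat g⁻¹ := by noncomm_ring
      _ = _ := by rw [← h1]; noncomm_ring

/-! ### Exponentials -/

theorem exp_mul_exp_neg (M : Mat) : NormedSpace.exp M * NormedSpace.exp (-M) = 1 := by
  rw [← Matrix.exp_add_of_commute _ _ (Commute.neg_right (Commute.refl M)), add_neg_cancel,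
    NormedSpace.exp_zero]

theorem hasDerivAt_exp (M : Mat) (t : ℂ) (i j : Fin n) :
    HasDerivAt (fun s : ℂ => NormedSpace.exp (s • M) i j) ((NormedSpace.exp (t • M) * M) i j) t := by
  let : NormedRing Mat := Matrix.linftyOpNormedRing
  let : NormedAlgebra ℂ Mat := Matrix.linftyOpNormedAlgebra
  have h1 : HasDerivAt (fun s : ℂ => NormedSpace.exp (s • M)) (NormedSpace.exp (t • M) * M) t :=
    hasDerivAt_exp_smul_const M t
  let l : Mat →L[ℂ] ℂ := LinearMap.toContinuousLinearMap (Matrix.entryLinearMap ℂ ℂ i j)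
  exact l.hasFDerivAt.comp_hasDerivAt t h1

theorem evalMat_leftField (M g : Mat) (p : MvPolynomial (Fin n × Fin n) ℂ) :
    evalMat g (leftField M p) = ∑ ij, (g * M) ij.1 ij.2 * evalMat g (MvPolynomial.pderiv ij p) := by
  have h1 := evalMat_one_leftField M (leftTranslate g p)
  rw [leftField_leftTranslate, evalMat_leftTranslate, mul_one] at h1
  rw [h1]
  have a := hasDerivAt_evalMat_one (γ := fun t => 1 + t • M) (by simp)
    (hasDerivAt_one_add_smul M) (leftTranslate g p)
  have b := hasDerivAt_evalMat (γ := fun t : ℂ => g * (1 + t • M)) (γ' := g * M) (t₀ := 0)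
    (fun i j => by
      simp only [mul_add, mul_one, mul_smul_comm, Matrix.add_apply, Matrix.smul_apply, smul_eq_mul]
      simpa using ((hasDerivAt_id (0 : ℂ)).mul_const ((g * M) i j)).const_add (g i j)) p
  simp only [evalMat_leftTranslate] at a
  rw [a.unique b]
  simp

/-- Along `s ↦ exp (s M)` a polynomial becomes an entire function whose derivatives at `0` are
obtained by iterating `leftField M`. The vanishing ideal is stable under this derivation, so all
Taylor coefficients are zero. -/
theorem evalMat_exp_eq_zero {M : Mat} (hM : M ∈ lieAlg G) {p : MvPolynomial (Fin n × Fin n) ℂ}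
    (hp : p ∈ vanishing G) : evalMat (NormedSpace.exp M) p = 0 := by
  have hd : ∀ (q : MvPolynomial (Fin n × Fin n) ℂ) (t : ℂ),
      HasDerivAt (fun s : ℂ => evalMat (NormedSpace.exp (s • M)) q)
        (evalMat (NormedSpace.exp (t • M)) (leftField M q)) t := fun q t => by
    rw [evalMat_leftField]
    exact hasDerivAt_evalMat (hasDerivAt_exp M t) q
  have hit : ∀ (k : ℕ) (q : MvPolynomial (Fin n × Fin n) ℂ),
      iteratedDeriv k (fun s : ℂ => evalMat (NormedSpace.exp (s • M)) q) =
        fun s => evalMat (NormedSpace.exp (s • M)) ((leftField M)^[k] q) := by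
    intro k
    induction k with
    | zero => intro q; simp
    | succ k ih =>
      intro q
      rw [iteratedDeriv_succ', funext fun t => (hd q t).deriv, ih, Function.iterate_succ_apply]
  have hv : ∀ k : ℕ, (leftField M)^[k] p ∈ vanishing G := by
    intro k
    induction k with
    | zero => exact hp
    | succ k ih =>
      rw [Function.iterate_succ_apply']
      exact leftField_mem_vanishing G hM ih
  have h1 := Complex.hasSum_taylorSeries_of_entire
    (f := fun s : ℂ => evalMat (NormedSpace.exp (s • M)) p)
    (fun t => (hd p t).differentiableAt) 0 1
  have h2 : ∀ k : ℕ, iteratedDeriv k (fun s : ℂ => evalMat (NormedSpace.exp (s • M)) p) 0 = 0 := by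
    intro k
    rw [hit]
    simp only [zero_smul, NormedSpace.exp_zero]
    exact hv k 1 G.one_mem
  simp only [h2, smul_zero] at h1
  simpa using h1.unique hasSum_zero

/-- The exponential of a matrix as an invertible matrix. -/
def expGL (M : Mat) : GL (Fin n) ℂ where
  val := NormedSpace.exp M
  inv := NormedSpace.exp (-M)
  val_inv := exp_mul_exp_neg M
  inv_val := by simpa using exp_mul_exp_neg (-M)

theorem expGL_mem (hG : IsLinearAlgebraic G) {M : Mat} (hM : M ∈ lieAlg G) : expGL M ∈ G := by
  obtain ⟨I, hI⟩ := hG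
  exact (hI _).2 fun p hp => evalMat_exp_eq_zero hM fun g hg => (hI g).1 hg p hp

theorem mem_lieAlg_of_path {γ : ℂ → Mat} {M : Mat} (h1 : γ 0 = 1)
    (hγ : ∀ i j, HasDerivAt (fun t => γ t i j) (M i j) 0)
    (h : ∀ p ∈ vanishing G, ∀ t, evalMat (γ t) p = 0) : M ∈ lieAlg G := by
  intro p hp
  have a := hasDerivAt_evalMat_one h1 hγ p
  simp only [h p hp] at a
  exact a.unique (hasDerivAt_const _ _)

theorem mem_of_forall_vanishing (hG : IsLinearAlgebraic G) {g : GL (Fin n) ℂ}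
    (h : ∀ p ∈ vanishing G, evalMat (g : Mat) p = 0) : g ∈ G := by
  obtain ⟨I, hI⟩ := hG
  exact (hI _).2 fun p hp => h p fun g hg => (hI g).1 hg p hp

end MatrixGroups

/-- If the independent family `D` contains the members of a spanning family `W`, then each `D c`
is spanned by the members of `W` that it contains. -/
theorem le_iSup_of_iSup_eq_top {ι κ R M : Type*} [Ring R] [AddCommGroup M] [Module R M]
    {W : ι → Submodule R M} {D : κ → Submodule R M} {φ : ι → κ} (hD : iSupIndep D)
    (hW : ∀ i, W i ≤ D (φ i)) (htop : ⨆ i, W i = ⊤) (c : κ) :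
    D c ≤ ⨆ (i) (_ : φ i = c), W i := by
  intro x hx
  have h1 : x ∈ (⨆ (i) (_ : φ i = c), W i) ⊔ ⨆ (d) (_ : d ≠ c), D d := by
    have : (⊤ : Submodule R M) ≤ (⨆ (i) (_ : φ i = c), W i) ⊔ ⨆ (d) (_ : d ≠ c), D d := by
      rw [← htop]
      refine iSup_le fun i => ?_
      by_cases hi : φ i = c
      · exact le_sup_of_le_left (le_iSup₂_of_le i hi le_rfl)
      · exact le_sup_of_le_right (le_iSup₂_of_le (φ i) hi (hW i))
    exact this trivial
  obtain ⟨a, ha, b, hb, rfl⟩ := Submodule.mem_sup.1 h1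
  have ha' : a ∈ D c := by
    refine (iSup₂_le fun i hi => ?_ : (⨆ (i) (_ : φ i = c), W i) ≤ D c) ha
    exact hi ▸ hW i
  have hb' : b ∈ D c := by simpa using (D c).sub_mem hx ha'
  have : b = 0 := (Submodule.disjoint_def.1 (hD c)) b hb' hb
  rwa [this, add_zero]

/-! ### Regular `sl₂`-triples, Cartan subalgebras and heights of roots -/

section LieAlgebra

attribute [local instance 100] LieRing.ofAssociativeRing

open LieAlgebra LieAlgebra.IsKilling LieModule Module

variable {L : Type*} [LieRing L] [LieAlgebra ℂ L] [FiniteDimensional ℂ L]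

/-- The relations of an `sl₂`-triple, allowing the zero triple. -/
structure IsLieSl2 (h e f : L) : Prop where
  lie_e_f : ⁅e, f⁆ = h
  lie_h_e : ⁅h, e⁆ = 2 • e
  lie_h_f : ⁅h, f⁆ = -(2 • f)

omit [FiniteDimensional ℂ L] in
theorem IsLieSl2.isSl2 {h e f : L} (t : IsLieSl2 h e f) {A : Type*} [Ring A] [Algebra ℂ A]
    (φ : L →ₗ⁅ℂ⁆ A) : IsSl2 (φ h) (φ e) (φ f) where
  h_e := by
    have := congrArg φ t.lie_h_e
    rw [LieHom.map_lie, Ring.lie_def, map_nsmul, sub_eq_iff_eq_add, ← Nat.cast_smul_eq_nsmul ℂ] at this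
    rw [this, add_comm]; rfl
  h_f := by
    have := congrArg φ t.lie_h_f
    rw [LieHom.map_lie, Ring.lie_def, map_neg, map_nsmul, sub_eq_iff_eq_add,
      ← Nat.cast_smul_eq_nsmul ℂ] at this
    rw [this, add_comm, sub_eq_add_neg]; rfl
  e_f := by
    have := congrArg φ t.lie_e_f
    rw [LieHom.map_lie, Ring.lie_def, sub_eq_iff_eq_add] at this
    rw [this, add_comm]

/-- The weight space of a Lie subalgebra for the adjoint action, as a linear subspace. -/
abbrev wt (H : LieSubalgebra ℂ L) [H.IsCartanSubalgebra] (α : H → ℂ) : Submodule ℂ L :=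
  (rootSpace H α).toSubmodule

section Cartan

variable {H : LieSubalgebra ℂ L} [H.IsCartanSubalgebra]

omit [FiniteDimensional ℂ L] in
theorem iSupIndep_wt : iSupIndep (wt H) :=
  LieSubmodule.iSupIndep_toSubmodule.2 (iSupIndep_genWeightSpace ℂ H L)

theorem iSup_wt_eq_top : ⨆ α : Weight ℂ H L, wt H α = ⊤ := by
  rw [← LieSubmodule.iSup_toSubmodule, iSup_genWeightSpace_eq_top', LieSubmodule.top_toSubmodule]

variable [IsKilling ℂ L]

theorem wt_le_eigenspace (α : H → ℂ) (y : H) : wt H α ≤ End.eigenspace (ad ℂ L y) (α y) := by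
  intro x hx
  rw [End.mem_eigenspace_iff]
  exact lie_eq_smul_of_mem_rootSpace hx y

theorem eigenspace_ad_le (y : H) (c : ℂ) :
    End.eigenspace (ad ℂ L y) c ≤ ⨆ (α : Weight ℂ H L) (_ : α y = c), wt H α :=
  le_iSup_of_iSup_eq_top (D := End.eigenspace (ad ℂ L y)) (φ := fun α : Weight ℂ H L => α y)
    (End.eigenspaces_iSupIndep _) (fun α => wt_le_eigenspace α y) iSup_wt_eq_top c

omit [IsKilling ℂ L] in
theorem wt_zero : wt H 0 = H.toSubmodule := by
  change (rootSpace H 0).toSubmodule = _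
  rw [rootSpace_zero_eq]; rfl

end Cartan

/-- No Engel subalgebra has dimension below the rank, so this one is minimal among those of its own
elements. It is then contained in all of them, and Engel's theorem makes it nilpotent. -/
theorem isCartanSubalgebra_engel {x : L}
    (hx : finrank ℂ (LieSubalgebra.engel ℂ x) ≤ LieAlgebra.rank ℂ L) :
    (LieSubalgebra.engel ℂ x).IsCartanSubalgebra := by
  refine ⟨?_, LieSubalgebra.normalizer_engel _ _⟩
  apply LieSubalgebra.isNilpotent_of_forall_le_engel
  intro y hy
  set Ex : {LieSubalgebra.engel ℂ z | z ∈ LieSubalgebra.engel ℂ x} :=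
    ⟨LieSubalgebra.engel ℂ x, x, LieSubalgebra.self_mem_engel _ _, rfl⟩
  suffices IsBot Ex from @this ⟨LieSubalgebra.engel ℂ y, y, hy, rfl⟩
  have hcard : (finrank ℂ L : Cardinal) ≤ Cardinal.mk ℂ :=
    Cardinal.natCast_le_aleph0.trans (Cardinal.infinite_iff.mp inferInstance)
  apply LieAlgebra.engel_isBot_of_isMin hcard (LieSubalgebra.engel ℂ x) Ex le_rfl
  rintro ⟨_, y, hy, rfl⟩ hyx
  suffices finrank ℂ (LieSubalgebra.engel ℂ x) ≤ finrank ℂ (LieSubalgebra.engel ℂ y) by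
    suffices LieSubalgebra.engel ℂ y = LieSubalgebra.engel ℂ x from this.ge
    apply LieSubalgebra.toSubmodule_injective
    exact Submodule.eq_of_le_of_finrank_le hyx this
  exact hx.trans (rank_le_finrank_engel ℂ y)

/-- The prescribed values define a functional on the span of the forms; extended to the whole dual
space, it is evaluation at a vector. -/
theorem exists_forall_apply_eq {ι V : Type*} [AddCommGroup V] [Module ℂ V] [FiniteDimensional ℂ V]
    {v : ι → Dual ℂ V} (hv : LinearIndependent ℂ v) (c : ι → ℂ) : ∃ y : V, ∀ i, v i y = c i := by
  obtain ⟨φ, hφ⟩ := LinearMap.exists_extend ((Basis.span hv).constr ℂ c)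
  refine ⟨(evalEquiv ℂ V).symm φ, fun i => ?_⟩
  have h1 : φ (v i) = c i := by
    have := LinearMap.congr_fun hφ (Basis.span hv i)
    rw [Basis.constr_basis, LinearMap.comp_apply, Submodule.subtype_apply, Basis.span_apply] at this
    exact this
  rw [← h1, apply_evalEquiv_symm_apply]

variable [IsKilling ℂ L]

variable (L) in
/-- There is an `sl₂`-triple with regular nilpotent element. -/
theorem exists_isLieSl2_finrank_ker_le : ∃ h e f : L, IsLieSl2 h e f ∧
    finrank ℂ (LinearMap.ker (ad ℂ L e : End ℂ L)) ≤ LieAlgebra.rank ℂ L := by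
  obtain ⟨x, hx⟩ := LieAlgebra.exists_isRegular ℂ L
  have hrk := (isRegular_iff_finrank_engel_eq_rank ℂ x).1 hx
  have hcar := isCartanSubalgebra_engel hrk.le
  set H := LieSubalgebra.engel ℂ x with hH
  obtain ⟨b⟩ := (rootSystem H).nonempty_base
  have hli : LinearIndependent ℂ (fun i : b.support => (i : Weight ℂ H L).toLinear) :=
    b.linearIndepOn_root
  -- The neutral element takes the value `2` on every simple root. Expanded in simple coroots with
  -- coefficients `c i`, it is completed by `e = ∑ e i` and `f = ∑ c i • f i`.
  obtain ⟨y, hy⟩ := exists_forall_apply_eq hli (fun _ => 2)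
  have hcor : y ∈ Submodule.span ℂ (Set.range fun i : b.support => coroot (i : Weight ℂ H L)) := by
    have h1 := b.span_coroot_support
    rw [RootPairing.corootSpan, RootPairing.IsRootSystem.span_coroot_eq_top] at h1
    have h2 : (Set.range fun i : b.support => coroot (i : Weight ℂ H L)) =
        (rootSystem H).coroot '' b.support := by
      rw [Set.image_eq_range]; rfl
    rw [h2, h1]; trivial
  obtain ⟨c, hc⟩ := (Submodule.mem_span_range_iff_exists_fun ℂ).1 hcor
  have hnz : ∀ i : b.support, (i : Weight ℂ H L).IsNonZero := fun i =>
    LieSubalgebra.isNonZero_coe_root _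
  choose h e f t he hf using fun i : b.support => exists_isSl2Triple_of_weight_isNonZero (hnz i)
  have hh : ∀ i, h i = coroot (i : Weight ℂ H L) := fun i =>
    (t i).h_eq_coroot (hnz i) (he i) (hf i)
  have hyL : (y : L) = ∑ i, c i • h i := by
    rw [← hc]; simp [hh]
  -- A nonzero bracket would make the difference of two simple roots a root.
  have hbr : ∀ i j : b.support, i ≠ j → ⁅e i, f j⁆ = 0 := by
    intro i j hij
    have hm := lie_mem_genWeightSpace_of_mem_genWeightSpace (he i) (hf j)
    by_contra h0
    have hne : rootSpace H ((i : Weight ℂ H L) + -(j : Weight ℂ H L) : H → ℂ) ≠ ⊥ := fun h =>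
      h0 (by
        change _ ∈ rootSpace H ((i : Weight ℂ H L) + -(j : Weight ℂ H L) : H → ℂ) at hm
        rw [h] at hm; simpa using hm)
    refine b.sub_notMem_range_root i.2 j.2 ⟨⟨⟨_, hne⟩, ?_⟩, ?_⟩
    · simp only [LieSubalgebra.root, Finset.mem_filter, Finset.mem_univ, true_and]
      intro hz
      have hz : ((i : Weight ℂ H L) + -(j : Weight ℂ H L) : H → ℂ) = 0 := hz
      apply hij
      rw [← sub_eq_add_neg, sub_eq_zero] at hz
      exact Subtype.ext (Subtype.ext (DFunLike.coe_injective hz))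
    · ext z
      change ((i : Weight ℂ H L) + -(j : Weight ℂ H L) : H → ℂ) z = _
      simp [sub_eq_add_neg]
  have hye : ∀ i, ⁅(y : L), e i⁆ = (2 : ℂ) • e i := fun i => by
    have := lie_eq_smul_of_mem_rootSpace (he i) y
    rw [show (i : Weight ℂ H L) y = 2 from hy i] at this
    exact this
  have hyf : ∀ i, ⁅(y : L), f i⁆ = -((2 : ℂ) • f i) := fun i => by
    have := lie_eq_smul_of_mem_rootSpace (hf i) y
    rw [Pi.neg_apply, show (i : Weight ℂ H L) y = 2 from hy i, neg_smul] at this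
    exact this
  have ht : IsLieSl2 (y : L) (∑ i, e i) (∑ i, c i • f i) := by
    refine ⟨?_, ?_, ?_⟩
    · rw [hyL, sum_lie]
      refine Finset.sum_congr rfl fun i _ => ?_
      rw [lie_sum, Finset.sum_eq_single i, lie_smul, (t i).lie_e_f]
      · intro j _ hj
        rw [lie_smul, hbr i j hj.symm, smul_zero]
      · simp
    · rw [lie_sum, Finset.smul_sum]
      exact Finset.sum_congr rfl fun i _ => by rw [hye, ← Nat.cast_smul_eq_nsmul ℂ]; rfl
    · rw [lie_sum, Finset.smul_sum, ← Finset.sum_neg_distrib]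
      exact Finset.sum_congr rfl fun i _ => by
        rw [lie_smul, hyf, ← Nat.cast_smul_eq_nsmul ℂ, smul_neg, smul_comm]; rfl
  refine ⟨_, _, _, ht, ?_⟩
  -- Every root takes a nonzero even value at `y`. Hence the eigenspace for `0` lies in the Cartan
  -- subalgebra, the eigenspace for `-1` vanishes, and the centralizer of `e` has dimension at most
  -- the rank.
  have hk := (ht.isSl2 (ad ℂ L)).finrank_ker_e
  have hroot : ∀ α : Weight ℂ H L, α.IsNonZero → ∃ m : ℕ, α y = 2 * (m + 1) ∨ α y = - (2 * (m + 1)) := by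
    intro α hα
    have hcl : ∀ β ∈ AddSubmonoid.closure ((rootSystem H).root '' b.support),
        β = 0 ∨ ∃ m : ℕ, β y = 2 * (m + 1) := by
      intro β hβ
      induction hβ using AddSubmonoid.closure_induction with
      | mem β hβ =>
        obtain ⟨i, hi, rfl⟩ := hβ
        exact Or.inr ⟨0, by simpa using hy ⟨i, hi⟩⟩
      | zero => exact Or.inl rfl
      | add β γ _ _ h1 h2 =>
        rcases h1 with rfl | ⟨m, hm⟩
        · simpa using h2
        rcases h2 with rfl | ⟨m', hm'⟩
        · exact Or.inr ⟨m, by simpa using hm⟩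
        exact Or.inr ⟨m + m' + 1, by rw [LinearMap.add_apply, hm, hm']; push_cast; ring⟩
    have hα0 : α.toLinear ≠ 0 := by simpa using hα
    rcases b.root_mem_or_neg_mem ⟨α, by simpa using hα⟩ with h1 | h1
    · obtain ⟨m, hm⟩ := (hcl _ h1).resolve_left hα0
      exact ⟨m, Or.inl hm⟩
    · obtain ⟨m, hm⟩ := (hcl _ h1).resolve_left (neg_ne_zero.2 hα0)
      refine ⟨m, Or.inr ?_⟩
      rw [← hm]; simp
  have h0 : End.eigenspace (ad ℂ L y) 0 ≤ H.toSubmodule := by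
    refine (eigenspace_ad_le y 0).trans (iSup₂_le fun α hα => ?_)
    by_cases hz : α.IsZero
    · rw [← wt_zero, hz]
    · obtain ⟨m, hm | hm⟩ := hroot α hz
      · rw [hα] at hm
        norm_cast at hm
      · rw [hα, zero_eq_neg] at hm
        norm_cast at hm
  have h1 : End.eigenspace (ad ℂ L y) (-1) = ⊥ := by
    rw [eq_bot_iff]
    refine (eigenspace_ad_le y (-1)).trans (iSup₂_le fun α hα => ?_)
    exfalso
    by_cases hz : α.IsZero
    · rw [hz] at hα; simp at hα
    · obtain ⟨m, hm | hm⟩ := hroot α hz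
      · rw [hα, neg_eq_iff_add_eq_zero] at hm
        norm_cast at hm
      · rw [hα, neg_inj] at hm
        norm_cast at hm
        omega
  rw [hk, h1, finrank_bot, add_zero, ← hrk]
  exact Submodule.finrank_mono h0

section Principal

variable {h e f : L} (t : IsLieSl2 h e f)
  (hk : finrank ℂ (LinearMap.ker (ad ℂ L e : End ℂ L)) ≤ LieAlgebra.rank ℂ L)

include t

-- Semisimplicity of `ad h`: the generalized eigenspace for `0` is the eigenspace.
omit [IsKilling ℂ L] in
theorem IsLieSl2.engel_eq : (LieSubalgebra.engel ℂ h).toSubmodule = End.eigenspace (ad ℂ L h) 0 := by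
  ext x
  rw [LieSubalgebra.mem_toSubmodule, LieSubalgebra.mem_engel_iff, End.mem_eigenspace_iff]
  constructor
  · rintro ⟨m, hm⟩
    exact (t.isSl2 (ad ℂ L)).apply_eq_smul (l := 0) (m := m) (by simpa using hm)
  · intro hx
    exact ⟨1, by simpa using hx⟩

include hk

-- The dimension of `𝔤_0` is at most that of the centralizer of `e`, hence at most the rank.
omit [IsKilling ℂ L] in
theorem IsLieSl2.isCartanSubalgebra : (LieSubalgebra.engel ℂ h).IsCartanSubalgebra := by
  apply isCartanSubalgebra_engel
  have h1 := (t.isSl2 (ad ℂ L)).finrank_ker_e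
  rw [← t.engel_eq] at h1
  exact le_trans (by rw [h1]; exact Nat.le_add_right _ _) hk

-- In `dim 𝔤_0 + dim 𝔤_{-1} = dim ker (ad e)` the right side is at most the rank and `dim 𝔤_0` is at
-- least the rank, so nothing is left for `𝔤_{-1}`.
omit [IsKilling ℂ L] in
theorem IsLieSl2.eigenspace_neg_one : End.eigenspace (ad ℂ L h) (-1) = ⊥ := by
  have h1 := (t.isSl2 (ad ℂ L)).finrank_ker_e
  rw [← t.engel_eq] at h1
  have h2 := rank_le_finrank_engel ℂ h
  rw [← Submodule.finrank_eq_zero]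
  change _ = finrank ℂ (LieSubalgebra.engel ℂ h) + _ at h1
  omega

-- `ad e` maps `𝔤_{-1}`, which is zero, onto `𝔤_1`.
omit [IsKilling ℂ L] in
theorem IsLieSl2.eigenspace_one : End.eigenspace (ad ℂ L h) 1 = ⊥ := by
  rw [eq_bot_iff]
  intro x hx
  obtain ⟨y, hy, rfl⟩ := (t.isSl2 (ad ℂ L)).exists_e_apply_eq (l := -1) (x := x) (fun k hk => by
    have : (1 + k : ℂ) = 0 := by linear_combination hk
    norm_cast at this
    omega) (by rw [End.mem_eigenspace_iff] at hx; rw [hx]; norm_num)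
  have : y ∈ End.eigenspace (ad ℂ L h) (-1) := End.mem_eigenspace_iff.2 hy
  rw [t.eigenspace_neg_one hk, Submodule.mem_bot] at this
  rw [this, map_zero]; rfl

end Principal

section Heights

variable {h e f : L} (t : IsLieSl2 h e f)
  (hk : finrank ℂ (LinearMap.ker (ad ℂ L e : End ℂ L)) ≤ LieAlgebra.rank ℂ L)
  {H : LieSubalgebra ℂ L} [H.IsCartanSubalgebra] (hH : H = LieSubalgebra.engel ℂ h)

/-- The value of a weight at the neutral element. -/
abbrev height (hH : H = LieSubalgebra.engel ℂ h) (α : H → ℂ) : ℂ :=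
  α ⟨h, hH ▸ LieSubalgebra.self_mem_engel ℂ h⟩

include t

theorem IsLieSl2.exists_int_height (α : Weight ℂ H L) : ∃ k : ℤ, height hH α = k := by
  obtain ⟨x, hx, hx0⟩ := α.exists_ne_zero
  have h1 := wt_le_eigenspace α ⟨h, hH ▸ LieSubalgebra.self_mem_engel ℂ h⟩ hx
  rw [End.mem_eigenspace_iff] at h1
  exact (t.isSl2 (ad ℂ L)).exists_int_of_apply_eq_smul h1 hx0

theorem IsLieSl2.height_ne_zero {α : Weight ℂ H L} (hα : α.IsNonZero) : height hH α ≠ 0 := by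
  intro h0
  obtain ⟨x, hx, hx0⟩ := α.exists_ne_zero
  have h1 := wt_le_eigenspace α ⟨h, hH ▸ LieSubalgebra.self_mem_engel ℂ h⟩ hx
  rw [show α ⟨h, hH ▸ LieSubalgebra.self_mem_engel ℂ h⟩ = 0 from h0] at h1
  have h2 : x ∈ wt H 0 := by
    rw [wt_zero, hH, t.engel_eq]; exact h1
  exact hx0 (Submodule.disjoint_def.1 (iSupIndep_wt.pairwiseDisjoint
    (show (α : H → ℂ) ≠ 0 from hα)) x hx h2)

omit t

theorem mem_iSup_wt_of_mem_eigenspace {c : ℂ} {x : L} (hx : x ∈ End.eigenspace (ad ℂ L h) c) :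
    x ∈ ⨆ (α : Weight ℂ H L) (_ : height hH α = c), wt H α :=
  eigenspace_ad_le (⟨h, hH ▸ LieSubalgebra.self_mem_engel ℂ h⟩ : H) c hx

include t

/-- A weight of height at least `3` is the sum of a weight of height `2` and another weight. -/
theorem IsLieSl2.exists_add {α : Weight ℂ H L} {k : ℤ} (hα : height hH α = k) (hk3 : 3 ≤ k) :
    ∃ β γ : Weight ℂ H L, height hH β = 2 ∧ height hH γ = (k - 2 : ℤ) ∧ (α : H → ℂ) = β + γ := by
  obtain ⟨x, hx, hx0⟩ := α.exists_ne_zero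
  have h1 := wt_le_eigenspace α ⟨h, hH ▸ LieSubalgebra.self_mem_engel ℂ h⟩ hx
  rw [show α ⟨h, hH ▸ LieSubalgebra.self_mem_engel ℂ h⟩ = k from hα, End.mem_eigenspace_iff] at h1
  -- The root vector is `⁅e, y⁆` with `y` of degree `k - 2`, while `e` is a sum of root vectors of
  -- height `2`. If `α` were no sum of two such weights, the bracket would lie in the sum of the
  -- other root spaces.
  obtain ⟨y, hy, hyx⟩ := (t.isSl2 (ad ℂ L)).exists_e_apply_eq (l := ((k - 2 : ℤ) : ℂ)) (x := x)
    (fun j hj => by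
      have : (k + j : ℂ) = 0 := by push_cast at hj; linear_combination hj
      norm_cast at this
      omega) (by rw [h1]; push_cast; congr 1; ring)
  by_contra hcon
  have hle : ∀ β γ : Weight ℂ H L, height hH β = 2 → height hH γ = (k - 2 : ℤ) →
      wt H (β + γ : H → ℂ) ≤ ⨆ (δ : H → ℂ) (_ : δ ≠ α), wt H δ := fun β γ hβ hγ =>
    le_iSup₂_of_le (β + γ : H → ℂ) (fun h => hcon ⟨β, γ, hβ, hγ, h.symm⟩) le_rfl
  have he : e ∈ ⨆ (β : Weight ℂ H L) (_ : height hH β = 2), wt H β :=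
    mem_iSup_wt_of_mem_eigenspace hH (End.mem_eigenspace_iff.2 (by
      rw [ad_apply, t.lie_h_e, ← Nat.cast_smul_eq_nsmul ℂ]; rfl))
  have hy' := mem_iSup_wt_of_mem_eigenspace hH (End.mem_eigenspace_iff.2 hy)
  have hmem : ⁅e, y⁆ ∈ ⨆ (δ : H → ℂ) (_ : δ ≠ α), wt H δ := by
    have key1 : ∀ β : Weight ℂ H L, height hH β = 2 → ∀ a ∈ wt H β,
        (⨆ (γ : Weight ℂ H L) (_ : height hH γ = (k - 2 : ℤ)), wt H γ) ≤
          (⨆ (δ : H → ℂ) (_ : δ ≠ α), wt H δ).comap (ad ℂ L a) := by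
      intro β hβ a ha
      refine iSup₂_le fun γ hγ c hc => ?_
      exact hle β γ hβ hγ (lie_mem_genWeightSpace_of_mem_genWeightSpace ha hc)
    have key2 : (⨆ (β : Weight ℂ H L) (_ : height hH β = 2), wt H β) ≤
        (⨆ (δ : H → ℂ) (_ : δ ≠ α), wt H δ).comap ((ad ℂ L : L →ₗ[ℂ] End ℂ L).flip y) := by
      refine iSup₂_le fun β hβ a ha => ?_
      exact key1 β hβ a ha hy'
    exact key2 he
  rw [← ad_apply ℂ, hyx] at hmem
  exact hx0 (Submodule.disjoint_def.1 (iSupIndep_wt (α : H → ℂ)) x hx hmem)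

include hk

theorem IsLieSl2.exists_nat_height {α : Weight ℂ H L} (hα : α.IsNonZero) :
    ∃ k : ℤ, height hH α = k ∧ (2 ≤ k ∨ k ≤ -2) := by
  obtain ⟨k, hk'⟩ := t.exists_int_height hH α
  refine ⟨k, hk', ?_⟩
  have h0 := t.height_ne_zero hH hα
  obtain ⟨x, hx, hx0⟩ := α.exists_ne_zero
  have h1 := wt_le_eigenspace α ⟨h, hH ▸ LieSubalgebra.self_mem_engel ℂ h⟩ hx
  rw [show α ⟨h, hH ▸ LieSubalgebra.self_mem_engel ℂ h⟩ = k from hk'] at h1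
  have k0 : k ≠ 0 := by rintro rfl; exact h0 (by simpa using hk')
  have k1 : k ≠ 1 := by
    rintro rfl
    rw [Int.cast_one] at h1
    change x ∈ End.eigenspace (ad ℂ L h) 1 at h1
    rw [t.eigenspace_one hk] at h1
    exact hx0 h1
  have k2 : k ≠ -1 := by
    rintro rfl
    rw [Int.cast_neg, Int.cast_one] at h1
    change x ∈ End.eigenspace (ad ℂ L h) (-1) at h1
    rw [t.eigenspace_neg_one hk] at h1
    exact hx0 h1
  omega

/-- The weights of height `2`. -/
abbrev SimpleWeight (hH : H = LieSubalgebra.engel ℂ h) : Type _ :=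
  {α : Weight ℂ H L // height hH α = 2}

-- Induction on the height: `exists_add` splits off a weight of height `2` until only that height is
-- left.
omit hk in
theorem IsLieSl2.mem_closure_of_height_pos (hk' : finrank ℂ (LinearMap.ker (ad ℂ L e : End ℂ L)) ≤ LieAlgebra.rank ℂ L)
    {α : Weight ℂ H L} {k : ℤ} (hα : height hH α = k) (hk0 : 0 < k) :
    α.toLinear ∈ AddSubmonoid.closure
      (Set.range fun β : SimpleWeight hH => (β.1.toLinear : H →ₗ[ℂ] ℂ)) := by
  induction hm : k.toNat using Nat.strong_induction_on generalizing α k with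
  | _ m ih =>
    have hnz : α.IsNonZero := by
      intro hz
      have : height hH α = 0 := by rw [height, hz]; rfl
      rw [hα] at this
      norm_cast at this
      omega
    obtain ⟨k', hk1, hk2⟩ := t.exists_nat_height hk' hH hnz
    have : k = k' := by rw [hα] at hk1; exact_mod_cast hk1
    subst this
    rcases eq_or_lt_of_le (show 2 ≤ k by omega) with rfl | hk3
    · exact AddSubmonoid.subset_closure ⟨⟨α, by simpa using hα⟩, rfl⟩
    · obtain ⟨β, γ, hβ, hγ, hαβ⟩ := t.exists_add hH hα (by omega)
      have hγ' := ih (k - 2).toNat (by omega) hγ (by omega) rfl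
      have : α.toLinear = β.toLinear + γ.toLinear := by
        ext z; exact congrFun hαβ z
      rw [this]
      exact add_mem (AddSubmonoid.subset_closure ⟨⟨β, hβ⟩, rfl⟩) hγ'

theorem IsLieSl2.span_simpleWeight :
    Submodule.span ℂ (Set.range fun β : SimpleWeight hH => (β.1.toLinear : H →ₗ[ℂ] ℂ)) = ⊤ := by
  rw [eq_top_iff, ← span_weight_isNonZero_eq_top ℂ L H, Submodule.span_le]
  rintro _ ⟨α, hα, rfl⟩
  obtain ⟨k, hk1, hk2⟩ := t.exists_nat_height hk hH hα
  have hcl : ∀ x ∈ AddSubmonoid.closure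
      (Set.range fun β : SimpleWeight hH => (β.1.toLinear : H →ₗ[ℂ] ℂ)),
      x ∈ Submodule.span ℂ (Set.range fun β : SimpleWeight hH => (β.1.toLinear : H →ₗ[ℂ] ℂ)) := by
    intro x hx
    have : AddSubmonoid.closure
      (Set.range fun β : SimpleWeight hH => (β.1.toLinear : H →ₗ[ℂ] ℂ)) ≤
      (Submodule.span ℂ (Set.range fun β : SimpleWeight hH => (β.1.toLinear : H →ₗ[ℂ] ℂ))).toAddSubmonoid :=
      AddSubmonoid.closure_le.2 Submodule.subset_span
    exact this hx
  rcases hk2 with hk2 | hk2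
  · exact hcl _ (t.mem_closure_of_height_pos hH hk hk1 (by omega))
  · have h1 : height hH ((-α : Weight ℂ H L) : H → ℂ) = ((-k : ℤ) : ℂ) := by
      rw [Int.cast_neg, ← hk1]; simp [height]
    have h2 := hcl _ (t.mem_closure_of_height_pos hH hk h1 (by omega))
    rw [Weight.toLinear_neg] at h2
    simpa using neg_mem h2

-- Root vectors of distinct weights are independent, and those of height `2` lie in the image of `H
-- = 𝔤_0` under `ad e`, which maps `𝔤_0` onto `𝔤_2`.
omit hk in
theorem IsLieSl2.card_simpleWeight_le [Fintype (SimpleWeight hH)] :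
    Fintype.card (SimpleWeight hH) ≤ finrank ℂ H := by
  choose x hx hx0 using fun α : SimpleWeight hH => α.1.exists_ne_zero
  have hli : LinearIndependent ℂ x := by
    have h1 : iSupIndep fun α : SimpleWeight hH => wt H α.1 :=
      (iSupIndep_wt (H := H)).comp (DFunLike.coe_injective.comp Subtype.val_injective)
    exact h1.linearIndependent _ hx hx0
  have hH0 : H.toSubmodule = End.eigenspace (ad ℂ L h) 0 := by rw [hH, t.engel_eq]
  have hmem : ∀ α, x α ∈ H.toSubmodule.map (ad ℂ L e : End ℂ L) := by
    intro α
    have h1 := wt_le_eigenspace α.1 ⟨h, hH ▸ LieSubalgebra.self_mem_engel ℂ h⟩ (hx α)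
    rw [show α.1 ⟨h, hH ▸ LieSubalgebra.self_mem_engel ℂ h⟩ = 2 from α.2, End.mem_eigenspace_iff] at h1
    obtain ⟨y, hy, hyx⟩ := (t.isSl2 (ad ℂ L)).exists_e_apply_eq (l := 0) (x := x α)
      (fun j hj => by
        have : (2 + j : ℂ) = 0 := by linear_combination hj
        norm_cast at this
        omega) (by rw [zero_add]; exact h1)
    exact ⟨y, by rw [hH0]; exact End.mem_eigenspace_iff.2 hy, hyx⟩
  have hli' : LinearIndependent ℂ (fun α => (⟨x α, hmem α⟩ : H.toSubmodule.map (ad ℂ L e : End ℂ L))) :=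
    LinearIndependent.of_comp (Submodule.subtype _) hli
  exact hli'.fintype_card_le_finrank.trans (Submodule.finrank_map_le _ _)

/-- The weights of height `2` span the dual of `H`, and `card_simpleWeight_le` bounds their number
by its dimension. -/
theorem IsLieSl2.linearIndependent_simpleWeight :
    LinearIndependent ℂ (fun β : SimpleWeight hH => (β.1.toLinear : H →ₗ[ℂ] ℂ)) := by
  have : Fintype (SimpleWeight hH) := Fintype.ofFinite _
  have h1 := t.span_simpleWeight hk hH
  refine linearIndependent_of_top_le_span_of_card_eq_finrank h1.ge ?_
  have h2 := t.card_simpleWeight_le hH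
  have h3 := finrank_range_le_card (R := ℂ) (fun β : SimpleWeight hH => (β.1.toLinear : H →ₗ[ℂ] ℂ))
  rw [Set.finrank, h1, finrank_top] at h3
  rw [show finrank ℂ (H →ₗ[ℂ] ℂ) = finrank ℂ H from Subspace.dual_finrank_eq] at *
  omega

end Heights

end LieAlgebra

/-! ### Centralizers of principal nilpotent elements -/

section Principal

attribute [local instance 100] LieRing.ofAssociativeRing

open LieAlgebra Module

variable {n : ℕ} {G : Subgroup (GL (Fin n) ℂ)}

local notation "Mat" => Matrix (Fin n) (Fin n) ℂ

/-- A linear form on matrices as a polynomial. -/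
def linearPoly (l : Mat →ₗ[ℂ] ℂ) : MvPolynomial (Fin n × Fin n) ℂ :=
  ∑ kl : Fin n × Fin n, MvPolynomial.C (l (Matrix.single kl.1 kl.2 1)) * MvPolynomial.X kl

theorem evalMat_linearPoly (l : Mat →ₗ[ℂ] ℂ) (M : Mat) : evalMat M (linearPoly l) = l M := by
  conv_rhs => rw [Matrix.matrix_eq_sum_single M]
  rw [linearPoly, Fintype.sum_prod_type]
  simp only [map_sum, map_mul, evalMat_C, evalMat_X]
  refine Finset.sum_congr rfl fun k _ => Finset.sum_congr rfl fun l _ => ?_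
  have : Matrix.single k l (M k l) = M k l • Matrix.single k l (1 : ℂ) := by
    rw [Matrix.smul_single, smul_eq_mul, mul_one]
  rw [this, map_smul, smul_eq_mul, mul_comm]

theorem finrank_range_ad_adG_le (g : G) (x : lieAlg G) :
    finrank ℂ (LinearMap.range (ad ℂ (lieAlg G) (adG g x) : End ℂ (lieAlg G))) ≤
      finrank ℂ (LinearMap.range (ad ℂ (lieAlg G) x : End ℂ (lieAlg G))) := by
  have h1 : LinearMap.range (ad ℂ (lieAlg G) (adG g x) : End ℂ (lieAlg G)) ≤
      (LinearMap.range (ad ℂ (lieAlg G) x : End ℂ (lieAlg G))).map (adG g) := by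
    rintro _ ⟨y, rfl⟩
    refine ⟨⁅x, adG g⁻¹ y⁆, ⟨_, rfl⟩, ?_⟩
    rw [adG_lie, ← adG_mul, mul_inv_cancel, adG_one]; rfl
  exact (Submodule.finrank_mono h1).trans (Submodule.finrank_map_le _ _)

/-- The centralizer of a principal nilpotent element has the smallest dimension among the
centralizers of nilpotent elements. -/
theorem IsPrincipal.finrank_ker_ad_le {ν : lieAlg G} (hν : IsPrincipal G ν) {x : lieAlg G}
    (hx : IsNilpotent (x : Mat)) :
    finrank ℂ (LinearMap.ker (ad ℂ (lieAlg G) ν : End ℂ (lieAlg G))) ≤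
      finrank ℂ (LinearMap.ker (ad ℂ (lieAlg G) x : End ℂ (lieAlg G))) := by
  have e1 := LinearMap.finrank_range_add_finrank_ker (ad ℂ (lieAlg G) ν : End ℂ (lieAlg G))
  have e2 := LinearMap.finrank_range_add_finrank_ker (ad ℂ (lieAlg G) x : End ℂ (lieAlg G))
  -- Suppose `ad ν` has smaller rank than `ad x`. With a right inverse `A` of `ad x` onto its range
  -- and a projection `B` to that range, `det (B ∘ ad z ∘ A)` is polynomial in `z`. It is zero on
  -- the orbit of `ν` for reasons of rank, hence at `x` by density; but at `x` it is `1`.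
  by_contra! hlt
  set W := LinearMap.range (ad ℂ (lieAlg G) x : End ℂ (lieAlg G)) with hW
  obtain ⟨A, hA⟩ := (ad ℂ (lieAlg G) x : End ℂ (lieAlg G)).rangeRestrict.exists_rightInverse_of_surjective
    (LinearMap.range_rangeRestrict _)
  obtain ⟨B, hB⟩ := W.subtype.exists_leftInverse_of_injective W.ker_subtype
  -- The principal condition concerns polynomials in all matrix entries, so the determinant is
  -- extended to every matrix through a projection onto the Lie algebra.
  obtain ⟨π, hπ⟩ := (lieAlg G).toSubmodule.subtype.exists_leftInverse_of_injective
    (lieAlg G).toSubmodule.ker_subtype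
  let π' : Mat →ₗ[ℂ] lieAlg G := π
  have hπ' : ∀ z : lieAlg G, π' (z : Mat) = z := fun z => LinearMap.congr_fun hπ z
  let b := finBasis ℂ W
  let F : Mat →ₗ[ℂ] Matrix (Fin (finrank ℂ W)) (Fin (finrank ℂ W)) ℂ :=
    (LinearMap.toMatrix b b).toLinearMap ∘ₗ
      ((LinearMap.llcomp ℂ W (lieAlg G) W B).comp (LinearMap.lcomp ℂ (lieAlg G) A)) ∘ₗ
      (ad ℂ (lieAlg G) : lieAlg G →ₗ[ℂ] End ℂ (lieAlg G)) ∘ₗ π'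
  have hF : ∀ z : lieAlg G, F z = LinearMap.toMatrix b b (B ∘ₗ (ad ℂ (lieAlg G) z) ∘ₗ A) := by
    intro z
    simp only [F, LinearMap.comp_apply, hπ']
    rfl
  let p : MvPolynomial (Fin n × Fin n) ℂ := Matrix.det
    (Matrix.of fun i j => linearPoly (Matrix.entryLinearMap ℂ ℂ i j ∘ₗ F))
  have hp : ∀ M, evalMat M p = (F M).det := by
    intro M
    simp only [p, RingHom.map_det]
    congr 1
    ext i j
    simp [evalMat_linearPoly]
  have h1 : evalMat (x : Mat) p = 0 := by
    refine hν.2 p (fun g y hy => ?_) x hx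
    rw [isAd_iff] at hy
    subst hy
    rw [hp, hF, LinearMap.det_toMatrix]
    by_contra hne
    have hbij := (LinearEquiv.ofIsUnitDet (f := B ∘ₗ (ad ℂ (lieAlg G) (adG g ν)) ∘ₗ A)
      (v := b) (v' := b) (by rw [LinearMap.det_toMatrix]; exact isUnit_iff_ne_zero.2 hne)).surjective
    have h2 : LinearMap.range (B ∘ₗ (ad ℂ (lieAlg G) (adG g ν)) ∘ₗ A) = ⊤ :=
      LinearMap.range_eq_top.2 hbij
    have h3 : (⊤ : Submodule ℂ W) ≤
        (LinearMap.range (ad ℂ (lieAlg G) (adG g ν) : End ℂ (lieAlg G))).map B := by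
      rw [← h2]
      rintro _ ⟨w, rfl⟩
      exact ⟨_, ⟨A w, rfl⟩, rfl⟩
    have h4 := (Submodule.finrank_mono h3).trans (Submodule.finrank_map_le _ _)
    rw [finrank_top] at h4
    have h5 := finrank_range_ad_adG_le g ν
    omega
  rw [hp, hF] at h1
  have h2 : B ∘ₗ (ad ℂ (lieAlg G) x) ∘ₗ A = LinearMap.id := by
    have : (ad ℂ (lieAlg G) x : End ℂ (lieAlg G)) ∘ₗ A = W.subtype := by
      ext1 w
      exact congrArg Subtype.val (LinearMap.congr_fun hA w)
    rw [this, hB]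
  rw [h2, LinearMap.toMatrix_id, Matrix.det_one] at h1
  exact one_ne_zero h1

theorem IsLieSl2.isSl2_toLin' {h e f : lieAlg G} (t : IsLieSl2 h e f) :
    IsSl2 (Matrix.toLin' (h : Mat)) (Matrix.toLin' (e : Mat)) (Matrix.toLin' (f : Mat)) := by
  have h1 := t.isSl2 (lieAlg G).incl
  have e1 := congrArg Matrix.toLin' h1.h_e
  have e2 := congrArg Matrix.toLin' h1.h_f
  have e3 := congrArg Matrix.toLin' h1.e_f
  simp only [map_add, map_sub, map_smul, Matrix.toLin'_mul] at e1 e2 e3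
  exact ⟨e1, e2, e3⟩

theorem isNilpotent_coe {h e f : lieAlg G} (t : IsLieSl2 h e f) : IsNilpotent (e : Mat) := by
  obtain ⟨N, hN⟩ := t.isSl2_toLin'.isNilpotent
  refine ⟨N, Matrix.toLin'.injective ?_⟩
  rw [Matrix.toLin'_pow, hN, map_zero]

theorem IsPrincipal.finrank_ker_ad_le_rank [IsKilling ℂ (lieAlg G)] {ν : lieAlg G}
    (hν : IsPrincipal G ν) :
    finrank ℂ (LinearMap.ker (ad ℂ (lieAlg G) ν : End ℂ (lieAlg G))) ≤
      LieAlgebra.rank ℂ (lieAlg G) := by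
  obtain ⟨h, e, f, t, hr⟩ := exists_isLieSl2_finrank_ker_le (lieAlg G)
  exact (hν.finrank_ker_ad_le (isNilpotent_coe t)).trans hr

end Principal

/-! ### Simultaneous eigenvectors for a Cartan subalgebra -/

section Eigenbasis

attribute [local instance 100] LieRing.ofAssociativeRing

open LieAlgebra LieAlgebra.IsKilling LieModule Module

variable {n : ℕ} {G : Subgroup (GL (Fin n) ℂ)}

local notation "Mat" => Matrix (Fin n) (Fin n) ℂ

variable [IsKilling ℂ (lieAlg G)] (H : LieSubalgebra ℂ (lieAlg G)) [H.IsCartanSubalgebra]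

theorem exists_isLieSl2_coroot {α : Weight ℂ H (lieAlg G)} (hα : α.IsNonZero) :
    ∃ e f : lieAlg G, IsLieSl2 ((coroot α : H) : lieAlg G) e f := by
  obtain ⟨h, e, f, t, he, hf⟩ := exists_isSl2Triple_of_weight_isNonZero hα
  rw [← t.h_eq_coroot hα he hf]
  exact ⟨e, f, t.lie_e_f, t.lie_h_e_nsmul, t.lie_h_f_nsmul⟩

/-- The nonzero weights. -/
abbrev Root : Type := {α : Weight ℂ H (lieAlg G) // α.IsNonZero}

theorem span_range_coroot :
    Submodule.span ℂ (Set.range fun α : Root H => coroot α.1) = ⊤ := by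
  rw [← RootPairing.IsRootSystem.span_coroot_eq_top (P := rootSystem H)]
  congr 1
  ext y
  constructor
  · rintro ⟨α, rfl⟩
    exact ⟨⟨α.1, by simpa using α.2⟩, rfl⟩
  · rintro ⟨α, rfl⟩
    exact ⟨⟨α.1, LieSubalgebra.isNonZero_coe_root α⟩, rfl⟩

/-- The elements of a Cartan subalgebra are simultaneously diagonalizable, and the coroots have
integral eigenvalues. -/
theorem exists_eigenbasis : ∃ (Q : GL (Fin n) ℂ) (lam : Fin n → Dual ℂ H),
    (∀ y : H, ((y : lieAlg G) : Mat) * (Q : Mat) = (Q : Mat) * Matrix.diagonal fun j => lam j y) ∧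
    ∀ (j : Fin n) (α : Root H), ∃ m : ℤ, lam j (coroot α.1) = m := by
  let F : H →ₗ[ℂ] End ℂ (Fin n → ℂ) :=
    (Matrix.toLin' : Mat ≃ₗ[ℂ] _).toLinearMap ∘ₗ (lieAlg G).toSubmodule.subtype ∘ₗ H.toSubmodule.subtype
  have hF : ∀ y : H, F y = Matrix.toLin' ((y : lieAlg G) : Mat) := fun _ => rfl
  have hcomm : ∀ x y : H, Commute (F x) (F y) := by
    intro x y
    have h1 : ⁅x, y⁆ = 0 := trivial_lie_zero _ _ _ _
    have h2 := congrArg (fun z : H => ((z : lieAlg G) : Mat)) h1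
    simp only [LieSubalgebra.coe_bracket, Ring.lie_def] at h2
    rw [Commute, SemiconjBy, hF, hF, Module.End.mul_eq_comp, Module.End.mul_eq_comp,
      ← Matrix.toLin'_mul, ← Matrix.toLin'_mul]
    exact congrArg _ (sub_eq_zero.1 h2)
  have hsl : ∀ α : Root H, ∃ e f, IsSl2 (F (coroot α.1)) e f := fun α => by
    obtain ⟨e, f, t⟩ := exists_isLieSl2_coroot H α.2
    exact ⟨_, _, t.isSl2_toLin'⟩
  -- The coroots commute, so generalized joint eigenspaces fill the space. Each coroot is the
  -- neutral element of an `sl₂`-triple, so these are true eigenspaces with integral eigenvalues.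
  have htop := Module.End.iSup_iInf_maxGenEigenspace_eq_top_of_iSup_maxGenEigenspace_eq_top_of_commute
    (fun α : Root H => F (coroot α.1)) (fun α β _ => hcomm _ _)
    (fun α => Module.End.iSup_maxGenEigenspace_eq_top _)
  let s : Set (Fin n → ℂ) := {v | ∃ χ : Root H → ℂ, ∀ α : Root H, F (coroot α.1) v = χ α • v}
  have hs : ⊤ ≤ Submodule.span ℂ s := by
    rw [← htop]
    refine iSup_le fun χ v hv => Submodule.subset_span ⟨χ, fun α => ?_⟩
    obtain ⟨e, f, t⟩ := hsl α
    have h1 := (Submodule.mem_iInf _).1 hv α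
    obtain ⟨m, hm⟩ := Module.End.mem_maxGenEigenspace _ _ _ |>.1 h1
    exact t.apply_eq_smul hm
  let b₀ := Basis.ofSpan hs
  have : Fintype ((linearIndepOn_empty ℂ id).extend (Set.empty_subset s)) :=
    FiniteDimensional.fintypeBasisIndex b₀
  let b : Basis (Fin n) ℂ (Fin n → ℂ) := b₀.reindex (Fintype.equivFinOfCardEq (by
    rw [← finrank_eq_card_basis b₀, finrank_fin_fun]))
  have hb : ∀ j, b j ∈ s := fun j => by
    apply Basis.ofSpan_subset hs
    rw [Basis.reindex_apply]
    exact ⟨_, rfl⟩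
  have hall : ∀ j, ∃ l : Dual ℂ H, ∀ y : H, F y (b j) = l y • b j := by
    intro j
    obtain ⟨χ, hχ⟩ := hb j
    -- The coroots span the Cartan subalgebra, so their joint eigenvectors are eigenvectors of all
    -- of it.
    have key : ∀ y : H, ∃ c : ℂ, F y (b j) = c • b j := by
      intro y
      have hy : y ∈ Submodule.span ℂ (Set.range fun α : Root H => coroot α.1) := by
        rw [span_range_coroot]; trivial
      induction hy using Submodule.span_induction with
      | mem y hy => obtain ⟨α, rfl⟩ := hy; exact ⟨_, hχ α⟩
      | zero => exact ⟨0, by simp⟩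
      | add y z _ _ h1 h2 =>
        obtain ⟨c, hc⟩ := h1
        obtain ⟨d, hd⟩ := h2
        exact ⟨c + d, by rw [map_add, LinearMap.add_apply, hc, hd, add_smul]⟩
      | smul a y _ h1 =>
        obtain ⟨c, hc⟩ := h1
        exact ⟨a * c, by rw [map_smul, LinearMap.smul_apply, hc, smul_smul]⟩
    have hc : ∀ y : H, F y (b j) = (b.coord j (F y (b j))) • b j := by
      intro y
      obtain ⟨c, hc⟩ := key y
      rw [hc]; simp
    exact ⟨(b.coord j) ∘ₗ (LinearMap.applyₗ (b j)) ∘ₗ F, hc⟩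
  choose lam hlam using hall
  let Q : Mat := Matrix.of fun i j => b j i
  have hQ : IsUnit Q.det := by
    have h1 : Q = (Pi.basisFun ℂ (Fin n)).toMatrix b := by
      ext i j; simp [Q, Basis.toMatrix_apply]
    rw [h1, ← Basis.det_apply]
    exact (Pi.basisFun ℂ (Fin n)).isUnit_det b
  refine ⟨Matrix.GeneralLinearGroup.mk'' Q hQ, lam, ?_, ?_⟩
  · intro y
    ext i j
    have h1 := congrFun (hlam j y) i
    rw [hF, Matrix.toLin'_apply] at h1
    change (((y : lieAlg G) : Mat) * Q) i j = (Q * Matrix.diagonal fun j => lam j y) i j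
    rw [Matrix.mul_diagonal, Matrix.mul_apply]
    simp only [Matrix.mulVec, dotProduct, Pi.smul_apply, smul_eq_mul] at h1
    simp only [Q, Matrix.of_apply]
    rw [h1, mul_comm]
  · intro j α
    obtain ⟨e, f, t⟩ := hsl α
    exact t.exists_int_of_apply_eq_smul (hlam j _) (b.ne_zero j)

end Eigenbasis

/-! ### The torus `T`, its characters and their differentials -/

section Torus

attribute [local instance 100] LieRing.ofAssociativeRing

open Module

variable {n : ℕ} {G : Subgroup (GL (Fin n) ℂ)}

local notation "Mat" => Matrix (Fin n) (Fin n) ℂ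

/-! ### The algebra generated by the matrix entries -/

section MatAlgebra

variable {X : Type} (ι : X → GL (Fin n) ℂ)

theorem linear_mem_of_entries_mem {A : Subalgebra ℂ (X → ℂ)} {M : X → Mat}
    (hM : ∀ i j, (fun x => M x i j) ∈ A) (l : Mat →ₗ[ℂ] ℂ) : (fun x => l (M x)) ∈ A := by
  have : (fun x => l (M x)) =
      ∑ k, ∑ j, (l (Matrix.single k j 1)) • (fun x => M x k j) := by
    ext x
    conv_lhs => rw [Matrix.matrix_eq_sum_single (M x)]
    simp only [map_sum, Finset.sum_apply, Pi.smul_apply, smul_eq_mul]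
    refine Finset.sum_congr rfl fun k _ => Finset.sum_congr rfl fun j _ => ?_
    have : Matrix.single k j (M x k j) = M x k j • Matrix.single k j (1 : ℂ) := by
      rw [Matrix.smul_single, smul_eq_mul, mul_one]
    rw [this, map_smul, smul_eq_mul, mul_comm]
  rw [this]
  exact sum_mem fun k _ => sum_mem fun j _ => A.smul_mem (hM k j) _

theorem entry_mem_matAlgebra (i j : Fin n) : (fun x => (ι x : Mat) i j) ∈ matAlgebra ι :=
  Algebra.subset_adjoin (Or.inl ⟨i, j, rfl⟩)

theorem det_inv_mem_matAlgebra : (fun x => (Matrix.det (ι x : Mat))⁻¹) ∈ matAlgebra ι :=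
  Algebra.subset_adjoin (Or.inr rfl)

theorem det_mem_of_entries_mem {m : ℕ} {A : Subalgebra ℂ (X → ℂ)} {M : X → Matrix (Fin m) (Fin m) ℂ}
    (h : ∀ i j, (fun x => M x i j) ∈ A) : (fun x => (M x).det) ∈ A := by
  have : (fun x => (M x).det) = (Matrix.of fun i j => (fun x => M x i j)).det := by
    ext x
    have := RingHom.map_det (Pi.evalRingHom (fun _ : X => ℂ) x) (Matrix.of fun i j => (fun x => M x i j))
    exact this.symm
  rw [this, Matrix.det_apply]
  refine sum_mem fun σ _ => ?_
  rw [Units.smul_def, ← Int.cast_smul_eq_zsmul ℂ]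
  exact Subalgebra.smul_mem _ (prod_mem fun i _ => h _ _) _

theorem adjugate_mem_of_entries_mem {m : ℕ} {A : Subalgebra ℂ (X → ℂ)}
    {M : X → Matrix (Fin m) (Fin m) ℂ}
    (h : ∀ i j, (fun x => M x i j) ∈ A) (i j : Fin m) : (fun x => (M x).adjugate i j) ∈ A := by
  simp only [Matrix.adjugate_apply]
  refine det_mem_of_entries_mem fun k l => ?_
  by_cases hk : k = j
  · subst hk
    simp only [Matrix.updateRow_self]
    exact A.algebraMap_mem _
  · simp only [Matrix.updateRow_ne hk]
    exact h k l

theorem inv_entry_mem_matAlgebra (i j : Fin n) :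
    (fun x => ((ι x)⁻¹ : GL (Fin n) ℂ).1 i j) ∈ matAlgebra ι := by
  have : (fun x => ((ι x)⁻¹ : GL (Fin n) ℂ).1 i j) =
      (fun x => (Matrix.det (ι x : Mat))⁻¹) * (fun x => (ι x : Mat).adjugate i j) := by
    ext x
    rw [Matrix.coe_units_inv, Matrix.inv_def]
    simp
  rw [this]
  exact mul_mem (det_inv_mem_matAlgebra ι) (adjugate_mem_of_entries_mem
    (entry_mem_matAlgebra ι) i j)

end MatAlgebra

/-- A basis of simultaneous eigenvectors for the centralizer of `h`. -/
structure EigenBasis (h : lieAlg G) where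
  Q : GL (Fin n) ℂ
  lam : Fin n → Dual ℂ (LieSubalgebra.engel ℂ h)
  conj : ∀ y : LieSubalgebra.engel ℂ h,
    ((y : lieAlg G) : Mat) * (Q : Mat) = (Q : Mat) * Matrix.diagonal fun j => lam j y

namespace EigenBasis

variable {h : lieAlg G} (E : EigenBasis h)

/-- The matrix with respect to the eigenbasis. -/
def co : Mat ≃ₐ[ℂ] Mat where
  toFun M := (E.Q⁻¹ : GL (Fin n) ℂ).1 * M * E.Q.1
  invFun M := E.Q.1 * M * (E.Q⁻¹ : GL (Fin n) ℂ).1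
  left_inv M := by simp only [← mul_assoc, Units.mul_inv, one_mul]; simp only [mul_assoc, Units.mul_inv, mul_one]
  right_inv M := by simp only [← mul_assoc, Units.inv_mul, one_mul]; simp only [mul_assoc, Units.inv_mul, mul_one]
  map_mul' M N := by
    simp only [mul_assoc]
    rw [← mul_assoc E.Q.1, Units.mul_inv, one_mul]
  map_add' M N := by simp [mul_add, add_mul]
  commutes' c := by
    rw [← Algebra.commutes, mul_assoc, Units.inv_mul, mul_one]

theorem co_apply (M : Mat) : E.co M = (E.Q⁻¹ : GL (Fin n) ℂ).1 * M * E.Q.1 := rfl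

theorem co_coe (y : LieSubalgebra.engel ℂ h) :
    E.co ((y : lieAlg G) : Mat) = Matrix.diagonal fun j => E.lam j y := by
  rw [co_apply, mul_assoc, E.conj, ← mul_assoc, Units.inv_mul, one_mul]

theorem co_exp (M : Mat) : E.co (NormedSpace.exp M) = NormedSpace.exp (E.co M) := by
  rw [co_apply, co_apply]
  exact (Matrix.exp_units_conj' E.Q M).symm

theorem co_exp_coe (y : LieSubalgebra.engel ℂ h) :
    E.co (NormedSpace.exp ((y : lieAlg G) : Mat)) = Matrix.diagonal fun j => Complex.exp (E.lam j y) := by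
  rw [co_exp, co_coe, Matrix.exp_diagonal]
  congr 1
  ext j
  rw [Complex.exp_eq_exp_ℂ, Pi.coe_exp]

theorem det_co (M : Mat) : (E.co M).det = M.det := by
  rw [co_apply, Matrix.det_mul, Matrix.det_mul, mul_comm, ← mul_assoc, ← Matrix.det_mul,
    Units.mul_inv, Matrix.det_one, one_mul]

include E in
theorem exp_add (x y : LieSubalgebra.engel ℂ h) :
    NormedSpace.exp (((x + y : LieSubalgebra.engel ℂ h) : lieAlg G) : Mat) =
      NormedSpace.exp ((x : lieAlg G) : Mat) * NormedSpace.exp ((y : lieAlg G) : Mat) := by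
  apply E.co.toEquiv.injective
  change E.co _ = E.co _
  rw [map_mul, co_exp_coe, co_exp_coe, co_exp_coe, Matrix.diagonal_mul_diagonal]
  simp [Complex.exp_add]

end EigenBasis

variable {h ν f : lieAlg G}

variable (G h ν f) in
/-- An `sl₂`-triple with principal nilpositive element `ν` in the semisimple Lie algebra of a linear
algebraic group, and a basis of eigenvectors for the centralizer of `h`. -/
structure PrincipalTriple where
  isLinearAlgebraic : IsLinearAlgebraic G
  isKilling : LieAlgebra.IsKilling ℂ (lieAlg G)
  triple : IsLieSl2 h ν f
  finrank_ker_le : finrank ℂ (LinearMap.ker (LieAlgebra.ad ℂ (lieAlg G) ν : End ℂ (lieAlg G))) ≤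
    LieAlgebra.rank ℂ (lieAlg G)
  basis : EigenBasis h
  span_integral :
    Submodule.span ℂ {y : LieSubalgebra.engel ℂ h | ∀ j, ∃ m : ℤ, basis.lam j y = m} = ⊤

namespace PrincipalTriple

variable (S : PrincipalTriple G h ν f)

include S

theorem gr_zero : gr G h 0 = (LieSubalgebra.engel ℂ h).toSubmodule := by
  rw [gr, S.triple.engel_eq, Int.cast_zero]

/-- In the eigenbasis the algebra `𝔤_0` is diagonal, so `exp` is a homomorphism on it and its image
is already a group. -/
theorem mem_torusT_iff {g : G} : g ∈ torusT G h ↔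
    ∃ y : LieSubalgebra.engel ℂ h, mat g = NormedSpace.exp ((y : lieAlg G) : Mat) := by
  constructor
  · intro hg
    induction hg using Subgroup.closure_induction with
    | mem g hg =>
      obtain ⟨x, hx, hgx⟩ := hg
      rw [S.gr_zero] at hx
      exact ⟨⟨x, hx⟩, hgx⟩
    | one => exact ⟨0, by simp [mat]⟩
    | mul a b _ _ ha hb =>
      obtain ⟨x, hx⟩ := ha
      obtain ⟨y, hy⟩ := hb
      exact ⟨x + y, by rw [S.basis.exp_add, mat_mul, hx, hy]⟩
    | inv a _ ha =>
      obtain ⟨x, hx⟩ := ha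
      refine ⟨-x, ?_⟩
      have h1 : mat a * NormedSpace.exp (((-x : LieSubalgebra.engel ℂ h) : lieAlg G) : Mat) = 1 := by
        rw [hx, ← S.basis.exp_add]; simp
      calc mat a⁻¹ = mat a⁻¹ * (mat a * NormedSpace.exp (((-x : LieSubalgebra.engel ℂ h) : lieAlg G) : Mat)) := by
            rw [h1, mul_one]
        _ = _ := by rw [← mul_assoc, mat_inv_mul_mat, one_mul]
  · rintro ⟨y, hy⟩
    exact Subgroup.subset_closure ⟨y, by rw [S.gr_zero]; exact y.2, hy⟩

/-- The exponential map of the torus. -/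
def expT (y : LieSubalgebra.engel ℂ h) : torusT G h :=
  ⟨⟨expGL ((y : lieAlg G) : Mat), expGL_mem S.isLinearAlgebraic (y : lieAlg G).2⟩,
    Subgroup.subset_closure ⟨y, by rw [S.gr_zero]; exact y.2, rfl⟩⟩

theorem mat_expT (y : LieSubalgebra.engel ℂ h) :
    mat (S.expT y : G) = NormedSpace.exp ((y : lieAlg G) : Mat) := rfl

theorem expT_surjective (s : torusT G h) : ∃ y, S.expT y = s := by
  obtain ⟨y, hy⟩ := S.mem_torusT_iff.1 s.2
  exact ⟨y, Subtype.ext (mat_injective (by rw [mat_expT, hy]))⟩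

theorem expT_add (x y : LieSubalgebra.engel ℂ h) : S.expT (x + y) = S.expT x * S.expT y :=
  Subtype.ext (mat_injective (by
    rw [Subgroup.coe_mul, mat_mul, mat_expT, mat_expT, mat_expT, S.basis.exp_add]))

theorem co_mat_torus (s : torusT G h) :
    S.basis.co (mat (s : G)) = Matrix.diagonal fun j => S.basis.co (mat (s : G)) j j := by
  obtain ⟨y, hy⟩ := S.mem_torusT_iff.1 s.2
  rw [hy, S.basis.co_exp_coe]
  simp

/-- The eigenvalues of the elements of the torus. -/
def coord (j : Fin n) : torusT G h →* ℂˣ :=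
  MonoidHom.toHomUnits
    { toFun := fun s => S.basis.co (mat (s : G)) j j
      map_one' := by
        change S.basis.co (1 : Mat) j j = 1
        rw [map_one, Matrix.one_apply_eq]
      map_mul' := fun s s' => by
        rw [Subgroup.coe_mul, mat_mul, map_mul, S.co_mat_torus s, S.co_mat_torus s',
          Matrix.diagonal_mul_diagonal]
        simp }

theorem coe_coord (j : Fin n) (s : torusT G h) : (S.coord j s : ℂ) = S.basis.co (mat (s : G)) j j := rfl

theorem coord_expT (j : Fin n) (y : LieSubalgebra.engel ℂ h) :
    (S.coord j (S.expT y) : ℂ) = Complex.exp (S.basis.lam j y) := by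
  rw [coe_coord, mat_expT, S.basis.co_exp_coe, Matrix.diagonal_apply_eq]

theorem coord_mem_torusAlgebra (j : Fin n) :
    (fun s => (S.coord j s : ℂ)) ∈ torusAlgebra G h := by
  let l : Mat →ₗ[ℂ] ℂ :=
    { toFun := fun M => S.basis.co M j j
      map_add' := fun M N => by rw [map_add]; rfl
      map_smul' := fun c M => by rw [map_smul]; rfl }
  exact linear_mem_of_entries_mem (entry_mem_matAlgebra _) l

theorem coord_inv_mem_torusAlgebra (j : Fin n) :
    (fun s => (((S.coord j s)⁻¹ : ℂˣ) : ℂ)) ∈ torusAlgebra G h := by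
  let l : Mat →ₗ[ℂ] ℂ :=
    { toFun := fun M => S.basis.co M j j
      map_add' := fun M N => by rw [map_add]; rfl
      map_smul' := fun c M => by rw [map_smul]; rfl }
  simp only [← map_inv]
  exact linear_mem_of_entries_mem (inv_entry_mem_matAlgebra fun s : torusT G h => ((s : G) : GL (Fin n) ℂ)) l

/-- The eigenvalues as elements of the character lattice. -/
def coordChar (j : Fin n) : CharLattice G h :=
  Additive.ofMul ⟨S.coord j, S.coord_mem_torusAlgebra j, S.coord_inv_mem_torusAlgebra j⟩

theorem charEval_coordChar (j : Fin n) (s : torusT G h) : charEval (S.coordChar j) s = S.coord j s := rfl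

omit S in
theorem charEval_add (χ ψ : CharLattice G h) (s : torusT G h) :
    charEval (χ + ψ) s = charEval χ s * charEval ψ s := rfl

omit S in
theorem charEval_ext {χ ψ : CharLattice G h} (H : ∀ s, charEval χ s = charEval ψ s) : χ = ψ :=
  Additive.toMul.injective (Subtype.ext (MonoidHom.ext H))

omit S in
variable (G h) in
/-- Evaluation of characters as a homomorphism. -/
def evalHom (s : torusT G h) : CharLattice G h →+ Additive ℂˣ where
  toFun χ := Additive.ofMul (charEval χ s)
  map_zero' := rfl
  map_add' _ _ := rfl

/-- The matrix entries are linear combinations of the diagonal entries in the eigenbasis, and the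
inverse determinant is the inverse of their product; products of characters are characters. -/
theorem torusAlgebra_le_span (F : torusT G h → ℂ) (hF : F ∈ torusAlgebra G h) :
    F ∈ Submodule.span ℂ {F | ∃ χ ∈ AddSubgroup.closure (Set.range S.coordChar),
      F = fun s => (charEval χ s : ℂ)} := by
  set W := Submodule.span ℂ {F | ∃ χ ∈ AddSubgroup.closure (Set.range S.coordChar),
      F = fun s => (charEval χ s : ℂ)} with hW
  have h1 : (1 : torusT G h → ℂ) ∈ W := Submodule.subset_span ⟨0, zero_mem _, by ext; rfl⟩
  have hmul : ∀ a ∈ W, ∀ b ∈ W, a * b ∈ W := by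
    intro a ha b hb
    have : a * b ∈ W * W := Submodule.mul_mem_mul ha hb
    rw [hW, Submodule.span_mul_span] at this
    refine Submodule.span_mono ?_ this
    rintro _ ⟨_, ⟨χ, hχ, rfl⟩, _, ⟨ψ, hψ, rfl⟩, rfl⟩
    exact ⟨χ + ψ, add_mem hχ hψ, by ext s; simp [charEval_add]⟩
  have hco : ∀ j, (fun s => (S.coord j s : ℂ)) ∈ W := fun j =>
    Submodule.subset_span ⟨S.coordChar j, AddSubgroup.subset_closure ⟨j, rfl⟩, rfl⟩
  let W' : Subalgebra ℂ (torusT G h → ℂ) :=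
    { carrier := W
      mul_mem' := fun {a b} ha hb => hmul a ha b hb
      add_mem' := fun ha hb => W.add_mem ha hb
      algebraMap_mem' := fun c => by
        rw [Algebra.algebraMap_eq_smul_one]
        exact W.smul_mem _ h1 }
  suffices torusAlgebra G h ≤ W' from this hF
  refine Algebra.adjoin_le ?_
  rintro _ (⟨i, j, rfl⟩ | rfl)
  · have : (fun s : torusT G h => mat (s : G) i j) =
        ∑ k, (S.basis.Q.1 i k * (S.basis.Q⁻¹ : GL (Fin n) ℂ).1 k j) • (fun s => (S.coord k s : ℂ)) := by
      ext s
      have h2 : mat (s : G) = S.basis.co.symm (Matrix.diagonal fun j => (S.coord j s : ℂ)) := by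
        rw [AlgEquiv.eq_symm_apply, S.co_mat_torus]; rfl
      rw [h2]
      change (((S.basis.Q : Mat) * _ * ((S.basis.Q⁻¹ : GL (Fin n) ℂ) : Mat)) : Mat) i j = _
      rw [Matrix.mul_apply]
      simp only [Matrix.mul_diagonal, Finset.sum_apply, Pi.smul_apply, smul_eq_mul]
      exact Finset.sum_congr rfl fun k _ => by ring
    exact this ▸ W.sum_mem fun k _ => W.smul_mem _ (hco k)
  · refine Submodule.subset_span ⟨∑ j, -S.coordChar j, sum_mem fun j _ => neg_mem
      (AddSubgroup.subset_closure ⟨j, rfl⟩), ?_⟩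
    ext s
    have h2 := map_sum (evalHom G h s) (fun j => -S.coordChar j) Finset.univ
    have h3 : charEval (∑ j, -S.coordChar j) s = ∏ j, (S.coord j s)⁻¹ := h2
    rw [h3, ← S.basis.det_co, S.co_mat_torus, Matrix.det_diagonal, Units.coe_prod, ← Finset.prod_inv_distrib]
    exact Finset.prod_congr rfl fun j _ => by simp [coe_coord]

/-- An algebraic character is a regular function, hence a combination of the characters generated by
the eigenvalues. By Dedekind's independence it must be one of them. -/
theorem closure_coordChar : AddSubgroup.closure (Set.range S.coordChar) = ⊤ := by
  rw [eq_top_iff]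
  intro χ _
  by_contra hχ
  let v : (torusT G h →* ℂ) → torusT G h → ℂ := fun φ => φ
  have hli : LinearIndependent ℂ v := linearIndependent_monoidHom _ _
  let c : CharLattice G h → (torusT G h →* ℂ) := fun χ => (Units.coeHom ℂ).comp (Additive.toMul χ).1
  have h1 : c χ ∉ c '' (AddSubgroup.closure (Set.range S.coordChar) : Set (CharLattice G h)) := by
    rintro ⟨ψ, hψ, hc⟩
    refine hχ ?_
    rw [show χ = ψ from charEval_ext fun s => Units.ext (DFunLike.congr_fun hc.symm s)]
    exact hψ
  refine hli.notMem_span_image h1 ?_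
  refine Submodule.span_mono ?_ (S.torusAlgebra_le_span _ (Additive.toMul χ).2.1)
  rintro _ ⟨ψ, hψ, rfl⟩
  exact ⟨c ψ, ⟨ψ, hψ, rfl⟩, rfl⟩

-- If the forms differ at `y`, then `y` can be scaled so that the difference is `1`, which would
-- give `exp 1 = 1`. This makes differentials of characters unique and additive.
omit S in
theorem eq_of_exp_eq {V : Type*} [AddCommGroup V] [Module ℂ V] {l l' : Dual ℂ V}
    (H : ∀ y, Complex.exp (l y) = Complex.exp (l' y)) : l = l' := by
  ext y
  by_contra hy
  rw [← ne_eq, ← sub_ne_zero] at hy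
  have h1 := H ((l y - l' y)⁻¹ • y)
  rw [Complex.exp_eq_exp_iff_exp_sub_eq_one, ← LinearMap.sub_apply, map_smul, LinearMap.sub_apply,
    smul_eq_mul, inv_mul_cancel₀ hy] at h1
  have h2 := congrArg norm h1
  rw [Complex.norm_exp, norm_one, Complex.one_re, Real.exp_eq_one_iff] at h2
  exact one_ne_zero h2

theorem exists_differential (χ : CharLattice G h) : ∃ l : Dual ℂ (LieSubalgebra.engel ℂ h),
    l ∈ AddSubgroup.closure (Set.range S.basis.lam) ∧
    ∀ y, (charEval χ (S.expT y) : ℂ) = Complex.exp (l y) := by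
  have : χ ∈ AddSubgroup.closure (Set.range S.coordChar) := by rw [S.closure_coordChar]; trivial
  induction this using AddSubgroup.closure_induction with
  | mem χ hχ =>
    obtain ⟨j, rfl⟩ := hχ
    exact ⟨S.basis.lam j, AddSubgroup.subset_closure ⟨j, rfl⟩, fun y => S.coord_expT j y⟩
  | zero => exact ⟨0, zero_mem _, fun y => by rw [LinearMap.zero_apply, Complex.exp_zero]; rfl⟩
  | add χ ψ _ _ h1 h2 =>
    obtain ⟨l, hl, h1⟩ := h1
    obtain ⟨l', hl', h2⟩ := h2
    exact ⟨l + l', add_mem hl hl', fun y => by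
      rw [charEval_add, Units.val_mul, h1, h2, LinearMap.add_apply, Complex.exp_add]⟩
  | neg χ _ h1 =>
    obtain ⟨l, hl, h1⟩ := h1
    refine ⟨-l, neg_mem hl, fun y => ?_⟩
    rw [LinearMap.neg_apply, Complex.exp_neg, ← h1, ← Units.val_inv_eq_inv_val]
    rfl

/-- The differential of a character. -/
def D : CharLattice G h →+ Dual ℂ (LieSubalgebra.engel ℂ h) where
  toFun χ := (S.exists_differential χ).choose
  map_zero' := eq_of_exp_eq fun y => by
    rw [← (S.exists_differential 0).choose_spec.2 y, LinearMap.zero_apply, Complex.exp_zero]; rfl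
  map_add' χ ψ := eq_of_exp_eq fun y => by
    rw [← (S.exists_differential (χ + ψ)).choose_spec.2 y, LinearMap.add_apply, Complex.exp_add,
      ← (S.exists_differential χ).choose_spec.2 y, ← (S.exists_differential ψ).choose_spec.2 y]
    rfl

theorem charEval_expT (χ : CharLattice G h) (y : LieSubalgebra.engel ℂ h) :
    (charEval χ (S.expT y) : ℂ) = Complex.exp (S.D χ y) :=
  (S.exists_differential χ).choose_spec.2 y

theorem D_mem (χ : CharLattice G h) : S.D χ ∈ AddSubgroup.closure (Set.range S.basis.lam) :=
  (S.exists_differential χ).choose_spec.1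

theorem D_injective : Function.Injective S.D := fun χ ψ H => charEval_ext fun s => by
  obtain ⟨y, rfl⟩ := S.expT_surjective s
  exact Units.ext (by rw [S.charEval_expT, S.charEval_expT, H])

theorem D_coordChar (j : Fin n) : S.D (S.coordChar j) = S.basis.lam j :=
  eq_of_exp_eq fun y => by rw [← S.charEval_expT]; exact S.coord_expT j y

theorem expT_eq_iff (x y : LieSubalgebra.engel ℂ h) : S.expT x = S.expT y ↔
    ∀ χ : CharLattice G h, Complex.exp (S.D χ x) = Complex.exp (S.D χ y) := by
  constructor
  · intro H χ
    rw [← S.charEval_expT, H, S.charEval_expT]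
  · intro H
    refine Subtype.ext (mat_injective (S.basis.co.toEquiv.injective ?_))
    change S.basis.co _ = S.basis.co _
    rw [mat_expT, mat_expT, S.basis.co_exp_coe, S.basis.co_exp_coe]
    congr 1
    ext j
    rw [← S.D_coordChar, H]

theorem exists_int_D_apply (χ : CharLattice G h) (y : LieSubalgebra.engel ℂ h)
    (hy : ∀ j, ∃ m : ℤ, S.basis.lam j y = m) : ∃ m : ℤ, S.D χ y = m := by
  have h1 := S.D_mem χ
  generalize S.D χ = l at h1 ⊢
  induction h1 using AddSubgroup.closure_induction with
  | mem l hl => obtain ⟨j, rfl⟩ := hl; exact hy j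
  | zero => exact ⟨0, by simp⟩
  | add a b _ _ ha hb =>
    obtain ⟨k, hk⟩ := ha
    obtain ⟨l, hl⟩ := hb
    exact ⟨k + l, by rw [LinearMap.add_apply, hk, hl]; push_cast; rfl⟩
  | neg a _ ha =>
    obtain ⟨k, hk⟩ := ha
    exact ⟨-k, by rw [LinearMap.neg_apply, hk]; push_cast; rfl⟩

end PrincipalTriple

end Torus

/-! ### Roots and simple roots of `T`, and the map `ρ` -/

section Roots

attribute [local instance 100] LieRing.ofAssociativeRing

open LieAlgebra LieAlgebra.IsKilling LieModule Module

variable {n : ℕ} {G : Subgroup (GL (Fin n) ℂ)} {h ν f : lieAlg G}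

local notation "Mat" => Matrix (Fin n) (Fin n) ℂ

theorem nonempty_principalTriple (hG : IsLinearAlgebraic G)
    (hss : LieAlgebra.HasTrivialRadical ℂ (lieAlg G)) (hν : IsPrincipal G ν)
    (t : IsLieSl2 h ν f) : Nonempty (PrincipalTriple G h ν f) := by
  have hK : IsKilling ℂ (lieAlg G) := inferInstance
  have hr := hν.finrank_ker_ad_le_rank
  have : (LieSubalgebra.engel ℂ h).IsCartanSubalgebra := t.isCartanSubalgebra hr
  obtain ⟨Q, lam, h1, h2⟩ := exists_eigenbasis (LieSubalgebra.engel ℂ h)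
  exact ⟨{
    isLinearAlgebraic := hG
    isKilling := hK
    triple := t
    finrank_ker_le := hr
    basis := ⟨Q, lam, h1⟩
    span_integral := by
      rw [eq_top_iff, ← span_range_coroot, Submodule.span_le]
      rintro _ ⟨α, rfl⟩
      exact Submodule.subset_span fun j => h2 j α }⟩

namespace PrincipalTriple

variable (S : PrincipalTriple G h ν f)

include S

theorem isCartanSubalgebra : (LieSubalgebra.engel ℂ h).IsCartanSubalgebra :=
  S.triple.isCartanSubalgebra S.finrank_ker_le

theorem co_lie (y : LieSubalgebra.engel ℂ h) (x : lieAlg G) (j k : Fin n) :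
    S.basis.co ((⁅(y : lieAlg G), x⁆ : lieAlg G) : Mat) j k =
      (S.basis.lam j y - S.basis.lam k y) * S.basis.co (x : Mat) j k := by
  rw [coe_lie, map_sub, map_mul, map_mul, S.basis.co_coe, Matrix.sub_apply, Matrix.diagonal_mul,
    Matrix.mul_diagonal]
  ring

theorem co_injective : Function.Injective (fun x : lieAlg G => S.basis.co (x : Mat)) :=
  S.basis.co.toEquiv.injective.comp Subtype.val_injective

/-- Conjugation by `exp y` multiplies the entry `(j, k)` in the eigenbasis by `exp` of `(lam j - lam
k) y`, so a weight vector has nonzero entries only where this difference is the differential of the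
weight. -/
theorem isWeightVector_iff_co {χ : CharLattice G h} {x : lieAlg G} : IsWeightVector G h χ x ↔
    ∀ j k, S.basis.co (x : Mat) j k ≠ 0 → S.basis.lam j - S.basis.lam k = S.D χ := by
  have key : ∀ y : LieSubalgebra.engel ℂ h,
      (IsAd (S.expT y : G) x ((charEval χ (S.expT y) : ℂ) • x) ↔
      ∀ j k, Complex.exp ((S.basis.lam j - S.basis.lam k) y) * S.basis.co (x : Mat) j k =
        Complex.exp (S.D χ y) * S.basis.co (x : Mat) j k) := by
    intro y
    have hinv : mat (S.expT y : G)⁻¹ = NormedSpace.exp (((-y : LieSubalgebra.engel ℂ h) : lieAlg G) : Mat) := by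
      rw [← S.mat_expT]
      have : S.expT y * S.expT (-y) = 1 := by
        rw [← S.expT_add, add_neg_cancel]
        exact Subtype.ext (mat_injective (by rw [S.mat_expT]; exact NormedSpace.exp_zero))
      rw [← Subgroup.coe_inv, inv_eq_of_mul_eq_one_right this]
    rw [IsAd, hinv, S.mat_expT, ← S.basis.co.toEquiv.injective.eq_iff]
    change S.basis.co ((charEval χ (S.expT y) : ℂ) • (x : Mat)) = S.basis.co _ ↔ _
    rw [map_smul, map_mul, map_mul, S.basis.co_exp_coe, S.basis.co_exp_coe, ← Matrix.ext_iff,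
      S.charEval_expT]
    refine forall_congr' fun j => forall_congr' fun k => ?_
    rw [Matrix.mul_diagonal, Matrix.diagonal_mul, Matrix.smul_apply, smul_eq_mul, map_neg,
      LinearMap.sub_apply, sub_eq_add_neg, Complex.exp_add, eq_comm]
    rw [mul_right_comm]
  constructor
  · intro H j k hjk
    refine eq_of_exp_eq fun y => ?_
    exact mul_right_cancel₀ hjk ((key y).1 (H _) j k)
  · intro H t
    obtain ⟨y, rfl⟩ := S.expT_surjective t
    rw [key]
    intro j k
    by_cases hjk : S.basis.co (x : Mat) j k = 0
    · rw [hjk, mul_zero, mul_zero]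
    · rw [H j k hjk]

theorem isWeightVector_iff {χ : CharLattice G h} {x : lieAlg G} : IsWeightVector G h χ x ↔
    ∀ y : LieSubalgebra.engel ℂ h, ⁅(y : lieAlg G), x⁆ = S.D χ y • x := by
  rw [S.isWeightVector_iff_co]
  have key : ∀ y : LieSubalgebra.engel ℂ h, (⁅(y : lieAlg G), x⁆ = S.D χ y • x ↔ ∀ j k,
      (S.basis.lam j - S.basis.lam k) y * S.basis.co (x : Mat) j k =
        S.D χ y * S.basis.co (x : Mat) j k) := by
    intro y
    rw [← S.co_injective.eq_iff, ← Matrix.ext_iff]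
    refine forall_congr' fun j => forall_congr' fun k => ?_
    rw [S.co_lie]
    change _ = S.basis.co (S.D χ y • (x : Mat)) j k ↔ _
    rw [map_smul, Matrix.smul_apply, smul_eq_mul, LinearMap.sub_apply]
  simp only [key]
  constructor
  · intro H y j k
    by_cases hjk : S.basis.co (x : Mat) j k = 0
    · rw [hjk, mul_zero, mul_zero]
    · rw [H j k hjk]
  · intro H j k hjk
    ext y
    exact mul_right_cancel₀ hjk (H y j k)

/-- A root integrates to the group: at any nonzero matrix entry of a root vector it is the
difference of two eigenvalue weights, which are differentials of characters. -/
theorem exists_char_of_weight [(LieSubalgebra.engel ℂ h).IsCartanSubalgebra]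
    (α : Weight ℂ (LieSubalgebra.engel ℂ h) (lieAlg G)) :
    ∃ χ : CharLattice G h, S.D χ = α.toLinear := by
  have := S.isKilling
  obtain ⟨x, hx, hx0⟩ := α.exists_ne_zero
  have h1 : S.basis.co (x : Mat) ≠ 0 := by
    intro h0
    refine hx0 (S.co_injective ?_)
    change S.basis.co (x : Mat) = S.basis.co (0 : Mat)
    rw [h0, map_zero]
  obtain ⟨j, k, hjk⟩ : ∃ j k, S.basis.co (x : Mat) j k ≠ 0 := by
    by_contra! H
    exact h1 (Matrix.ext H)
  refine ⟨S.coordChar j - S.coordChar k, ?_⟩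
  ext y
  rw [map_sub, S.D_coordChar, S.D_coordChar]
  have h2 : ⁅(y : lieAlg G), x⁆ = α y • x := lie_eq_smul_of_mem_rootSpace hx y
  have h3 := S.co_lie y x j k
  rw [h2] at h3
  change S.basis.co (α y • (x : Mat)) j k = _ at h3
  rw [map_smul, Matrix.smul_apply, smul_eq_mul] at h3
  exact (mul_right_cancel₀ hjk h3).symm

theorem isWeightVector_iff_mem_wt [(LieSubalgebra.engel ℂ h).IsCartanSubalgebra]
    {χ : CharLattice G h} {x : lieAlg G} :
    IsWeightVector G h χ x ↔ x ∈ wt (LieSubalgebra.engel ℂ h) (S.D χ) := by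
  have := S.isKilling
  rw [S.isWeightVector_iff]
  constructor
  · intro H
    exact weightSpace_le_genWeightSpace (lieAlg G) _ ((mem_weightSpace _ _).2 H)
  · intro hx y
    exact lie_eq_smul_of_mem_rootSpace hx y

theorem exists_weight_of_isWeightVector [(LieSubalgebra.engel ℂ h).IsCartanSubalgebra]
    {χ : CharLattice G h} {x : lieAlg G} (hx0 : x ≠ 0) (hx : IsWeightVector G h χ x) :
    ∃ α : Weight ℂ (LieSubalgebra.engel ℂ h) (lieAlg G), α.toLinear = S.D χ := by
  have := S.isKilling
  rw [S.isWeightVector_iff_mem_wt] at hx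
  refine ⟨⟨S.D χ, ?_⟩, rfl⟩
  intro hbot
  have h2 : x ∈ genWeightSpace (lieAlg G) (S.D χ : LieSubalgebra.engel ℂ h → ℂ) := hx
  rw [hbot] at h2
  exact hx0 ((LieSubmodule.mem_bot x).1 h2)

omit S in
/-- `h` as an element of its centralizer. -/
def neutral (h : lieAlg G) : LieSubalgebra.engel ℂ h := ⟨h, LieSubalgebra.self_mem_engel ℂ h⟩

omit S in
theorem exists_int_of_mem_grGE {k : ℤ} {c : ℂ} {x : lieAlg G} (hx : x ∈ grGE G h k) (hx0 : x ≠ 0)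
    (hc : ⁅h, x⁆ = c • x) : ∃ i : ℤ, k ≤ i ∧ c = i := by
  by_contra! H
  have h1 := (Module.End.eigenspaces_iSupIndep (ad ℂ (lieAlg G) h : End ℂ (lieAlg G))) c
  have h2 : grGE G h k ≤ ⨆ (d : ℂ) (_ : d ≠ c), Module.End.eigenspace (ad ℂ (lieAlg G) h : End ℂ (lieAlg G)) d := by
    refine iSup_le fun i => ?_
    exact le_iSup₂_of_le (i : ℂ) (H i i.2).symm le_rfl
  exact hx0 (Submodule.disjoint_def.1 h1 x (Module.End.mem_eigenspace_iff.2 hc) (h2 hx))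

theorem mem_posRoots_iff [(LieSubalgebra.engel ℂ h).IsCartanSubalgebra] {χ : CharLattice G h} :
    χ ∈ posRoots G h ↔ ∃ (α : Weight ℂ (LieSubalgebra.engel ℂ h) (lieAlg G)) (k : ℤ),
      α.toLinear = S.D χ ∧ α (neutral h) = k ∧ 0 < k := by
  have := S.isKilling
  constructor
  · rintro ⟨x, hx, hx0, hχ⟩
    obtain ⟨α, hα⟩ := S.exists_weight_of_isWeightVector hx0 hχ
    have h1 := S.isWeightVector_iff.1 hχ (neutral h)
    obtain ⟨i, hi, hc⟩ := exists_int_of_mem_grGE hx hx0 h1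
    refine ⟨α, i, hα, ?_, by omega⟩
    rw [← hc, ← hα]; rfl
  · rintro ⟨α, k, hα, hk, hk0⟩
    obtain ⟨x, hx, hx0⟩ := α.exists_ne_zero
    have h1 : IsWeightVector G h χ x := by
      rw [S.isWeightVector_iff_mem_wt, ← hα]; exact hx
    refine ⟨x, ?_, hx0, h1⟩
    refine Submodule.mem_iSup_of_mem (⟨k, by omega⟩ : {i : ℤ // 1 ≤ i}) ?_
    rw [gr, Module.End.mem_eigenspace_iff]
    have h2 := S.isWeightVector_iff.1 h1 (neutral h)
    rw [← hα] at h2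
    change _ = α (neutral h) • x at h2
    rw [hk] at h2
    exact h2

/-- All positive roots have height at least `2`. Those of larger height decompose by `exists_add`,
and height `2` is too small for a sum of two positive roots. -/
theorem mem_simpleRoots_iff [(LieSubalgebra.engel ℂ h).IsCartanSubalgebra] {χ : CharLattice G h} :
    χ ∈ simpleRoots G h ↔ ∃ α : SimpleWeight (H := LieSubalgebra.engel ℂ h) rfl,
      α.1.toLinear = S.D χ := by
  have := S.isKilling
  have hge : ∀ {β : CharLattice G h}, β ∈ posRoots G h → ∃ (α : Weight ℂ (LieSubalgebra.engel ℂ h) (lieAlg G)) (k : ℤ),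
      α.toLinear = S.D β ∧ α (neutral h) = k ∧ 2 ≤ k := by
    intro β hβ
    obtain ⟨α, k, h1, h2, h3⟩ := S.mem_posRoots_iff.1 hβ
    have hnz : α.IsNonZero := by
      intro hz
      have h4 : α (neutral h) = 0 := by rw [hz]; rfl
      rw [h2] at h4
      norm_cast at h4
      omega
    obtain ⟨k', h4, h5⟩ := S.triple.exists_nat_height S.finrank_ker_le rfl hnz
    have : k = k' := by exact_mod_cast h2.symm.trans h4
    exact ⟨α, k, h1, h2, by omega⟩
  constructor
  · rintro ⟨hχ, hns⟩
    obtain ⟨α, k, h1, h2, h3⟩ := hge hχ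
    rcases eq_or_lt_of_le h3 with rfl | h3
    · exact ⟨⟨α, h2.trans (by norm_num)⟩, h1⟩
    · obtain ⟨β, γ, hβ, hγ, hαβ⟩ := S.triple.exists_add rfl h2 (by omega)
      obtain ⟨β', hβ'⟩ := S.exists_char_of_weight β
      obtain ⟨γ', hγ'⟩ := S.exists_char_of_weight γ
      refine absurd (S.D_injective ?_) (hns β' (S.mem_posRoots_iff.2 ⟨β, 2, hβ'.symm, hβ.trans (by norm_num), by omega⟩)
        γ' (S.mem_posRoots_iff.2 ⟨γ, k - 2, hγ'.symm, hγ, by omega⟩))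
      rw [map_add, hβ', hγ', ← h1]
      ext z; exact congrFun hαβ z
  · rintro ⟨α, hα⟩
    refine ⟨S.mem_posRoots_iff.2 ⟨α.1, 2, hα, α.2.trans (by norm_num), by omega⟩, ?_⟩
    rintro β hβ γ hγ rfl
    obtain ⟨β', k, h1, h2, h3⟩ := hge hβ
    obtain ⟨γ', l, h4, h5, h6⟩ := hge hγ
    have h7 := LinearMap.congr_fun hα (neutral h)
    rw [map_add, ← h1, ← h4] at h7
    have h8 : (2 : ℂ) = k + l := by
      rw [← h2, ← h5]
      exact (show (2 : ℂ) = _ from α.2.symm).trans h7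
    norm_cast at h8
    omega

/-- The simple roots are the weights of height `2`. -/
theorem exists_simpleWeight_equiv [(LieSubalgebra.engel ℂ h).IsCartanSubalgebra] :
    ∃ e : simpleRoots G h ≃ SimpleWeight (H := LieSubalgebra.engel ℂ h) (L := lieAlg G) rfl,
      ∀ α, (e α).1.toLinear = S.D α.1 := by
  choose e he using fun α : simpleRoots G h => S.mem_simpleRoots_iff.1 α.2
  refine ⟨Equiv.ofBijective e ⟨fun α β hαβ => ?_, fun α => ?_⟩, he⟩
  · exact Subtype.ext (S.D_injective (by rw [← he, ← he, hαβ]))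
  · obtain ⟨χ, hχ⟩ := S.exists_char_of_weight α.1
    refine ⟨⟨χ, S.mem_simpleRoots_iff.2 ⟨α, hχ.symm⟩⟩, ?_⟩
    refine Subtype.ext (DFunLike.coe_injective ?_)
    have := (he ⟨χ, S.mem_simpleRoots_iff.2 ⟨α, hχ.symm⟩⟩).trans hχ
    ext z
    exact LinearMap.congr_fun this z

theorem finite_simpleRoots : Finite (simpleRoots G h) := by
  have := S.isKilling
  have := S.isCartanSubalgebra
  obtain ⟨e, -⟩ := S.exists_simpleWeight_equiv
  exact Finite.of_equiv _ e.symm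

theorem linearIndependent_D_simpleRoots :
    LinearIndependent ℂ (fun α : simpleRoots G h => S.D α.1) := by
  have := S.isKilling
  have := S.isCartanSubalgebra
  obtain ⟨e, he⟩ := S.exists_simpleWeight_equiv
  have h1 := (S.triple.linearIndependent_simpleWeight S.finrank_ker_le
    (H := LieSubalgebra.engel ℂ h) rfl).comp e e.injective
  convert h1 using 1
  ext α : 1
  exact (he α).symm

theorem span_D_simpleRoots :
    Submodule.span ℂ (Set.range fun α : simpleRoots G h => S.D α.1) = ⊤ := by
  have := S.isKilling
  have := S.isCartanSubalgebra
  obtain ⟨e, he⟩ := S.exists_simpleWeight_equiv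
  rw [← S.triple.span_simpleWeight S.finrank_ker_le (H := LieSubalgebra.engel ℂ h) rfl]
  congr 1
  rw [← e.surjective.range_comp]
  congr 1
  ext α : 1
  exact (he α).symm

theorem D_simpleRoot_neutral (α : simpleRoots G h) : S.D α.1 (neutral h) = 2 := by
  have := S.isKilling
  have := S.isCartanSubalgebra
  obtain ⟨e, he⟩ := S.exists_simpleWeight_equiv
  rw [← he]
  exact (e α).2

/-- A root of positive height is a sum of weights of height `2`; one of negative height is the
opposite of such a root. -/
theorem roots_subset_closure :
    roots G h ⊆ (AddSubgroup.closure (simpleRoots G h) : Set (CharLattice G h)) := by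
  have := S.isKilling
  have := S.isCartanSubalgebra
  obtain ⟨e, he⟩ := S.exists_simpleWeight_equiv
  have key : ∀ (α : Weight ℂ (LieSubalgebra.engel ℂ h) (lieAlg G)) (k : ℤ) (χ : CharLattice G h),
      α.toLinear = S.D χ → α (neutral h) = k → 0 < k → χ ∈ AddSubgroup.closure (simpleRoots G h) := by
    intro α k χ h1 h2 h3
    have h4 := S.triple.mem_closure_of_height_pos (H := LieSubalgebra.engel ℂ h) rfl S.finrank_ker_le h2 h3
    have h5 : AddSubmonoid.closure (Set.range fun β : SimpleWeight (H := LieSubalgebra.engel ℂ h) (L := lieAlg G) rfl =>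
        (β.1.toLinear : LieSubalgebra.engel ℂ h →ₗ[ℂ] ℂ)) ≤
        ((AddSubgroup.closure (simpleRoots G h)).map S.D).toAddSubmonoid := by
      rw [AddSubmonoid.closure_le]
      rintro _ ⟨β, rfl⟩
      refine ⟨(e.symm β).1, AddSubgroup.subset_closure (e.symm β).2, ?_⟩
      rw [← he, Equiv.apply_symm_apply]
    obtain ⟨ψ, hψ, h6⟩ := h5 h4
    rwa [← S.D_injective (h6.trans h1)]
  rintro χ ⟨hχ0, x, hx0, hx⟩
  obtain ⟨α, hα⟩ := S.exists_weight_of_isWeightVector hx0 hx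
  have hnz : α.IsNonZero := by
    intro hz
    refine hχ0 (S.D_injective ?_)
    rw [map_zero, ← hα]
    ext z
    exact congrFun hz z
  obtain ⟨k, h1, h2⟩ := S.triple.exists_nat_height S.finrank_ker_le rfl hnz
  rcases h2 with h2 | h2
  · exact key α k χ hα h1 (by omega)
  · have h3 := key (-α) (-k) (-χ) (by rw [Weight.toLinear_neg, hα, map_neg])
      (by rw [Int.cast_neg, ← h1]; rfl) (by omega)
    simpa using h3

theorem simpleRoots_subset_roots : simpleRoots G h ⊆ roots G h := by
  rintro χ hχ
  obtain ⟨x, -, hx0, hx⟩ := hχ.1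
  refine ⟨?_, x, hx0, hx⟩
  rintro rfl
  have := S.D_simpleRoot_neutral ⟨0, hχ⟩
  simp at this

theorem gr_one : gr G h 1 = ⊥ := by
  rw [gr, Int.cast_one]
  exact S.triple.eigenspace_one S.finrank_ker_le

theorem nilradical_eq : nilradical G h = grGE G h 2 := by
  refine le_antisymm (iSup_le fun ⟨i, hi⟩ => ?_) (iSup_le fun ⟨i, hi⟩ => ?_)
  · rcases eq_or_lt_of_le hi with rfl | hi
    · rw [S.gr_one]; exact bot_le
    · exact le_iSup_of_le (⟨i, by omega⟩ : {i : ℤ // 2 ≤ i}) le_rfl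
  · exact le_iSup_of_le (⟨i, by omega⟩ : {i : ℤ // 1 ≤ i}) le_rfl

/-- `ν` has degree `2`, and `𝔤_2` is the sum of the simple root spaces. -/
theorem exists_rootVectors : ∃ E : simpleRoots G h → lieAlg G,
    (∀ α, IsWeightVector G h α.1 (E α)) ∧ ν = ∑ᶠ α, E α := by
  have := S.isKilling
  have := S.isCartanSubalgebra
  have := S.finite_simpleRoots
  have : Fintype (simpleRoots G h) := Fintype.ofFinite _
  obtain ⟨e, he⟩ := S.exists_simpleWeight_equiv
  have h1 : ν ∈ Module.End.eigenspace (ad ℂ (lieAlg G) h : End ℂ (lieAlg G)) 2 := by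
    rw [Module.End.mem_eigenspace_iff]
    exact S.triple.lie_h_e.trans (ofNat_smul_eq_nsmul ℂ 2 ν).symm
  have h2 := mem_iSup_wt_of_mem_eigenspace (H := LieSubalgebra.engel ℂ h) rfl h1
  have h3 : ν ∈ ⨆ α : simpleRoots G h, wt (LieSubalgebra.engel ℂ h) (S.D α.1) := by
    have hle : (⨆ (α : Weight ℂ (LieSubalgebra.engel ℂ h) (lieAlg G))
        (_ : height (H := LieSubalgebra.engel ℂ h) rfl α = 2), wt (LieSubalgebra.engel ℂ h) α) ≤
        ⨆ α : simpleRoots G h, wt (LieSubalgebra.engel ℂ h) (S.D α.1) :=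
      iSup₂_le fun α hα => ?_
    · exact hle h2
    refine le_iSup_of_le (e.symm ⟨α, hα⟩) (le_of_eq ?_)
    rw [← he, Equiv.apply_symm_apply]; rfl
  obtain ⟨x, hx, hsum⟩ := (Submodule.mem_iSup_iff_exists_finsupp _ _).1 h3
  refine ⟨x, fun α => S.isWeightVector_iff_mem_wt.2 (hx α), ?_⟩
  rw [finsum_eq_sum_of_fintype, ← hsum, Finsupp.sum_fintype _ _ fun _ => rfl]

/-- Weight spaces of distinct weights are independent. The choice of root vectors in `IsRho` is thus
forced by `ν`, and `ρ` is a function. -/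
theorem rootVectors_unique {E E' : simpleRoots G h → lieAlg G}
    (hE : ∀ α, IsWeightVector G h α.1 (E α)) (hE' : ∀ α, IsWeightVector G h α.1 (E' α))
    (hsum : ∑ᶠ α, E α = ∑ᶠ α, E' α) : E = E' := by
  have := S.isKilling
  have := S.isCartanSubalgebra
  have := S.finite_simpleRoots
  have : Fintype (simpleRoots G h) := Fintype.ofFinite _
  classical
  have h1 : iSupIndep fun α : simpleRoots G h => wt (LieSubalgebra.engel ℂ h) (S.D α.1) :=
    (iSupIndep_wt (H := LieSubalgebra.engel ℂ h)).comp
      (DFunLike.coe_injective.comp (S.D_injective.comp Subtype.val_injective))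
  rw [finsum_eq_sum_of_fintype, finsum_eq_sum_of_fintype, ← sub_eq_zero, ← Finset.sum_sub_distrib] at hsum
  ext1 α
  rw [← sub_eq_zero]
  refine Submodule.disjoint_def.1 (h1 α) _ (Submodule.sub_mem _ (S.isWeightVector_iff_mem_wt.1 (hE α))
    (S.isWeightVector_iff_mem_wt.1 (hE' α))) ?_
  rw [← Finset.add_sum_erase _ _ (Finset.mem_univ α), add_eq_zero_iff_eq_neg] at hsum
  rw [hsum]
  refine Submodule.neg_mem _ (Submodule.sum_mem _ fun β hβ => ?_)
  refine Submodule.mem_iSup_of_mem β (Submodule.mem_iSup_of_mem (Finset.ne_of_mem_erase hβ) ?_)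
  exact Submodule.sub_mem _ (S.isWeightVector_iff_mem_wt.1 (hE β)) (S.isWeightVector_iff_mem_wt.1 (hE' β))

/-- The root vectors with sum `ν`. -/
def E : simpleRoots G h → lieAlg G := S.exists_rootVectors.choose

theorem isWeightVector_E (α : simpleRoots G h) : IsWeightVector G h α.1 (S.E α) :=
  S.exists_rootVectors.choose_spec.1 α

/-- The map `ρ`. -/
def rho (v : ToricPoint (latticeP G h)) : lieAlg G :=
  ∑ᶠ α, toricEval v (toReal G h α.1) (simpleRoot_mem G h α) • S.E α

theorem isRho_iff {v : ToricPoint (latticeP G h)} {y : lieAlg G} :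
    IsRho G h ν v y ↔ y = S.rho v := by
  constructor
  · rintro ⟨E, hE, hν, hy⟩
    have h1 := S.rootVectors_unique hE S.isWeightVector_E
      (hν.symm.trans S.exists_rootVectors.choose_spec.2)
    rw [hy, h1]; rfl
  · rintro rfl
    exact ⟨S.E, S.isWeightVector_E, S.exists_rootVectors.choose_spec.2, rfl⟩

end PrincipalTriple

end Roots

/-! ### The character lattice, the root lattice and the lattices `Q_d` -/

section Lattice

attribute [local instance 100] LieRing.ofAssociativeRing

open Module

variable {n : ℕ} {G : Subgroup (GL (Fin n) ℂ)} {h ν f : lieAlg G}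

namespace PrincipalTriple

variable (S : PrincipalTriple G h ν f)

include S

/-- The root lattice has finite index in the character lattice. -/
theorem exists_nsmul_mem_closure :
    ∃ d : ℕ, 0 < d ∧ ∀ χ : CharLattice G h, d • χ ∈ AddSubgroup.closure (simpleRoots G h) := by
  classical
  have := S.finite_simpleRoots
  have : Fintype (simpleRoots G h) := Fintype.ofFinite _
  -- The vectors on which all eigenvalue weights are integral span `𝔱`, so a basis can be chosen
  -- among them; every character has integral coordinates with respect to it.
  obtain ⟨b, hb, hspan, hli⟩ := exists_linearIndependent ℂ
    {y : LieSubalgebra.engel ℂ h | ∀ j, ∃ m : ℤ, S.basis.lam j y = m}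
  rw [S.span_integral] at hspan
  let B : Basis b ℂ (LieSubalgebra.engel ℂ h) := Basis.mk hli (by rw [Subtype.range_coe]; exact hspan.ge)
  let B' : Basis (simpleRoots G h) ℂ (Dual ℂ (LieSubalgebra.engel ℂ h)) :=
    Basis.mk S.linearIndependent_D_simpleRoots S.span_D_simpleRoots.ge
  have hfin : Finite b := Module.Finite.finite_basis B
  have : Fintype b := Fintype.ofFinite _
  have hcard : Fintype.card (simpleRoots G h) = Fintype.card b := by
    rw [← finrank_eq_card_basis B, ← finrank_eq_card_basis B', Subspace.dual_finrank_eq]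
  let ε : simpleRoots G h ≃ b := Fintype.equivOfCardEq hcard
  have hint : ∀ (χ : CharLattice G h) (i : simpleRoots G h), ∃ m : ℤ, S.D χ (ε i) = m :=
    fun χ i => S.exists_int_D_apply χ _ (hb (ε i).2)
  choose x hx using hint
  let A : Matrix (simpleRoots G h) (simpleRoots G h) ℤ := Matrix.of fun α i => x α.1 i
  have hext : ∀ l l' : Dual ℂ (LieSubalgebra.engel ℂ h), (∀ i, l (ε i) = l' (ε i)) → l = l' := by
    intro l l' H
    refine B.ext fun i => ?_
    have := H (ε.symm i)
    rw [Equiv.apply_symm_apply] at this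
    simpa [B] using this
  have hA : A.det ≠ 0 := by
    intro h0
    obtain ⟨v, hv0, hv⟩ := Matrix.exists_vecMul_eq_zero_iff.2 h0
    refine hv0 ?_
    have h1 : ∑ α, (v α : ℂ) • S.D α.1 = 0 := by
      refine hext _ _ fun i => ?_
      rw [LinearMap.sum_apply, LinearMap.zero_apply]
      have := congrFun hv i
      simp only [Matrix.vecMul, dotProduct, Pi.zero_apply] at this
      have h2 : ((∑ α, v α * A α i : ℤ) : ℂ) = 0 := by rw [this, Int.cast_zero]
      rw [← h2]
      push_cast
      refine Finset.sum_congr rfl fun α _ => ?_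
      rw [LinearMap.smul_apply, hx, smul_eq_mul]; rfl
    ext α
    exact_mod_cast Fintype.linearIndependent_iff.1 S.linearIndependent_D_simpleRoots _ h1 α
  -- Cramer's rule: multiplying by the adjugate expresses `det A` times a character by simple roots
  -- with integral coefficients, so `|det A|` can serve as `d`.
  have key : ∀ χ : CharLattice G h, A.det • χ ∈ AddSubgroup.closure (simpleRoots G h) := by
    intro χ
    have h1 : A.det • χ = ∑ α : simpleRoots G h, (Matrix.vecMul (x χ) A.adjugate α) • α.1 := by
      refine S.D_injective (hext _ _ fun i => ?_)
      have h2 : Matrix.vecMul (Matrix.vecMul (x χ) A.adjugate) A = A.det • x χ := by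
        rw [Matrix.vecMul_vecMul, Matrix.adjugate_mul, Matrix.vecMul_smul, Matrix.vecMul_one]
      have h3 := congrFun h2 i
      simp only [Pi.smul_apply, smul_eq_mul] at h3
      rw [map_zsmul, map_sum, LinearMap.smul_apply, hx, LinearMap.sum_apply, zsmul_eq_mul,
        ← Int.cast_mul, ← h3]
      conv_lhs => rw [Matrix.vecMul, dotProduct]
      push_cast
      refine Finset.sum_congr rfl fun α _ => ?_
      rw [map_zsmul, LinearMap.smul_apply, hx, zsmul_eq_mul]; rfl
    rw [h1]
    exact sum_mem fun α _ => zsmul_mem (AddSubgroup.subset_closure α.2) _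
  refine ⟨A.det.natAbs, Int.natAbs_pos.2 hA, fun χ => ?_⟩
  rcases Int.natAbs_eq A.det with h1 | h1
  · rw [← natCast_zsmul, ← h1]; exact key χ
  · have := key χ
    rw [h1, neg_smul] at this
    rw [← natCast_zsmul]
    simpa using this

/-- The real linear extension of the differential. -/
def DR : RealSpan G h →ₗ[ℝ] Dual ℂ (LieSubalgebra.engel ℂ h) :=
  S.D.toIntLinearMap.liftBaseChange ℝ

theorem DR_toReal (χ : CharLattice G h) : S.DR (toReal G h χ) = S.D χ := by
  change S.D.toIntLinearMap.liftBaseChange ℝ ((1 : ℝ) ⊗ₜ χ) = _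
  rw [LinearMap.liftBaseChange_tmul, one_smul]; rfl

theorem toReal_injective : Function.Injective (toReal G h) := fun χ ψ H =>
  S.D_injective (by rw [← S.DR_toReal, H, S.DR_toReal])

/-- The differential extends to the real span of the characters, where the simple roots go to
vectors that are independent even over `ℂ`. -/
theorem linearIndependent_toReal_simpleRoots :
    LinearIndependent ℝ (fun α : simpleRoots G h => toReal G h α.1) := by
  have h1 := S.linearIndependent_D_simpleRoots.restrict_scalars (R := ℝ) (fun a b hab => by
    simpa using hab)
  refine LinearIndependent.of_comp S.DR ?_
  convert h1 using 1
  ext α : 1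
  exact S.DR_toReal α.1

theorem span_toReal_simpleRoots :
    Submodule.span ℝ (Set.range fun α : simpleRoots G h => toReal G h α.1) = ⊤ := by
  rw [eq_top_iff]
  set W := Submodule.span ℝ (Set.range fun α : simpleRoots G h => toReal G h α.1)
  obtain ⟨d, hd, h1⟩ := S.exists_nsmul_mem_closure
  have h2 : AddSubgroup.closure (simpleRoots G h) ≤ W.toAddSubgroup.comap (toReal G h) := by
    rw [AddSubgroup.closure_le]
    exact fun α hα => Submodule.subset_span ⟨⟨α, hα⟩, rfl⟩
  have h3 : ∀ χ, toReal G h χ ∈ W := by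
    intro χ
    have h4 : toReal G h (d • χ) ∈ W := h2 (h1 χ)
    rw [map_nsmul, ← Nat.cast_smul_eq_nsmul ℝ] at h4
    exact (W.smul_mem_iff (Nat.cast_ne_zero.2 hd.ne')).1 h4
  intro x _
  induction x using TensorProduct.induction_on with
  | zero => exact zero_mem _
  | tmul c χ =>
    have : c ⊗ₜ[ℤ] χ = c • toReal G h χ := by
      change _ = c • ((1 : ℝ) ⊗ₜ[ℤ] χ)
      rw [TensorProduct.smul_tmul', smul_eq_mul, mul_one]
    rw [this]
    exact W.smul_mem _ (h3 χ)
  | add x y hx hy => exact W.add_mem (hx trivial) (hy trivial)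

/-- The simple roots as a basis of the real span of the characters. -/
def simpleBasis : Basis (simpleRoots G h) ℝ (RealSpan G h) :=
  Basis.mk S.linearIndependent_toReal_simpleRoots S.span_toReal_simpleRoots.ge

theorem simpleBasis_apply (α : simpleRoots G h) : S.simpleBasis α = toReal G h α.1 := by
  simp [simpleBasis]

theorem latticeQ_eq_closure : latticeQ G h = AddSubgroup.closure (Set.range S.simpleBasis) := by
  refine le_antisymm ?_ ?_
  · rw [latticeQ, AddSubgroup.closure_le]
    rintro _ ⟨χ, hχ, rfl⟩
    have h1 : AddSubgroup.closure (simpleRoots G h) ≤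
        (AddSubgroup.closure (Set.range S.simpleBasis)).comap (toReal G h) := by
      rw [AddSubgroup.closure_le]
      intro α hα
      exact AddSubgroup.subset_closure (⟨⟨α, hα⟩, S.simpleBasis_apply ⟨α, hα⟩⟩ :
        toReal G h α ∈ Set.range S.simpleBasis)
    exact h1 (S.roots_subset_closure hχ)
  · rw [latticeQ]
    refine AddSubgroup.closure_mono ?_
    rintro _ ⟨α, rfl⟩
    exact ⟨α.1, S.simpleRoots_subset_roots α.2, (S.simpleBasis_apply α).symm⟩

theorem mem_latticeQ_iff {x : RealSpan G h} :
    x ∈ latticeQ G h ↔ ∀ α, ∃ m : ℤ, S.simpleBasis.repr x α = m := by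
  have := S.finite_simpleRoots
  have : Fintype (simpleRoots G h) := Fintype.ofFinite _
  classical
  rw [S.latticeQ_eq_closure]
  constructor
  · intro hx α
    induction hx using AddSubgroup.closure_induction with
    | mem x hx =>
      obtain ⟨β, rfl⟩ := hx
      rw [Basis.repr_self, Finsupp.single_apply]
      exact ⟨if β = α then 1 else 0, by split_ifs <;> simp⟩
    | zero => exact ⟨0, by simp⟩
    | add x y _ _ hx hy =>
      obtain ⟨k, hk⟩ := hx
      obtain ⟨l, hl⟩ := hy
      exact ⟨k + l, by rw [map_add, Finsupp.add_apply, hk, hl]; push_cast; rfl⟩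
    | neg x _ hx =>
      obtain ⟨k, hk⟩ := hx
      exact ⟨-k, by rw [map_neg, Finsupp.neg_apply, hk]; push_cast; rfl⟩
  · intro hx
    choose m hm using hx
    rw [← S.simpleBasis.sum_repr x]
    refine sum_mem fun α _ => ?_
    rw [hm, Int.cast_smul_eq_zsmul]
    exact zsmul_mem (AddSubgroup.subset_closure (Set.mem_range_self α)) _

theorem mem_latticeQd_iff {d : ℕ} {x : RealSpan G h} :
    x ∈ latticeQd G h d ↔ ∀ α, ∃ m : ℤ, d * S.simpleBasis.repr x α = m := by
  change d • x ∈ latticeQ G h ↔ _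
  rw [S.mem_latticeQ_iff]
  simp only [map_nsmul, Finsupp.smul_apply, nsmul_eq_mul]

theorem mem_dualCone_iff {x : RealSpan G h} :
    x ∈ dualCone G h ↔ ∀ α, 0 ≤ S.simpleBasis.repr x α := by
  have := S.finite_simpleRoots
  have : Fintype (simpleRoots G h) := Fintype.ofFinite _
  classical
  constructor
  · intro hx α
    refine Submodule.span_induction (p := fun x _ => 0 ≤ S.simpleBasis.repr x α) ?_ ?_ ?_ ?_ hx
    · rintro _ ⟨β, hβ, rfl⟩
      rw [← S.simpleBasis_apply ⟨β, hβ⟩, Basis.repr_self, Finsupp.single_apply]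
      split_ifs <;> simp
    · simp
    · intro x y _ _ hx hy
      rw [map_add, Finsupp.add_apply]
      exact add_nonneg hx hy
    · intro c x _ hx
      have : c • x = (c : ℝ) • x := rfl
      rw [this, map_smul, Finsupp.smul_apply, smul_eq_mul]
      exact mul_nonneg c.2 hx
  · intro hx
    rw [← S.simpleBasis.sum_repr x]
    refine sum_mem fun α _ => ?_
    have h1 : S.simpleBasis α ∈ dualCone G h := by
      rw [S.simpleBasis_apply]
      exact Submodule.subset_span ⟨α.1, α.2, rfl⟩
    exact (dualCone G h).smul_mem (hx α) h1

omit S in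
theorem latticeQ_le_latticeP : latticeQ G h ≤ latticeP G h := by
  rw [latticeQ, AddSubgroup.closure_le]
  rintro _ ⟨χ, -, rfl⟩
  exact ⟨χ, rfl⟩

theorem exists_latticeP_le : ∃ d : ℕ, 0 < d ∧ latticeP G h ≤ latticeQd G h d := by
  obtain ⟨d, hd, h1⟩ := S.exists_nsmul_mem_closure
  refine ⟨d, hd, ?_⟩
  rintro _ ⟨χ, rfl⟩
  change d • toReal G h χ ∈ latticeQ G h
  rw [← map_nsmul]
  have h2 : AddSubgroup.closure (simpleRoots G h) ≤ (latticeQ G h).comap (toReal G h) := by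
    rw [AddSubgroup.closure_le]
    exact fun α hα => AddSubgroup.subset_closure ⟨α, S.simpleRoots_subset_roots hα, rfl⟩
  exact h2 (h1 χ)

variable {d : ℕ} (hd : 0 < d)

/-- The coordinate multiplied by `d` is already an integer; the floor only names it. -/
theorem floor_repr (μ : latticeQd G h d) (α : simpleRoots G h) :
    ((⌊d * S.simpleBasis.repr μ.1 α⌋ : ℤ) : ℝ) = d * S.simpleBasis.repr μ.1 α := by
  obtain ⟨m, hm⟩ := S.mem_latticeQd_iff.1 μ.2 α
  rw [hm, Int.floor_intCast]

theorem floor_repr_add (μ μ' : latticeQd G h d) (α : simpleRoots G h) :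
    ⌊(d : ℝ) * S.simpleBasis.repr (μ + μ').1 α⌋ =
      ⌊(d : ℝ) * S.simpleBasis.repr μ.1 α⌋ + ⌊(d : ℝ) * S.simpleBasis.repr μ'.1 α⌋ := by
  refine Int.cast_injective (α := ℝ) ?_
  have h1 : S.simpleBasis.repr (μ + μ').1 α =
      S.simpleBasis.repr μ.1 α + S.simpleBasis.repr μ'.1 α :=
    DFunLike.congr_fun (S.simpleBasis.repr.map_add μ.1 μ'.1) α
  rw [Int.cast_add, S.floor_repr (μ + μ') α, S.floor_repr μ α, S.floor_repr μ' α, ← mul_add]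
  exact congrArg (fun z : ℝ => (d : ℝ) * z) h1

/-- The coordinates on `Q_d` with respect to its basis `α / d`. -/
def coordHom : latticeQd G h d →+ (simpleRoots G h → ℤ) :=
  AddMonoidHom.mk' (fun μ α => ⌊(d : ℝ) * S.simpleBasis.repr μ.1 α⌋) fun μ μ' =>
    funext fun α => S.floor_repr_add μ μ' α

theorem coordHom_bijective (hd : 0 < d) : Function.Bijective (S.coordHom (d := d)) := by
  have := S.finite_simpleRoots
  have : Fintype (simpleRoots G h) := Fintype.ofFinite _
  have hd' : (d : ℝ) ≠ 0 := Nat.cast_ne_zero.2 hd.ne'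
  constructor
  · intro μ μ' H
    refine Subtype.ext (S.simpleBasis.ext_elem fun α => mul_left_cancel₀ hd' ?_)
    rw [← S.floor_repr μ α, ← S.floor_repr μ' α]
    exact congrArg Int.cast (congrFun H α)
  · intro m
    have h1 : ∀ α, d * S.simpleBasis.repr
        (S.simpleBasis.equivFun.symm fun α => (d : ℝ)⁻¹ * m α) α = m α := by
      intro α
      rw [← Basis.equivFun_apply, LinearEquiv.apply_symm_apply, mul_inv_cancel_left₀ hd']
    refine ⟨⟨S.simpleBasis.equivFun.symm fun α => (d : ℝ)⁻¹ * m α,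
      S.mem_latticeQd_iff.2 fun α => ⟨m α, h1 α⟩⟩, ?_⟩
    ext α
    change ⌊(d : ℝ) * _⌋ = m α
    rw [h1, Int.floor_intCast]

/-- The coordinates on `Q_d` with respect to its basis `α / d`. -/
def coordQ (hd : 0 < d) : latticeQd G h d ≃+ (simpleRoots G h → ℤ) :=
  AddEquiv.ofBijective S.coordHom (S.coordHom_bijective hd)

theorem coordQ_apply (μ : latticeQd G h d) (α : simpleRoots G h) :
    (S.coordQ hd μ α : ℝ) = d * S.simpleBasis.repr μ.1 α :=
  S.floor_repr μ α

theorem coordQ_nonneg_iff (μ : latticeQd G h d) :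
    (∀ α, 0 ≤ S.coordQ hd μ α) ↔ μ.1 ∈ coneSemigroup (latticeQd G h d) := by
  have hd' : (0 : ℝ) < d := Nat.cast_pos.2 hd
  have : μ.1 ∈ coneSemigroup (latticeQd G h d) ↔ μ.1 ∈ dualCone G h :=
    ⟨fun H => H.1, fun H => ⟨H, μ.2⟩⟩
  rw [this, S.mem_dualCone_iff]
  refine forall_congr' fun α => ?_
  rw [← Int.cast_nonneg_iff (R := ℝ), S.coordQ_apply, mul_nonneg_iff_of_pos_left hd']

omit S in
theorem nsmul_mem_latticeP (μ : latticeQd G h d) : d • μ.1 ∈ latticeP G h :=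
  latticeQ_le_latticeP μ.2

end PrincipalTriple

end Lattice

/-! ### Coordinates on `Q_d` and the toric varieties `𝒱_d` and `𝒱` -/

section ToricVarieties

attribute [local instance 100] LieRing.ofAssociativeRing

open Module

variable {n : ℕ} {G : Subgroup (GL (Fin n) ℂ)} {h ν f : lieAlg G}

variable (G h) in
/-- The lattice `P` as a subgroup of `Q_d`, written multiplicatively. -/
def latticePIn (d : ℕ) : Subgroup (Multiplicative (latticeQd G h d)) where
  carrier := {μ | μ.toAdd.1 ∈ latticeP G h}
  one_mem' := zero_mem (latticeP G h)
  mul_mem' := fun {a b} ha hb => (latticeP G h).add_mem (x := a.toAdd.1) (y := b.toAdd.1) ha hb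
  inv_mem' := fun {a} ha => (latticeP G h).neg_mem (x := a.toAdd.1) ha

instance : DecidableEq (simpleRoots G h) := Classical.decEq _

theorem groupZd_eq_annihilator (d : ℕ) : groupZd G h d = annihilator (latticePIn G h d) := by
  ext z
  exact ⟨fun H μ hμ => H μ.toAdd hμ, fun H μ hμ => H (Multiplicative.ofAdd μ) hμ⟩

/-- The inclusion of `σ^∨ ∩ P` in `σ^∨ ∩ Q_d`. -/
def coneInclusionP {d : ℕ} (hP : latticeP G h ≤ latticeQd G h d) :
    Multiplicative (coneSemigroup (latticeP G h)) →* Multiplicative (coneSemigroup (latticeQd G h d)) :=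
  AddMonoidHom.toMultiplicative (AddSubmonoid.inclusion fun _ hμ => ⟨hμ.1, hP hμ.2⟩)

theorem coneInclusionP_injective {d : ℕ} (hP : latticeP G h ≤ latticeQd G h d) :
    Function.Injective (coneInclusionP hP) := fun _ _ H =>
  Subtype.ext (congrArg (fun z : Multiplicative (coneSemigroup (latticeQd G h d)) => z.toAdd.1) H)

theorem coneInclusion_mem_iff {d : ℕ} (hP : latticeP G h ≤ latticeQd G h d)
    (μ : Multiplicative (coneSemigroup (latticeQd G h d))) :
    coneInclusion (latticeQd G h d) μ ∈ latticePIn G h d ↔ μ ∈ Set.range (coneInclusionP hP) := by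
  constructor
  · intro hμ
    exact ⟨Multiplicative.ofAdd ⟨μ.toAdd.1, μ.toAdd.2.1, hμ⟩, rfl⟩
  · rintro ⟨μ, rfl⟩
    exact μ.toAdd.2.2

theorem pow_mem_latticePIn {d : ℕ} (μ : Multiplicative (latticeQd G h d)) :
    μ ^ d ∈ latticePIn G h d := by
  change d • μ.toAdd.1 ∈ latticeP G h
  exact PrincipalTriple.nsmul_mem_latticeP μ.toAdd

namespace PrincipalTriple

variable (S : PrincipalTriple G h ν f) {d : ℕ} (hd : 0 < d)

/-- The coordinates on `Q_d`, written multiplicatively. -/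
def groupCoords : GroupCoords (Multiplicative (latticeQd G h d)) (simpleRoots G h) where
  expo μ := S.coordQ hd μ.toAdd
  expo_mul μ μ' := map_add (S.coordQ hd) μ.toAdd μ'.toAdd
  expo_injective _ _ H := (S.coordQ hd).injective H
  omega α := Multiplicative.ofAdd ((S.coordQ hd).symm (Pi.single α 1))
  expo_omega _ := (S.coordQ hd).apply_symm_apply _

include S

theorem coordQ_cone_nonneg (μ : Multiplicative (coneSemigroup (latticeQd G h d))) (α : simpleRoots G h) :
    0 ≤ (S.groupCoords hd).expo (coneInclusion (latticeQd G h d) μ) α :=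
  (S.coordQ_nonneg_iff hd _).2 μ.toAdd.2 α

omit S in
theorem coneInclusion_injective (L : AddSubgroup (RealSpan G h)) :
    Function.Injective (coneInclusion L) := fun _ _ H =>
  Subtype.ext (congrArg (fun z : Multiplicative L => z.toAdd.1) H)

theorem exists_coneInclusion_omega (α : simpleRoots G h) :
    ∃ μ, coneInclusion (latticeQd G h d) μ = (S.groupCoords hd).omega α := by
  refine ⟨Multiplicative.ofAdd ⟨((S.groupCoords hd).omega α).toAdd.1, ?_⟩, rfl⟩
  refine (S.coordQ_nonneg_iff hd _).1 fun β => ?_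
  have h1 : S.coordQ hd ((S.groupCoords hd).omega α).toAdd = Pi.single α 1 :=
    (S.coordQ hd).apply_symm_apply _
  rw [h1]
  by_cases hβ : β = α
  · subst hβ; simp
  · simp [hβ]

/-- The coordinates on `σ^∨ ∩ Q_d`, written multiplicatively. -/
def coneCoords : MonoidCoords (Multiplicative (coneSemigroup (latticeQd G h d))) (simpleRoots G h) :=
  (S.groupCoords hd).cone (coneInclusion (latticeQd G h d)) (coneInclusion_injective _)
    (S.coordQ_cone_nonneg hd) (S.exists_coneInclusion_omega hd)

theorem groupCoords_expo (μ : Multiplicative (coneSemigroup (latticeQd G h d))) (α : simpleRoots G h) :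
    (S.groupCoords hd).expo (coneInclusion (latticeQd G h d) μ) α = ((S.coneCoords hd).expo μ α : ℤ) :=
  (Int.toNat_of_nonneg (S.coordQ_cone_nonneg hd μ α)).symm

theorem exists_equiv_fin : Nonempty (Fin (simpleRoots G h).ncard ≃ simpleRoots G h) := by
  have := S.finite_simpleRoots
  exact ⟨(Finite.equivFinOfCardEq rfl).symm⟩

include hd

theorem exists_isIso_torusOf :
    ∃ e : (Fin (simpleRoots G h).ncard → ℂˣ) ≃* TorusOf (latticeQd G h d),
      (standardTorus (simpleRoots G h).ncard).IsIso (torusOf (latticeQd G h d)) e.toEquiv := by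
  have := S.finite_simpleRoots
  have := Fintype.ofFinite (simpleRoots G h)
  obtain ⟨ε⟩ := S.exists_equiv_fin
  exact (S.groupCoords hd).exists_isIso_standardTorus ε

theorem finite_groupZd : Finite (groupZd G h d) := by
  have := S.finite_simpleRoots
  have := Fintype.ofFinite (simpleRoots G h)
  rw [groupZd_eq_annihilator]
  exact finite_annihilator (S.groupCoords hd) hd pow_mem_latticePIn

theorem isOpenImmersion_torusToToric :
    (torusOf (latticeQd G h d)).IsOpenImmersion (toric (latticeQd G h d))
      (torusToToric (latticeQd G h d)) := by
  have := S.finite_simpleRoots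
  have := Fintype.ofFinite (simpleRoots G h)
  exact isOpenImmersion_torusTo (S.coneCoords hd) (S.groupCoords hd) (S.groupCoords_expo hd)

theorem dense_range_torusToToric :
    Dense (X := (toric (latticeQd G h d)).carrier) (Set.range (torusToToric (latticeQd G h d))) := by
  have := S.finite_simpleRoots
  have := Fintype.ofFinite (simpleRoots G h)
  exact dense_range_torusTo (S.coneCoords hd) (S.groupCoords hd) (S.groupCoords_expo hd)

theorem toric_isomorphic_affineSpace :
    (toric (latticeQd G h d)).Isomorphic (affineSpace (simpleRoots G h).ncard) := by
  have := S.finite_simpleRoots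
  have := Fintype.ofFinite (simpleRoots G h)
  obtain ⟨ε⟩ := S.exists_equiv_fin
  exact (S.coneCoords hd).isomorphic_affineSpace ε

variable (hP : latticeP G h ≤ latticeQd G h d)

include hP

theorem exists_isIso_toricV :
    ∃ e, ((toric (latticeQd G h d)).orbitSpace (groupZd G h d)).IsIso (toricV G h) e ∧
      ∀ (v : ToricPoint (latticeQd G h d)) (μ : RealSpan G h)
        (hμ : μ ∈ coneSemigroup (latticeQd G h d)) (hμ' : μ ∈ coneSemigroup (latticeP G h)),
        toricEval (e (Quot.mk _ v)) μ hμ' = toricEval v μ hμ := by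
  have := S.finite_simpleRoots
  have := Fintype.ofFinite (simpleRoots G h)
  -- The action depends on the group as a term, so the group is generalized before `Z_d` is replaced
  -- by the annihilator of `P`.
  suffices H : ∀ Γ : Subgroup (TorusOf (latticeQd G h d)), Γ = annihilator (latticePIn G h d) →
      ∃ e, ((toric (latticeQd G h d)).orbitSpace Γ).IsIso (toricV G h) e ∧
      ∀ (v : ToricPoint (latticeQd G h d)) (μ : RealSpan G h)
        (hμ : μ ∈ coneSemigroup (latticeQd G h d)) (hμ' : μ ∈ coneSemigroup (latticeP G h)),
        toricEval (e (Quot.mk _ v)) μ hμ' = toricEval v μ hμ from H _ (groupZd_eq_annihilator d)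
  rintro _ rfl
  have key := exists_isIso_quotient_annihilator (coneInclusion (latticeQd G h d))
    (S.coneCoords hd) (S.groupCoords hd) (S.groupCoords_expo hd) hd
    pow_mem_latticePIn (coneInclusion_mem_iff hP) (coneInclusionP_injective hP)
  obtain ⟨e, he, hev⟩ := key
  refine ⟨e, he, fun v μ hμ hμ' => ?_⟩
  exact hev v (Multiplicative.ofAdd ⟨μ, hμ'⟩)

theorem isAffineModel_toricAlgebra : IsAffineModel (toricAlgebra (latticeP G h)) := by
  have := S.finite_simpleRoots
  have := Fintype.ofFinite (simpleRoots G h)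
  exact isAffineModel_homAlgebra_of_hom (coneInclusion (latticeQd G h d))
    (S.coneCoords hd) hd
    pow_mem_latticePIn (coneInclusion_mem_iff hP) (coneInclusionP_injective hP)

/-- The group acts trivially on the vector space `E`, so `𝒱 × E` is the quotient of the affine space
`𝒱_d × E`. This serves the charts of the mixed space and, with `E = 0`, the variety `𝒱` itself. -/
theorem isSmoothQuotient_groupZd {E : Type} [AddCommGroup E] [Module ℂ E] [FiniteDimensional ℂ E]
    {Z : FunctionSpace} (hZ : Z.Isomorphic (ofAlgebra (ToricPoint (latticeP G h) × E)
      (prodAlgebra (toricAlgebra (latticeP G h)) (polyAlgebra E)))) :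
    Z.IsSmoothQuotient (groupZd G h d) := by
  have := S.finite_simpleRoots
  have := Fintype.ofFinite (simpleRoots G h)
  rw [groupZd_eq_annihilator]
  exact isSmoothQuotient_annihilator (coneInclusion (latticeQd G h d))
    (S.coneCoords hd) (S.groupCoords hd) (S.groupCoords_expo hd) hd
    pow_mem_latticePIn (coneInclusion_mem_iff hP) (coneInclusionP_injective hP) hZ

end PrincipalTriple

end ToricVarieties

/-! ### The isogeny from `T_d` to `T` -/

section TorusMap

attribute [local instance 100] LieRing.ofAssociativeRing

open Module

variable {n : ℕ} {G : Subgroup (GL (Fin n) ℂ)} {h ν f : lieAlg G}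

/-- A homomorphism from a group of characters to a group that is separated by characters. -/
theorem exists_hom_of_characters {N T X : Type} [CommGroup N] [Group T] (ev : X → T →* ℂˣ) (q : X → N)
    (hsep : ∀ t t', (∀ χ, ev χ t = ev χ t') → t = t')
    (hex : ∀ s : N →* ℂˣ, ∃ t, ∀ χ, ev χ t = s (q χ)) :
    ∃ φ : (N →* ℂˣ) →* T, ∀ s χ, ev χ (φ s) = s (q χ) := by
  choose φ hφ using hex
  exact ⟨MonoidHom.mk' φ fun s s' => hsep _ _ fun χ => by
    rw [hφ, map_mul, hφ, hφ, MonoidHom.mul_apply], hφ⟩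

theorem comp_mem_unitsAlgebra {N T X : Type} [CommGroup N] (ev : X → T → ℂˣ) (q : X → N)
    {φ : (N →* ℂˣ) → T} (hφ : ∀ s χ, ev χ (φ s) = s (q χ)) {F : T → ℂ}
    (hF : F ∈ Submodule.span ℂ {F : T → ℂ | ∃ χ, F = fun t => (ev χ t : ℂ)}) : F ∘ φ ∈ unitsAlgebra N := by
  refine Submodule.span_induction (p := fun F _ => F ∘ φ ∈ unitsAlgebra N) ?_ ?_ ?_ ?_ hF
  · rintro _ ⟨χ, rfl⟩
    have : (fun t => (ev χ t : ℂ)) ∘ φ = fun s => (s (q χ) : ℂ) := by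
      ext s
      rw [Function.comp_apply, hφ]
    rw [this]
    exact eval_mem_unitsAlgebra _
  · exact Subalgebra.zero_mem _
  · exact fun _ _ _ _ h1 h2 => Subalgebra.add_mem _ h1 h2
  · exact fun a _ _ h1 => Subalgebra.smul_mem _ h1 a

namespace PrincipalTriple

variable (S : PrincipalTriple G h ν f) {d : ℕ} (hd : 0 < d) (hP : latticeP G h ≤ latticeQd G h d)

/-- The character `χ` of `T` as a character of `T_d`. -/
def charQd (hP : latticeP G h ≤ latticeQd G h d) (χ : CharLattice G h) :
    Multiplicative (latticeQd G h d) :=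
  Multiplicative.ofAdd ⟨toReal G h χ, hP ⟨χ, rfl⟩⟩

theorem D_eq_sum [Fintype (simpleRoots G h)] (χ : CharLattice G h) :
    S.D χ = ∑ α, S.simpleBasis.repr (toReal G h χ) α • S.D α.1 := by
  rw [← S.DR_toReal χ]
  conv_lhs => rw [← S.simpleBasis.sum_repr (toReal G h χ), map_sum]
  refine Finset.sum_congr rfl fun α _ => ?_
  rw [map_smul, S.simpleBasis_apply, S.DR_toReal]

theorem expo_charQd (χ : CharLattice G h) (α : simpleRoots G h) :
    (((S.groupCoords hd).expo (charQd hP χ) α : ℤ) : ℝ) = d * S.simpleBasis.repr (toReal G h χ) α :=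
  S.coordQ_apply hd ⟨toReal G h χ, hP ⟨χ, rfl⟩⟩ α

/-- The factor `d` clears the denominators, so the integral coordinates on `Q_d` can be compared
with differentials of characters on `T`. -/
theorem nsmul_D [Fintype (simpleRoots G h)] (χ : CharLattice G h) (y : LieSubalgebra.engel ℂ h) :
    d * S.D χ y = ∑ α, ((S.groupCoords hd).expo (charQd hP χ) α : ℂ) * S.D α.1 y := by
  have h1 := S.D_eq_sum χ
  have h3 := S.expo_charQd hd hP χ
  generalize (S.groupCoords hd).expo (charQd hP χ) = m at h3 ⊢
  have h4 : ∃ r : simpleRoots G h → ℝ, S.D χ = ∑ α, r α • S.D α.1 ∧ ∀ α, (m α : ℝ) = d * r α :=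
    ⟨fun α => S.simpleBasis.repr (toReal G h χ) α, h1, h3⟩
  clear h1 h3
  obtain ⟨r, h1, h3⟩ := h4
  rw [h1, LinearMap.sum_apply, Finset.mul_sum]
  refine Finset.sum_congr rfl fun α _ => ?_
  have h5 : (m α : ℂ) = d * (r α : ℂ) := by
    have := congrArg (fun z : ℝ => (z : ℂ)) (h3 α)
    simpa using this
  rw [h5, LinearMap.smul_apply, Complex.real_smul, mul_assoc]

include S in
theorem torusT_ext {t t' : torusT G h} (H : ∀ χ : CharLattice G h, charEval χ t = charEval χ t') :
    t = t' := by
  obtain ⟨x, rfl⟩ := S.expT_surjective t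
  obtain ⟨y, rfl⟩ := S.expT_surjective t'
  refine (S.expT_eq_iff x y).2 fun χ => ?_
  rw [← S.charEval_expT, H, S.charEval_expT]

-- Take logarithms of the values of `s` on the generators `α / d`. The simple roots form a basis, so
-- some `y ∈ 𝔱` takes on them `d` times these logarithms, and `exp y` is the required point.
include S hd in
theorem exists_torusT (s : TorusOf (latticeQd G h d)) :
    ∃ t : torusT G h, ∀ χ, charEval χ t = s (charQd hP χ) := by
  have := S.finite_simpleRoots
  have := Fintype.ofFinite (simpleRoots G h)
  have h1 : ∀ α, ∃ c : ℂ, (s ((S.groupCoords hd).omega α) : ℂ) = Complex.exp c := fun α =>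
    ⟨_, (Complex.exp_log (Units.ne_zero _)).symm⟩
  choose c hc using h1
  obtain ⟨y, hy⟩ := exists_forall_apply_eq S.linearIndependent_D_simpleRoots fun α => d * c α
  refine ⟨S.expT y, fun χ => Units.ext ?_⟩
  have hd' : (d : ℂ) ≠ 0 := Nat.cast_ne_zero.2 hd.ne'
  rw [(S.groupCoords hd).apply_eq_exp s c hc, S.charEval_expT]
  congr 1
  refine mul_left_cancel₀ hd' ?_
  rw [S.nsmul_D hd hP, Finset.mul_sum]
  refine Finset.sum_congr rfl fun α _ => ?_
  rw [hy]
  ring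

include S hd in
theorem exists_torusMap : ∃ φ : TorusOf (latticeQd G h d) →* torusT G h,
    ∀ s (χ : CharLattice G h), charEval χ (φ s) = s (charQd hP χ) :=
  exists_hom_of_characters (fun χ : CharLattice G h => (Additive.toMul χ).1) (charQd hP)
    (fun _ _ => S.torusT_ext) (S.exists_torusT hd hP)

/-- The homomorphism `T_d → T`. -/
def torusMap : TorusOf (latticeQd G h d) →* torusT G h := (S.exists_torusMap hd hP).choose

theorem charEval_torusMap (s : TorusOf (latticeQd G h d)) (χ : CharLattice G h) :
    charEval χ (S.torusMap hd hP s) = s (charQd hP χ) :=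
  (S.exists_torusMap hd hP).choose_spec s χ

theorem isMorphism_torusMap : (torusOf (latticeQd G h d)).IsMorphism
    (ofAlgebra (torusT G h) (torusAlgebra G h)) (S.torusMap hd hP) := by
  refine isMorphism_of_comp_mem fun F hF => ?_
  refine comp_mem_unitsAlgebra (fun χ : CharLattice G h => charEval χ) (charQd hP)
    (S.charEval_torusMap hd hP) (Submodule.span_mono ?_ (S.torusAlgebra_le_span F hF))
  rintro _ ⟨χ, -, rfl⟩
  exact ⟨χ, rfl⟩

theorem torusMap_surjective : Function.Surjective (S.torusMap hd hP) := by
  have := S.finite_simpleRoots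
  have := Fintype.ofFinite (simpleRoots G h)
  intro t
  obtain ⟨y, rfl⟩ := S.expT_surjective t
  have hd' : (d : ℂ) ≠ 0 := Nat.cast_ne_zero.2 hd.ne'
  -- A preimage of `exp y` takes the value `exp (α(y) / d)` at the generator `α / d`.
  let s : TorusOf (latticeQd G h d) := (S.groupCoords hd).equiv fun α =>
    Units.mk0 (Complex.exp ((d : ℂ)⁻¹ * S.D α.1 y)) (Complex.exp_ne_zero _)
  refine ⟨s, S.torusT_ext fun χ => ?_⟩
  rw [S.charEval_torusMap]
  refine Units.ext ?_
  rw [S.charEval_expT, (S.groupCoords hd).apply_eq_exp s (fun α => (d : ℂ)⁻¹ * S.D α.1 y)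
    (fun α => congrArg Units.val ((S.groupCoords hd).equiv_apply_omega _ α))]
  congr 1
  refine mul_left_cancel₀ hd' ?_
  rw [S.nsmul_D hd hP, Finset.mul_sum]
  refine Finset.sum_congr rfl fun α _ => ?_
  rw [mul_left_comm, mul_inv_cancel_left₀ hd']

theorem ker_torusMap : (S.torusMap hd hP).ker = groupZd G h d := by
  ext s
  rw [MonoidHom.mem_ker]
  constructor
  · rintro hs ⟨_, hμ⟩ ⟨χ, rfl⟩
    have := S.charEval_torusMap hd hP s χ
    rw [hs] at this
    refine this.symm.trans ?_
    exact map_one (Additive.toMul χ).1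
  · intro hs
    refine S.torusT_ext fun χ => ?_
    rw [S.charEval_torusMap]
    refine (hs (charQd hP χ).toAdd ⟨χ, rfl⟩).trans ?_
    exact (map_one (Additive.toMul χ).1).symm

end PrincipalTriple

end TorusMap

/-! ### Unipotent matrices -/

section Unipotent

variable {n : ℕ}

local notation "Mat" => Matrix (Fin n) (Fin n) ℂ
local notation "PMat" => Matrix (Fin n) (Fin n) (Polynomial ℂ)

/-- The value of a matrix of polynomials. -/
def evPoly (s : ℂ) : PMat →+* Mat := (Polynomial.evalRingHom s).mapMatrix

theorem evPoly_apply (s : ℂ) (Γ : PMat) (a b : Fin n) : evPoly s Γ a b = (Γ a b).eval s := rfl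

theorem eq_of_evPoly_natCast {Γ Δ : PMat} (H : ∀ j : ℕ, evPoly (j : ℂ) Γ = evPoly (j : ℂ) Δ) : Γ = Δ := by
  ext1 a b
  refine Polynomial.eq_of_infinite_eval_eq _ _ ((Set.infinite_range_of_injective
    (Nat.cast_injective (R := ℂ))).mono ?_)
  rintro _ ⟨j, rfl⟩
  exact congrFun (congrFun (H j) a) b

/-- The derivative at `0` of a matrix of polynomials. -/
def velocity (Γ : PMat) : Mat := Matrix.of fun a b => (Polynomial.derivative (Γ a b)).eval 0

theorem hasDerivAt_evPoly_zero (Γ : PMat) (a b : Fin n) :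
    HasDerivAt (fun s => evPoly s Γ a b) (velocity Γ a b) 0 := (Γ a b).hasDerivAt 0

/-- The identity holds for natural arguments. Both sides are polynomial in each variable, so it
extends first to all `s` and then to all `t`. -/
theorem evPoly_add_of_pow {Γ : PMat} {g : Mat} (H : ∀ j : ℕ, evPoly (j : ℂ) Γ = g ^ j) (s t : ℂ) :
    evPoly (s + t) Γ = evPoly s Γ * evPoly t Γ := by
  let sh : ℂ → PMat := fun t => Γ.map (Polynomial.taylor t)
  have hsh : ∀ s t, evPoly s (sh t) = evPoly (s + t) Γ := fun s t => by
    ext a b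
    exact Polynomial.taylor_eval _ _ _
  let cst : Mat → PMat := fun M => M.map Polynomial.C
  have hcst : ∀ s M, evPoly s (cst M) = M := fun s M => by
    ext a b
    exact Polynomial.eval_C
  have h1 : ∀ (j : ℕ) (s : ℂ), evPoly (s + j) Γ = evPoly s Γ * evPoly (j : ℂ) Γ := by
    intro j s
    have : sh j = Γ * cst (g ^ j) := eq_of_evPoly_natCast fun k => by
      rw [hsh, map_mul, hcst, H, ← pow_add, ← H, Nat.cast_add]
    rw [← hsh, this, map_mul, hcst, H]
  have : sh s = cst (evPoly s Γ) * Γ := eq_of_evPoly_natCast fun k => by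
    rw [hsh, map_mul, hcst, ← h1, add_comm]
  rw [add_comm, ← hsh, this, map_mul, hcst]

theorem evPoly_eq_exp {Γ : PMat} {g : Mat} (H : ∀ j : ℕ, evPoly (j : ℂ) Γ = g ^ j) (s : ℂ) :
    evPoly s Γ = NormedSpace.exp (s • velocity Γ) := by
  set X := velocity Γ with hX
  have hadd := evPoly_add_of_pow H
  have h0 : evPoly 0 Γ = 1 := by
    have := H 0
    rwa [Nat.cast_zero, pow_zero] at this
  have hd : ∀ s a b, HasDerivAt (fun t => evPoly t Γ a b) ((evPoly s Γ * X) a b) s := by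
    intro s a b
    have h1 : ∀ t, evPoly t Γ a b = ∑ k, evPoly s Γ a k * evPoly (t - s) Γ k b := fun t => by
      rw [← Matrix.mul_apply, ← hadd, add_sub_cancel]
    simp only [h1, Matrix.mul_apply]
    refine HasDerivAt.fun_sum fun k _ => HasDerivAt.const_mul _ ?_
    have h2 := hasDerivAt_evPoly_zero Γ k b
    rw [← sub_self s] at h2
    exact h2.comp_sub_const s s
  -- The product with the opposite exponential has zero derivative, so it stays equal to its value
  -- `1` at the origin.
  let F : ℂ → Mat := fun t => evPoly t Γ * NormedSpace.exp (t • (-X))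
  have hF : ∀ t a b, HasDerivAt (fun t => F t a b) 0 t := by
    intro t a b
    have h1 : HasDerivAt (fun t => F t a b)
        (∑ k, ((evPoly t Γ * X) a k * NormedSpace.exp (t • (-X)) k b +
          evPoly t Γ a k * (NormedSpace.exp (t • (-X)) * (-X)) k b)) t := by
      simp only [F, Matrix.mul_apply (M := evPoly _ Γ) (N := NormedSpace.exp _)]
      exact HasDerivAt.fun_sum fun k _ => (hd t a k).mul (hasDerivAt_exp (-X) t k b)
    refine h1.congr_deriv ?_
    rw [Finset.sum_add_distrib, ← Matrix.mul_apply, ← Matrix.mul_apply, ← Matrix.add_apply]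
    have hc : NormedSpace.exp (t • (-X)) * (-X) = (-X) * NormedSpace.exp (t • (-X)) :=
      (((Commute.refl (-X)).smul_left t).exp_left).eq
    rw [hc, mul_assoc, neg_mul, mul_neg, add_neg_cancel]
    rfl
  have hconst : ∀ t, F t = 1 := by
    intro t
    ext a b
    have h1 : F t a b = F 0 a b := is_const_of_deriv_eq_zero
      (fun t => (hF t a b).differentiableAt) (fun t => (hF t a b).deriv) t 0
    rw [h1]
    simp [F, h0]
  have h1 := hconst s
  calc evPoly s Γ = evPoly s Γ * (NormedSpace.exp (-(s • X)) * NormedSpace.exp (-(-(s • X)))) := by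
        rw [exp_mul_exp_neg, mul_one]
    _ = F s * NormedSpace.exp (s • X) := by
        rw [neg_neg, ← mul_assoc]
        simp only [F, smul_neg]
    _ = _ := by rw [h1, one_mul]

theorem velocity_eq_of_exp {Γ : PMat} {M : Mat} (H : ∀ s, evPoly s Γ = NormedSpace.exp (s • M)) :
    velocity Γ = M := by
  ext a b
  have h1 := hasDerivAt_evPoly_zero Γ a b
  simp only [H] at h1
  have h2 := hasDerivAt_exp M 0 a b
  rw [zero_smul, NormedSpace.exp_zero, one_mul] at h2
  exact h1.unique h2

/-- The polynomial `s ↦ binom(s, k)`. -/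
def binomPoly (k : ℕ) : Polynomial ℂ := Polynomial.C ((k.factorial : ℂ)⁻¹) * descPochhammer ℂ k

theorem binomPoly_eval (j k : ℕ) : (binomPoly k).eval (j : ℂ) = j.choose k := by
  rw [binomPoly, Polynomial.eval_mul, Polynomial.eval_C, descPochhammer_eval_eq_descFactorial,
    Nat.descFactorial_eq_factorial_mul_choose, Nat.cast_mul, inv_mul_cancel_left₀]
  exact Nat.cast_ne_zero.2 k.factorial_ne_zero

/-- The matrix of polynomials `s ↦ (1 + N) ^ s` for a nilpotent matrix `N`. -/
def binomPath (m : ℕ) (N : Mat) : PMat := ∑ k ∈ Finset.range m, binomPoly k • (N ^ k).map Polynomial.C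

theorem evPoly_binomPath (m : ℕ) (N : Mat) (s : ℂ) :
    evPoly s (binomPath m N) = ∑ k ∈ Finset.range m, (binomPoly k).eval s • N ^ k := by
  rw [binomPath, map_sum]
  refine Finset.sum_congr rfl fun k _ => ?_
  ext a b
  rw [evPoly_apply]
  simp

theorem evPoly_binomPath_natCast {m : ℕ} {N : Mat} (hN : N ^ m = 0) (j : ℕ) :
    evPoly (j : ℂ) (binomPath m N) = (1 + N) ^ j := by
  rw [evPoly_binomPath, add_comm, Commute.add_pow (Commute.one_right N)]
  simp only [binomPoly_eval, one_pow, mul_one]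
  have h1 : ∀ k, ((j.choose k : ℕ) : ℂ) • N ^ k = N ^ k * ((j.choose k : ℕ) : Mat) := fun k => by
    rw [Nat.cast_smul_eq_nsmul, nsmul_eq_mul, Nat.cast_comm]
  simp only [h1]
  have h2 : ∀ M, m ≤ M → ∑ k ∈ Finset.range M, N ^ k * ((j.choose k : ℕ) : Mat) =
      ∑ k ∈ Finset.range m, N ^ k * ((j.choose k : ℕ) : Mat) := fun M hM => by
    refine (Finset.sum_subset (Finset.range_mono hM) fun k _ hk => ?_).symm
    rw [pow_eq_zero_of_le (not_lt.1 fun h => hk (Finset.mem_range.2 h)) hN, zero_mul]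
  -- Both sums are compared on a common range: extra terms of one vanish since `N ^ m = 0`, those of
  -- the other since the binomial coefficient is zero.
  rw [← h2 (max m (j + 1)) (le_max_left _ _)]
  refine (Finset.sum_subset (Finset.range_mono (le_max_right _ _)) fun k _ hk => ?_).symm
  rw [Nat.choose_eq_zero_of_lt (by simpa [Nat.lt_succ_iff] using hk), Nat.cast_zero, mul_zero]

/-- The logarithm of `1 + N` for a nilpotent matrix `N`. -/
def unipLog (m : ℕ) (N : Mat) : Mat := velocity (binomPath m N)

theorem unipLog_eq_sum (m : ℕ) (N : Mat) : unipLog m N =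
    ∑ k ∈ Finset.range m, (Polynomial.derivative (binomPoly k)).eval 0 • N ^ k := by
  ext a b
  simp [unipLog, velocity, binomPath, Matrix.sum_apply, Polynomial.eval_finsetSum]

theorem derivative_binomPoly_zero : Polynomial.derivative (binomPoly 0) = 0 := by
  simp [binomPoly]

theorem evPoly_binomPath_eq_exp {m : ℕ} {N : Mat} (hN : N ^ m = 0) (s : ℂ) :
    evPoly s (binomPath m N) = NormedSpace.exp (s • unipLog m N) :=
  evPoly_eq_exp (evPoly_binomPath_natCast hN) s

theorem exp_unipLog {m : ℕ} {N : Mat} (hN : N ^ m = 0) : NormedSpace.exp (unipLog m N) = 1 + N := by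
  have h1 := evPoly_binomPath_eq_exp hN 1
  rw [one_smul] at h1
  have h2 := evPoly_binomPath_natCast hN 1
  rw [Nat.cast_one, pow_one] at h2
  rw [← h1, h2]

theorem exp_eq_sum_of_pow {m : ℕ} {M : Mat} (hM : M ^ m = 0) :
    NormedSpace.exp M = ∑ k ∈ Finset.range m, ((k.factorial : ℂ)⁻¹) • M ^ k := by
  rw [NormedSpace.exp_eq_tsum ℂ]
  refine tsum_eq_sum fun k hk => ?_
  rw [pow_eq_zero_of_le (not_lt.1 fun h => hk (Finset.mem_range.2 h)) hM, smul_zero]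

/-- The matrix of polynomials `s ↦ exp (s M)` for a nilpotent matrix `M`. -/
def expPath (m : ℕ) (M : Mat) : PMat :=
  ∑ k ∈ Finset.range m, (Polynomial.C ((k.factorial : ℂ)⁻¹) * Polynomial.X ^ k) • (M ^ k).map Polynomial.C

theorem evPoly_expPath {m : ℕ} {M : Mat} (hM : M ^ m = 0) (s : ℂ) :
    evPoly s (expPath m M) = NormedSpace.exp (s • M) := by
  rw [exp_eq_sum_of_pow (m := m) (by rw [smul_pow, hM, smul_zero]), expPath, map_sum]
  refine Finset.sum_congr rfl fun k _ => ?_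
  ext a b
  rw [evPoly_apply]
  simp only [smul_pow, Matrix.smul_apply, Matrix.map_apply, smul_eq_mul,
    Polynomial.eval_mul, Polynomial.eval_C, Polynomial.eval_pow, Polynomial.eval_X]
  ring

/-- The paths `s ↦ exp (s M)` and `s ↦ (exp M) ^ s` are both polynomial and agree at the natural
numbers, hence have the same velocity at `0`. -/
theorem unipLog_exp {m : ℕ} {M : Mat} (hM : M ^ m = 0) (hN : (NormedSpace.exp M - 1) ^ m = 0) :
    unipLog m (NormedSpace.exp M - 1) = M := by
  have h1 : expPath m M = binomPath m (NormedSpace.exp M - 1) := eq_of_evPoly_natCast fun j => by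
    rw [evPoly_binomPath_natCast hN, add_sub_cancel, evPoly_expPath hM, Nat.cast_smul_eq_nsmul,
      Matrix.exp_nsmul]
  rw [unipLog, ← h1]
  exact velocity_eq_of_exp (evPoly_expPath hM)

/-! ### Filtrations by weights -/

/-- The matrices whose entries raise the weight by at least `k`. -/
def weightFilt (w : Fin n → ℤ) (k : ℤ) : Submodule ℂ Mat where
  carrier := {M | ∀ a b, M a b ≠ 0 → k ≤ w a - w b}
  zero_mem' := fun a b h => absurd rfl h
  add_mem' := fun {M N} hM hN a b h => by
    by_cases h1 : M a b = 0
    · refine hN a b fun h2 => h ?_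
      rw [Matrix.add_apply, h1, h2, add_zero]
    · exact hM a b h1
  smul_mem' := fun c M hM a b h => hM a b (right_ne_zero_of_mul h)

variable {w : Fin n → ℤ}

theorem weightFilt_mono {k l : ℤ} (h : k ≤ l) : weightFilt w l ≤ weightFilt w k :=
  fun _ hM a b hab => h.trans (hM a b hab)

theorem one_mem_weightFilt : (1 : Mat) ∈ weightFilt w 0 := fun a b h => by
  by_cases hab : a = b
  · rw [hab, sub_self]
  · exact absurd (Matrix.one_apply_ne hab) h

theorem diagonal_mem_weightFilt (d : Fin n → ℂ) : Matrix.diagonal d ∈ weightFilt w 0 := fun a b h => by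
  by_cases hab : a = b
  · rw [hab, sub_self]
  · exact absurd (Matrix.diagonal_apply_ne _ hab) h

theorem mul_mem_weightFilt {k l : ℤ} {M N : Mat} (hM : M ∈ weightFilt w k) (hN : N ∈ weightFilt w l) :
    M * N ∈ weightFilt w (k + l) := by
  intro a b h
  rw [Matrix.mul_apply] at h
  obtain ⟨c, -, hc⟩ := Finset.exists_ne_zero_of_sum_ne_zero h
  have h1 := hM a c (left_ne_zero_of_mul hc)
  have h2 := hN c b (right_ne_zero_of_mul hc)
  omega

theorem pow_mem_weightFilt {k : ℤ} {M : Mat} (hM : M ∈ weightFilt w k) (j : ℕ) :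
    M ^ j ∈ weightFilt w (j * k) := by
  induction j with
  | zero => simpa using one_mem_weightFilt
  | succ j ih =>
    rw [pow_succ, Nat.cast_succ, add_mul, one_mul]
    exact mul_mem_weightFilt ih hM

theorem pow_mem_weightFilt_one {M : Mat} (hM : M ∈ weightFilt w 1) {j : ℕ} (hj : j ≠ 0) :
    M ^ j ∈ weightFilt w 1 :=
  weightFilt_mono (by omega) (pow_mem_weightFilt hM j)

variable {R : ℕ}

theorem pow_eq_zero_of_mem_weightFilt (hR : ∀ a b, w a - w b < R) {M : Mat} (hM : M ∈ weightFilt w 1) :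
    M ^ R = 0 := by
  ext a b
  by_contra h
  have := pow_mem_weightFilt hM R a b h
  have := hR a b
  omega

theorem unipLog_mem {N : Mat} (hN : N ∈ weightFilt w 1) (m : ℕ) : unipLog m N ∈ weightFilt w 1 := by
  rw [unipLog_eq_sum]
  refine Submodule.sum_mem _ fun k _ => ?_
  by_cases hk : k = 0
  · rw [hk, derivative_binomPoly_zero, Polynomial.eval_zero, zero_smul]
    exact zero_mem _
  · exact Submodule.smul_mem _ _ (pow_mem_weightFilt_one hN hk)

theorem exp_sub_one_mem (hR : ∀ a b, w a - w b < R) {M : Mat} (hM : M ∈ weightFilt w 1) :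
    NormedSpace.exp M - 1 ∈ weightFilt w 1 := by
  rw [exp_eq_sum_of_pow (m := R + 1) (by rw [pow_succ, pow_eq_zero_of_mem_weightFilt hR hM, zero_mul]),
    Finset.sum_range_succ', Nat.factorial_zero, pow_zero, Nat.cast_one, inv_one, one_smul, add_sub_cancel_right]
  exact Submodule.sum_mem _ fun k _ => Submodule.smul_mem _ _ (pow_mem_weightFilt_one hM k.succ_ne_zero)

end Unipotent

/-! ### Sets with the same tangent space at a point -/

section Tangent

open MvPolynomial Asymptotics

variable {σ : Type} [Fintype σ]

local notation "Pol" => MvPolynomial σ ℂ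

omit [Fintype σ] in
theorem exists_single_of_degree_eq_one {d : σ →₀ ℕ} (h : d.degree = 1) :
    ∃ j, d = Finsupp.single j 1 := by
  classical
  have hd : d ≠ 0 := fun h0 => by simp [h0] at h
  obtain ⟨j, hj⟩ := Finsupp.support_nonempty_iff.2 hd
  have h1 : Finsupp.single j 1 ≤ d := by
    rw [Finsupp.single_le_iff]
    exact Nat.one_le_iff_ne_zero.2 (Finsupp.mem_support_iff.1 hj)
  obtain ⟨e, rfl⟩ := exists_add_of_le h1
  rw [map_add, Finsupp.degree_single, Nat.add_eq_left, Finsupp.degree_eq_zero_iff] at h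
  exact ⟨j, by rw [h, add_zero]⟩

theorem hasDerivAt_eval_path {γ : ℂ → σ → ℂ} {Y : σ → ℂ} (h0 : γ 0 = 0)
    (hγ : ∀ i, HasDerivAt (fun t => γ t i) (Y i) 0) (p : Pol) :
    HasDerivAt (fun t => eval (γ t) p) (∑ i, Y i * coeff (Finsupp.single i 1) p) 0 := by
  classical
  induction p using MvPolynomial.induction_on with
  | C a =>
    have : ∀ i : σ, coeff (Finsupp.single i 1) (C a : Pol) = 0 := fun i => by
      rw [coeff_C, if_neg]
      exact fun h => one_ne_zero (α := ℕ) (by simpa using (DFunLike.congr_fun h i).symm)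
    simpa [this] using hasDerivAt_const (0 : ℂ) a
  | add p q hp hq =>
    simp only [map_add, coeff_add, mul_add, Finset.sum_add_distrib]
    exact hp.add hq
  | mul_X p j hp =>
    simp only [map_mul, eval_X]
    refine (hp.mul (hγ j)).congr_deriv ?_
    have h1 : ∀ i : σ, coeff (Finsupp.single i 1) (p * X j) = if i = j then coeff 0 p else 0 := by
      intro i
      rw [coeff_mul_X']
      by_cases hij : i = j
      · subst hij; simp
      · rw [if_neg hij, if_neg]
        simpa [Finsupp.single_apply] using Ne.symm hij
    simp only [h1, h0, Pi.zero_apply, mul_zero, zero_add]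
    rw [Finset.sum_eq_single j (fun i _ hi => by rw [if_neg hi, mul_zero]) (by simp), if_pos rfl,
      mul_comm, ← constantCoeff_eq, ← eval_zero]

/-- A polynomial of order `k` at the origin cannot distinguish a curve from its tangent line up to
`o(t ^ k)`. The bounds by `O(t ^ k)` are carried along for the induction on products. -/
theorem eval_isLittleO {γ : ℂ → σ → ℂ} {Y : σ → ℂ} (h0 : γ 0 = 0)
    (hγ : ∀ i, HasDerivAt (fun t => γ t i) (Y i) 0) {k : ℕ} {p : Pol} (hp : p ∈ idealOfVars σ ℂ ^ k) :
    (fun t => eval (γ t) p) =O[𝓝 0] (fun t : ℂ => t ^ k) ∧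
      (fun t => eval (t • Y) p) =O[𝓝 0] (fun t : ℂ => t ^ k) ∧
      (fun t => eval (γ t) p - eval (t • Y) p) =o[𝓝 0] (fun t : ℂ => t ^ k) := by
  have hl0 : (fun t : ℂ => t • Y) 0 = 0 := zero_smul _ _
  have hl : ∀ i, HasDerivAt (fun t : ℂ => (t • Y) i) (Y i) 0 := fun i => by
    simpa using (hasDerivAt_id (0 : ℂ)).mul_const (Y i)
  have hcont : ∀ (δ : ℂ → σ → ℂ) (_ : δ 0 = 0) (_ : ∀ i, HasDerivAt (fun t => δ t i) (Y i) 0) (p : Pol),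
      (fun t => eval (δ t) p) =O[𝓝 0] (fun _ : ℂ => (1 : ℂ)) := fun δ hδ0 hδ p =>
    (hasDerivAt_eval_path hδ0 hδ p).continuousAt.isBigO_one ℂ
  induction k generalizing p with
  | zero =>
    simp only [pow_zero]
    refine ⟨hcont γ h0 hγ p, hcont _ hl0 hl p, ?_⟩
    rw [isLittleO_one_iff]
    have h1 := ((hasDerivAt_eval_path h0 hγ p).continuousAt.sub
      (hasDerivAt_eval_path hl0 hl p).continuousAt).tendsto
    simp only [Pi.sub_apply, h0, zero_smul, sub_self] at h1
    exact h1
  | succ k ih =>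
    rw [pow_succ'] at hp
    refine Submodule.mul_induction_on hp ?_ ?_
    · intro a ha b hb
      obtain ⟨b1, b2, b3⟩ := ih hb
      have ha0 : ∀ δ : ℂ → σ → ℂ, δ 0 = 0 → eval (δ 0) a = 0 := by
        intro δ hδ
        have h1 : a ∈ idealOfVars σ ℂ ^ 1 := by rwa [pow_one]
        rw [mem_pow_idealOfVars_iff'] at h1
        rw [hδ]
        change eval 0 a = 0
        rw [eval_zero, constantCoeff_eq]
        exact h1 0 (by simp)
      have hO : ∀ (δ : ℂ → σ → ℂ) (_ : δ 0 = 0) (_ : ∀ i, HasDerivAt (fun t => δ t i) (Y i) 0),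
          (fun t => eval (δ t) a) =O[𝓝 0] (fun t : ℂ => t) := fun δ hδ0 hδ => by
        have h1 := (hasDerivAt_eval_path hδ0 hδ a).isBigO_sub
        simpa [ha0 δ hδ0] using h1
      have ho : (fun t => eval (γ t) a - eval (t • Y) a) =o[𝓝 0] (fun t : ℂ => t) := by
        have h1 := (hasDerivAt_eval_path h0 hγ a).sub (hasDerivAt_eval_path hl0 hl a)
        rw [sub_self] at h1
        have h2 := (hasDerivAt_iff_isLittleO.1 h1)
        have h3 := ha0 γ h0
        have h4 := ha0 (fun t => t • Y) hl0
        simp only [h0, zero_smul] at h3 h4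
        simpa only [Pi.sub_apply, h0, zero_smul, h3, sub_zero, smul_zero] using h2
      simp only [map_mul, pow_succ']
      refine ⟨(hO γ h0 hγ).mul b1, (hO _ hl0 hl).mul b2, ?_⟩
      have h1 := (ho.mul_isBigO b1).add ((hO _ hl0 hl).mul_isLittleO b3)
      refine h1.congr_left fun t => ?_
      ring
    · rintro a b ⟨a1, a2, a3⟩ ⟨b1, b2, b3⟩
      simp only [map_add]
      exact ⟨a1.add b1, a2.add b2, (a3.add b3).congr_left fun t => by ring⟩

theorem coeff_eq_zero_of_isLittleO {P : Polynomial ℂ} {k : ℕ}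
    (h : (fun t => P.eval t) =o[𝓝 0] (fun t : ℂ => t ^ k)) {j : ℕ} (hj : j ≤ k) : P.coeff j = 0 := by
  by_contra hne
  have hP : P ≠ 0 := fun h0 => hne (by rw [h0, Polynomial.coeff_zero])
  obtain ⟨Q, hQ⟩ : Polynomial.X ^ P.natTrailingDegree ∣ P :=
    Polynomial.X_pow_dvd_iff.2 fun d hd => Polynomial.coeff_eq_zero_of_lt_natTrailingDegree hd
  set l := P.natTrailingDegree with hl
  have hlk : l ≤ k := (Polynomial.natTrailingDegree_le_of_ne_zero hne).trans hj
  have hQ0 : Q.eval 0 ≠ 0 := by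
    rw [← Polynomial.coeff_zero_eq_eval_zero]
    have h1 : P.coeff l ≠ 0 := Polynomial.coeff_natTrailingDegree_ne_zero.2 hP
    rw [hQ] at h1
    simpa [Polynomial.coeff_X_pow_mul'] using h1
  have h1 : (fun t : ℂ => t ^ k) =O[𝓝 0] (fun t : ℂ => t ^ l) := by
    have h2 : (fun t : ℂ => t ^ (k - l)) =O[𝓝 0] (fun _ : ℂ => (1 : ℂ)) :=
      (continuous_pow (k - l)).continuousAt.isBigO_one ℂ
    refine (h2.mul (isBigO_refl (fun t : ℂ => t ^ l) _)).congr (fun t => ?_) fun t => one_mul _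
    rw [← pow_add, Nat.sub_add_cancel hlk]
  have h2 := ((h.trans_isBigO h1).tendsto_div_nhds_zero).mono_left (nhdsWithin_le_nhds (s := {0}ᶜ))
  have h3 : Tendsto (fun t => Q.eval t) (𝓝[≠] 0) (𝓝 0) := by
    refine h2.congr' ?_
    filter_upwards [self_mem_nhdsWithin] with t ht
    rw [hQ, Polynomial.eval_mul, Polynomial.eval_pow, Polynomial.eval_X,
      mul_div_cancel_left₀ _ (pow_ne_zero _ ht)]
  exact hQ0 (tendsto_nhds_unique (Q.continuous.continuousAt.mono_left nhdsWithin_le_nhds) h3)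

theorem eval_smul_of_isHomogeneous {p : Pol} {k : ℕ} (hp : p.IsHomogeneous k) (t : ℂ) (A : σ → ℂ) :
    eval (t • A) p = t ^ k * eval A p := by
  rw [eval_eq', eval_eq', Finset.mul_sum]
  refine Finset.sum_congr rfl fun d hd => ?_
  have h1 : ∑ i, d i = k := by
    have : d.degree = k := by
      rw [Finsupp.degree_eq_weight_one]
      exact hp (mem_support_iff.1 hd)
    rwa [Finsupp.degree_eq_sum] at this
  simp only [Pi.smul_apply, smul_eq_mul, mul_pow, Finset.prod_mul_distrib, Finset.prod_pow_eq_pow_sum,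
    h1]
  ring

/-- A polynomial is of order at least `k` at the origin when it is so on every line. -/
theorem mem_pow_idealOfVars_of_isLittleO {p : Pol} {k : ℕ}
    (h : ∀ A : σ → ℂ, (fun t : ℂ => eval (t • A) p) =o[𝓝 0] (fun t : ℂ => t ^ k)) :
    p ∈ idealOfVars σ ℂ ^ (k + 1) := by
  rw [mem_pow_idealOfVars_iff']
  intro d hd
  have h1 : homogeneousComponent d.degree p = 0 := by
    refine MvPolynomial.funext fun A => ?_
    rw [map_zero]
    -- The coefficients of the restriction to the line through `A` are the values at `A` of the
    -- homogeneous components.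
    let P : Polynomial ℂ := ∑ j ∈ Finset.range (p.totalDegree + 1),
      Polynomial.C (eval A (homogeneousComponent j p)) * Polynomial.X ^ j
    have hP : ∀ t, P.eval t = eval (t • A) p := by
      intro t
      conv_rhs => rw [← sum_homogeneousComponent p, map_sum]
      simp only [P, Polynomial.eval_finsetSum, Polynomial.eval_mul, Polynomial.eval_C,
        Polynomial.eval_pow, Polynomial.eval_X]
      refine Finset.sum_congr rfl fun j _ => ?_
      rw [eval_smul_of_isHomogeneous (homogeneousComponent_isHomogeneous j p), mul_comm]
    have h2 := coeff_eq_zero_of_isLittleO (P := P) (k := k) (by simpa only [hP] using h A)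
      (Nat.lt_succ_iff.1 hd)
    by_cases hdeg : d.degree ≤ p.totalDegree
    · simpa [P, Polynomial.finsetSum_coeff, Polynomial.coeff_C_mul, Polynomial.coeff_X_pow,
        Nat.lt_succ_iff, hdeg] using h2
    · rw [homogeneousComponent_eq_zero _ _ (not_le.1 hdeg), map_zero]
  have h2 := congrArg (coeff d) h1
  rwa [coeff_homogeneousComponent, if_pos rfl, coeff_zero] at h2

omit [Fintype σ] in
/-- A polynomial differs from its composition with a linear substitution by an element of an
explicit ideal. -/
theorem sub_aeval_mem {θ : Pol →ₐ[ℂ] Pol} {L : Ideal Pol} (hL : ∀ i, X i - θ (X i) ∈ L)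
    (hθ : ∀ i, θ (X i) ∈ idealOfVars σ ℂ) {k : ℕ} {p : Pol} (hp : p ∈ idealOfVars σ ℂ ^ (k + 1)) :
    p - θ p ∈ L * idealOfVars σ ℂ ^ k := by
  have hL' : ∀ a : Pol, a - θ a ∈ L := by
    intro a
    induction a using MvPolynomial.induction_on with
    | C c => rw [← algebraMap_eq, AlgHom.commutes, sub_self]; exact zero_mem _
    | add a b ha hb =>
      rw [map_add, add_sub_add_comm]
      exact add_mem ha hb
    | mul_X a i ha =>
      have : a * X i - θ (a * X i) = (a - θ a) * X i + θ a * (X i - θ (X i)) := by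
        rw [map_mul]; ring
      rw [this]
      exact add_mem (L.mul_mem_right _ ha) (L.mul_mem_left _ (hL i))
  have hm : ∀ a ∈ idealOfVars σ ℂ, θ a ∈ idealOfVars σ ℂ := by
    have : idealOfVars σ ℂ ≤ (idealOfVars σ ℂ).comap θ := by
      rw [Ideal.span_le]
      rintro _ ⟨i, rfl⟩
      exact hθ i
    exact fun a ha => this ha
  induction k generalizing p with
  | zero => rw [pow_zero, mul_one]; exact hL' p
  | succ k ih =>
    rw [pow_succ'] at hp
    refine Submodule.mul_induction_on hp ?_ ?_
    · intro a ha b hb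
      have : a * b - θ (a * b) = (a - θ a) * b + θ a * (b - θ b) := by
        rw [map_mul]; ring
      rw [this]
      refine add_mem (Ideal.mul_mem_mul (hL' a) hb) ?_
      have h1 : θ a * (b - θ b) ∈ idealOfVars σ ℂ * (L * idealOfVars σ ℂ ^ k) :=
        Ideal.mul_mem_mul (hm a ha) (ih hb)
      rwa [mul_left_comm, ← pow_succ'] at h1
    · intro a b ha hb
      rw [map_add, add_sub_add_comm]
      exact add_mem ha hb

/-- If a subset of an algebraic set, given by an ideal `J ≥ I`, contains curves in all tangent
directions at the origin, then both sets coincide near the origin. -/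
theorem exists_localizer {I J : Ideal Pol} (hIJ : I ≤ J)
    (hpath : ∀ Y : σ → ℂ, (∀ p ∈ I, ∑ i, Y i * coeff (Finsupp.single i 1) p = 0) →
      ∃ γ : ℂ → σ → ℂ, γ 0 = 0 ∧ (∀ i, HasDerivAt (fun t => γ t i) (Y i) 0) ∧
        ∀ p ∈ J, ∀ t, eval (γ t) p = 0) :
    ∃ s : Pol, eval 0 s ≠ 0 ∧ ∀ p ∈ J, s * p ∈ I := by
  classical
  set m := idealOfVars σ ℂ with hm
  have hJ0 : ∀ p ∈ J, coeff 0 p = 0 := by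
    obtain ⟨γ, h0, -, hγ⟩ := hpath 0 (fun p _ => by simp)
    intro p hp
    have h1 := hγ p hp 0
    rw [h0] at h1
    rwa [← constantCoeff_eq, ← eval_zero]
  -- the differential at the origin
  let D : Pol →ₗ[ℂ] Module.Dual ℂ (σ → ℂ) :=
    { toFun := fun p =>
        { toFun := fun Y => ∑ i, Y i * coeff (Finsupp.single i 1) p
          map_add' := fun Y Z => by simp [add_mul, Finset.sum_add_distrib]
          map_smul' := fun c Y => by simp [mul_assoc, Finset.mul_sum] }
      map_add' := fun p q => LinearMap.ext fun Y => by simp [mul_add, Finset.sum_add_distrib]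
      map_smul' := fun c p => LinearMap.ext fun Y => by simp [Finset.mul_sum, mul_left_comm] }
  have hD : ∀ p Y, D p Y = ∑ i, Y i * coeff (Finsupp.single i 1) p := fun _ _ => rfl
  let W : Submodule ℂ (Module.Dual ℂ (σ → ℂ)) := (I.restrictScalars ℂ).map D
  let g : Submodule ℂ (σ → ℂ) := W.dualCoannihilator
  have hg : ∀ Y, Y ∈ g ↔ ∀ p ∈ I, ∑ i, Y i * coeff (Finsupp.single i 1) p = 0 := by
    intro Y
    rw [Submodule.mem_dualCoannihilator]
    constructor
    · exact fun H p hp => H _ ⟨p, hp, rfl⟩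
    · rintro H _ ⟨p, hp, rfl⟩
      exact H p hp
  obtain ⟨π, hπ⟩ := LinearMap.exists_leftInverse_of_injective g.subtype (Submodule.ker_subtype g)
  have hπg : ∀ Y ∈ g, (π Y : σ → ℂ) = Y := fun Y hY =>
    congrArg Subtype.val (LinearMap.congr_fun hπ ⟨Y, hY⟩)
  let lin : Module.Dual ℂ (σ → ℂ) → Pol := fun l => ∑ j, C (l (Pi.single j 1)) * X j
  have hlin : ∀ l Y, eval Y (lin l) = l Y := by
    intro l Y
    conv_rhs => rw [← Finset.univ_sum_single Y, map_sum]
    simp only [lin, map_sum, map_mul, eval_C, eval_X]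
    refine Finset.sum_congr rfl fun j _ => ?_
    have : (Pi.single j (Y j) : σ → ℂ) = Y j • Pi.single j 1 := by
      rw [← Pi.single_smul, smul_eq_mul, mul_one]
    rw [this, map_smul, smul_eq_mul, mul_comm]
  have hlinm : ∀ l, lin l ∈ m := fun l => Ideal.sum_mem _ fun j _ =>
    Ideal.mul_mem_left _ _ (Ideal.subset_span ⟨j, rfl⟩)
  have hcoeff : ∀ l i, coeff (Finsupp.single i 1) (lin l) = l (Pi.single i 1) := by
    intro l i
    simp only [lin, coeff_sum, coeff_C_mul, coeff_X]
    rw [Finset.sum_eq_single i]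
    · simp
    · intro j _ hj
      rw [if_neg, mul_zero]
      exact fun h => hj (Finsupp.single_left_injective one_ne_zero h)
    · simp
  -- Substitution of a linear projection onto the tangent space `g` of `I`.
  let θ : Pol →ₐ[ℂ] Pol := aeval fun i => lin (LinearMap.proj i ∘ₗ g.subtype ∘ₗ π)
  have hθX : ∀ i, θ (X i) = lin (LinearMap.proj i ∘ₗ g.subtype ∘ₗ π) := fun i => aeval_X _ _
  have hθ : ∀ A p, eval A (θ p) = eval (π A : σ → ℂ) p := by
    intro A p
    have h1 : ((aeval (R := ℂ) A).comp θ : Pol →ₐ[ℂ] ℂ) = aeval (π A : σ → ℂ) := by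
      refine MvPolynomial.algHom_ext fun i => ?_
      rw [AlgHom.comp_apply, hθX, aeval_X]
      exact hlin _ A
    exact DFunLike.congr_fun h1 p
  let L : Ideal Pol := Ideal.span (Set.range fun i => X i - θ (X i))
  -- The linear form `X i - θ (X i)` vanishes on the tangent space, so it is the linear part of an
  -- element of `I`.
  have hL : L ≤ I ⊔ m ^ 2 := by
    rw [Ideal.span_le]
    rintro _ ⟨i, rfl⟩
    let l : Module.Dual ℂ (σ → ℂ) := LinearMap.proj i - LinearMap.proj i ∘ₗ g.subtype ∘ₗ π
    have hl : l ∈ W := by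
      have h1 : W = g.dualAnnihilator := (Subspace.dualCoannihilator_dualAnnihilator_eq).symm
      rw [h1, Submodule.mem_dualAnnihilator]
      intro Y hY
      simp [l, hπg Y hY]
    obtain ⟨q, hq, hql⟩ := hl
    have h1 : X i - θ (X i) = q + (X i - θ (X i) - q) := by ring
    change X i - θ (X i) ∈ I ⊔ m ^ 2
    rw [h1]
    refine Submodule.add_mem_sup hq ?_
    rw [hm, mem_pow_idealOfVars_iff']
    intro d hd
    have hd' : d = 0 ∨ ∃ j, d = Finsupp.single j 1 := by
      have : d.degree = 0 ∨ d.degree = 1 := by omega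
      rcases this with h | h
      · exact Or.inl ((Finsupp.degree_eq_zero_iff d).1 h)
      · exact Or.inr (exists_single_of_degree_eq_one h)
    rcases hd' with rfl | ⟨j, rfl⟩
    · have h2 : ∀ p ∈ m, coeff 0 p = 0 := fun p hp => by
        have hp' : p ∈ m ^ 1 := by rwa [pow_one]
        rw [hm, mem_pow_idealOfVars_iff'] at hp'
        exact hp' 0 (by simp)
      rw [coeff_sub, coeff_sub, hθX, h2 _ (hlinm _), h2 _ (Ideal.subset_span ⟨i, rfl⟩), hJ0 q (hIJ hq)]
      simp
    · rw [coeff_sub, coeff_sub, hθX, hcoeff]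
      have h2 : D q (Pi.single j 1) = coeff (Finsupp.single j 1) q := by
        rw [hD, Finset.sum_eq_single j]
        · simp
        · intro k _ hk; simp [hk]
        · simp
      rw [← h2, hql]
      have h3 : coeff (Finsupp.single j 1) (X i : Pol) = (Pi.single j 1 : σ → ℂ) i := by
        rw [coeff_X, Pi.single_apply]
        by_cases hij : i = j
        · subst hij; simp
        · rw [if_neg hij, if_neg]
          exact fun h => hij (Finsupp.single_left_injective one_ne_zero h)
      rw [h3]
      simp [l]
  -- For `f ∈ J` of order `k + 1`, the difference `f - θ f` lies in `I + m ^ (k + 2)`. The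
  -- polynomial `θ f` has order `k + 2`: on a line it is `f` along a tangent line, and `f` vanishes
  -- along a curve with that tangent.
  have claim : ∀ k, J ≤ I ⊔ m ^ (k + 1) := by
    intro k
    induction k with
    | zero =>
      intro p hp
      refine Submodule.mem_sup_right ?_
      rw [zero_add, hm, mem_pow_idealOfVars_iff']
      intro d hd
      rw [(Finsupp.degree_eq_zero_iff d).1 (by omega)]
      exact hJ0 p hp
    | succ k ih =>
      intro p hp
      obtain ⟨q, hq, f, hf, rfl⟩ := Submodule.mem_sup.1 (ih hp)
      have hfJ : f ∈ J := by
        have := J.sub_mem hp (hIJ hq)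
        rwa [add_sub_cancel_left] at this
      refine add_mem (Submodule.mem_sup_left hq) ?_
      have h1 : f - θ f ∈ I ⊔ m ^ (k + 1 + 1) := by
        have h2 := sub_aeval_mem (L := L) (θ := θ) (fun i => Ideal.subset_span ⟨i, rfl⟩)
          (fun i => by rw [hθX]; exact hlinm _) hf
        have h3 : L * m ^ k ≤ I ⊔ m ^ (k + 1 + 1) := by
          refine (Ideal.mul_mono_left hL).trans ?_
          rw [Ideal.sup_mul, ← pow_add, add_comm 2 k]
          exact sup_le_sup Ideal.mul_le_left (by rw [show k + 1 + 1 = k + 2 from rfl])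
        exact h3 h2
      have h2 : θ f ∈ m ^ (k + 1 + 1) := by
        refine mem_pow_idealOfVars_of_isLittleO fun A => ?_
        obtain ⟨γ, h0, hγ, hγJ⟩ := hpath (π A) ((hg _).1 (π A).2)
        have h3 := (eval_isLittleO h0 hγ hf).2.2
        have h4 : ∀ t : ℂ, eval (t • A) (θ f) = -(eval (γ t) f - eval (t • (π A : σ → ℂ)) f) := by
          intro t
          rw [hθ, map_smul, hγJ f hfJ t]
          simp
        simp only [h4]
        exact h3.neg_left
      have : f = (f - θ f) + θ f := by ring
      rw [this]
      exact add_mem h1 (Submodule.mem_sup_right h2)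
  -- Krull's intersection theorem in the quotient by `I`
  have hkrull : ∀ p ∈ J, ∃ s : Pol, eval 0 s ≠ 0 ∧ s * p ∈ I := by
    intro p hp
    have h1 : (Ideal.Quotient.mk I p) ∈ (⨅ i : ℕ, m ^ i • ⊤ : Submodule Pol (Pol ⧸ I)) := by
      rw [Submodule.mem_iInf]
      intro k
      obtain ⟨q, hq, f, hf, rfl⟩ := Submodule.mem_sup.1 (claim k hp)
      rw [map_add, Ideal.Quotient.eq_zero_iff_mem.2 hq, zero_add]
      have h2 : (Ideal.Quotient.mk I f) = f • (1 : Pol ⧸ I) := by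
        conv_lhs => rw [← mul_one f]
        rfl
      rw [h2]
      exact Submodule.smul_mem_smul (Ideal.pow_le_pow_right (Nat.le_succ k) hf) trivial
    obtain ⟨r, hr⟩ := (m.mem_iInf_smul_pow_eq_bot_iff _).1 h1
    refine ⟨1 - r, ?_, ?_⟩
    · have h2 : eval 0 (r : Pol) = 0 := by
        have h3 : (r : Pol) ∈ m ^ 1 := by rw [pow_one]; exact r.2
        have h4 := (mem_pow_idealOfVars_iff' 1 (r : Pol)).1 h3
        rw [eval_zero, constantCoeff_eq]
        exact h4 0 (by simp)
      rw [map_sub, map_one, h2, sub_zero]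
      exact one_ne_zero
    · have h2 : Ideal.Quotient.mk I ((r : Pol) * p) = Ideal.Quotient.mk I p := hr
      rw [← Ideal.Quotient.eq_zero_iff_mem, sub_mul, one_mul, map_sub, h2, sub_self]
  -- Each element of `J` has its own multiplier; multiplying those of finitely many generators gives
  -- one for all of `J`.
  obtain ⟨T, hT⟩ := (inferInstance : IsNoetherian Pol Pol).noetherian J
  have hT' : ∀ p ∈ T, p ∈ J := fun p hp => hT ▸ Submodule.subset_span hp
  choose! s hs using hkrull
  refine ⟨∏ p ∈ T, s p, ?_, fun p hp => ?_⟩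
  · rw [map_prod]
    exact Finset.prod_ne_zero_iff.2 fun p hp => (hs p (hT' p hp)).1
  · rw [← hT] at hp
    refine Submodule.span_induction (p := fun p _ => (∏ p ∈ T, s p) * p ∈ I) ?_ ?_ ?_ ?_ hp
    · intro p hp
      rw [← Finset.mul_prod_erase T s hp, mul_right_comm]
      exact I.mul_mem_right _ (hs p (hT' p hp)).2
    · rw [mul_zero]; exact zero_mem _
    · intro a b _ _ ha hb
      rw [mul_add]; exact add_mem ha hb
    · intro a b _ hb
      rw [smul_eq_mul, mul_left_comm]
      exact I.mul_mem_left _ hb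

end Tangent

section Unip

attribute [local instance 100] LieRing.ofAssociativeRing

open Module

variable {n : ℕ} {G : Subgroup (GL (Fin n) ℂ)} {h ν f : lieAlg G}

local notation "Mat" => Matrix (Fin n) (Fin n) ℂ

/-! ### Unipotent subgroups defined by weights -/

theorem exists_sub_lt (w : Fin n → ℤ) : ∃ R : ℕ, ∀ a b, w a - w b < R := by
  obtain ⟨M, hM⟩ := (Set.finite_range fun p : Fin n × Fin n => w p.1 - w p.2).bddAbove
  refine ⟨M.toNat + 1, fun a b => ?_⟩
  have := hM ⟨(a, b), rfl⟩
  simp only at this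
  omega

/-- A bound for the differences of weights. -/
def weightBound (w : Fin n → ℤ) : ℕ := (exists_sub_lt w).choose

theorem sub_lt_weightBound (w : Fin n → ℤ) (a b : Fin n) : w a - w b < weightBound w :=
  (exists_sub_lt w).choose_spec a b

/-- The polynomial path `s ↦ g ^ s` meets `G` at all natural numbers. Equations of `G` restrict to
polynomials in `s`, so they vanish identically along it, and its velocity is tangent to `G`. -/
theorem unipLog_mem_lieAlg (g : G) {m : ℕ} (hN : (mat g - 1) ^ m = 0) :
    unipLog m (mat g - 1) ∈ lieAlg G := by
  have hpow : ∀ j : ℕ, evPoly (j : ℂ) (binomPath m (mat g - 1)) = mat (g ^ j) := fun j => by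
    rw [evPoly_binomPath_natCast hN, add_sub_cancel]
    simp [mat]
  refine mem_lieAlg_of_path (γ := fun s => evPoly s (binomPath m (mat g - 1))) ?_
    (hasDerivAt_evPoly_zero _) fun p hp => ?_
  · have := hpow 0
    rwa [Nat.cast_zero, pow_zero] at this
  · let q : Polynomial ℂ := MvPolynomial.aeval (fun ij => binomPath m (mat g - 1) ij.1 ij.2) p
    have hq : ∀ s, q.eval s = evalMat (evPoly s (binomPath m (mat g - 1))) p := fun s => by
      have h1 : ((Polynomial.aeval s : Polynomial ℂ →ₐ[ℂ] ℂ).comp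
          (MvPolynomial.aeval fun ij => binomPath m (mat g - 1) ij.1 ij.2)) =
          MvPolynomial.aeval fun ij : Fin n × Fin n => evPoly s (binomPath m (mat g - 1)) ij.1 ij.2 := by
        refine MvPolynomial.algHom_ext fun ij => ?_
        rw [AlgHom.comp_apply, MvPolynomial.aeval_X, MvPolynomial.aeval_X]
        rfl
      exact DFunLike.congr_fun h1 p
    have hq0 : q = 0 := by
      refine Polynomial.eq_zero_of_infinite_isRoot _ ((Set.infinite_range_of_injective
        (Nat.cast_injective (R := ℂ))).mono ?_)
      rintro _ ⟨j, rfl⟩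
      change q.eval (j : ℂ) = 0
      rw [hq, hpow]
      exact hp _ (g ^ j).2
    intro s
    rw [← hq, hq0, Polynomial.eval_zero]

namespace PrincipalTriple

variable (S : PrincipalTriple G h ν f)

/-- The matrix of an element of the Lie algebra with respect to the eigenbasis. -/
def coLie : lieAlg G →ₗ[ℂ] Mat := S.basis.co.toLinearMap ∘ₗ (lieAlg G).toSubmodule.subtype

theorem coLie_injective : Function.Injective S.coLie := S.co_injective

/-- The elements of the Lie algebra with matrix entries only at differences of weights `≥ k`. -/
def fil (w : Fin n → ℤ) (k : ℤ) : Submodule ℂ (lieAlg G) := (weightFilt w k).comap S.coLie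

theorem mem_fil {w : Fin n → ℤ} {k : ℤ} {x : lieAlg G} :
    x ∈ S.fil w k ↔ S.basis.co (x : Mat) ∈ weightFilt w k := Iff.rfl

theorem co_sub_one (M : Mat) : S.basis.co (M - 1) = S.basis.co M - 1 := by rw [map_sub, map_one]

theorem pow_eq_zero_of_co_mem {w : Fin n → ℤ} {M : Mat} (hM : S.basis.co M ∈ weightFilt w 1) :
    M ^ weightBound w = 0 := by
  apply S.basis.co.injective
  rw [map_pow, map_zero]
  exact pow_eq_zero_of_mem_weightFilt (sub_lt_weightBound w) hM

theorem co_unipLog (m : ℕ) (N : Mat) : S.basis.co (unipLog m N) = unipLog m (S.basis.co N) := by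
  rw [unipLog_eq_sum, unipLog_eq_sum, map_sum]
  simp only [map_smul, map_pow]

theorem co_exp_sub_one_mem {w : Fin n → ℤ} {M : Mat} (hM : S.basis.co M ∈ weightFilt w 1) :
    S.basis.co (NormedSpace.exp M) - 1 ∈ weightFilt w 1 := by
  rw [S.basis.co_exp]
  exact exp_sub_one_mem (sub_lt_weightBound w) hM

theorem co_inv_sub_one_mem {w : Fin n → ℤ} {M M' : Mat} (h1 : M * M' = 1)
    (hM : S.basis.co M - 1 ∈ weightFilt w 1) : S.basis.co M' - 1 ∈ weightFilt w 1 := by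
  rw [← S.co_sub_one] at hM
  have h2 := exp_unipLog (S.pow_eq_zero_of_co_mem hM)
  rw [add_sub_cancel] at h2
  have h3 := exp_mul_exp_neg (unipLog (weightBound w) (M - 1))
  rw [h2] at h3
  have h4 : M' = NormedSpace.exp (-unipLog (weightBound w) (M - 1)) := by
    have h5 := mul_eq_one_comm.1 h1
    calc M' = M' * (M * NormedSpace.exp (-unipLog (weightBound w) (M - 1))) := by rw [h3, mul_one]
      _ = _ := by rw [← mul_assoc, h5, one_mul]
  rw [h4]
  refine S.co_exp_sub_one_mem ?_
  rw [map_neg, S.co_unipLog]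
  exact neg_mem (unipLog_mem hM _)

theorem mul_sub_one_mem_weightFilt {w : Fin n → ℤ} {M N : Mat} {k : ℤ} (hk : 0 ≤ k)
    (hM : M - 1 ∈ weightFilt w k)
    (hN : N - 1 ∈ weightFilt w k) : M * N - 1 ∈ weightFilt w k := by
  have h1 : M * N - 1 = (M - 1) * (N - 1) + (M - 1) + (N - 1) := by noncomm_ring
  rw [h1]
  exact add_mem (add_mem (weightFilt_mono (by omega) (mul_mem_weightFilt hM hN)) hM) hN

/-- The unipotent subgroup of elements of `G` that are unipotent with respect to the order
of the eigenbasis given by `w`. -/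
def unip (w : Fin n → ℤ) : Subgroup G where
  carrier := {g | S.basis.co (mat g) - 1 ∈ weightFilt w 1}
  one_mem' := by
    change S.basis.co (1 : Mat) - 1 ∈ weightFilt w 1
    rw [map_one, sub_self]
    exact zero_mem _
  mul_mem' := fun {a b} ha hb => by
    change S.basis.co (mat (a * b)) - 1 ∈ weightFilt w 1
    rw [mat_mul, map_mul]
    exact mul_sub_one_mem_weightFilt zero_le_one ha hb
  inv_mem' := fun {a} ha => S.co_inv_sub_one_mem (mat_mul_mat_inv a) ha

theorem mem_unip {w : Fin n → ℤ} {g : G} : g ∈ S.unip w ↔ S.basis.co (mat g) - 1 ∈ weightFilt w 1 :=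
  Iff.rfl

theorem co_mem_weightFilt_of_mem_unip {w : Fin n → ℤ} {g : G} (hg : g ∈ S.unip w) :
    S.basis.co (mat g) ∈ weightFilt w 0 := by
  have := add_mem (weightFilt_mono zero_le_one (S.mem_unip.1 hg)) one_mem_weightFilt
  rwa [sub_add_cancel] at this

include S in
/-- The exponential map. -/
def expG (x : lieAlg G) : G := ⟨expGL (x : Mat), expGL_mem S.isLinearAlgebraic x.2⟩

theorem mat_expG (x : lieAlg G) : mat (S.expG x) = NormedSpace.exp (x : Mat) := rfl

theorem expG_mem_unip {w : Fin n → ℤ} {x : lieAlg G} (hx : x ∈ S.fil w 1) : S.expG x ∈ S.unip w :=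
  S.co_exp_sub_one_mem hx

theorem mat_sub_one_pow {w : Fin n → ℤ} {g : G} (hg : g ∈ S.unip w) :
    (mat g - 1) ^ weightBound w = 0 :=
  S.pow_eq_zero_of_co_mem (by rw [S.co_sub_one]; exact hg)

/-- The logarithm on a unipotent subgroup. -/
def logU {w : Fin n → ℤ} {g : G} (hg : g ∈ S.unip w) : lieAlg G :=
  ⟨unipLog (weightBound w) (mat g - 1), unipLog_mem_lieAlg g (S.mat_sub_one_pow hg)⟩

theorem coe_logU {w : Fin n → ℤ} {g : G} (hg : g ∈ S.unip w) :
    (S.logU hg : Mat) = unipLog (weightBound w) (mat g - 1) := rfl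

theorem logU_mem {w : Fin n → ℤ} {g : G} (hg : g ∈ S.unip w) : S.logU hg ∈ S.fil w 1 := by
  rw [mem_fil, coe_logU, co_unipLog, co_sub_one]
  exact unipLog_mem hg _

theorem expG_logU {w : Fin n → ℤ} {g : G} (hg : g ∈ S.unip w) : S.expG (S.logU hg) = g :=
  mat_injective (by rw [mat_expG, coe_logU, exp_unipLog (S.mat_sub_one_pow hg), add_sub_cancel])

theorem logU_expG {w : Fin n → ℤ} {x : lieAlg G} (hx : x ∈ S.fil w 1) :
    S.logU (S.expG_mem_unip hx) = x :=
  Subtype.ext (unipLog_exp (S.pow_eq_zero_of_co_mem hx) (S.mat_sub_one_pow (S.expG_mem_unip hx)))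

/-! ### The grading by the neutral element -/

/-- The space `ℂ ^ n` is itself a representation of the triple, so the eigenvalues of `h` on it are
integers. -/
theorem exists_lam_neutral (a : Fin n) : ∃ k : ℤ, S.basis.lam a (neutral h) = k := by
  let v : Fin n → ℂ := S.basis.Q.1.mulVec (Pi.single a 1)
  have hv : (h : Mat).mulVec v = S.basis.lam a (neutral h) • v := by
    have h1 := S.basis.conj (neutral h)
    have h2 : (Matrix.diagonal fun j => S.basis.lam j (neutral h)).mulVec (Pi.single a 1) =
        S.basis.lam a (neutral h) • (Pi.single a 1 : Fin n → ℂ) := by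
      ext b
      rw [Matrix.mulVec_diagonal, Pi.smul_apply, smul_eq_mul]
      by_cases hab : b = a
      · rw [hab]
      · rw [Pi.single_eq_of_ne hab, mul_zero, mul_zero]
    calc (h : Mat).mulVec v = ((h : Mat) * S.basis.Q.1).mulVec (Pi.single a 1) := by
          rw [← Matrix.mulVec_mulVec]
      _ = _ := by
          change (((neutral h : LieSubalgebra.engel ℂ h) : lieAlg G) * S.basis.Q.1 : Mat).mulVec _ = _
          rw [h1, ← Matrix.mulVec_mulVec, h2, Matrix.mulVec_smul]
  refine S.triple.isSl2_toLin'.exists_int_of_apply_eq_smul (v := v) (by rw [Matrix.toLin'_apply]; exact hv) ?_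
  intro h0
  have h1 : (S.basis.Q⁻¹ : GL (Fin n) ℂ).1.mulVec v = Pi.single a 1 := by
    rw [Matrix.mulVec_mulVec, Units.inv_mul, Matrix.one_mulVec]
  rw [h0, Matrix.mulVec_zero] at h1
  have := congrFun h1 a
  rw [Pi.single_eq_same] at this
  exact zero_ne_one this

/-- The eigenvalues of `h` on the eigenbasis. -/
def wt (a : Fin n) : ℤ := (S.exists_lam_neutral a).choose

theorem lam_neutral (a : Fin n) : S.basis.lam a (neutral h) = S.wt a := (S.exists_lam_neutral a).choose_spec

theorem wt_sub_of_mem_gr {k : ℤ} {x : lieAlg G} (hx : x ∈ gr G h k) {a b : Fin n}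
    (hab : S.basis.co (x : Mat) a b ≠ 0) : S.wt a - S.wt b = k := by
  have h1 := S.co_lie (neutral h) x a b
  rw [gr, Module.End.mem_eigenspace_iff] at hx
  have h2 : ⁅((neutral h : LieSubalgebra.engel ℂ h) : lieAlg G), x⁆ = (k : ℂ) • x := hx
  rw [h2, S.lam_neutral, S.lam_neutral] at h1
  change S.basis.co ((k : ℂ) • (x : Mat)) a b = _ at h1
  rw [map_smul, Matrix.smul_apply, smul_eq_mul] at h1
  have h3 := mul_right_cancel₀ hab h1
  exact_mod_cast h3.symm

include S in
theorem iSup_gr : ⨆ k : ℤ, gr G h k = ⊤ :=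
  (S.triple.isSl2 (LieAlgebra.ad ℂ (lieAlg G))).iSup_eigenspace

/-- An element of `ad h`-degree `i` has matrix entries only at weight difference `i`. The converse
inclusion splits off the components of degree less than `k`, which lie in the opposite filtration
`N` and so must vanish. -/
theorem grGE_eq_fil (k : ℤ) : grGE G h k = S.fil S.wt k := by
  refine le_antisymm (iSup_le fun i x hx a b hab => ?_) fun x hx => ?_
  · have h1 := S.wt_sub_of_mem_gr hx hab
    have := i.2
    omega
  · let N : Submodule ℂ (lieAlg G) := S.fil (-S.wt) (1 - k)
    have h1 : grGE G h k ⊔ N = ⊤ := by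
      rw [eq_top_iff, ← S.iSup_gr]
      refine iSup_le fun i => ?_
      by_cases hi : k ≤ i
      · exact le_sup_of_le_left (le_iSup_of_le (⟨i, hi⟩ : {i : ℤ // k ≤ i}) le_rfl)
      · refine le_sup_of_le_right fun y hy a b hab => ?_
        have h1 := S.wt_sub_of_mem_gr hy hab
        simp only [Pi.neg_apply]
        omega
    have h2 : x ∈ grGE G h k ⊔ N := by rw [h1]; trivial
    obtain ⟨y, hy, z, hz, rfl⟩ := Submodule.mem_sup.1 h2
    have hz0 : z = 0 := by
      apply S.coLie_injective
      rw [map_zero]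
      have h3 : y ∈ S.fil S.wt k := by
        have : grGE G h k ≤ S.fil S.wt k := iSup_le fun i x hx a b hab => by
          have h1 := S.wt_sub_of_mem_gr hx hab
          have := i.2
          omega
        exact this hy
      have h4 := (S.fil S.wt k).sub_mem hx h3
      rw [add_sub_cancel_left] at h4
      ext a b
      by_contra hab
      have h5 := h4 a b hab
      have h6 := hz a b hab
      simp only [Pi.neg_apply] at h6
      omega
    rw [hz0, add_zero]
    exact hy

theorem exists_add_add (x : lieAlg G) : ∃ y ∈ S.fil (-S.wt) 1, ∃ z : LieSubalgebra.engel ℂ h,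
    ∃ u ∈ S.fil S.wt 1, x = y + (z : lieAlg G) + u := by
  have h1 : S.fil (-S.wt) 1 ⊔ (LieSubalgebra.engel ℂ h).toSubmodule ⊔ S.fil S.wt 1 = ⊤ := by
    rw [eq_top_iff, ← S.iSup_gr]
    refine iSup_le fun i => ?_
    rcases lt_trichotomy i 0 with hi | rfl | hi
    · refine le_sup_of_le_left (le_sup_of_le_left fun y hy a b hab => ?_)
      have h1 := S.wt_sub_of_mem_gr hy hab
      simp only [Pi.neg_apply]
      omega
    · exact le_sup_of_le_left (le_sup_of_le_right S.gr_zero.le)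
    · refine le_sup_of_le_right fun y hy a b hab => ?_
      have h1 := S.wt_sub_of_mem_gr hy hab
      omega
  have h2 : x ∈ S.fil (-S.wt) 1 ⊔ (LieSubalgebra.engel ℂ h).toSubmodule ⊔ S.fil S.wt 1 := by
    rw [h1]; trivial
  obtain ⟨w, hw, u, hu, rfl⟩ := Submodule.mem_sup.1 h2
  obtain ⟨y, hy, z, hz, rfl⟩ := Submodule.mem_sup.1 hw
  exact ⟨y, hy, ⟨z, hz⟩, u, hu, rfl⟩

theorem nilradical_eq_fil_two : nilradical G h = S.fil S.wt 2 := by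
  rw [S.nilradical_eq, S.grGE_eq_fil]

theorem nilradical_eq_fil_one : nilradical G h = S.fil S.wt 1 := by
  rw [nilradical, S.grGE_eq_fil]

/-- Every element of the unipotent group is the exponential of its logarithm, which lies in `𝔲`;
conversely such exponentials are unipotent. -/
theorem groupU_eq_unip : groupU G h = S.unip S.wt := by
  refine le_antisymm ((Subgroup.closure_le _).2 ?_) fun g hg => ?_
  · rintro g ⟨x, hx, hg⟩
    rw [S.nilradical_eq_fil_one] at hx
    change S.basis.co (mat g) - 1 ∈ weightFilt S.wt 1
    rw [hg]
    exact S.co_exp_sub_one_mem hx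
  · refine Subgroup.subset_closure ⟨S.logU hg, ?_, ?_⟩
    · rw [S.nilradical_eq_fil_one]
      exact S.logU_mem hg
    · rw [← S.mat_expG, S.expG_logU]

/-- There are no odd weights in degree one. -/
theorem co_sub_one_mem_two {g : G} (hg : g ∈ S.unip S.wt) : S.basis.co (mat g) - 1 ∈ weightFilt S.wt 2 := by
  -- The logarithm lies in `𝔲`, whose degrees start at `2` because `𝔤_1 = 0`; all nonconstant terms
  -- of the exponential series inherit this.
  have h1 := S.logU_mem hg
  rw [← S.nilradical_eq_fil_one, S.nilradical_eq_fil_two, mem_fil, coe_logU, co_unipLog, co_sub_one] at h1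
  have h2 := exp_unipLog (pow_eq_zero_of_mem_weightFilt (sub_lt_weightBound S.wt) hg)
  have h3 : unipLog (weightBound S.wt) (S.basis.co (mat g) - 1) ^ (weightBound S.wt + 1) = 0 := by
    rw [pow_succ, pow_eq_zero_of_mem_weightFilt (sub_lt_weightBound S.wt)
      (weightFilt_mono (by norm_num) h1), zero_mul]
  rw [exp_eq_sum_of_pow h3, Finset.sum_range_succ', Nat.factorial_zero, pow_zero, Nat.cast_one, inv_one,
    one_smul, add_comm, add_left_cancel_iff] at h2
  rw [← h2]
  refine Submodule.sum_mem _ fun k _ => Submodule.smul_mem _ _ ?_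
  exact weightFilt_mono (by push_cast; omega) (pow_mem_weightFilt h1 (k + 1))

end PrincipalTriple

end Unip

/-! ### Points of the torus and the action of the Borel subgroup on `𝔲̃` -/

section BorelAction

attribute [local instance 100] LieRing.ofAssociativeRing

open Module

variable {n : ℕ} {G : Subgroup (GL (Fin n) ℂ)} {h ν f : lieAlg G}

local notation "Mat" => Matrix (Fin n) (Fin n) ℂ

/-! ### The torus is closed -/

theorem zsmul_surjective_units {k : ℤ} (hk : k ≠ 0) :
    Function.Surjective (fun z : Additive ℂˣ => k • z) := by
  intro z
  refine ⟨Additive.ofMul (Units.mk0 (Complex.exp (Complex.log (z.toMul : ℂ) / k)) (Complex.exp_ne_zero _)), ?_⟩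
  apply Additive.toMul.injective
  refine Units.ext ?_
  change ((Units.mk0 (Complex.exp (Complex.log (z.toMul : ℂ) / k)) (Complex.exp_ne_zero _) ^ k : ℂˣ) : ℂ) = _
  rw [Units.val_zpow_eq_zpow_val, Units.val_mk0, ← Complex.exp_int_mul,
    mul_div_cancel₀ _ (Int.cast_ne_zero.2 hk), Complex.exp_log (Units.ne_zero _)]

/-- The group `ℂ^×` is divisible, hence an injective abelian group, so a homomorphism that vanishes
on `ker q` extends from the image of `q`. -/
theorem exists_extension {N M : Type} [AddCommGroup N] [AddCommGroup M] (q : N →+ M)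
    (ψ : N →+ Additive ℂˣ) (H : ∀ x, q x = 0 → ψ x = 0) :
    ∃ s : M →+ Additive ℂˣ, ∀ x, s (q x) = ψ x := by
  let : DivisibleBy (Additive ℂˣ) ℤ := divisibleByOfSMulRightSurj _ _ zsmul_surjective_units
  obtain ⟨s, hs⟩ := (Module.Baer.of_divisible (Additive ℂˣ)).extension_property_addMonoidHom
    (QuotientAddGroup.kerLift q) (QuotientAddGroup.kerLift_injective q)
    (QuotientAddGroup.lift q.ker ψ fun x hx => H x hx)
  exact ⟨s, fun x => DFunLike.congr_fun hs (x : N ⧸ q.ker)⟩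

/-- A lattice of characters on a torus all of whose homomorphisms come from points. -/
theorem exists_point_of_relations {C M T ι : Type} [AddCommGroup C] [AddCommGroup M] [Fintype ι]
    (q : C →+ M) (hq : Function.Injective q) (ev : C → T → ℂˣ)
    (hex : ∀ s : M →+ Additive ℂˣ, ∃ t, ∀ χ, Additive.ofMul (ev χ t) = s (q χ))
    (c : ι → C) (x : ι → ℂˣ) (hx : ∀ m : ι → ℤ, ∑ j, m j • c j = 0 → ∏ j, x j ^ m j = 1) :
    ∃ t, ∀ j, ev (c j) t = x j := by
  classical
  let φ : (ι → ℤ) →+ C :=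
    { toFun := fun m => ∑ j, m j • c j
      map_zero' := by simp
      map_add' := fun a b => by simp [add_smul, Finset.sum_add_distrib] }
  let ψ : (ι → ℤ) →+ Additive ℂˣ :=
    { toFun := fun m => Additive.ofMul (∏ j, x j ^ m j)
      map_zero' := by simp
      map_add' := fun a b => by simp [zpow_add, Finset.prod_mul_distrib] }
  obtain ⟨s, hs⟩ := exists_extension (q.comp φ) ψ fun m hm => by
    have h1 : φ m = 0 := hq (by rw [map_zero]; exact hm)
    exact congrArg Additive.ofMul (hx m h1)
  obtain ⟨t, ht⟩ := hex s
  refine ⟨t, fun j => ?_⟩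
  have h1 := hs (Pi.single j 1)
  have h2 : φ (Pi.single j 1) = c j := by
    change ∑ i, (Pi.single j 1 : ι → ℤ) i • c i = c j
    rw [Finset.sum_eq_single j]
    · simp
    · intro i _ hi; simp [hi]
    · simp
  have h3 : ψ (Pi.single j 1) = Additive.ofMul (x j) := by
    change Additive.ofMul (∏ i, x i ^ (Pi.single j 1 : ι → ℤ) i) = Additive.ofMul (x j)
    rw [Finset.prod_eq_single j]
    · simp
    · intro i _ hi; simp [hi]
    · simp
  rw [AddMonoidHom.comp_apply, h2, h3, ← ht] at h1
  exact Additive.ofMul.injective h1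

namespace PrincipalTriple

variable (S : PrincipalTriple G h ν f)

/-- The matrices of the elements of the torus are the invertible diagonal matrices that satisfy the
relations of the weights of the eigenbasis. -/
theorem exists_torusT_coord (x : Fin n → ℂˣ)
    (hx : ∀ m : Fin n → ℤ, ∑ j, m j • S.coordChar j = 0 → ∏ j, x j ^ m j = 1) :
    ∃ t : torusT G h, ∀ j, S.coord j t = x j := by
  obtain ⟨d, hd, hP⟩ := S.exists_latticeP_le
  let q : CharLattice G h →+ latticeQd G h d :=
    (AddSubgroup.inclusion hP).comp (toReal G h).rangeRestrict
  have hq : Function.Injective q := fun χ ψ H => S.toReal_injective (congrArg Subtype.val H)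
  refine exists_point_of_relations q hq (fun χ t => charEval χ t) (fun s => ?_) S.coordChar x hx
  obtain ⟨t, ht⟩ := S.exists_torusT hd hP (AddMonoidHom.toMultiplicativeLeft s)
  exact ⟨t, fun χ => congrArg Additive.ofMul (ht χ)⟩

/-! ### The action of the torus on the toric variety -/

include S in
theorem exists_torusHom (t : torusT G h) : ∃ s : TorusOf (latticeP G h),
    ∀ (χ : CharLattice G h) (hχ : toReal G h χ ∈ latticeP G h),
      s (Multiplicative.ofAdd ⟨toReal G h χ, hχ⟩) = charEval χ t := by
  let e := AddMonoidHom.ofInjective S.toReal_injective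
  refine ⟨AddMonoidHom.toMultiplicativeLeft ((evalHom G h t).comp e.symm.toAddMonoidHom), fun χ hχ => ?_⟩
  have h1 : e.symm ⟨toReal G h χ, hχ⟩ = χ := by
    rw [AddEquiv.symm_apply_eq]; rfl
  change ((evalHom G h t) (e.symm ⟨toReal G h χ, hχ⟩)).toMul = _
  rw [h1]; rfl

/-- The translate of a point of the toric variety by an element of the torus. -/
def smulV (t : torusT G h) (v : ToricPoint (latticeP G h)) : ToricPoint (latticeP G h) :=
  torusToToric (latticeP G h) (S.exists_torusHom t).choose * v

theorem toricEval_smulV (t : torusT G h) (v : ToricPoint (latticeP G h)) (χ : CharLattice G h)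
    (hχ : toReal G h χ ∈ coneSemigroup (latticeP G h)) :
    toricEval (S.smulV t v) (toReal G h χ) hχ = charEval χ t * toricEval v (toReal G h χ) hχ := by
  rw [← (S.exists_torusHom t).choose_spec χ hχ.2]
  rfl

omit S in
theorem toricPoint_ext {v v' : ToricPoint (latticeP G h)}
    (H : ∀ (χ : CharLattice G h) (hχ : toReal G h χ ∈ coneSemigroup (latticeP G h)),
      toricEval v (toReal G h χ) hχ = toricEval v' (toReal G h χ) hχ) : v = v' := by
  refine MonoidHom.ext ?_
  rintro ⟨μ, hμ⟩
  obtain ⟨χ, rfl⟩ := hμ.2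
  exact H χ hμ

theorem smulV_mul (t t' : torusT G h) (v : ToricPoint (latticeP G h)) :
    S.smulV (t * t') v = S.smulV t (S.smulV t' v) :=
  toricPoint_ext fun χ hχ => by
    rw [S.toricEval_smulV, S.toricEval_smulV, S.toricEval_smulV, ← mul_assoc, ← Units.val_mul]
    congr 2
    exact map_mul (Additive.toMul χ).1 t t'

theorem smulV_one (v : ToricPoint (latticeP G h)) : S.smulV 1 v = v :=
  toricPoint_ext fun χ hχ => by
    rw [S.toricEval_smulV]
    have : charEval χ (1 : torusT G h) = 1 := map_one (Additive.toMul χ).1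
    rw [this, Units.val_one, one_mul]

/-! ### The adjoint action -/

theorem torusT_ext_coord {t t' : torusT G h} (H : ∀ j, S.coord j t = S.coord j t') : t = t' := by
  refine Subtype.ext (mat_injective (S.basis.co.injective ?_))
  rw [S.co_mat_torus t, S.co_mat_torus t']
  congr 1
  ext j
  rw [← S.coe_coord, ← S.coe_coord, H]

theorem co_torus_mem (t : torusT G h) (w : Fin n → ℤ) : S.basis.co (mat (t : G)) ∈ weightFilt w 0 := by
  rw [S.co_mat_torus]
  exact diagonal_mem_weightFilt _

theorem co_mul_torus_unip (t : torusT G h) {w : Fin n → ℤ} {u : G} (hu : u ∈ S.unip w) (j : Fin n) :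
    S.basis.co (mat ((t : G) * u)) j j = S.coord j t := by
  rw [mat_mul, map_mul, S.co_mat_torus, Matrix.diagonal_mul, S.coe_coord]
  have h1 : S.basis.co (mat u) j j = 1 := by
    by_contra hne
    have := hu j j (by rw [Matrix.sub_apply, Matrix.one_apply_eq]; exact sub_ne_zero.2 hne)
    omega
  rw [h1, mul_one]

/-- The torus normalizes the unipotent subgroups. -/
theorem conj_mem_unip (t : torusT G h) {w : Fin n → ℤ} {u : G} (hu : u ∈ S.unip w) :
    (t : G) * u * (t : G)⁻¹ ∈ S.unip w := by
  have h1 : mat ((t : G) * u * (t : G)⁻¹) - 1 = mat (t : G) * (mat u - 1) * mat ((t⁻¹ : torusT G h) : G) := by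
    rw [mul_sub, sub_mul, mul_one, Subgroup.coe_inv, mat_mul_mat_inv, mat_mul, mat_mul]
  rw [mem_unip, ← S.co_sub_one, h1, map_mul, map_mul, S.co_sub_one]
  have := mul_mem_weightFilt (mul_mem_weightFilt (S.co_torus_mem t w) hu) (S.co_torus_mem t⁻¹ w)
  simpa using this

theorem adG_mem_fil {w : Fin n → ℤ} {k : ℤ} {g : G} (hg : S.basis.co (mat g) ∈ weightFilt w 0)
    (hg' : S.basis.co (mat g⁻¹) ∈ weightFilt w 0) {x : lieAlg G} (hx : x ∈ S.fil w k) :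
    adG g x ∈ S.fil w k := by
  rw [mem_fil, coe_adG, map_mul, map_mul]
  have := mul_mem_weightFilt (mul_mem_weightFilt hg hx) hg'
  rwa [zero_add, add_zero] at this

theorem adG_torus_mem_fil (t : torusT G h) {w : Fin n → ℤ} {k : ℤ} {x : lieAlg G} (hx : x ∈ S.fil w k) :
    adG (t : G) x ∈ S.fil w k :=
  S.adG_mem_fil (S.co_torus_mem t w) (S.co_torus_mem t⁻¹ w) hx

/-- `u - 1` raises weights by at least `2`. So `U` acts trivially on `𝔲 / 𝔤_{≥ 4}`, compatibly with
its trivial action on `𝒱`. -/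
theorem adG_unip_sub_mem_fil {u : G} (hu : u ∈ S.unip S.wt) {k : ℤ} {x : lieAlg G} (hx : x ∈ S.fil S.wt k) :
    adG u x - x ∈ S.fil S.wt (k + 2) := by
  have h1 : ((adG u x - x : lieAlg G) : Mat) = (mat u - 1) * x * mat u⁻¹ + x * (mat u⁻¹ - 1) := by
    rw [AddSubgroupClass.coe_sub, coe_adG]
    noncomm_ring
  rw [mem_fil, h1, map_add, map_mul, map_mul, map_mul, S.co_sub_one, S.co_sub_one]
  have h2 := S.co_sub_one_mem_two hu
  have h3 := S.co_sub_one_mem_two ((S.unip S.wt).inv_mem hu)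
  have h4 := S.co_mem_weightFilt_of_mem_unip ((S.unip S.wt).inv_mem hu)
  refine add_mem ?_ (mul_mem_weightFilt hx h3)
  have := mul_mem_weightFilt (mul_mem_weightFilt h2 hx) h4
  rwa [add_zero, add_comm] at this

theorem adG_torus_rho (t : torusT G h) (v : ToricPoint (latticeP G h)) :
    adG (t : G) (S.rho v) = S.rho (S.smulV t v) := by
  have := S.finite_simpleRoots
  have : Fintype (simpleRoots G h) := Fintype.ofFinite _
  rw [rho, rho, finsum_eq_sum_of_fintype, finsum_eq_sum_of_fintype, map_sum]
  refine Finset.sum_congr rfl fun α _ => ?_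
  rw [map_smul, ← isAd_iff.1 (S.isWeightVector_E α t), S.toricEval_smulV, smul_smul, mul_comm]

theorem E_mem_fil (α : simpleRoots G h) : S.E α ∈ S.fil S.wt 2 := by
  rw [← S.grGE_eq_fil]
  refine Submodule.mem_iSup_of_mem (⟨2, le_rfl⟩ : {i : ℤ // 2 ≤ i}) ?_
  rw [gr, Module.End.mem_eigenspace_iff]
  have h1 := S.isWeightVector_iff.1 (S.isWeightVector_E α) (neutral h)
  rw [S.D_simpleRoot_neutral] at h1
  have h2 : ((2 : ℤ) : ℂ) = 2 := by norm_num
  rw [h2]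
  exact h1

theorem rho_mem_fil (v : ToricPoint (latticeP G h)) : S.rho v ∈ S.fil S.wt 2 := by
  have := S.finite_simpleRoots
  have : Fintype (simpleRoots G h) := Fintype.ofFinite _
  rw [rho, finsum_eq_sum_of_fintype]
  exact Submodule.sum_mem _ fun α _ => Submodule.smul_mem _ _ (S.E_mem_fil α)

theorem fil_mono (w : Fin n → ℤ) {k l : ℤ} (hkl : k ≤ l) : S.fil w l ≤ S.fil w k :=
  fun _ hx => weightFilt_mono hkl hx

/-- `ρ(v)` lies in `𝔤_2`, so membership in `𝔲` is automatic; the fibre product is `𝒱 × 𝔤_{≥ 4}`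
after subtraction of `ρ(v)`. -/
theorem mem_uTilde_iff {w : ToricPoint (latticeP G h) × lieAlg G} :
    w ∈ uTilde G h ν ↔ w.2 - S.rho w.1 ∈ S.fil S.wt 4 := by
  rw [uTilde, Set.mem_ofPred_eq, S.nilradical_eq_fil_two, S.grGE_eq_fil]
  constructor
  · rintro ⟨-, y, hy, h2⟩
    rwa [S.isRho_iff.1 hy] at h2
  · intro h2
    refine ⟨?_, S.rho w.1, S.isRho_iff.2 rfl, h2⟩
    have := add_mem (S.fil_mono S.wt (by norm_num : (2 : ℤ) ≤ 4) h2) (S.rho_mem_fil w.1)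
    rwa [sub_add_cancel] at this

theorem translate_sub_rho_mem (t : torusT G h) {u : G} (hu : u ∈ S.unip S.wt)
    {v : ToricPoint (latticeP G h)} {x : lieAlg G} (hw : (v, x) ∈ uTilde G h ν) :
    adG ((t : G) * u) x - S.rho (S.smulV t v) ∈ S.fil S.wt 4 := by
  have h0 : x ∈ nilradical G h := hw.1
  rw [S.nilradical_eq_fil_two] at h0
  rw [S.mem_uTilde_iff] at hw
  have h1 : adG ((t : G) * u) x - S.rho (S.smulV t v) =
      adG (t : G) ((adG u x - x) + (x - S.rho v)) := by
    rw [adG_mul, ← S.adG_torus_rho, ← map_sub, sub_add_sub_cancel]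
  rw [h1]
  exact S.adG_torus_mem_fil t (add_mem (S.adG_unip_sub_mem_fil hu h0) hw)

/-- The factor in `T` is unique, being the diagonal part in the eigenbasis, so the existential over
factorizations reduces to the given one. -/
theorem isBorelTranslate_iff (t : torusT G h) {u : G} (hu : u ∈ S.unip S.wt) {w w' : uTilde G h ν} :
    IsBorelTranslate G h ν ((t : G) * u) w w' ↔
      w'.1.1 = S.smulV t w.1.1 ∧ w'.1.2 = adG ((t : G) * u) w.1.2 := by
  rw [IsBorelTranslate, isAd_iff]
  refine and_congr_left fun _ => ?_
  constructor
  · rintro ⟨t', u', hu', htu, H⟩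
    rw [S.groupU_eq_unip] at hu'
    have ht : t' = t := S.torusT_ext_coord fun j => Units.ext (by
      rw [← S.co_mul_torus_unip t' hu', ← htu, S.co_mul_torus_unip t hu])
    subst ht
    exact toricPoint_ext fun χ hχ => by rw [H, S.toricEval_smulV]
  · intro H
    refine ⟨t, u, by rwa [S.groupU_eq_unip], rfl, fun χ hχ => ?_⟩
    rw [H, S.toricEval_smulV]

include S in
theorem torus_mul_mem_borel (t : torusT G h) {u : G} (hu : u ∈ S.unip S.wt) : (t : G) * u ∈ borel G h := by
  refine mul_mem ?_ ?_
  · refine Subgroup.closure_mono ?_ t.2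
    rintro g ⟨x, hx, hg⟩
    exact ⟨x, Submodule.mem_sup_left hx, hg⟩
  · rw [← S.groupU_eq_unip] at hu
    refine Subgroup.closure_mono ?_ hu
    rintro g ⟨x, hx, hg⟩
    exact ⟨x, Submodule.mem_sup_right hx, hg⟩

end PrincipalTriple

end BorelAction

/-! ### Regular functions near a point -/

namespace FunctionSpace

/-- The algebra of functions that are regular near a given point. -/
def regSubalgebra (X : FunctionSpace) (x : X.carrier) : Subalgebra ℂ (X.carrier → ℂ) where
  carrier := {F | X.RegAt x F}
  mul_mem' := fun {f g} hf hg => X.mul x f g hf hg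
  add_mem' := fun {f g} hf hg => X.add x f g hf hg
  algebraMap_mem' := fun c => X.const x c

theorem inv_mem_regSubalgebra {X : FunctionSpace} {x : X.carrier} {F : X.carrier → ℂ}
    (hF : F ∈ X.regSubalgebra x) (h0 : F x ≠ 0) : (fun y => (F y)⁻¹) ∈ X.regSubalgebra x :=
  X.inv x F hF h0

theorem zpow_mem_regSubalgebra {X : FunctionSpace} {x : X.carrier} {F : X.carrier → ℂ}
    (hF : F ∈ X.regSubalgebra x) (h0 : F x ≠ 0) (k : ℤ) : (fun y => F y ^ k) ∈ X.regSubalgebra x := by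
  obtain ⟨m, rfl | rfl⟩ := k.eq_nat_or_neg
  · simp only [zpow_natCast]
    exact pow_mem hF m
  · simp only [zpow_neg, zpow_natCast]
    exact inv_mem_regSubalgebra (F := fun y => F y ^ m) (pow_mem hF m) (pow_ne_zero _ h0)

theorem prod_mem_regSubalgebra {X : FunctionSpace} {x : X.carrier} {ι : Type} [Fintype ι]
    {F : ι → X.carrier → ℂ} (hF : ∀ i, F i ∈ X.regSubalgebra x) :
    (fun y => ∏ i, F i y) ∈ X.regSubalgebra x := by
  have : (fun y => ∏ i, F i y) = ∏ i, F i := by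
    ext y
    rw [Finset.prod_apply]
  rw [this]
  exact prod_mem fun i _ => hF i

variable {X : FunctionSpace} {x : X.carrier} {n : ℕ}

theorem mul_entry_mem {Z : Type} {A : Subalgebra ℂ (Z → ℂ)} {M N : Z → Matrix (Fin n) (Fin n) ℂ}
    (hM : ∀ i j, (fun y => M y i j) ∈ A) (hN : ∀ i j, (fun y => N y i j) ∈ A) (i j : Fin n) :
    (fun y => (M y * N y) i j) ∈ A := by
  have : (fun y => (M y * N y) i j) = ∑ k, (fun y => M y i k) * (fun y => N y k j) := by
    ext y
    simp [Matrix.mul_apply]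
  rw [this]
  exact sum_mem fun k _ => mul_mem (hM i k) (hN k j)

theorem inv_entry_mem_regSubalgebra {M : X.carrier → Matrix (Fin n) (Fin n) ℂ}
    (hM : ∀ i j, (fun y => M y i j) ∈ X.regSubalgebra x) (h0 : (M x).det ≠ 0) (i j : Fin n) :
    (fun y => (M y)⁻¹ i j) ∈ X.regSubalgebra x := by
  have : (fun y => (M y)⁻¹ i j) = (fun y => ((M y).det)⁻¹) * (fun y => (M y).adjugate i j) := by
    ext y
    rw [Matrix.inv_def]
    simp
  rw [this]
  exact mul_mem (inv_mem_regSubalgebra (det_mem_of_entries_mem hM) h0) (adjugate_mem_of_entries_mem hM i j)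

theorem eval_mem_of_entries_mem {Z : Type} {A : Subalgebra ℂ (Z → ℂ)}
    {M : Z → Matrix (Fin n) (Fin n) ℂ}
    (hM : ∀ i j, (fun y => M y i j) ∈ A) (p : MvPolynomial (Fin n × Fin n) ℂ) :
    (fun y => evalMat (M y) p) ∈ A := by
  induction p using MvPolynomial.induction_on with
  | C a =>
    simp only [evalMat_C]
    exact A.algebraMap_mem a
  | add p q hp hq =>
    simp only [map_add]
    exact add_mem hp hq
  | mul_X p ij hp =>
    simp only [map_mul, evalMat, MvPolynomial.eval_X]
    exact mul_mem hp (hM ij.1 ij.2)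

end FunctionSpace

/-! ### The Gauss decomposition -/

section Gauss

variable {n : ℕ} (w : Fin n → ℤ)

local notation "Mat" => Matrix (Fin n) (Fin n) ℂ

/-- The projection to the coordinates of weight at least `i`. -/
def weightProj (i : ℤ) : Mat := Matrix.diagonal fun a => if i ≤ w a then 1 else 0

/-- The corner of weights at least `i`, completed by the identity. -/
def corner (i : ℤ) (M : Mat) : Mat := weightProj w i * M * weightProj w i + (1 - weightProj w i)

/-- The lower unipotent factor of a matrix. -/
def lowerPart (M : Mat) : Mat := Matrix.of fun a b => (M * (corner w (w b) M)⁻¹) a b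

variable {w}

theorem weightProj_mul_self (i : ℤ) : weightProj w i * weightProj w i = weightProj w i := by
  rw [weightProj, Matrix.diagonal_mul_diagonal]
  congr 1
  ext a
  simp

theorem mul_weightProj {M : Mat} (hM : M ∈ weightFilt w 0) (i : ℤ) :
    weightProj w i * M * weightProj w i = M * weightProj w i := by
  ext a b
  rw [weightProj, Matrix.mul_diagonal, Matrix.mul_diagonal, Matrix.diagonal_mul]
  by_cases hab : M a b = 0
  · simp [hab]
  · have := hM a b hab
    split_ifs <;> first | omega | simp

theorem weightProj_mul {M : Mat} (hM : M ∈ weightFilt (-w) 0) (i : ℤ) :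
    weightProj w i * M * weightProj w i = weightProj w i * M := by
  ext a b
  rw [weightProj, Matrix.mul_diagonal, Matrix.diagonal_mul]
  by_cases hab : M a b = 0
  · simp [hab]
  · have := hM a b hab
    simp only [Pi.neg_apply] at this
    split_ifs <;> first | omega | simp

theorem corner_one (i : ℤ) : corner w i 1 = 1 := by
  rw [corner, mul_one, weightProj_mul_self, add_sub_cancel]

theorem corner_mul_of_eq {M N : Mat} {i : ℤ}
    (H : weightProj w i * (M * N) * weightProj w i =
      weightProj w i * M * weightProj w i * N * weightProj w i) :
    corner w i (M * N) = corner w i M * corner w i N := by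
  have hE := weightProj_mul_self (w := w) i
  have h1 : weightProj w i * (1 - weightProj w i) = 0 := by rw [mul_sub, mul_one, hE, sub_self]
  have h2 : (1 - weightProj w i) * weightProj w i = 0 := by rw [sub_mul, one_mul, hE, sub_self]
  have h3 : (1 - weightProj w i) * (1 - weightProj w i) = 1 - weightProj w i := by
    rw [mul_sub, h2, sub_zero, mul_one]
  rw [corner, H, corner, corner, add_mul, mul_add, mul_add, h3]
  have h4 : weightProj w i * M * weightProj w i * (1 - weightProj w i) = 0 := by
    rw [mul_assoc, h1, mul_zero]
  have h5 : (1 - weightProj w i) * (weightProj w i * N * weightProj w i) = 0 := by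
    rw [← mul_assoc, ← mul_assoc, h2, zero_mul, zero_mul]
  rw [h4, h5, add_zero, zero_add]
  congr 1
  rw [← mul_assoc, ← mul_assoc, mul_assoc (weightProj w i * M) (weightProj w i) (weightProj w i), hE]

/-- For a lower triangular left factor, rows of weight at least `i` only involve columns of weight
at least `i`, so compression to the corner is multiplicative; an upper triangular right factor has
the same effect. -/
theorem corner_mul_of_lower {M N : Mat} (hM : M ∈ weightFilt (-w) 0) (i : ℤ) :
    corner w i (M * N) = corner w i M * corner w i N :=
  corner_mul_of_eq (by rw [weightProj_mul hM, ← mul_assoc])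

theorem corner_mul_of_upper {M N : Mat} (hN : N ∈ weightFilt w 0) (i : ℤ) :
    corner w i (M * N) = corner w i M * corner w i N :=
  corner_mul_of_eq (by
    rw [← mul_assoc, mul_assoc _ N, ← mul_weightProj hN]
    simp only [mul_assoc])

theorem mem_weightFilt_zero_of_sub_one {w : Fin n → ℤ} {m : Mat} (hm : m - 1 ∈ weightFilt w 1) :
    m ∈ weightFilt w 0 := by
  have := add_mem (weightFilt_mono zero_le_one hm) one_mem_weightFilt
  rwa [sub_add_cancel] at this

theorem corner_mul_corner {m m' b b' : Mat} (hm : m - 1 ∈ weightFilt (-w) 1)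
    (hb' : b' ∈ weightFilt w 0) (hmm : m * m' = 1) (hbb : b * b' = 1) (i : ℤ) :
    corner w i (m * b) * (corner w i b' * corner w i m') = 1 := by
  rw [corner_mul_of_lower (mem_weightFilt_zero_of_sub_one hm), mul_assoc, ← mul_assoc (corner w i b),
    ← corner_mul_of_upper hb', hbb, corner_one, one_mul,
    ← corner_mul_of_lower (mem_weightFilt_zero_of_sub_one hm), hmm, corner_one]

theorem det_corner_ne_zero {m m' b b' : Mat} (hm : m - 1 ∈ weightFilt (-w) 1)
    (hb' : b' ∈ weightFilt w 0) (hmm : m * m' = 1) (hbb : b * b' = 1) (i : ℤ) : (corner w i (m * b)).det ≠ 0 := by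
  have h1 := congrArg Matrix.det (corner_mul_corner hm hb' hmm hbb i)
  rw [Matrix.det_mul, Matrix.det_one] at h1
  exact left_ne_zero_of_mul_eq_one h1

/-- The inverse corner of `m * b` is `corner b' * corner m'`. On a column of weight `i` the corner
of `m'` acts as the identity, and that of `b'` agrees with `b'`, which cancels `b`; what remains is
the column of `m`. -/
theorem lowerPart_mul {m m' b b' : Mat} (hm : m - 1 ∈ weightFilt (-w) 1)
    (hm' : m' - 1 ∈ weightFilt (-w) 1) (hb' : b' ∈ weightFilt w 0) (hmm : m * m' = 1) (hbb : b * b' = 1) : lowerPart w (m * b) = m := by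
  ext a c
  set i := w c with hi
  set F : Mat := Matrix.diagonal fun k => if w k = i then 1 else 0 with hF
  set E := weightProj w i with hE
  have hEF : E * F = F := by
    rw [hE, hF, weightProj, Matrix.diagonal_mul_diagonal]
    congr 1
    ext k
    split_ifs <;> first | omega | simp
  have h1 : E * m' * F = F := by
    ext k l
    rw [hE, hF, weightProj, Matrix.mul_diagonal, Matrix.diagonal_mul, Matrix.diagonal_apply]
    by_cases hkl : k = l
    · subst hkl
      have : m' k k = 1 := by
        by_contra hne
        have := hm' k k (by rw [Matrix.sub_apply, Matrix.one_apply_eq]; exact sub_ne_zero.2 hne)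
        omega
      rw [this, if_pos rfl]
      split_ifs <;> first | omega | simp
    · rw [if_neg hkl]
      by_cases hz : m' k l = 0
      · simp [hz]
      · have := hm' k l (by rwa [Matrix.sub_apply, Matrix.one_apply_ne hkl, sub_zero])
        simp only [Pi.neg_apply] at this
        split_ifs <;> first | omega | simp
  have h2 : corner w i m' * F = F := by
    rw [corner, ← hE, add_mul, sub_mul, one_mul, hEF, sub_self, add_zero, mul_assoc, hEF, h1]
  have h3 : corner w i b' * F = E * b' * F := by
    rw [corner, ← hE, add_mul, sub_mul, one_mul, hEF, sub_self, add_zero, mul_assoc, hEF]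
  have h4 : m * b * (corner w i (m * b))⁻¹ * F = m * F := by
    rw [Matrix.inv_eq_right_inv (corner_mul_corner hm hb' hmm hbb i), mul_assoc, mul_assoc (corner w i b'),
      h2, h3]
    have h5 : E * b' * F = b' * F := by
      rw [← hEF, ← mul_assoc, hE, mul_weightProj hb', ← hE, mul_assoc]
    rw [h5, mul_assoc, ← mul_assoc b, hbb, one_mul]
  have h6 := congrFun (congrFun h4 a) c
  rw [hF, Matrix.mul_diagonal, Matrix.mul_diagonal, if_pos rfl, mul_one, mul_one] at h6
  exact h6

end Gauss

/-! ### The big cell and its tangent directions at the identity -/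

section BigCell

attribute [local instance 100] LieRing.ofAssociativeRing

open Module

variable {n : ℕ} {G : Subgroup (GL (Fin n) ℂ)} {h ν f : lieAlg G}

local notation "Mat" => Matrix (Fin n) (Fin n) ℂ

variable (G) in
/-- The regular functions on `G`. -/
abbrev groupAlgebra : Subalgebra ℂ (G → ℂ) := matAlgebra fun g : G => (g : GL (Fin n) ℂ)

theorem hasDerivAt_mul_entry {A B : ℂ → Mat} {A' B' : Mat} {t : ℂ}
    (hA : ∀ i j, HasDerivAt (fun s => A s i j) (A' i j) t)
    (hB : ∀ i j, HasDerivAt (fun s => B s i j) (B' i j) t) (i j : Fin n) :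
    HasDerivAt (fun s => (A s * B s) i j) ((A' * B t + A t * B') i j) t := by
  simp only [Matrix.mul_apply]
  refine (HasDerivAt.fun_sum fun k _ => (hA i k).mul (hB k j)).congr_deriv ?_
  rw [Matrix.add_apply, Matrix.mul_apply, Matrix.mul_apply, Finset.sum_add_distrib]

theorem hasDerivAt_exp_smul_zero (M : Mat) (i j : Fin n) :
    HasDerivAt (fun s : ℂ => NormedSpace.exp (s • M) i j) (M i j) 0 := by
  have := hasDerivAt_exp M 0 i j
  rwa [zero_smul, NormedSpace.exp_zero, one_mul] at this

/-- Translation of the variables by the identity matrix. -/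
def shiftPoly (p : MvPolynomial (Fin n × Fin n) ℂ) : MvPolynomial (Fin n × Fin n) ℂ :=
  MvPolynomial.aeval (fun ij => MvPolynomial.X ij + MvPolynomial.C ((1 : Mat) ij.1 ij.2)) p

theorem eval_shiftPoly (x : Fin n × Fin n → ℂ) (p : MvPolynomial (Fin n × Fin n) ℂ) :
    MvPolynomial.eval x (shiftPoly p) = evalMat (Matrix.of (fun i j => x (i, j)) + 1) p := by
  induction p using MvPolynomial.induction_on with
  | C a => simp [shiftPoly, evalMat]
  | add p q hp hq => simpa only [shiftPoly, map_add] using congrArg₂ (· + ·) hp hq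
  | mul_X p ij hp =>
    rw [shiftPoly, map_mul, map_mul, map_mul, MvPolynomial.aeval_X]
    refine congrArg₂ (· * ·) hp ?_
    simp [evalMat]

/-- The entries of a matrix relative to the identity matrix. -/
def entriesSubOne (M : Mat) (ij : Fin n × Fin n) : ℂ := (M - 1) ij.1 ij.2

theorem eval_shiftPoly_entries (M : Mat) (p : MvPolynomial (Fin n × Fin n) ℂ) :
    MvPolynomial.eval (entriesSubOne M) (shiftPoly p) = evalMat M p := by
  rw [eval_shiftPoly]
  have : (Matrix.of fun i j => entriesSubOne M (i, j)) + 1 = M := by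
    ext i j
    simp [entriesSubOne]
  rw [this]

/-- Regular functions are fractions of a polynomial and a power of the determinant. -/
theorem exists_polynomial_of_mem_groupAlgebra {F : G → ℂ} (hF : F ∈ groupAlgebra G) :
    ∃ (k : ℕ) (p : MvPolynomial (Fin n × Fin n) ℂ), ∀ g : G, evalMat (mat g) p = (mat g).det ^ k * F g := by
  let detP : MvPolynomial (Fin n × Fin n) ℂ := (Matrix.of fun i j => MvPolynomial.X (i, j)).det
  have hdetP : ∀ M : Mat, evalMat M detP = M.det := fun M => by
    have h1 := RingHom.map_det (evalMat M) (Matrix.of fun i j => (MvPolynomial.X (i, j) : MvPolynomial (Fin n × Fin n) ℂ))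
    refine h1.trans ?_
    congr 1
    ext i j
    exact evalMat_X M i j
  have hne : ∀ g : G, (mat g).det ≠ 0 := fun g =>
    ((Matrix.isUnit_iff_isUnit_det _).1 (Units.isUnit (g : GL (Fin n) ℂ))).ne_zero
  induction hF using Algebra.adjoin_induction with
  | mem F hF =>
    rcases hF with ⟨i, j, rfl⟩ | rfl
    · exact ⟨0, MvPolynomial.X (i, j), fun g => by rw [evalMat_X, pow_zero, one_mul]⟩
    · exact ⟨1, 1, fun g => by rw [map_one, pow_one, mul_inv_cancel₀ (hne g)]⟩
  | algebraMap c => exact ⟨0, MvPolynomial.C c, fun g => by rw [evalMat_C, pow_zero, one_mul]; rfl⟩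
  | add F F' _ _ hF hF' =>
    obtain ⟨k, p, hp⟩ := hF
    obtain ⟨k', p', hp'⟩ := hF'
    refine ⟨k + k', detP ^ k' * p + detP ^ k * p', fun g => ?_⟩
    rw [map_add, map_mul, map_mul, map_pow, map_pow, hdetP, hp, hp', Pi.add_apply]
    ring
  | mul F F' _ _ hF hF' =>
    obtain ⟨k, p, hp⟩ := hF
    obtain ⟨k', p', hp'⟩ := hF'
    refine ⟨k + k', p * p', fun g => ?_⟩
    rw [map_mul, hp, hp', Pi.mul_apply]
    ring

/-- The polynomials in the entries relative to the identity that vanish on a subset of `G`. -/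
def vanishingAtOne (V : Set G) : Ideal (MvPolynomial (Fin n × Fin n) ℂ) where
  carrier := {p | ∀ g ∈ V, MvPolynomial.eval (entriesSubOne (mat g)) p = 0}
  add_mem' := fun {a b} ha hb g hg => by rw [map_add, ha g hg, hb g hg, add_zero]
  zero_mem' := fun g _ => map_zero _
  smul_mem' := fun c {a} ha g hg => by rw [smul_eq_mul, map_mul, ha g hg, mul_zero]

theorem isMorphism_mul_mul (a b : G) :
    (ofAlgebra G (groupAlgebra G)).IsMorphism (ofAlgebra G (groupAlgebra G)) (fun g : G => a * g * b) := by
  refine isMorphism_of_comp_mem fun F hF => comp_mem_of_adjoin ?_ hF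
  rintro F (⟨i, j, rfl⟩ | rfl)
  · let l : Mat →ₗ[ℂ] ℂ :=
      { toFun := fun M => (mat a * M * mat b) i j
        map_add' := fun M N => by rw [mul_add, add_mul]; rfl
        map_smul' := fun c M => by rw [mul_smul_comm, smul_mul_assoc]; rfl }
    exact linear_mem_of_entries_mem (entry_mem_matAlgebra fun g : G => (g : GL (Fin n) ℂ)) l
  · have : (fun x : G => (Matrix.det (mat x))⁻¹) ∘ (fun g : G => a * g * b) =
        ((mat a).det⁻¹ * (mat b).det⁻¹) • fun x : G => (Matrix.det (mat x))⁻¹ := by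
      ext g
      simp only [Function.comp_apply, mat_mul, Matrix.det_mul, mul_inv, Pi.smul_apply, smul_eq_mul]
      ring
    change (fun x : G => (Matrix.det (mat x))⁻¹) ∘ (fun g : G => a * g * b) ∈ _
    rw [this]
    exact Subalgebra.smul_mem _ (det_inv_mem_matAlgebra fun g : G => (g : GL (Fin n) ℂ)) _

namespace PrincipalTriple

variable (S : PrincipalTriple G h ν f)

/-- The big cell `U⁻ T U`. -/
def bigCell : Set G := {g | ∃ m ∈ S.unip (-S.wt), ∃ t : torusT G h, ∃ u ∈ S.unip S.wt, g = m * (t * u)}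

theorem one_mem_bigCell : (1 : G) ∈ S.bigCell :=
  ⟨1, one_mem _, 1, 1, one_mem _, by simp⟩

theorem mul_torus_mul_unip (t t' : torusT G h) {u u' : G} (hu : u ∈ S.unip S.wt) (hu' : u' ∈ S.unip S.wt) :
    ∃ u'' ∈ S.unip S.wt, (t : G) * u * ((t' : G) * u') = ((t * t' : torusT G h) : G) * u'' := by
  refine ⟨((t'⁻¹ : torusT G h) : G) * u * ((t'⁻¹ : torusT G h) : G)⁻¹ * u',
    mul_mem (S.conj_mem_unip t'⁻¹ hu) hu', ?_⟩
  rw [Subgroup.coe_mul, Subgroup.coe_inv]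
  group

theorem inv_torus_mul_unip (t : torusT G h) {u : G} (hu : u ∈ S.unip S.wt) :
    ∃ u' ∈ S.unip S.wt, ((t : G) * u)⁻¹ = ((t⁻¹ : torusT G h) : G) * u' := by
  refine ⟨(t : G) * u⁻¹ * (t : G)⁻¹, S.conj_mem_unip t (inv_mem hu), ?_⟩
  rw [Subgroup.coe_inv]
  group

theorem mul_mem_bigCell {g : G} (hg : g ∈ S.bigCell) {m : G} (hm : m ∈ S.unip (-S.wt)) (t : torusT G h)
    {u : G} (hu : u ∈ S.unip S.wt) : m * g * ((t : G) * u) ∈ S.bigCell := by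
  obtain ⟨m', hm', t', u', hu', rfl⟩ := hg
  obtain ⟨u'', hu'', h1⟩ := S.mul_torus_mul_unip t' t hu' hu
  exact ⟨m * m', mul_mem hm hm', t' * t, u'', hu'', by rw [← h1]; group⟩

/-- Writing `x = y + z + u` along `𝔲⁻ + 𝔱 + 𝔲`, the product of the three exponentials stays in the
big cell and has velocity `x`. -/
theorem exists_path {x : lieAlg G} : ∃ γ : ℂ → G, (∀ t, γ t ∈ S.bigCell) ∧ γ 0 = 1 ∧
    ∀ i j, HasDerivAt (fun t => mat (γ t) i j) ((x : Mat) i j) 0 := by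
  obtain ⟨y, hy, z, u, hu, rfl⟩ := S.exists_add_add x
  refine ⟨fun t => S.expG (t • y) * ((S.expT (t • z) : G) * S.expG (t • u)), fun t => ?_, ?_, fun i j => ?_⟩
  · exact ⟨_, S.expG_mem_unip (Submodule.smul_mem _ t hy), _, _, S.expG_mem_unip (Submodule.smul_mem _ t hu), rfl⟩
  · apply mat_injective
    rw [mat_mul, mat_mul, mat_expG, mat_expG, mat_expT]
    simp [mat]
  · have h1 := hasDerivAt_mul_entry (hasDerivAt_exp_smul_zero (y : Mat))
      (hasDerivAt_mul_entry (hasDerivAt_exp_smul_zero ((z : lieAlg G) : Mat)) (hasDerivAt_exp_smul_zero (u : Mat))) i j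
    refine h1.congr_deriv ?_
    simp only [zero_smul, NormedSpace.exp_zero, mul_one, one_mul]
    rw [Submodule.coe_add, Submodule.coe_add, add_assoc]

/-- By `exists_path` the big cell has curves in all directions of `𝔤`, so `exists_localizer` gives
`s` with `s * p` zero on `G` whenever `p` is zero on the big cell. No component of `G` through the
identity can escape its closure. -/
theorem exists_localizing_function : ∃ s ∈ groupAlgebra G, s 1 ≠ 0 ∧
    ∀ F ∈ groupAlgebra G, (∀ c ∈ S.bigCell, F c = 0) → ∀ x, s x ≠ 0 → F x = 0 := by
  obtain ⟨s, hs0, hs⟩ := exists_localizer (I := vanishingAtOne (Set.univ : Set G))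
    (J := vanishingAtOne S.bigCell) (fun p hp g _ => hp g trivial) (fun Y hY => by
      let M : Mat := Matrix.of fun i j => Y (i, j)
      have hM : M ∈ lieAlg G := by
        intro q hq
        have h1 := hY (shiftPoly q) fun g _ => by rw [eval_shiftPoly_entries]; exact hq g g.2
        have h2 := hasDerivAt_eval_path (γ := fun t => t • Y) (zero_smul _ _)
          (fun i => by simpa using (hasDerivAt_id (0 : ℂ)).mul_const (Y i)) (shiftPoly q)
        have h3 := hasDerivAt_evalMat_one (γ := fun t : ℂ => 1 + t • M) (t₀ := 0) (by simp)
          (hasDerivAt_one_add_smul M) q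
        rw [h1] at h2
        refine h3.unique (h2.congr_of_eventuallyEq (Eventually.of_forall fun t => ?_))
        simp only
        rw [eval_shiftPoly, add_comm]
        rfl
      obtain ⟨γ, hγC, hγ0, hγ⟩ := S.exists_path (x := ⟨M, hM⟩)
      refine ⟨fun t => entriesSubOne (mat (γ t)), ?_, fun ij => ?_, fun p hp t => hp _ (hγC t)⟩
      · ext ij
        simp [entriesSubOne, hγ0, mat]
      · exact (hγ ij.1 ij.2).sub_const _)
  let sF : G → ℂ := fun g => MvPolynomial.eval (entriesSubOne (mat g)) s
  refine ⟨sF, ?_, ?_, fun F hF hFC x hx => ?_⟩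
  · have : sF = fun g : G => evalMat (mat g - 1) s := rfl
    rw [this]
    refine eval_mem_of_entries_mem (fun i j => ?_) s
    exact sub_mem (entry_mem_matAlgebra (fun g : G => (g : GL (Fin n) ℂ)) i j)
      (Subalgebra.algebraMap_mem _ ((1 : Mat) i j))
  · have : entriesSubOne (mat (1 : G)) = 0 := by
      ext ij
      simp [entriesSubOne, mat]
    change MvPolynomial.eval (entriesSubOne (mat (1 : G))) s ≠ 0
    rwa [this]
  · obtain ⟨k, p, hp⟩ := exists_polynomial_of_mem_groupAlgebra hF
    have h1 := hs (shiftPoly p) (fun c hc => by rw [eval_shiftPoly_entries, hp, hFC c hc, mul_zero]) x trivial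
    rw [map_mul, eval_shiftPoly_entries, hp] at h1
    have hne : (mat x).det ≠ 0 :=
      ((Matrix.isUnit_iff_isUnit_det _).1 (Units.isUnit (x : GL (Fin n) ℂ))).ne_zero
    exact ((mul_eq_zero.1 ((mul_eq_zero.1 h1).resolve_left hx))).resolve_left (pow_ne_zero _ hne)

end PrincipalTriple

end BigCell

/-! ### Extending the Gauss factors and openness of the big cell -/

section BigCell

attribute [local instance 100] LieRing.ofAssociativeRing

open Module

variable {n : ℕ} {G : Subgroup (GL (Fin n) ℂ)} {h ν f : lieAlg G}

local notation "Mat" => Matrix (Fin n) (Fin n) ℂ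

theorem comp_mem_regSubalgebra {X : FunctionSpace} {Y : Type} {A : Subalgebra ℂ (Y → ℂ)}
    {φ : X.carrier → Y} (hφ : X.IsMorphism (ofAlgebra Y A) φ) {F : Y → ℂ} (hF : F ∈ A) (x : X.carrier) :
    (fun y => F (φ y)) ∈ X.regSubalgebra x := hφ.2 x F (regAt_of_mem hF _)

namespace PrincipalTriple

variable (S : PrincipalTriple G h ν f)

theorem co_entry_mem {Z : Type} {A : Subalgebra ℂ (Z → ℂ)} {M : Z → Mat}
    (hM : ∀ i j, (fun y => M y i j) ∈ A) (i j : Fin n) : (fun y => S.basis.co (M y) i j) ∈ A := by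
  let l : Mat →ₗ[ℂ] ℂ :=
    { toFun := fun M => S.basis.co M i j
      map_add' := fun M N => by rw [map_add]; rfl
      map_smul' := fun c M => by rw [map_smul]; rfl }
  exact linear_mem_of_entries_mem hM l

theorem co_symm_entry_mem {Z : Type} {A : Subalgebra ℂ (Z → ℂ)} {M : Z → Mat}
    (hM : ∀ i j, (fun y => M y i j) ∈ A) (i j : Fin n) : (fun y => S.basis.co.symm (M y) i j) ∈ A := by
  let l : Mat →ₗ[ℂ] ℂ :=
    { toFun := fun M => S.basis.co.symm M i j
      map_add' := fun M N => by rw [map_add]; rfl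
      map_smul' := fun c M => by rw [map_smul]; rfl }
  exact linear_mem_of_entries_mem hM l

/-- The matrix of the lower unipotent factor of an element of the big cell. -/
def lowerMat (g : G) : Mat := lowerPart S.wt (S.basis.co (mat g))

/-- The open set on which the lower unipotent factor is defined. -/
def IsGood (g : G) : Prop := ∀ b : Fin n, (corner S.wt (S.wt b) (S.basis.co (mat g))).det ≠ 0

section Factors

variable {m : G} (hm : m ∈ S.unip (-S.wt)) (t : torusT G h) {u : G} (hu : u ∈ S.unip S.wt)

include hu in
theorem co_inv_torus_mul_mem : S.basis.co (mat ((t : G) * u)⁻¹) ∈ weightFilt S.wt 0 := by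
  obtain ⟨u', hu', h1⟩ := S.inv_torus_mul_unip t hu
  rw [h1, mat_mul, map_mul]
  have := mul_mem_weightFilt (S.co_torus_mem t⁻¹ S.wt) (S.co_mem_weightFilt_of_mem_unip hu')
  rwa [zero_add] at this

include hm hu

theorem isGood_of_mul : S.IsGood (m * ((t : G) * u)) := fun b => by
  rw [mat_mul, map_mul]
  refine det_corner_ne_zero hm (S.co_inv_torus_mul_mem t hu) (m' := S.basis.co (mat m⁻¹)) ?_ ?_ _
  · rw [← map_mul, mat_mul_mat_inv, map_one]
  · rw [← map_mul, mat_mul_mat_inv, map_one]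

theorem lowerMat_mul : S.lowerMat (m * ((t : G) * u)) = S.basis.co (mat m) := by
  rw [lowerMat, mat_mul, map_mul]
  refine lowerPart_mul hm (m' := S.basis.co (mat m⁻¹)) (inv_mem hm) (S.co_inv_torus_mul_mem t hu) ?_ ?_
  · rw [← map_mul, mat_mul_mat_inv, map_one]
  · rw [← map_mul, mat_mul_mat_inv, map_one]

theorem inv_lowerMat_mul :
    (S.lowerMat (m * ((t : G) * u)))⁻¹ * S.basis.co (mat (m * ((t : G) * u))) = S.basis.co (mat ((t : G) * u)) := by
  have h1 : (S.basis.co (mat m))⁻¹ = S.basis.co (mat m⁻¹) :=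
    Matrix.inv_eq_right_inv (by rw [← map_mul, mat_mul_mat_inv, map_one])
  rw [S.lowerMat_mul hm t hu, h1, ← map_mul, ← mat_mul, inv_mul_cancel_left]

theorem co_inv_mul_lowerMat :
    S.basis.co (mat (m * ((t : G) * u))⁻¹) * S.lowerMat (m * ((t : G) * u)) =
      S.basis.co (mat ((t : G) * u)⁻¹) := by
  rw [S.lowerMat_mul hm t hu, ← map_mul, ← mat_mul, mul_inv_rev m, inv_mul_cancel_right]

omit hm

theorem co_torus_mul_offDiag {a b : Fin n} (hab : a ≠ b)
    (h0 : S.basis.co (mat ((t : G) * u)) a b ≠ 0) : 1 ≤ S.wt a - S.wt b := by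
  rw [mat_mul, map_mul, S.co_mat_torus, Matrix.diagonal_mul] at h0
  refine hu a b ?_
  rw [Matrix.sub_apply, Matrix.one_apply_ne hab, sub_zero]
  exact right_ne_zero_of_mul h0

theorem co_inv_torus_mul_unip_diag (j : Fin n) :
    S.basis.co (mat ((t : G) * u)⁻¹) j j = ((S.coord j t)⁻¹ : ℂˣ) := by
  obtain ⟨u', hu', h1⟩ := S.inv_torus_mul_unip t hu
  rw [h1, S.co_mul_torus_unip t⁻¹ hu', map_inv]

end Factors

theorem prod_coord_zpow (m : Fin n → ℤ) (hm : ∑ j, m j • S.coordChar j = 0) (t : torusT G h) :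
    ∏ j, (S.coord j t : ℂ) ^ m j = 1 := by
  have h1 : evalHom G h t (∑ j, m j • S.coordChar j) = Additive.ofMul (∏ j, S.coord j t ^ m j) := by
    rw [map_sum, ofMul_prod]
    refine Finset.sum_congr rfl fun j _ => ?_
    rw [map_zsmul, ofMul_zpow]
    rfl
  rw [hm, map_zero] at h1
  have h2 : ∏ j, S.coord j t ^ m j = 1 := (Additive.ofMul.injective h1).symm
  have h3 := congrArg Units.val h2
  rw [Units.coe_prod, Units.val_one] at h3
  simpa only [Units.val_zpow_eq_zpow_val] using h3

variable {X : FunctionSpace} {φ : X.carrier → G}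
  (hφ : X.IsMorphism (ofAlgebra G (groupAlgebra G)) φ) (x : X.carrier)

include hφ

omit S in
theorem mat_entry_mem (i j : Fin n) : (fun y => mat (φ y) i j) ∈ X.regSubalgebra x :=
  comp_mem_regSubalgebra hφ (entry_mem_matAlgebra (fun g : G => (g : GL (Fin n) ℂ)) i j) x

omit S in
theorem mat_inv_entry_mem (i j : Fin n) : (fun y => mat (φ y)⁻¹ i j) ∈ X.regSubalgebra x :=
  comp_mem_regSubalgebra hφ (inv_entry_mem_matAlgebra (fun g : G => (g : GL (Fin n) ℂ)) i j) x

theorem corner_entry_mem (k : ℤ) (i j : Fin n) :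
    (fun y => corner S.wt k (S.basis.co (mat (φ y))) i j) ∈ X.regSubalgebra x := by
  have h1 := S.co_entry_mem (mat_entry_mem hφ x) i j
  have : (fun y => corner S.wt k (S.basis.co (mat (φ y))) i j) =
      ((if k ≤ S.wt i then 1 else 0) * (if k ≤ S.wt j then 1 else 0) : ℂ) • (fun y => S.basis.co (mat (φ y)) i j) +
        algebraMap ℂ (X.carrier → ℂ) ((1 - weightProj S.wt k) i j) := by
    ext y
    rw [corner, Matrix.add_apply, weightProj, Matrix.mul_diagonal, Matrix.diagonal_mul]
    simp only [Pi.add_apply, Pi.smul_apply, smul_eq_mul, Pi.algebraMap_apply, Algebra.algebraMap_self,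
      RingHom.id_apply]
    ring
  rw [this]
  exact add_mem (Subalgebra.smul_mem _ h1 _) (Subalgebra.algebraMap_mem _ _)

theorem lowerMat_entry_mem (hx : S.IsGood (φ x)) (i j : Fin n) :
    (fun y => S.lowerMat (φ y) i j) ∈ X.regSubalgebra x :=
  mul_entry_mem (S.co_entry_mem (mat_entry_mem hφ x))
    (inv_entry_mem_regSubalgebra (S.corner_entry_mem hφ x (S.wt j)) (hx j)) i j

/-- A point of the closure of the big cell for which the lower unipotent factor is defined belongs
to the big cell. -/
theorem mem_bigCell_of_closure (hx : S.IsGood (φ x))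
    (H : ∀ F ∈ X.regSubalgebra x, (∀ y, φ y ∈ S.bigCell → F y = 0) → F x = 0) : φ x ∈ S.bigCell := by
  -- The matrix `lowerMat` is regular at `x`, and on the big cell it is the factor in `U⁻`. Every
  -- equation it satisfies there persists at `x`; this applies to unipotency and to the equations of
  -- `G`.
  have hN := S.lowerMat_entry_mem hφ x hx
  have hN1 : S.lowerMat (φ x) - 1 ∈ weightFilt (-S.wt) 1 := by
    intro a b hab
    by_contra hlt
    refine hab (H (fun y => (S.lowerMat (φ y) - 1) a b)
      (sub_mem (hN a b) (Subalgebra.algebraMap_mem _ ((1 : Mat) a b))) ?_)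
    rintro y ⟨m, hm, t, u, hu, hy⟩
    rw [hy, S.lowerMat_mul hm t hu]
    by_contra h0
    exact hlt (hm a b h0)
  have hunit : IsUnit (S.lowerMat (φ x)) := by
    have h1 : IsNilpotent (S.lowerMat (φ x) - 1) :=
      ⟨_, pow_eq_zero_of_mem_weightFilt (sub_lt_weightBound (-S.wt)) hN1⟩
    have := h1.isUnit_add_one
    rwa [sub_add_cancel] at this
  obtain ⟨m, hm⟩ : ∃ m : G, S.basis.co (mat m) = S.lowerMat (φ x) := by
    obtain ⟨g, hg⟩ : IsUnit (S.basis.co.symm (S.lowerMat (φ x))) := hunit.map S.basis.co.symm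
    refine ⟨⟨g, mem_of_forall_vanishing S.isLinearAlgebraic fun p hp => ?_⟩, ?_⟩
    · rw [hg]
      refine H (fun y => evalMat (S.basis.co.symm (S.lowerMat (φ y))) p)
        (eval_mem_of_entries_mem (S.co_symm_entry_mem hN) p) ?_
      rintro y ⟨m, hm, t, u, hu, hy⟩
      rw [hy, S.lowerMat_mul hm t hu, AlgEquiv.symm_apply_apply]
      exact hp _ m.2
    · change S.basis.co g.1 = _
      rw [hg, AlgEquiv.apply_symm_apply]
  have hmU : m ∈ S.unip (-S.wt) := by rwa [mem_unip, hm]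
  have hdet : (S.lowerMat (φ x)).det ≠ 0 := ((Matrix.isUnit_iff_isUnit_det _).1 hunit).ne_zero
  set β : X.carrier → Mat := fun y => (S.lowerMat (φ y))⁻¹ * S.basis.co (mat (φ y)) with hβ
  have hβr : ∀ i j, (fun y => β y i j) ∈ X.regSubalgebra x :=
    mul_entry_mem (inv_entry_mem_regSubalgebra hN hdet) (S.co_entry_mem (mat_entry_mem hφ x))
  have hβr' : ∀ i j, (fun y => (S.basis.co (mat (φ y)⁻¹) * S.lowerMat (φ y)) i j) ∈ X.regSubalgebra x :=
    mul_entry_mem (S.co_entry_mem (mat_inv_entry_mem hφ x)) hN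
  have hβx : β x = S.basis.co (mat (m⁻¹ * φ x)) := by
    have h1 : (S.basis.co (mat m))⁻¹ = S.basis.co (mat m⁻¹) :=
      Matrix.inv_eq_right_inv (by rw [← map_mul, mat_mul_mat_inv, map_one])
    rw [hβ]
    simp only
    rw [← hm, h1, ← map_mul, mat_mul]
  have hoff : ∀ a b, a ≠ b → β x a b ≠ 0 → 1 ≤ S.wt a - S.wt b := by
    intro a b hab h0
    by_contra hlt
    refine h0 (H (fun y => β y a b) (hβr a b) ?_)
    rintro y ⟨m, hm, t, u, hu, hy⟩
    by_contra hne
    simp only [hβ] at hne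
    rw [hy, S.inv_lowerMat_mul hm t hu] at hne
    exact hlt (S.co_torus_mul_offDiag t hu hab hne)
  -- On the big cell the diagonal entries of the remaining factor and of its inverse are mutually
  -- inverse; this identity also passes to `x`.
  have hdiag : ∀ j, β x j j ≠ 0 := by
    intro j
    have h1 := H (fun y => β y j j * (S.basis.co (mat (φ y)⁻¹) * S.lowerMat (φ y)) j j - 1)
      (sub_mem (mul_mem (hβr j j) (hβr' j j)) (one_mem _)) (by
        rintro y ⟨m, hm, t, u, hu, hy⟩
        simp only [hβ]
        rw [hy, S.inv_lowerMat_mul hm t hu, S.co_inv_mul_lowerMat hm t hu, S.co_mul_torus_unip t hu,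
          S.co_inv_torus_mul_unip_diag t hu, Units.mul_inv, sub_self])
    exact left_ne_zero_of_mul_eq_one (sub_eq_zero.1 h1)
  -- The diagonal comes from `T` exactly when it satisfies the multiplicative relations among the
  -- eigenvalue characters, and these relations are closed conditions.
  obtain ⟨t, ht⟩ := S.exists_torusT_coord (fun j => Units.mk0 _ (hdiag j)) fun k hk => by
    have h1 := H (fun y => ∏ j, β y j j ^ k j - 1)
      (sub_mem (prod_mem_regSubalgebra fun j => zpow_mem_regSubalgebra (hβr j j) (hdiag j) (k j))
        (one_mem _)) (by
        rintro y ⟨m, hm, t, u, hu, hy⟩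
        simp only [hβ]
        rw [hy, S.inv_lowerMat_mul hm t hu]
        simp only [S.co_mul_torus_unip t hu]
        rw [S.prod_coord_zpow k hk, sub_self])
    refine Units.ext ?_
    rw [Units.coe_prod, Units.val_one]
    simpa only [Units.val_zpow_eq_zpow_val, Units.val_mk0] using sub_eq_zero.1 h1
  have ht' : ∀ j, S.coord j t = β x j j := fun j => by rw [ht]; rfl
  refine ⟨m, hmU, t, (t : G)⁻¹ * (m⁻¹ * φ x), ?_, by group⟩
  intro a b hab
  have h1 : mat ((t : G)⁻¹ * (m⁻¹ * φ x)) = mat ((t⁻¹ : torusT G h) : G) * mat (m⁻¹ * φ x) := by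
    rw [mat_mul, Subgroup.coe_inv]
  rw [h1, map_mul, ← hβx, S.co_mat_torus, Matrix.sub_apply, Matrix.diagonal_mul, ← S.coe_coord, map_inv,
    Units.val_inv_eq_inv_val, ht'] at hab
  by_cases h2 : a = b
  · subst h2
    rw [inv_mul_cancel₀ (hdiag a), Matrix.one_apply_eq, sub_self] at hab
    exact absurd rfl hab
  · rw [Matrix.one_apply_ne h2, sub_zero] at hab
    exact hoff a b h2 (right_ne_zero_of_mul hab)

omit hφ

/-- Where the localizing function and the corner determinants do not vanish, a regular function that
vanishes on the big cell is zero, so `mem_bigCell_of_closure` applies. This gives a neighbourhood of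
the identity, and left and right translations carry it to any point `m t u`. -/
theorem isOpen_bigCell : IsOpen[zariski (groupAlgebra G)] S.bigCell := by
  let : TopologicalSpace G := zariski (groupAlgebra G)
  obtain ⟨s, hs, hs1, H⟩ := S.exists_localizing_function
  let O : Set G := {g | s g ≠ 0} ∩ ⋂ b : Fin n, {g | (corner S.wt (S.wt b) (S.basis.co (mat g))).det ≠ 0}
  have hO : IsOpen O := by
    refine (isOpen_ne_zero hs).inter (isOpen_iInter_of_finite fun b => ?_)
    refine isOpen_iff_mem_nhds.2 fun g hg => ?_
    exact (ofAlgebra G (groupAlgebra G)).ne_zero g _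
      (det_mem_of_entries_mem (S.corner_entry_mem (isMorphism_id _) g (S.wt b))) hg
  have hOC : O ⊆ S.bigCell := by
    rintro g ⟨hg1, hg2⟩
    refine S.mem_bigCell_of_closure (X := ofAlgebra G (groupAlgebra G)) (φ := id) (isMorphism_id _) g
      (fun b => Set.mem_iInter.1 hg2 b) fun F hF hFC => ?_
    obtain ⟨p, hp, q, hq, hqx, h1⟩ := regAt_iff.1 hF
    have h2 := H p hp (fun c hc => by
      rw [← h1]
      change F c * q c = 0
      rw [hFC c hc, zero_mul]) g hg1
    rw [← h1] at h2
    exact (mul_eq_zero.1 h2).resolve_right hqx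
  refine isOpen_iff_mem_nhds.2 ?_
  rintro g ⟨m, hm, t, u, hu, rfl⟩
  have h1 : ContinuousAt (fun g : G => m⁻¹ * g * ((t : G) * u)⁻¹) (m * ((t : G) * u)) :=
    (isMorphism_mul_mul m⁻¹ ((t : G) * u)⁻¹).1.continuousAt
  have h2 : O ∈ 𝓝 (m⁻¹ * (m * ((t : G) * u)) * ((t : G) * u)⁻¹) := by
    have : m⁻¹ * (m * ((t : G) * u)) * ((t : G) * u)⁻¹ = 1 := by group
    rw [this]
    refine hO.mem_nhds ⟨hs1, Set.mem_iInter.2 fun b => ?_⟩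
    have := S.isGood_of_mul (one_mem (S.unip (-S.wt))) 1 (one_mem (S.unip S.wt)) b
    simpa using this
  filter_upwards [h1 h2] with g' hg'
  have h3 := S.mul_mem_bigCell (hOC hg') hm t hu
  have h4 : m * (m⁻¹ * g' * ((t : G) * u)⁻¹) * ((t : G) * u) = g' := by group
  rwa [h4] at h3

end PrincipalTriple

end BigCell

section Charts

attribute [local instance 100] LieRing.ofAssociativeRing

open Module

variable {n : ℕ} {G : Subgroup (GL (Fin n) ℂ)} {h ν f : lieAlg G}

local notation "Mat" => Matrix (Fin n) (Fin n) ℂ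

/-! ### Regularity of maps to the group and the Lie algebra -/

theorem comp_mem_of_mat_entries {Z : Type} {A : Subalgebra ℂ (Z → ℂ)} {ψ : Z → G}
    (h1 : ∀ i j, (fun z => mat (ψ z) i j) ∈ A) (h2 : ∀ i j, (fun z => mat (ψ z)⁻¹ i j) ∈ A)
    {F : G → ℂ} (hF : F ∈ groupAlgebra G) : F ∘ ψ ∈ A := by
  refine comp_mem_of_adjoin ?_ hF
  rintro F (⟨i, j, rfl⟩ | rfl)
  · exact h1 i j
  · have : (fun g : G => (Matrix.det (mat g))⁻¹) ∘ ψ = fun z => (mat (ψ z)⁻¹).det := by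
      ext z
      have h3 := congrArg Matrix.det (mat_mul_mat_inv (ψ z))
      rw [Matrix.det_mul, Matrix.det_one] at h3
      exact (eq_inv_of_mul_eq_one_right h3).symm
    change (fun g : G => (Matrix.det (mat g))⁻¹) ∘ ψ ∈ A
    rw [this]
    exact det_mem_of_entries_mem h2

theorem dual_comp_mem {Z : Type} {A : Subalgebra ℂ (Z → ℂ)} {ξ : Z → lieAlg G}
    (H : ∀ i j, (fun z => (ξ z : Mat) i j) ∈ A) (l : Dual ℂ (lieAlg G)) : (fun z => l (ξ z)) ∈ A := by
  obtain ⟨l', hl'⟩ := LinearMap.exists_extend (p := (lieAlg G).toSubmodule) l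
  have : (fun z => l (ξ z)) = fun z => l' (ξ z : Mat) := by
    ext z
    exact (LinearMap.congr_fun hl' (ξ z)).symm
  rw [this]
  exact linear_mem_of_entries_mem H l'

theorem dual_submodule_comp_mem {Z : Type} {A : Subalgebra ℂ (Z → ℂ)} {p : Submodule ℂ (lieAlg G)}
    {ξ : Z → p} (H : ∀ i j, (fun z => ((ξ z : lieAlg G) : Mat) i j) ∈ A) (l : Dual ℂ p) :
    (fun z => l (ξ z)) ∈ A := by
  obtain ⟨l', hl'⟩ := LinearMap.exists_extend (p := p) l
  have : (fun z => l (ξ z)) = fun z => l' (ξ z : lieAlg G) := by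
    ext z
    exact (LinearMap.congr_fun hl' (ξ z)).symm
  rw [this]
  exact dual_comp_mem H l'

theorem entry_mem_polyAlgebra {E : Type} [AddCommGroup E] [Module ℂ E] (φ : E →ₗ[ℂ] lieAlg G) (i j : Fin n) :
    (fun x => (φ x : Mat) i j) ∈ polyAlgebra E := by
  let l : Dual ℂ E :=
    { toFun := fun x => (φ x : Mat) i j
      map_add' := fun a b => by rw [map_add]; rfl
      map_smul' := fun c a => by rw [map_smul]; rfl }
  exact dual_mem_polyAlgebra l

theorem pow_entry_mem {Z : Type} {A : Subalgebra ℂ (Z → ℂ)} {M : Z → Mat}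
    (hM : ∀ i j, (fun y => M y i j) ∈ A) (k : ℕ) (i j : Fin n) : (fun y => (M y ^ k) i j) ∈ A := by
  induction k generalizing i j with
  | zero =>
    simp only [pow_zero]
    exact Subalgebra.algebraMap_mem _ ((1 : Mat) i j)
  | succ k ih =>
    simp only [pow_succ]
    exact mul_entry_mem ih hM i j

theorem sum_smul_pow_entry_mem {Z : Type} {A : Subalgebra ℂ (Z → ℂ)} {M : Z → Mat}
    (hM : ∀ i j, (fun y => M y i j) ∈ A) (R : ℕ) (c : ℕ → ℂ) (i j : Fin n) :
    (fun y => (∑ k ∈ Finset.range R, c k • M y ^ k) i j) ∈ A := by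
  have : (fun y => (∑ k ∈ Finset.range R, c k • M y ^ k) i j) =
      ∑ k ∈ Finset.range R, c k • fun y => (M y ^ k) i j := by
    ext y
    simp [Matrix.sum_apply]
  rw [this]
  exact sum_mem fun k _ => Subalgebra.smul_mem _ (pow_entry_mem hM k i j) _

theorem unipLog_entry_mem {Z : Type} {A : Subalgebra ℂ (Z → ℂ)} {M : Z → Mat}
    (hM : ∀ i j, (fun y => M y i j) ∈ A) (R : ℕ) (i j : Fin n) : (fun y => unipLog R (M y) i j) ∈ A := by
  simp only [unipLog_eq_sum]
  exact sum_smul_pow_entry_mem hM R _ i j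

namespace PrincipalTriple

variable (S : PrincipalTriple G h ν f)

theorem expG_neg (x : lieAlg G) : (S.expG x)⁻¹ = S.expG (-x) := by
  refine inv_eq_of_mul_eq_one_right (mat_injective ?_)
  rw [mat_mul, mat_expG, mat_expG]
  exact exp_mul_exp_neg _

theorem mat_expG_entry_mem {Z : Type} {A : Subalgebra ℂ (Z → ℂ)} {w : Fin n → ℤ} {ξ : Z → lieAlg G}
    (hw : ∀ z, ξ z ∈ S.fil w 1) (H : ∀ i j, (fun z => (ξ z : Mat) i j) ∈ A) (i j : Fin n) :
    (fun z => mat (S.expG (ξ z)) i j) ∈ A := by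
  have : (fun z => mat (S.expG (ξ z)) i j) =
      fun z => (∑ k ∈ Finset.range (weightBound w), ((k.factorial : ℂ)⁻¹) • (ξ z : Mat) ^ k) i j := by
    ext z
    have h0 : NormedSpace.exp (ξ z : Mat) = _ := exp_eq_sum_of_pow (S.pow_eq_zero_of_co_mem (hw z))
    change NormedSpace.exp (ξ z : Mat) i j = _
    rw [h0]
  rw [this]
  exact sum_smul_pow_entry_mem H _ _ i j

/-! ### The decomposition of the elements of the big cell -/

section Cell

variable {S} {g : G} (hg : g ∈ S.bigCell)

/-- The factor in `U⁻`. -/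
def cellM : G := hg.choose

theorem cellM_mem : cellM hg ∈ S.unip (-S.wt) := hg.choose_spec.1

/-- The factor in `T`. -/
def cellT : torusT G h := hg.choose_spec.2.choose

/-- The factor in `U`. -/
def cellU : G := hg.choose_spec.2.choose_spec.choose

theorem cellU_mem : cellU hg ∈ S.unip S.wt := hg.choose_spec.2.choose_spec.choose_spec.1

theorem cell_eq : g = cellM hg * ((cellT hg : G) * cellU hg) :=
  hg.choose_spec.2.choose_spec.choose_spec.2

/-- The lower factor is recovered by `lowerMat`, and then the torus factor as the diagonal of what
remains; chosen factors therefore do not depend on the choice. -/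
theorem cell_unique {m : G} (hm : m ∈ S.unip (-S.wt)) (t : torusT G h) {u : G} (hu : u ∈ S.unip S.wt)
    (H : g = m * ((t : G) * u)) : cellM hg = m ∧ cellT hg = t := by
  have h1 : cellM hg = m := by
    refine mat_injective (S.basis.co.injective ?_)
    rw [← S.lowerMat_mul hm t hu, ← S.lowerMat_mul (cellM_mem hg) (cellT hg) (cellU_mem hg), ← cell_eq hg, H]
  refine ⟨h1, S.torusT_ext_coord fun j => Units.ext ?_⟩
  have h2 : (cellT hg : G) * cellU hg = (t : G) * u := by
    refine mul_left_cancel (a := m) ?_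
    rw [← H, ← h1]
    exact (cell_eq hg).symm
  rw [← S.co_mul_torus_unip (cellT hg) (cellU_mem hg), h2, S.co_mul_torus_unip t hu]

theorem inv_cellM_mul : (cellM hg)⁻¹ * g = (cellT hg : G) * cellU hg :=
  inv_mul_eq_iff_eq_mul.2 (cell_eq hg)

theorem lowerMat_eq : S.lowerMat g = S.basis.co (mat (cellM hg)) := by
  have h1 := S.lowerMat_mul (cellM_mem hg) (cellT hg) (cellU_mem hg)
  rwa [← cell_eq hg] at h1

include hg in
theorem isGood_of_mem : S.IsGood g := by
  have h1 := S.isGood_of_mul (cellM_mem hg) (cellT hg) (cellU_mem hg)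
  rwa [← cell_eq hg] at h1

end Cell

section CellRegular

variable {X : FunctionSpace} {φ : X.carrier → G} (hφ : X.IsMorphism (ofAlgebra G (groupAlgebra G)) φ)
  (hC : ∀ y, φ y ∈ S.bigCell) (x : X.carrier)

include hφ

theorem cellM_entry_mem (i j : Fin n) : (fun y => mat (cellM (hC y)) i j) ∈ X.regSubalgebra x := by
  have : (fun y => mat (cellM (hC y)) i j) = fun y => S.basis.co.symm (S.lowerMat (φ y)) i j := by
    ext y
    rw [lowerMat_eq (hC y), AlgEquiv.symm_apply_apply]
  rw [this]
  exact S.co_symm_entry_mem (S.lowerMat_entry_mem hφ x (isGood_of_mem (hC x))) i j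

theorem cellM_inv_entry_mem (i j : Fin n) : (fun y => mat (cellM (hC y))⁻¹ i j) ∈ X.regSubalgebra x := by
  have h1 : ∀ y, mat (cellM (hC y))⁻¹ = (mat (cellM (hC y)))⁻¹ := fun y =>
    (Matrix.inv_eq_right_inv (mat_mul_mat_inv _)).symm
  simp only [h1]
  exact inv_entry_mem_regSubalgebra (S.cellM_entry_mem hφ hC x)
    ((Matrix.isUnit_iff_isUnit_det _).1 (Units.isUnit (cellM (hC x) : GL (Fin n) ℂ))).ne_zero i j

theorem cellB_entry_mem (i j : Fin n) :
    (fun y => mat ((cellT (hC y) : G) * cellU (hC y)) i j) ∈ X.regSubalgebra x := by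
  simp only [← inv_cellM_mul, mat_mul]
  exact mul_entry_mem (S.cellM_inv_entry_mem hφ hC x) (mat_entry_mem hφ x) i j

theorem cellB_inv_entry_mem (i j : Fin n) :
    (fun y => mat ((cellT (hC y) : G) * cellU (hC y))⁻¹ i j) ∈ X.regSubalgebra x := by
  simp only [← inv_cellM_mul, mul_inv_rev, inv_inv, mat_mul]
  exact mul_entry_mem (mat_inv_entry_mem hφ x) (S.cellM_entry_mem hφ hC x) i j

/-- The eigenvalue characters of the torus factor are diagonal entries of the factor in `T U`, and
they generate all characters. -/
theorem charEval_cellT_mem (χ : CharLattice G h) :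
    (fun y => (charEval χ (cellT (hC y)) : ℂ)) ∈ X.regSubalgebra x := by
  have h1 : χ ∈ AddSubgroup.closure (Set.range S.coordChar) := by rw [S.closure_coordChar]; trivial
  induction h1 using AddSubgroup.closure_induction with
  | mem χ hχ =>
    obtain ⟨j, rfl⟩ := hχ
    have : (fun y => (charEval (S.coordChar j) (cellT (hC y)) : ℂ)) =
        fun y => S.basis.co (mat ((cellT (hC y) : G) * cellU (hC y))) j j := by
      ext y
      rw [S.charEval_coordChar, S.co_mul_torus_unip _ (cellU_mem (hC y))]
    rw [this]
    exact S.co_entry_mem (S.cellB_entry_mem hφ hC x) j j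
  | zero =>
    exact one_mem (X.regSubalgebra x)
  | add a b _ _ ha hb => exact mul_mem ha hb
  | neg a _ ha =>
    have : (fun y => (charEval (-a) (cellT (hC y)) : ℂ)) = fun y => (charEval a (cellT (hC y)) : ℂ)⁻¹ := by
      ext y
      rw [← Units.val_inv_eq_inv_val]
      rfl
    rw [this]
    exact inv_mem_regSubalgebra (F := fun y => (charEval a (cellT (hC y)) : ℂ)) ha (Units.ne_zero _)

end CellRegular

omit S in
theorem toricEval_mem_toricAlgebra {L : AddSubgroup (RealSpan G h)} (μ : RealSpan G h)
    (hμ : μ ∈ coneSemigroup L) : (fun v => toricEval v μ hμ) ∈ toricAlgebra L :=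
  Algebra.subset_adjoin ⟨⟨μ, hμ⟩, rfl⟩

theorem rho_entry_mem {Z : Type} {A : Subalgebra ℂ (Z → ℂ)} {v : Z → ToricPoint (latticeP G h)}
    (hv : ∀ (χ : CharLattice G h) (hχ : toReal G h χ ∈ coneSemigroup (latticeP G h)),
      (fun z => toricEval (v z) (toReal G h χ) hχ) ∈ A) (i j : Fin n) :
    (fun z => (S.rho (v z) : Mat) i j) ∈ A := by
  have := S.finite_simpleRoots
  have : Fintype (simpleRoots G h) := Fintype.ofFinite _
  have h1 : (fun z => (S.rho (v z) : Mat) i j) = ∑ α : simpleRoots G h,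
      (S.E α : Mat) i j • fun z => toricEval (v z) (toReal G h α.1) (simpleRoot_mem G h α) := by
    ext z
    rw [rho, finsum_eq_sum_of_fintype, AddSubmonoidClass.coe_finsetSum, Matrix.sum_apply, Finset.sum_apply]
    refine Finset.sum_congr rfl fun α _ => ?_
    exact mul_comm _ _
  rw [h1]
  exact sum_mem fun α _ => Subalgebra.smul_mem _ (hv _ _) _

end PrincipalTriple

end Charts

/-! ### Charts of the mixed space -/

section Charts

attribute [local instance 100] LieRing.ofAssociativeRing

open Module

variable {n : ℕ} {G : Subgroup (GL (Fin n) ℂ)} {h ν f : lieAlg G}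

local notation "Mat" => Matrix (Fin n) (Fin n) ℂ

variable (G h ν) in
/-- The variety `G × 𝔲̃`. -/
abbrev mixedCover : FunctionSpace :=
  ofAlgebra (G × uTilde G h ν) (prodAlgebra (groupAlgebra G) (uTildeAlgebra G h ν))

variable (G h ν) in
/-- The relation that defines the mixed space. -/
def mixedRel (p q : G × uTilde G h ν) : Prop :=
  ∃ b ∈ borel G h, q.1 = p.1 * b⁻¹ ∧ IsBorelTranslate G h ν b p.2 q.2

namespace PrincipalTriple

variable (S : PrincipalTriple G h ν f)

/-- The vector space of the affine part of the charts. -/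
abbrev ChartSpace : Type := S.fil (-S.wt) 1 × S.fil S.wt 4

/-- The saturated open sets of the charts. -/
def chartSet (g₀ : G) : Set (G × uTilde G h ν) := {q | g₀⁻¹ * q.1 * 1 ∈ S.bigCell}

/-- The right factor `1` makes the map an instance of the two-sided translation in
`isMorphism_mul_mul`. -/
theorem isMorphism_translate (g₀ : G) : (mixedCover G h ν).IsMorphism (ofAlgebra G (groupAlgebra G))
    (fun q : G × uTilde G h ν => g₀⁻¹ * q.1 * 1) :=
  (isMorphism_mul_mul g₀⁻¹ 1).comp (isMorphism_of_comp_mem fun _ hF => fst_mem_prodAlgebra hF)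

theorem isOpen_chartSet (g₀ : G) : IsOpen (X := (mixedCover G h ν).carrier) (S.chartSet g₀) :=
  S.isOpen_bigCell.preimage (isMorphism_translate (h := h) (ν := ν) g₀).1

theorem translate_sub_mem (t : torusT G h) {u : G} (hu : u ∈ S.unip S.wt) (w : uTilde G h ν) :
    adG ((t : G) * u) w.1.2 - S.rho (S.smulV t w.1.1) ∈ S.fil S.wt 4 := by
  obtain ⟨⟨v, x⟩, hw⟩ := w
  exact S.translate_sub_rho_mem t hu hw

variable {S}

theorem mem_bigCell_of_chartSet {g₀ : G} (q : S.chartSet g₀) : g₀⁻¹ * q.1.1 * 1 ∈ S.bigCell := q.2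

/-- The coordinates of a chart. -/
def chartMap {g₀ : G} (q : S.chartSet g₀) : ToricPoint (latticeP G h) × S.ChartSpace :=
  (S.smulV (cellT (mem_bigCell_of_chartSet q)) q.1.2.1.1,
    ⟨S.logU (cellM_mem (mem_bigCell_of_chartSet q)), S.logU_mem (cellM_mem (mem_bigCell_of_chartSet q))⟩,
    ⟨_, S.translate_sub_mem (cellT (mem_bigCell_of_chartSet q)) (cellU_mem (mem_bigCell_of_chartSet q)) q.1.2⟩)

theorem chartMap_eq {g₀ : G} (q : S.chartSet g₀) {m : G} (hm : m ∈ S.unip (-S.wt)) (t : torusT G h)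
    {u : G} (hu : u ∈ S.unip S.wt) (H : g₀⁻¹ * q.1.1 * 1 = m * ((t : G) * u)) :
    chartMap q = (S.smulV t q.1.2.1.1, ⟨S.logU hm, S.logU_mem hm⟩, ⟨_, S.translate_sub_mem t hu q.1.2⟩) := by
  obtain ⟨h1, h2⟩ := cell_unique (mem_bigCell_of_chartSet q) hm t hu H
  have h3 : (cellT (mem_bigCell_of_chartSet q) : G) * cellU (mem_bigCell_of_chartSet q) = (t : G) * u := by
    rw [← inv_cellM_mul (mem_bigCell_of_chartSet q), h1, H, inv_mul_cancel_left]
  refine Prod.ext ?_ (Prod.ext (Subtype.ext ?_) (Subtype.ext ?_))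
  · simp only [chartMap]
    rw [h2]
  · refine Subtype.ext ?_
    simp only [chartMap, coe_logU]
    rw [h1]
  · simp only [chartMap]
    rw [h3, h2]

variable (S)

/-- The section of a chart. -/
def chartSection (g₀ : G) (z : ToricPoint (latticeP G h) × S.ChartSpace) : G × uTilde G h ν :=
  (g₀ * S.expG z.2.1, ⟨(z.1, S.rho z.1 + z.2.2), S.mem_uTilde_iff.2 (by
    rw [add_sub_cancel_left]
    exact z.2.2.2)⟩)

theorem translate_chartSection (g₀ : G) (z : ToricPoint (latticeP G h) × S.ChartSpace) :
    g₀⁻¹ * (S.chartSection g₀ z).1 * 1 = S.expG z.2.1 * (((1 : torusT G h) : G) * 1) := by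
  rw [chartSection, inv_mul_cancel_left]
  simp

theorem chartSection_mem (g₀ : G) (z : ToricPoint (latticeP G h) × S.ChartSpace) :
    S.chartSection g₀ z ∈ S.chartSet g₀ :=
  ⟨_, S.expG_mem_unip z.2.1.2, 1, 1, one_mem _, S.translate_chartSection g₀ z⟩

theorem chartMap_chartSection (g₀ : G) (z : ToricPoint (latticeP G h) × S.ChartSpace) :
    chartMap ⟨S.chartSection g₀ z, S.chartSection_mem g₀ z⟩ = z := by
  rw [chartMap_eq ⟨S.chartSection g₀ z, S.chartSection_mem g₀ z⟩ (S.expG_mem_unip z.2.1.2) 1 (one_mem _)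
    (S.translate_chartSection g₀ z)]
  refine Prod.ext ?_ (Prod.ext (Subtype.ext ?_) (Subtype.ext ?_))
  · exact S.smulV_one _
  · exact S.logU_expG z.2.1.2
  · change adG (((1 : torusT G h) : G) * 1) (S.rho z.1 + (z.2.2 : lieAlg G)) - S.rho (S.smulV 1 z.1) = _
    rw [S.smulV_one, Subgroup.coe_one, mul_one, adG_one, add_sub_cancel_left]

/-- The big cell is stable under right multiplication by `T U`, and the inverse of an element of `T
U` is again of this form. -/
theorem chartSet_saturated (g₀ : G) {p q : G × uTilde G h ν} (H : mixedRel G h ν p q) :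
    p ∈ S.chartSet g₀ ↔ q ∈ S.chartSet g₀ := by
  obtain ⟨b, -, hq, ⟨t, u, hu, rfl, -⟩, -⟩ := H
  rw [S.groupU_eq_unip] at hu
  constructor
  · intro hp
    obtain ⟨u', hu', h1⟩ := S.inv_torus_mul_unip t hu
    have := S.mul_mem_bigCell hp (one_mem _) t⁻¹ hu'
    rw [← h1, one_mul, mul_one, mul_assoc, ← hq] at this
    change g₀⁻¹ * q.1 * 1 ∈ S.bigCell
    rwa [mul_one]
  · intro hp
    have := S.mul_mem_bigCell hp (one_mem _) t hu
    rw [one_mul, mul_one, mul_assoc, hq, inv_mul_cancel_right] at this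
    change g₀⁻¹ * p.1 * 1 ∈ S.bigCell
    rwa [mul_one]

/-- Acting by `b` multiplies the group component by `b⁻¹` and the other by `b`. The factor in `U⁻`
is unaffected, and transporting `𝔲̃` by the remaining factor in `T U` cancels `b`. -/
theorem chartMap_eq_of_rel {g₀ : G} (p q : S.chartSet g₀) (H : mixedRel G h ν p.1 q.1) :
    chartMap p = chartMap q := by
  obtain ⟨b, -, hq, hb⟩ := H
  obtain ⟨t, u, hu, rfl, -⟩ := hb.1
  rw [S.groupU_eq_unip] at hu
  obtain ⟨h1, h2⟩ := (S.isBorelTranslate_iff t hu).1 hb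
  obtain ⟨m, hm, t', u', hu', hp⟩ := q.2
  obtain ⟨u'', hu'', h3⟩ := S.mul_torus_mul_unip t' t hu' hu
  have hp' : g₀⁻¹ * p.1.1 * 1 = m * (((t' * t : torusT G h) : G) * u'') := by
    rw [← h3, ← mul_assoc, ← hp, hq]
    group
  rw [chartMap_eq q hm t' hu' hp, chartMap_eq p hm (t' * t) hu'' hp']
  have h4 : S.smulV (t' * t) p.1.2.1.1 = S.smulV t' q.1.2.1.1 := by rw [h1, S.smulV_mul]
  refine Prod.ext h4 (Prod.ext rfl (Subtype.ext ?_))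
  simp only
  rw [h4, h2, ← adG_mul, h3]

/-- Acting with the factor in `T U` of the translated group component moves the point to the unique
representative in `g₀ U⁻`. -/
theorem mixedRel_chartSection {g₀ : G} (q : S.chartSet g₀) :
    mixedRel G h ν q.1 (S.chartSection g₀ (chartMap q)) := by
  refine ⟨(cellT (mem_bigCell_of_chartSet q) : G) * cellU (mem_bigCell_of_chartSet q), S.torus_mul_mem_borel _ (cellU_mem (mem_bigCell_of_chartSet q)), ?_,
    (S.isBorelTranslate_iff (cellT (mem_bigCell_of_chartSet q)) (cellU_mem (mem_bigCell_of_chartSet q))).2 ⟨rfl, ?_⟩⟩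
  · change g₀ * S.expG (S.logU (cellM_mem (mem_bigCell_of_chartSet q))) = _
    rw [S.expG_logU, eq_mul_inv_iff_mul_eq, mul_assoc, ← cell_eq (mem_bigCell_of_chartSet q)]
    group
  · exact add_sub_cancel _ _

/-! ### Regularity of the charts -/

theorem isMorphism_chartSection (g₀ : G) :
    (ofAlgebra (ToricPoint (latticeP G h) × S.ChartSpace)
      (prodAlgebra (toricAlgebra (latticeP G h)) (polyAlgebra S.ChartSpace))).IsMorphism
      (mixedCover G h ν) (S.chartSection g₀) := by
  set A := prodAlgebra (toricAlgebra (latticeP G h)) (polyAlgebra S.ChartSpace) with hA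
  have hv : ∀ (χ : CharLattice G h) (hχ : toReal G h χ ∈ coneSemigroup (latticeP G h)),
      (fun z : ToricPoint (latticeP G h) × S.ChartSpace => toricEval z.1 (toReal G h χ) hχ) ∈ A := fun χ hχ =>
    fst_mem_prodAlgebra (toricEval_mem_toricAlgebra _ hχ)
  have hlin : ∀ (l : S.ChartSpace →ₗ[ℂ] lieAlg G) (i j : Fin n),
      (fun z : ToricPoint (latticeP G h) × S.ChartSpace => (l z.2 : Mat) i j) ∈ A := fun l i j =>
    snd_mem_prodAlgebra (entry_mem_polyAlgebra l i j)
  have hconst : ∀ (M : Mat) (i j : Fin n),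
      (fun _ : ToricPoint (latticeP G h) × S.ChartSpace => M i j) ∈ A := fun M i j =>
    Subalgebra.algebraMap_mem A (M i j)
  let l1 : S.ChartSpace →ₗ[ℂ] lieAlg G := (S.fil (-S.wt) 1).subtype ∘ₗ LinearMap.fst ℂ _ _
  let l2 : S.ChartSpace →ₗ[ℂ] lieAlg G := (S.fil S.wt 4).subtype ∘ₗ LinearMap.snd ℂ _ _
  refine isMorphism_prod (isMorphism_of_comp_mem fun F hF => ?_) (isMorphism_of_comp_mem fun F hF => ?_)
  · refine comp_mem_of_mat_entries (fun i j => ?_) (fun i j => ?_) hF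
    · simp only [chartSection, mat_mul]
      exact mul_entry_mem (hconst (mat g₀)) (S.mat_expG_entry_mem (fun z => z.2.1.2) (hlin l1)) i j
    · simp only [chartSection, mul_inv_rev, mat_mul, S.expG_neg]
      refine mul_entry_mem (S.mat_expG_entry_mem (w := -S.wt) (fun z => neg_mem z.2.1.2) (hlin (-l1)))
        (hconst (mat g₀⁻¹)) i j
  · refine comp_mem_of_adjoin ?_ hF
    rintro _ ⟨F, hF, rfl⟩
    change F ∘ (fun z : ToricPoint (latticeP G h) × S.ChartSpace =>
      (z.1, S.rho z.1 + (z.2.2 : lieAlg G))) ∈ A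
    refine prod_comp_mem (φ := fun z : ToricPoint (latticeP G h) × S.ChartSpace =>
      (z.1, S.rho z.1 + (z.2.2 : lieAlg G))) (fun F hF => fst_mem_prodAlgebra hF) (fun F hF => ?_) hF
    change F ∘ (fun z : ToricPoint (latticeP G h) × S.ChartSpace => S.rho z.1 + (z.2.2 : lieAlg G)) ∈ A
    refine comp_mem_of_adjoin ?_ hF
    rintro _ ⟨l, rfl⟩
    refine dual_comp_mem (fun i j => ?_) l
    exact add_mem (S.rho_entry_mem hv i j) (hlin l2 i j)

/-- The cell factors have regular entries by the Gauss formulas, the logarithm is polynomial on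
unipotent matrices, and `ρ` is linear in the values of the simple roots; the coordinates are built
from these. -/
theorem isMorphism_chartMap (g₀ : G) :
    ((mixedCover G h ν).restrict (S.chartSet g₀)).IsMorphism
      (ofAlgebra (ToricPoint (latticeP G h) × S.ChartSpace)
        (prodAlgebra (toricAlgebra (latticeP G h)) (polyAlgebra S.ChartSpace)))
      (fun q : S.chartSet g₀ => chartMap q) := by
  set X := (mixedCover G h ν).restrict (S.chartSet g₀) with hX
  have hφ : X.IsMorphism (ofAlgebra G (groupAlgebra G)) (fun q : S.chartSet g₀ => g₀⁻¹ * q.1.1 * 1) :=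
    (isMorphism_translate g₀).comp (isMorphism_subtypeVal _ _)
  have hC : ∀ q : S.chartSet g₀, g₀⁻¹ * q.1.1 * 1 ∈ S.bigCell := mem_bigCell_of_chartSet
  have hw : X.IsMorphism (ofAlgebra (uTilde G h ν) (uTildeAlgebra G h ν))
      (fun q : S.chartSet g₀ => q.1.2) :=
    IsMorphism.comp (Y := mixedCover G h ν) (isMorphism_of_comp_mem fun _ hF => snd_mem_prodAlgebra hF)
      (isMorphism_subtypeVal _ _)
  have hv : ∀ (x : S.chartSet g₀) (χ : CharLattice G h) (hχ : toReal G h χ ∈ coneSemigroup (latticeP G h)),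
      (fun q : S.chartSet g₀ => toricEval (S.smulV (cellT (hC q)) q.1.2.1.1) (toReal G h χ) hχ) ∈
        X.regSubalgebra x := fun x χ hχ => by
    simp only [S.toricEval_smulV]
    refine mul_mem (S.charEval_cellT_mem hφ hC x χ) ?_
    exact comp_mem_regSubalgebra hw (F := fun w : uTilde G h ν => toricEval w.1.1 (toReal G h χ) hχ)
      (Algebra.subset_adjoin ⟨_, fst_mem_prodAlgebra (toricEval_mem_toricAlgebra _ hχ), rfl⟩) x
  have hx : ∀ (x : S.chartSet g₀) (i j : Fin n),
      (fun q : S.chartSet g₀ => ((q.1.2.1.2 : lieAlg G) : Mat) i j) ∈ X.regSubalgebra x := fun x i j =>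
    comp_mem_regSubalgebra hw (F := fun w : uTilde G h ν => ((w.1.2 : lieAlg G) : Mat) i j)
      (Algebra.subset_adjoin ⟨_, snd_mem_prodAlgebra (entry_mem_polyAlgebra LinearMap.id i j), rfl⟩) x
  refine isMorphism_prod ?_ (isMorphism_adjoin ?_)
  · refine isMorphism_adjoin ?_
    rintro _ ⟨μ, rfl⟩ x
    obtain ⟨_, hμ1, χ, rfl⟩ := μ
    exact hv x χ _
  · rintro _ ⟨l, rfl⟩ x
    have h1 : (fun q : S.chartSet g₀ => (l ∘ₗ LinearMap.inl ℂ _ _) (chartMap q).2.1) ∈ X.regSubalgebra x := by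
      refine dual_submodule_comp_mem (fun i j => ?_) _
      refine unipLog_entry_mem (fun i j => ?_) _ i j
      exact sub_mem (S.cellM_entry_mem hφ hC x i j) (Subalgebra.algebraMap_mem _ ((1 : Mat) i j))
    have h2 : (fun q : S.chartSet g₀ => (l ∘ₗ LinearMap.inr ℂ _ _) (chartMap q).2.2) ∈ X.regSubalgebra x := by
      refine dual_submodule_comp_mem (fun i j => ?_) _
      refine sub_mem ?_ (S.rho_entry_mem (hv x) i j)
      exact mul_entry_mem (mul_entry_mem (S.cellB_entry_mem hφ hC x) (hx x)) (S.cellB_inv_entry_mem hφ hC x) i j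
    have h3 := add_mem h1 h2
    have h4 : (fun q : S.chartSet g₀ => (l ∘ₗ LinearMap.inl ℂ _ _) (chartMap q).2.1) +
        (fun q : S.chartSet g₀ => (l ∘ₗ LinearMap.inr ℂ _ _) (chartMap q).2.2) =
        fun q : S.chartSet g₀ => l (chartMap q).2 := by
      ext q
      simp only [Pi.add_apply, LinearMap.comp_apply, ← map_add]
      congr 1
      simp
    have h5 : (fun q : S.chartSet g₀ => l (chartMap q).2) ∈ X.regSubalgebra x := by
      rw [← h4]
      exact h3
    exact h5

/-- `chartSection` is a section of the invariant map `chartMap` over a saturated open set, which is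
the situation of `quot_restrict_isomorphic`. -/
theorem chart_isomorphic (g₀ : G) :
    IsOpen (X := (mixedSpace G h ν).carrier) (Quot.mk (mixedRel G h ν) '' S.chartSet g₀) ∧
      ((mixedSpace G h ν).restrict (Quot.mk (mixedRel G h ν) '' S.chartSet g₀)).Isomorphic
        (ofAlgebra (ToricPoint (latticeP G h) × S.ChartSpace)
          (prodAlgebra (toricAlgebra (latticeP G h)) (polyAlgebra S.ChartSpace))) :=
  quot_restrict_isomorphic (X := mixedCover G h ν) (r := mixedRel G h ν) (s := S.chartSet g₀)
    (S.isOpen_chartSet g₀) (fun _ _ H => S.chartSet_saturated g₀ H) (S.isMorphism_chartMap g₀)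
    (fun p q H => S.chartMap_eq_of_rel p q H) (S.isMorphism_chartSection g₀) (S.chartSection_mem g₀)
    (S.chartMap_chartSection g₀) (fun q => Relation.EqvGen.rel _ _ (S.mixedRel_chartSection q))

end PrincipalTriple

end Charts

/-! ### The orbifold structures on `ℳ̃` and `𝒱` -/

section Orbifolds

open Module

variable {n : ℕ} {G : Subgroup (GL (Fin n) ℂ)} {h ν f : lieAlg G}

namespace PrincipalTriple

variable (S : PrincipalTriple G h ν f) {d : ℕ} (hd : 0 < d) (hP : latticeP G h ≤ latticeQd G h d)

theorem mk_mem_chart (q : G × uTilde G h ν) :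
    Quot.mk (mixedRel G h ν) q ∈ Quot.mk (mixedRel G h ν) '' S.chartSet q.1 :=
  ⟨q, by
    change q.1⁻¹ * q.1 * 1 ∈ S.bigCell
    rw [inv_mul_cancel, mul_one]
    exact S.one_mem_bigCell, rfl⟩

include S hd hP

theorem exists_cover : ∃ 𝒲 : Set (Set (mixedSpace G h ν).carrier), ⋃₀ 𝒲 = Set.univ ∧
    ∀ W ∈ 𝒲, IsOpen W ∧ ((mixedSpace G h ν).restrict W).IsVariety ∧
      ((mixedSpace G h ν).restrict W).IsSmoothQuotient (groupZd G h d) := by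
  refine ⟨Set.range fun g₀ : G => Quot.mk (mixedRel G h ν) '' S.chartSet g₀, ?_, ?_⟩
  · refine Set.eq_univ_of_forall fun x => ?_
    obtain ⟨q, rfl⟩ := Quot.exists_rep x
    exact ⟨_, ⟨q.1, rfl⟩, S.mk_mem_chart q⟩
  · rintro _ ⟨g₀, rfl⟩
    obtain ⟨h1, h2⟩ := S.chart_isomorphic g₀
    exact ⟨h1, ((S.isAffineModel_toricAlgebra hd hP).prod
      (isAffineModel_polyAlgebra S.ChartSpace)).isVariety h2, S.isSmoothQuotient_groupZd hd hP h2⟩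

theorem isOrbifold_mixedSpace : (mixedSpace G h ν).IsOrbifold := by
  intro x
  obtain ⟨𝒲, hU, hW⟩ := S.exists_cover hd hP
  obtain ⟨W, hWm, hx⟩ := Set.mem_sUnion.1 (hU ▸ Set.mem_univ x)
  exact ⟨W, (hW W hWm).1, hx, groupZd G h d, inferInstance, S.finite_groupZd hd, (hW W hWm).2.2⟩

theorem isOrbifold_toricV : (toricV G h).IsOrbifold := by
  intro x
  refine ⟨Set.univ, isOpen_univ, Set.mem_univ x, groupZd G h d, inferInstance, S.finite_groupZd hd, ?_⟩
  -- The zero vector space as second factor specializes the product statement to `𝒱`.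
  refine S.isSmoothQuotient_groupZd hd hP (E := Fin 0 → ℂ)
    ((restrict_univ_isomorphic _).trans ⟨⟨fun v : ToricPoint (latticeP G h) => (v, 0), Prod.fst, fun _ => rfl, fun _ => Prod.ext rfl (Subsingleton.elim _ _)⟩, ?_, ?_⟩)
  · refine isMorphism_prod (isMorphism_id _) (isMorphism_of_comp_mem fun F _ => ?_)
    exact Subalgebra.algebraMap_mem (toricAlgebra (latticeP G h)) (F 0)
  · exact isMorphism_of_comp_mem fun _ hF => fst_mem_prodAlgebra hF

end PrincipalTriple

end Orbifolds

end Orbifold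

end

theorem proposition4p7 {n : ℕ} (G : Subgroup (GL (Fin n) ℂ)) (hG : IsLinearAlgebraic G)
    (hsimplyConnected : SimplyConnectedSpace G)
    (hsemisimple : LieAlgebra.HasTrivialRadical ℂ (lieAlg G))
    (h ν f : lieAlg G) (hν : IsPrincipal G ν)
    (lie_e_f : ⁅ν, f⁆ = h) (lie_h_e : ⁅h, ν⁆ = 2 • ν) (lie_h_f : ⁅h, f⁆ = -(2 • f)) :
    (∃ d : ℕ, 0 < d ∧ latticeP G h ≤ latticeQd G h d) ∧
    ∀ d : ℕ, 0 < d → latticeP G h ≤ latticeQd G h d →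
      -- `T_d` is a torus of rank `r`
      (∃ e : (Fin (simpleRoots G h).ncard → ℂˣ) ≃* TorusOf (latticeQd G h d),
        (standardTorus (simpleRoots G h).ncard).IsIso (torusOf (latticeQd G h d)) e.toEquiv) ∧
      -- `T_d → T` is a surjective homomorphism with finite kernel `Z_d`
      (∃ φ : TorusOf (latticeQd G h d) →* torusT G h,
        (torusOf (latticeQd G h d)).IsMorphism (ofAlgebra (torusT G h) (torusAlgebra G h)) φ ∧
        (∀ s (χ : CharLattice G h) (hχ : toReal G h χ ∈ latticeQd G h d),
          charEval χ (φ s) = s (Multiplicative.ofAdd ⟨toReal G h χ, hχ⟩)) ∧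
        Function.Surjective φ ∧ φ.ker = groupZd G h d) ∧
      Finite (groupZd G h d) ∧
      -- `𝒱_d` is a toric variety for `T_d`, isomorphic to `ℂ ^ r`
      ((torusOf (latticeQd G h d)).IsOpenImmersion (toric (latticeQd G h d))
          (torusToToric (latticeQd G h d)) ∧
        Dense (X := (toric (latticeQd G h d)).carrier)
          (Set.range (torusToToric (latticeQd G h d)))) ∧
      (toric (latticeQd G h d)).Isomorphic (affineSpace (simpleRoots G h).ncard) ∧
      -- `𝒱_d / Z_d ≅ 𝒱`, by the map that restricts `v : σ^∨ ∩ Q_d → ℂ` to `σ^∨ ∩ P`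
      (∃ e, ((toric (latticeQd G h d)).orbitSpace (groupZd G h d)).IsIso (toricV G h) e ∧
        ∀ (v : ToricPoint (latticeQd G h d)) (μ : RealSpan G h)
          (hμ : μ ∈ coneSemigroup (latticeQd G h d)) (hμ' : μ ∈ coneSemigroup (latticeP G h)),
          toricEval (e (Quot.mk _ v)) μ hμ' = toricEval v μ hμ) ∧
      (toricV G h).IsOrbifold ∧
      -- `ℳ̃` is covered by open subvarieties of the form `W / Z_d` with `W` smooth
      (∃ 𝒲 : Set (Set (mixedSpace G h ν).carrier), ⋃₀ 𝒲 = Set.univ ∧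
        ∀ W ∈ 𝒲, IsOpen W ∧ ((mixedSpace G h ν).restrict W).IsVariety ∧
          ((mixedSpace G h ν).restrict W).IsSmoothQuotient (groupZd G h d)) ∧
      (mixedSpace G h ν).IsOrbifold := by
  have S : PrincipalTriple G h ν f :=
    (nonempty_principalTriple hG hsemisimple hν ⟨lie_e_f, lie_h_e, lie_h_f⟩).some
  refine ⟨S.exists_latticeP_le, fun d hd hP => ⟨?_, ?_, ?_, ⟨?_, ?_⟩, ?_, ?_, ?_, ?_, ?_⟩⟩
  · exact S.exists_isIso_torusOf hd
  · refine ⟨S.torusMap hd hP, S.isMorphism_torusMap hd hP, fun s χ hχ => ?_,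
      S.torusMap_surjective hd hP, S.ker_torusMap hd hP⟩
    exact S.charEval_torusMap hd hP s χ
  · exact S.finite_groupZd hd
  · exact S.isOpenImmersion_torusToToric hd
  · exact S.dense_range_torusToToric hd
  · exact S.toric_isomorphic_affineSpace hd
  · exact S.exists_isIso_toricV hd hP
  · exact S.isOrbifold_toricV hd hP
  · exact S.exists_cover hd hP
  · exact S.isOrbifold_mixedSpace hd hP
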